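/- Conventions. $K$ is a field of characteristic zero, everything is $\mathbb Z$-graded over $K$, $A$ is an associative graded commutative unital $K$-algebra, $L$ and $Q$ are graded $A$-modules. Elements are homogeneous, $\bar v$ is the degree of $v$ (written $v$ in exponents of signs), $S_{i,j}$ is the set of $(i,j)$-unshuffles, $\alpha(\sigma,v)$ is the Koszul sign with $v_{\sigma(1)}\odot\cdots\odot v_{\sigma(n)}=\alpha(\sigma,v)\,v_1\odot\cdots\odot v_n$, and $[\cdot,\cdot]$ is the graded commutator. An $LR_\infty[1]$ algebra structure on $(A,L)$ consists of graded symmetric $K$-multilinear brackets $X_k:L^{\times k}\to L$ ($k\ge 1$) and graded symmetric, graded $A$-multilinear anchors $\sigma_k:L^{\times(k-1)}\to\mathrm{Der}\,A$, all of degree $1$, with $$X_k(\xi_1,\dots,\xi_{k-1},a\xi_k)=\sigma_k(\xi_1,\dots,\xi_{k-1}|a)\,\xi_k+(-)^{(1+\bar\xi_1+\cdots+\bar\xi_{k-1})\bar a}\,a\,X_k(\xi_1,\dots,\xi_k),$$ such that both components of the higher Jacobiator vanish: $$\sum_{i+j=k}\sum_{\sigma\in S_{i,j}}\alpha(\sigma,\xi)\,X_{j+1}(X_i(\xi_{\sigma(1)},\dots,\xi_{\sigma(i)}),\xi_{\sigma(i+1)},\dots,\xi_{\sigma(k)})=0,$$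 $$\sum_{i+j=n}\sum_{\sigma\in S_{i,j}}\alpha(\sigma,\xi)\Big((-)^{\bar\xi_{\sigma(1)}+\cdots+\bar\xi_{\sigma(i)}}\sigma(\xi_{\sigma(1)},\dots,\xi_{\sigma(i)}|\sigma(\xi_{\sigma(i+1)},\dots,\xi_{\sigma(n)}|a))+\sigma(X_i(\xi_{\sigma(1)},\dots,\xi_{\sigma(i)}),\xi_{\sigma(i+1)},\dots,\xi_{\sigma(n)}|a)\Big)=0$$ (with $X_0=0$). A right $(A,L)$-connection in $Q$ is a family of degree $1$, $K$-multilinear maps $\Delta_k:L^{\times(k-1)}\times Q\to Q$ ($k\ge 1$), graded symmetric in the first $k-1$ arguments, with $$\Delta(\xi_1,\dots,\xi_{n}|aq)=(-)^{(1+\bar\xi_1+\cdots+\bar\xi_{n})\bar a}\,a\,\Delta(\xi_1,\dots,\xi_{n}|q)-\sigma(\xi_1,\dots,\xi_{n}|a)\,q,$$ $$\Delta(a\xi_1,\xi_2,\dots,\xi_{n}|q)=(-)^{\bar a(\bar\xi_1+\cdots+\bar\xi_{n})}\,\Delta(\xi_1,\dots,\xi_{n}|aq).$$ Its curvature is $$J(\Delta)(\xi_1,\dots,\xi_n|q)=\sum_{i+j=n}\sum_{\sigma\in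 S_{i,j}}\alpha(\sigma,\xi)\Big(\Delta(X_i(\xi_{\sigma(1)},\dots,\xi_{\sigma(i)}),\xi_{\sigma(i+1)},\dots,\xi_{\sigma(n)}|q)-(-)^{\bar\xi_{\sigma(1)}+\cdots+\bar\xi_{\sigma(i)}}\Delta(\xi_{\sigma(1)},\dots,\xi_{\sigma(i)}|\Delta(\xi_{\sigma(i+1)},\dots,\xi_{\sigma(n)}|q))\Big).$$ Let $(A,L)$ be an $LR_\infty[1]$ algebra and $\Delta$ a right $(A,L)$-connection in $Q$. Let $S_A^\bullet L$ be the graded symmetric algebra, and for $u\in S_A^\bullet L$ let $\mu_u$ be multiplication by $u$ on $S_A^\bullet L\otimes_A Q$. **Statement.** (0) There is a unique $LR_\infty[1]$ algebra structure $\{\cdot,\dots,\cdot\}$ on $(K,S_A^\bullet L)$ whose brackets are multiderivations of the algebra $S_A^\bullet L$, map $S_A^{\ell_1}L\times\cdots\times S_A^{\ell_k}L$ to $S_A^{\ell_1+\cdots+\ell_k-k+1}L$ (to $0$ if the exponent is negative) and satisfy $\{\xi_1,\dots,\xi_k\}=X_k(\xi_1,\dots,\xi_k)$, $\{\xi_1,\dots,\xi_{k-1},a\}=\sigma_k(\xi_1,\dots,\xi_{k-1}|a)$.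 There are unique $K$-linear operators $D_k^\Delta$ ($k\ge 1$) on $S_A^\bullet L\otimes_A Q$ with $$D_k^\Delta(\xi_1\cdots\xi_\ell\otimes q)=\sum_{\tau\in S_{k,\ell-k}}\alpha(\tau,\xi)\,X_k(\xi_{\tau(1)},\dots,\xi_{\tau(k)})\,\xi_{\tau(k+1)}\cdots\xi_{\tau(\ell)}\otimes q$$ $$-\sum_{\sigma\in S_{\ell-k+1,k-1}}(-)^{\bar\xi_{\sigma(1)}+\cdots+\bar\xi_{\sigma(\ell-k+1)}}\alpha(\sigma,\xi)\,\xi_{\sigma(1)}\cdots\xi_{\sigma(\ell-k+1)}\otimes\Delta(\xi_{\sigma(\ell-k+2)},\dots,\xi_{\sigma(\ell)}|q),$$ where a sum over $S_{i,j}$ with $i<0$ or $j<0$ is zero. (1) For all $k\ge1$ and all $u_1,\dots,u_k\in S_A^\bullet L$, $$[\cdots[[D_k^\Delta,\mu_{u_1}],\mu_{u_2}]\cdots,\mu_{u_k}]=\mu_{\{u_1,\dots,u_k\}},$$ and $D_k^\Delta$ is a degree $1$ differential operator of order $k$ in the $S_A^\bullet L$-module $S_A^\bullet L\otimes_AQ$,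 i.e. $[\cdots[[D_k^\Delta,\mu_{u_1}],\mu_{u_2}]\cdots,\mu_{u_{k+1}}]=0$ for all $u_1,\dots,u_{k+1}\in S_A^\bullet L$. (2) The operations $$R^\Delta(u_1,\dots,u_{k-1}|U):=[\cdots[[D_k^\Delta,\mu_{u_1}],\mu_{u_2}]\cdots,\mu_{u_{k-1}}]U,\qquad k\ge1,$$ are the components of a right $(K,S_A^\bullet L)$-connection $R^\Delta$ in $S_A^\bullet L\otimes_AQ$; so are their negatives, and the curvature of $-R^\Delta$ is given by $$J(-R^\Delta)(u_1,\dots,u_{k-1}|U)=-[\cdots[[\mathcal J_k^\Delta,\mu_{u_1}],\mu_{u_2}]\cdots,\mu_{u_{k-1}}]U,\qquad \mathcal J_k^\Delta:=\tfrac12\sum_{i+j=k+1}[D_i^\Delta,D_j^\Delta].$$ (3) For all $k\ge 1$, $$R^\Delta(u_1,\dots,u_{k-1}|\mu_uU)=\mu_{\{u_1,\dots,u_{k-1},u\}}U+(-)^{\bar u(\bar u_1+\cdots+\bar u_{k-1}+1)}\mu_uR^\Delta(u_1,\dots,u_{k-1}|U),$$ and for all $k\ge2$, $$R^\Delta(uu_1,u_2,\dots,u_{k-1}|U)=(-)^{\bar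 u}\mu_uR^\Delta(u_1,\dots,u_{k-1}|U)+(-)^{\bar u_1(\bar u_2+\cdots+\bar u_{k-1})}R^\Delta(u,u_2,\dots,u_{k-1}|\mu_{u_1}U).$$ -/

import Mathlib

open scoped TensorProduct

noncomputable section

namespace SHLR

/-! ### Signs, unshuffles -/

/-- The entries number `i`, ..., `i + j - 1` of a tuple (numbered from zero). -/
def block {α : Type*} {n : ℕ} (i j : ℕ) (h : i + j ≤ n) (v : Fin n → α) : Fin j → α :=
  fun b => v ⟨i + b, by omega⟩

/-- The sign `α(σ, v)` with `v_{σ 1} ⊙ ⋯ ⊙ v_{σ n} = α(σ, v) v_1 ⊙ ⋯ ⊙ v_n` in the graded symmetric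
algebra, for homogeneous `v_i` of degree `d i`: every inversion contributes the sign of
interchanging the two entries. -/
def koszul {n : ℕ} (σ : Equiv.Perm (Fin n)) (d : Fin n → ℤ) : ℤˣ :=
  ∏ p ∈ Finset.univ.filter (fun p : Fin n × Fin n => p.1 < p.2 ∧ σ p.2 < σ p.1),
    Int.negOnePow (d (σ p.1) * d (σ p.2))

open Classical in
/-- The `(i, n - i)`-unshuffles: permutations of `n` indices that are increasing on the first `i`
indices and on the remaining ones. -/
def unshuffles (i n : ℕ) : Finset (Equiv.Perm (Fin n)) :=
  Finset.univ.filter fun σ =>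
    (∀ a b : Fin n, a < b → (b : ℕ) < i → σ a < σ b) ∧
    (∀ a b : Fin n, a < b → i ≤ (a : ℕ) → σ a < σ b)

/-! ### `LR_∞[1]` algebras and right connections -/

section Structures

variable {K A L Q : Type*} [Field K] [Ring A] [Algebra K A]
  [AddCommGroup L] [Module K L] [Module A L]
  [AddCommGroup Q] [Module K Q] [Module A Q]

/-- An `LR_∞[1]` algebra structure on `(A, L)`, where `𝒜` and `ℒ` are the gradings of `A`, `L`.
`bracket k` is the `k`-entry component of the structure multiderivation, and `anchor n` the component
with `n` entries from `L` of its symbol (i.e. the symbol of `bracket (n + 1)`). -/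
@[ext]
structure LRInfty (𝒜 : ℤ → Submodule K A) (ℒ : ℤ → Submodule K L) where
  bracket : ∀ k : ℕ, MultilinearMap K (fun _ : Fin k => L) L
  anchor : ∀ n : ℕ, MultilinearMap K (fun _ : Fin n => L) (Module.End K A)
  bracket_zero : bracket 0 = 0
  bracket_degree : ∀ (k : ℕ) (d : Fin k → ℤ) (ξ : Fin k → L), (∀ t, ξ t ∈ ℒ (d t)) →
    bracket k ξ ∈ ℒ (1 + ∑ t, d t)
  bracket_symm : ∀ (k : ℕ) (d : Fin k → ℤ) (ξ : Fin k → L), (∀ t, ξ t ∈ ℒ (d t)) →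
    ∀ σ : Equiv.Perm (Fin k), bracket k (ξ ∘ σ) = koszul σ d • bracket k ξ
  anchor_degree : ∀ (n : ℕ) (d : Fin n → ℤ) (ξ : Fin n → L), (∀ t, ξ t ∈ ℒ (d t)) →
    ∀ (e : ℤ) (a : A), a ∈ 𝒜 e → anchor n ξ a ∈ 𝒜 (1 + ∑ t, d t + e)
  anchor_symm : ∀ (n : ℕ) (d : Fin n → ℤ) (ξ : Fin n → L), (∀ t, ξ t ∈ ℒ (d t)) →
    ∀ σ : Equiv.Perm (Fin n), anchor n (ξ ∘ σ) = koszul σ d • anchor n ξ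
  /-- The anchors are graded `A`-linear in the first entry, hence by symmetry in every entry. -/
  anchor_linear : ∀ (n : ℕ) (e : ℤ) (a : A), a ∈ 𝒜 e → ∀ (ζ : L) (ξ : Fin n → L) (b : A),
    anchor (n + 1) (Fin.cons (a • ζ) ξ) b
      = Int.negOnePow e • (a * anchor (n + 1) (Fin.cons ζ ξ) b)
  /-- The anchors take values in the graded derivations of `A`. -/
  anchor_derivation : ∀ (n : ℕ) (d : Fin n → ℤ) (ξ : Fin n → L), (∀ t, ξ t ∈ ℒ (d t)) →
    ∀ (e : ℤ) (a : A), a ∈ 𝒜 e → ∀ b : A,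
      anchor n ξ (a * b)
        = anchor n ξ a * b + Int.negOnePow ((1 + ∑ t, d t) * e) • (a * anchor n ξ b)
  /-- `anchor n` is the symbol of `bracket (n + 1)`. -/
  bracket_leibniz : ∀ (n : ℕ) (d : Fin n → ℤ) (ξ : Fin n → L), (∀ t, ξ t ∈ ℒ (d t)) →
    ∀ (e : ℤ) (a : A), a ∈ 𝒜 e → ∀ ζ : L,
      bracket (n + 1) (Fin.snoc (α := fun _ => L) ξ (a • ζ))
        = anchor n ξ a • ζ
          + Int.negOnePow ((1 + ∑ t, d t) * e) •
            (a • bracket (n + 1) (Fin.snoc (α := fun _ => L) ξ ζ))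
  /-- The bracket component of the higher Jacobiator vanishes. -/
  jacobi : ∀ (k : ℕ) (d : Fin k → ℤ) (ξ : Fin k → L), (∀ t, ξ t ∈ ℒ (d t)) →
    ∑ i : Fin (k + 1), ∑ σ ∈ unshuffles i k, koszul σ d •
      bracket (k - i + 1)
        (Fin.cons (bracket i (block 0 i (by omega) (ξ ∘ σ))) (block i (k - i) (by omega) (ξ ∘ σ)))
      = 0
  /-- The symbol of the higher Jacobiator vanishes. -/
  anchor_jacobi : ∀ (n : ℕ) (d : Fin n → ℤ) (ξ : Fin n → L), (∀ t, ξ t ∈ ℒ (d t)) →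
    (∑ i : Fin (n + 1), ∑ σ ∈ unshuffles i n,
      (Int.negOnePow (∑ t, block 0 i (by omega) (d ∘ σ) t) * koszul σ d) •
        (anchor i (block 0 i (by omega) (ξ ∘ σ)) *
          anchor (n - i) (block i (n - i) (by omega) (ξ ∘ σ))))
    + (∑ i : Fin (n + 1), ∑ σ ∈ unshuffles i n, koszul σ d •
        anchor (n - i + 1)
          (Fin.cons (bracket i (block 0 i (by omega) (ξ ∘ σ)))
            (block i (n - i) (by omega) (ξ ∘ σ))))
      = 0

/-- A right `(A, L)`-connection in the graded `A`-module `Q` (with grading `𝒬`).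
`op n ξ q` is `Δ(ξ_1, ..., ξ_n | q)`, i.e. `op n` is the `(n + 1)`-entry component. -/
structure RightConnection {𝒜 : ℤ → Submodule K A} {ℒ : ℤ → Submodule K L}
    (X : LRInfty 𝒜 ℒ) (𝒬 : ℤ → Submodule K Q) where
  op : ∀ n : ℕ, MultilinearMap K (fun _ : Fin n => L) (Module.End K Q)
  op_degree : ∀ (n : ℕ) (d : Fin n → ℤ) (ξ : Fin n → L), (∀ t, ξ t ∈ ℒ (d t)) →
    ∀ (e : ℤ) (q : Q), q ∈ 𝒬 e → op n ξ q ∈ 𝒬 (1 + ∑ t, d t + e)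
  op_symm : ∀ (n : ℕ) (d : Fin n → ℤ) (ξ : Fin n → L), (∀ t, ξ t ∈ ℒ (d t)) →
    ∀ σ : Equiv.Perm (Fin n), op n (ξ ∘ σ) = koszul σ d • op n ξ
  /-- `op n ξ` is a derivation of `Q` whose symbol is minus the anchor. -/
  op_leibniz : ∀ (n : ℕ) (d : Fin n → ℤ) (ξ : Fin n → L), (∀ t, ξ t ∈ ℒ (d t)) →
    ∀ (e : ℤ) (a : A), a ∈ 𝒜 e → ∀ q : Q,
      op n ξ (a • q)
        = Int.negOnePow ((1 + ∑ t, d t) * e) • (a • op n ξ q) - X.anchor n ξ a • q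
  /-- Graded `A`-linearity in the first entry (hence by symmetry in every entry) for the `A`-module
  structure on derivations of `Q` that is given by composition with multiplications on the right:
  `Δ(aζ, ξ_1, ..., ξ_n | q) = (-1)^{|a|(|ζ| + |ξ_1| + ⋯ + |ξ_n|)} Δ(ζ, ξ_1, ..., ξ_n | aq)`. -/
  op_linear : ∀ (n : ℕ) (d : Fin n → ℤ) (ξ : Fin n → L), (∀ t, ξ t ∈ ℒ (d t)) →
    ∀ (c : ℤ) (ζ : L), ζ ∈ ℒ c → ∀ (e : ℤ) (a : A), a ∈ 𝒜 e → ∀ q : Q,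
      op (n + 1) (Fin.cons (a • ζ) ξ) q
        = Int.negOnePow (e * (c + ∑ t, d t)) • op (n + 1) (Fin.cons ζ ξ) (a • q)

/-- The curvature `J(Δ) = Δ ∘ X - ½ [Δ, Δ]` of a right connection, in components:
`Δ.curvature d ξ q = J(Δ)(ξ_1, ..., ξ_n | q)` for homogeneous `ξ_t` of degree `d t`. -/
def RightConnection.curvature {𝒜 : ℤ → Submodule K A} {ℒ : ℤ → Submodule K L}
    {X : LRInfty 𝒜 ℒ} {𝒬 : ℤ → Submodule K Q} (Δ : RightConnection X 𝒬)
    {n : ℕ} (d : Fin n → ℤ) (ξ : Fin n → L) : Module.End K Q :=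
  (∑ i : Fin (n + 1), ∑ σ ∈ unshuffles i n, koszul σ d •
      Δ.op (n - i + 1)
        (Fin.cons (X.bracket i (block 0 i (by omega) (ξ ∘ σ)))
          (block i (n - i) (by omega) (ξ ∘ σ))))
  - (∑ i : Fin (n + 1), ∑ σ ∈ unshuffles i n,
      (Int.negOnePow (∑ t, block 0 i (by omega) (d ∘ σ) t) * koszul σ d) •
        (Δ.op i (block 0 i (by omega) (ξ ∘ σ)) *
          Δ.op (n - i) (block i (n - i) (by omega) (ξ ∘ σ))))

end Structures

/-- The ground field as a graded algebra concentrated in degree zero. -/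
def groundGrading (K : Type*) [Field K] : ℤ → Submodule K K :=
  fun i => if i = 0 then ⊤ else ⊥

/-! ### Graded commutators with multiplications, differential operators -/

section Commutators

variable {K B M : Type*} [Field K] [Ring B] [Algebra K B]
  [AddCommGroup M] [Module K M] [Module B M] [IsScalarTower K B M]

/-- Multiplication by `u`. -/
def mu (K : Type*) {B M : Type*} [Field K] [Ring B] [Algebra K B]
    [AddCommGroup M] [Module K M] [Module B M] [IsScalarTower K B M] (u : B) : Module.End K M where
  toFun m := u • m
  map_add' := smul_add u
  map_smul' c m := by
    simp only [RingHom.id_apply]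
    rw [← algebraMap_smul B c m, ← algebraMap_smul B c (u • m), smul_smul, smul_smul,
      Algebra.commutes]

/-- The graded commutator `[T, μ_u]` for `T` of degree `t` and `u` of degree `e`. -/
def gradedComm (T : Module.End K M) (t : ℤ) (u : B) (e : ℤ) : Module.End K M :=
  T * mu K u - Int.negOnePow (t * e) • (mu K u * T)

/-- The iterated graded commutator `[⋯[[T, μ_{u_1}], μ_{u_2}] ⋯, μ_{u_n}]` for `T` of degree `t` and
`u_i` of degree `d i`. -/
def iterComm : {n : ℕ} → Module.End K M → ℤ → (Fin n → ℤ) → (Fin n → B) → Module.End K M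
  | 0, T, _, _, _ => T
  | _ + 1, T, t, d, u =>
      iterComm (gradedComm T t (u 0) (d 0)) (t + d 0) (Fin.tail d) (Fin.tail u)

/-- `T` is a differential operator of degree `t` and order `k` in the graded `B`-module `M`. -/
def IsDiffOp (ℬ : ℤ → Submodule K B) (ℳ : ℤ → Submodule K M) (t : ℤ) (k : ℕ)
    (T : Module.End K M) : Prop :=
  (∀ e : ℤ, ∀ m ∈ ℳ e, T m ∈ ℳ (t + e)) ∧
  ∀ (d : Fin (k + 1) → ℤ) (u : Fin (k + 1) → B), (∀ i, u i ∈ ℬ (d i)) → iterComm T t d u = 0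

end Commutators

/-! ### The graded symmetric algebra `S_A L` and the module `S_A L ⊗_A Q` -/

section Symmetric

variable {K A L Q : Type*} [Field K] [Ring A] [Algebra K A]
  [AddCommGroup L] [Module K L] [Module A L]
  [AddCommGroup Q] [Module K Q] [Module A Q]

/-- The relations that present `S_A L` as a quotient of the free `K`-algebra on `A × L`. -/
inductive SymRel (𝒜 : ℤ → Submodule K A) (ℒ : ℤ → Submodule K L) :
    TensorAlgebra K (A × L) → TensorAlgebra K (A × L) → Prop
  | one : SymRel 𝒜 ℒ (TensorAlgebra.ι K ((1, 0) : A × L)) 1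
  | mul (a b : A) : SymRel 𝒜 ℒ (TensorAlgebra.ι K ((a * b, 0) : A × L))
      (TensorAlgebra.ι K ((a, 0) : A × L) * TensorAlgebra.ι K ((b, 0) : A × L))
  | smul (a : A) (ξ : L) : SymRel 𝒜 ℒ (TensorAlgebra.ι K ((0, a • ξ) : A × L))
      (TensorAlgebra.ι K ((a, 0) : A × L) * TensorAlgebra.ι K ((0, ξ) : A × L))
  | comm_scalar (i j : ℤ) (a : A) (ξ : L) : a ∈ 𝒜 i → ξ ∈ ℒ j →
      SymRel 𝒜 ℒ
        (TensorAlgebra.ι K ((a, 0) : A × L) * TensorAlgebra.ι K ((0, ξ) : A × L))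
        (Int.negOnePow (i * j) •
          (TensorAlgebra.ι K ((0, ξ) : A × L) * TensorAlgebra.ι K ((a, 0) : A × L)))
  | comm (i j : ℤ) (ξ ζ : L) : ξ ∈ ℒ i → ζ ∈ ℒ j →
      SymRel 𝒜 ℒ
        (TensorAlgebra.ι K ((0, ξ) : A × L) * TensorAlgebra.ι K ((0, ζ) : A × L))
        (Int.negOnePow (i * j) •
          (TensorAlgebra.ι K ((0, ζ) : A × L) * TensorAlgebra.ι K ((0, ξ) : A × L)))

/-- The graded symmetric algebra `S_A L` of the graded module `L` over the graded commutative
algebra `A`. -/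
def SymAlg (𝒜 : ℤ → Submodule K A) (ℒ : ℤ → Submodule K L) : Type _ := RingQuot (SymRel 𝒜 ℒ)

variable (𝒜 : ℤ → Submodule K A) (ℒ : ℤ → Submodule K L) (𝒬 : ℤ → Submodule K Q)

instance : Ring (SymAlg 𝒜 ℒ) := inferInstanceAs (Ring (RingQuot (SymRel 𝒜 ℒ)))

instance : Algebra K (SymAlg 𝒜 ℒ) := inferInstanceAs (Algebra K (RingQuot (SymRel 𝒜 ℒ)))

/-- The canonical map `A → S_A L`. -/
def SymAlg.scalar : A →ₗ[K] SymAlg 𝒜 ℒ :=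
  (RingQuot.mkAlgHom K (SymRel 𝒜 ℒ)).toLinearMap ∘ₗ TensorAlgebra.ι K ∘ₗ LinearMap.inl K A L

/-- The canonical map `L → S_A L`. -/
def SymAlg.vec : L →ₗ[K] SymAlg 𝒜 ℒ :=
  (RingQuot.mkAlgHom K (SymRel 𝒜 ℒ)).toLinearMap ∘ₗ TensorAlgebra.ι K ∘ₗ LinearMap.inr K A L

/-- The product `ξ_1 ⋯ ξ_l` in `S_A L`. -/
def SymAlg.prod {l : ℕ} (ξ : Fin l → L) : SymAlg 𝒜 ℒ := (List.ofFn fun t => SymAlg.vec 𝒜 ℒ (ξ t)).prod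

/-- The symmetric `l`-tensors `S_A^l L`. -/
def SymAlg.weight (l : ℕ) : Submodule K (SymAlg 𝒜 ℒ) :=
  Submodule.span K {u | ∃ (a : A) (ξ : Fin l → L), u = SymAlg.scalar 𝒜 ℒ a * SymAlg.prod 𝒜 ℒ ξ}

/-- The tensors of degree `e`; the degree of `a ξ_1 ⋯ ξ_l` is `|a| + |ξ_1| + ⋯ + |ξ_l|`. -/
def SymAlg.grading (e : ℤ) : Submodule K (SymAlg 𝒜 ℒ) :=
  Submodule.span K {u | ∃ (i : ℤ) (l : ℕ) (d : Fin l → ℤ) (a : A) (ξ : Fin l → L),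
    a ∈ 𝒜 i ∧ (∀ t, ξ t ∈ ℒ (d t)) ∧ i + ∑ t, d t = e ∧
    u = SymAlg.scalar 𝒜 ℒ a * SymAlg.prod 𝒜 ℒ ξ}

/-- The relations `ua ⊗ q = u ⊗ aq` in `S_A L ⊗_K Q`. -/
def symTensorRel (Q : Type*) [AddCommGroup Q] [Module K Q] [Module A Q] :
    Submodule (SymAlg 𝒜 ℒ) (SymAlg 𝒜 ℒ ⊗[K] Q) :=
  Submodule.span (SymAlg 𝒜 ℒ) {x | ∃ (u : SymAlg 𝒜 ℒ) (a : A) (q : Q),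
    x = (u * SymAlg.scalar 𝒜 ℒ a) ⊗ₜ[K] q - u ⊗ₜ[K] (a • q)}

/-- The `S_A L`-module `S_A L ⊗_A Q`. -/
abbrev SymTensor (Q : Type*) [AddCommGroup Q] [Module K Q] [Module A Q] : Type _ :=
  (SymAlg 𝒜 ℒ ⊗[K] Q) ⧸ symTensorRel 𝒜 ℒ Q

/-- The element `u ⊗ q` of `S_A L ⊗_A Q`. -/
def symTmul (u : SymAlg 𝒜 ℒ) (q : Q) : SymTensor 𝒜 ℒ Q :=
  Submodule.Quotient.mk (u ⊗ₜ[K] q)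

/-- The elements of degree `e` of `S_A L ⊗_A Q`. -/
def symTensorGrading (e : ℤ) : Submodule K (SymTensor 𝒜 ℒ Q) :=
  Submodule.span K {x | ∃ (i j : ℤ) (u : SymAlg 𝒜 ℒ) (q : Q),
    u ∈ SymAlg.grading 𝒜 ℒ i ∧ q ∈ 𝒬 j ∧ i + j = e ∧ x = symTmul 𝒜 ℒ u q}

variable {𝒜 ℒ 𝒬}

/-- The `LR_∞[1]` algebra structure `Λ` on `(K, S_A L)` is the `P_∞[1]` algebra structure that
extends the structure multiderivation of `(A, L)`. -/
structure IsPoissonExtension (X : LRInfty 𝒜 ℒ)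
    (Λ : LRInfty (groundGrading K) (SymAlg.grading 𝒜 ℒ)) : Prop where
  vec : ∀ (k : ℕ) (ξ : Fin k → L),
    Λ.bracket k (fun t => SymAlg.vec 𝒜 ℒ (ξ t)) = SymAlg.vec 𝒜 ℒ (X.bracket k ξ)
  scalar : ∀ (n : ℕ) (ξ : Fin n → L) (a : A),
    Λ.bracket (n + 1)
        (Fin.snoc (α := fun _ => SymAlg 𝒜 ℒ) (fun t => SymAlg.vec 𝒜 ℒ (ξ t)) (SymAlg.scalar 𝒜 ℒ a))
      = SymAlg.scalar 𝒜 ℒ (X.anchor n ξ a)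
  /-- The brackets are multiderivations of the algebra `S_A L`. -/
  derivation : ∀ (n : ℕ) (d : Fin n → ℤ) (u : Fin n → SymAlg 𝒜 ℒ),
    (∀ t, u t ∈ SymAlg.grading 𝒜 ℒ (d t)) →
    ∀ (e : ℤ) (v : SymAlg 𝒜 ℒ), v ∈ SymAlg.grading 𝒜 ℒ e → ∀ w : SymAlg 𝒜 ℒ,
      Λ.bracket (n + 1) (Fin.snoc (α := fun _ => SymAlg 𝒜 ℒ) u (v * w))
        = Int.negOnePow ((1 + ∑ t, d t) * e) •
            (v * Λ.bracket (n + 1) (Fin.snoc (α := fun _ => SymAlg 𝒜 ℒ) u w))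
          + Λ.bracket (n + 1) (Fin.snoc (α := fun _ => SymAlg 𝒜 ℒ) u v) * w
  /-- The `k`-th bracket maps `S^{l_1} × ⋯ × S^{l_k}` to `S^m` with `m = l_1 + ⋯ + l_k - k + 1`. -/
  weight : ∀ (k : ℕ) (l : Fin k → ℕ) (u : Fin k → SymAlg 𝒜 ℒ),
    (∀ t, u t ∈ SymAlg.weight 𝒜 ℒ (l t)) →
    ∀ m : ℕ, m + k = ∑ t, l t + 1 → Λ.bracket k u ∈ SymAlg.weight 𝒜 ℒ m
  /-- ... and vanishes there if `m` is negative. -/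
  weight_neg : ∀ (k : ℕ) (l : Fin k → ℕ) (u : Fin k → SymAlg 𝒜 ℒ),
    (∀ t, u t ∈ SymAlg.weight 𝒜 ℒ (l t)) → ∑ t, l t + 1 < k → Λ.bracket k u = 0

/-- `D = D_1 + D_2 + ⋯` is the family of operators on `S_A L ⊗_A Q` given by the higher Rinehart
formula of the right connection `Δ`; `D k` is `D_k`. -/
structure IsRinehart {X : LRInfty 𝒜 ℒ} (Δ : RightConnection X 𝒬)
    (D : ℕ → Module.End K (SymTensor 𝒜 ℒ Q)) : Prop where
  zero : D 0 = 0
  formula : ∀ (n l : ℕ) (d : Fin l → ℤ) (ξ : Fin l → L), (∀ t, ξ t ∈ ℒ (d t)) → ∀ q : Q,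
    D (n + 1) (symTmul 𝒜 ℒ (SymAlg.prod 𝒜 ℒ ξ) q)
      = (if h : n + 1 ≤ l then
          ∑ τ ∈ unshuffles (n + 1) l, koszul τ d •
            symTmul 𝒜 ℒ
              (SymAlg.vec 𝒜 ℒ (X.bracket (n + 1) (block 0 (n + 1) (by omega) (ξ ∘ τ))) *
                SymAlg.prod 𝒜 ℒ (block (n + 1) (l - (n + 1)) (by omega) (ξ ∘ τ))) q
        else 0)
      - (if h : n ≤ l then
          ∑ σ ∈ unshuffles (l - n) l,
            (Int.negOnePow (∑ t, block 0 (l - n) (by omega) (d ∘ σ) t) * koszul σ d) •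
              symTmul 𝒜 ℒ (SymAlg.prod 𝒜 ℒ (block 0 (l - n) (by omega) (ξ ∘ σ)))
                (Δ.op n (block (l - n) n (by omega) (ξ ∘ σ)) q)
        else 0)

end Symmetric

/-- The component `𝒥_k = ½ ∑_{i + j = k + 1} [D_i, D_j]` of `½ [D, D]`, where the `D_i` are odd. -/
def halfSquare {K M : Type*} [Field K] [AddCommGroup M] [Module K M]
    (D : ℕ → Module.End K M) (k : ℕ) : Module.End K M :=
  (2 : K)⁻¹ • ∑ p ∈ Finset.HasAntidiagonal.antidiagonal (k + 1), (D p.1 * D p.2 + D p.2 * D p.1)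

end SHLR

end

open SHLR

noncomputable section

namespace SHLR

set_option linter.unusedSectionVars false

/-! ### Permutations of `n + 1` indices and their signs -/

/-! The engine is the correspondence between odd operators and their jets. Moving an operator `T`
past a product gives `T (x_1 ⋯ x_l m) = ∑ ± x_J [T, x_I] m` over all splittings into complementary
subwords (`apply_mulL_smul`), so `T` is determined by the values of its iterated commutators on
module generators. Over the free graded commutative algebra these values may be prescribed as any
graded symmetric function `F` of words: the algebra acts on such functions by `(x_i F)(l) = F (l ++
[i]) ± x_i F(l)` (`jetAct`, well defined by `jetAct_comm`), and `u ↦ (u F)(l)` is the commutator,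
along the word `l`, of the operator sought. If `F` vanishes on words longer than `k`, the operator
has order `k`.

Brackets. On homogeneous `K`-bases of `A` and `L`, let `F_k` be `X_k` on `k` letters from `L`, the
anchor on `k - 1` letters from `L` and one from `A`, and zero otherwise. The operator `D_k` so
obtained has order `k`, and its `k`-fold commutators are multiplications by elements that define the
`k`-th bracket (`freeBr_isSymbol`); this alone makes the bracket a multiderivation. Commutators with
multiplications are derivations of composition (`itL_mul`), so the `k`-fold commutator of `∑ D_i
D_j`, `i + j = k + 1`, is multiplication by the Jacobiator (`IsSymbol.square_one`). Its vanishing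
can be tested on generators (`itL_eq_zero_of_gen`), where it is one of the two Jacobi identities of
`X`, or trivial if two letters come from `A`. The algebra `S_A L` is a quotient of the free algebra,
and the kernel is spanned by homogeneous elements all of whose brackets lie in the kernel again
(`mem_poissonIdeal`); this uses the derivation property and `A`-linearity of the anchors and the
Leibniz rule of `X`. Hence the brackets descend. They are unique because multiderivations are
determined on generators and because brackets with two scalar entries have negative weight.

Rinehart operators. The same construction is run with values in `Hom_K(Q, S_A L ⊗_A Q)`: the jet of
`D_k` on `1 ⊗ q` is `X_k(ξ) ⊗ q` on `k` vectors, `-1 ⊗ Δ(ξ|q)` on `k - 1` vectors, and the anchor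
term if one letter is a scalar. To descend to `S_A L ⊗_A Q` the jets must vanish on the kernel
(`jetOp_eq_zero`) and respect `ua ⊗ q = u ⊗ aq` (`jetOp_mul_scalar`). Both reduce to `jetVec_smul`
and `jetVec_cons`, that is, to the two axioms of a right connection played against the Leibniz rule
of `X`. The explicit formula is the rule for moving `D_k` past `ξ_1 ⋯ ξ_l`. The jets of length `k`
are multiplications by brackets and the longer ones vanish, which gives (1) on generators and then
everywhere (`rinehartOp_isSymbol`).

The rest is formal. Part (3) is the Leibniz rule for iterated commutators
(`IsGradedComm.itL_mul_cons`) together with (1). For the curvature, take the `n`-fold commutator of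
`∑ D_i D_j` with `i + j = n + 2`. For a splitting `I, J` of the arguments only `(i, j) = (|I|, |J| +
2)`, `(|I| + 1, |J| + 1)`, `(|I| + 2, |J|)` survive; the outer two combine to `R({I}, J | ·)` and
the middle one is `R(I | R(J | ·))` up to sign (`IsSymbol.square_two`). Passing to `-R` produces the
relative sign in the definition of the curvature.

Two devices keep the signs manageable. Tuples are replaced by lists of elements paired with degrees,
and sums over unshuffles by the recursion `ush`. Iterated commutators involve the degrees of their
arguments, but only through parities, so projections to the even and odd parts turn them into honest
multilinear maps (`itMul`). -/

theorem negOnePow_congr {a b : ℤ} (h : Even (a - b)) : a.negOnePow = b.negOnePow :=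
  (Int.negOnePow_eq_iff a b).2 h

/-- The permutation of `n + 1` indices that maps `j` to `0` and is `σ` on the remaining indices. -/
def insertAt {n : ℕ} (j : Fin (n + 1)) (σ : Equiv.Perm (Fin n)) : Equiv.Perm (Fin (n + 1)) :=
  (finSuccEquiv' j).trans ((Equiv.optionCongr σ).trans (finSuccEquiv' 0).symm)

@[simp] theorem insertAt_self {n : ℕ} (j : Fin (n + 1)) (σ : Equiv.Perm (Fin n)) :
    insertAt j σ j = 0 := by
  simp [insertAt]

@[simp] theorem insertAt_succAbove {n : ℕ} (j : Fin (n + 1)) (σ : Equiv.Perm (Fin n)) (a : Fin n) :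
    insertAt j σ (j.succAbove a) = (σ a).succ := by
  simp [insertAt]

/-- The index `j` is recovered as the preimage of `0`, and then `σ` from the other values; the
cardinalities are both `(n + 1)!`. -/
theorem insertAt_bijective (n : ℕ) : Function.Bijective
    (fun p : Fin (n + 1) × Equiv.Perm (Fin n) => insertAt p.1 p.2) := by
  rw [Fintype.bijective_iff_injective_and_card]
  constructor
  · rintro ⟨j, σ⟩ ⟨k, τ⟩ h
    simp only at h
    have hjk : j = k := by
      have h1 : insertAt k τ j = 0 := by rw [← h]; simp
      rw [← insertAt_self k τ] at h1
      exact (insertAt k τ).injective h1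
    subst hjk
    have : σ = τ := by
      ext a
      have := congrArg (fun ρ => ρ (j.succAbove a)) h
      simp only [insertAt_succAbove] at this
      rw [Fin.succ_injective _ this]
    rw [this]
  · simp [Fintype.card_perm, Nat.factorial_succ]

theorem sum_perm_succ {M : Type*} [AddCommMonoid M] {n : ℕ} (f : Equiv.Perm (Fin (n + 1)) → M) :
    ∑ σ, f σ = ∑ j, ∑ σ, f (insertAt j σ) := by
  rw [← Fintype.sum_prod_type']
  exact ((insertAt_bijective n).sum_comp f).symm

/-- Position `j` carries the least value, so it forms an inversion exactly with the positions before
it; all other inversions are those of `σ`. This is the recursion that matches Koszul signs with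
operations on lists. -/
theorem koszul_insertAt {n : ℕ} (j : Fin (n + 1)) (σ : Equiv.Perm (Fin n)) (d : Fin (n + 1) → ℤ) :
    koszul (insertAt j σ) d
      = (∏ a : Fin n, if (a : ℕ) < j then (d 0 * d (σ a).succ).negOnePow else 1)
        * koszul σ (Fin.tail d) := by
  have h1 : ∀ a : Fin n, j.succAbove a < j ↔ (a : ℕ) < j := by
    intro a
    rw [Fin.succAbove_lt_iff_castSucc_lt]
    rfl
  simp only [koszul, Finset.prod_filter, Fintype.prod_prod_type]
  rw [Fin.prod_univ_succAbove _ j]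
  simp only [Fin.prod_univ_succAbove _ j, insertAt_self, insertAt_succAbove, if_false, Fin.not_lt_zero, and_false, Finset.prod_const_one, one_mul,
    Fin.succ_pos, and_true, Finset.prod_mul_distrib, h1, Fin.succ_lt_succ_iff,
    Fin.succAbove_lt_succAbove_iff, Fin.tail, mul_comm (d 0)]

theorem comp_insertAt {α : Type*} {n : ℕ} (v : Fin (n + 1) → α) (j : Fin (n + 1))
    (σ : Equiv.Perm (Fin n)) :
    v ∘ insertAt j σ = Fin.insertNth (α := fun _ => α) j (v 0) (Fin.tail v ∘ σ) := by
  funext a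
  refine Fin.succAboveCases j ?_ (fun b => ?_) a
  · simp
  · simp [Fin.tail]

/-! ### Graded symmetric functions of lists -/

section Lists

variable {α : Type*} {M : Type*} [AddCommGroup M]

/-- The total degree of a list. -/
def degL (l : List (ℤ × α)) : ℤ := (l.map Prod.fst).sum

@[simp] theorem degL_nil : degL ([] : List (ℤ × α)) = 0 := rfl

@[simp] theorem degL_cons (x : ℤ × α) (l : List (ℤ × α)) : degL (x :: l) = x.1 + degL l := by
  simp [degL]

@[simp] theorem degL_append (l l' : List (ℤ × α)) : degL (l ++ l') = degL l + degL l' := by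
  simp [degL]

theorem degL_ofFn {n : ℕ} (v : Fin n → ℤ × α) : degL (List.ofFn v) = ∑ t, (v t).1 := by
  simp [degL, List.map_ofFn, List.sum_ofFn]

/-- A function of lists of homogeneous elements is graded symmetric. -/
def GradedSymm (f : List (ℤ × α) → M) : Prop :=
  ∀ (l₁ l₂ : List (ℤ × α)) (x y : ℤ × α),
    f (l₁ ++ x :: y :: l₂) = (x.1 * y.1).negOnePow • f (l₁ ++ y :: x :: l₂)

theorem GradedSymm.cons {f : List (ℤ × α) → M} (hf : GradedSymm f) (x : ℤ × α) :
    GradedSymm (fun l => f (x :: l)) := by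
  intro l₁ l₂ y z
  exact hf (x :: l₁) l₂ y z

theorem insertNth_succ_eq_cons {β : Type*} {n : ℕ} (x : β) (w : Fin (n + 1) → β)
    (j : Fin (n + 1)) : Fin.insertNth (α := fun _ => β) j.succ x w
      = Fin.cons (w 0) (Fin.insertNth (α := fun _ => β) j x (Fin.tail w)) := by
  funext a
  refine Fin.cases ?_ (fun b => ?_) a
  · have : (0 : Fin (n + 2)) = j.succ.succAbove 0 := by simp
    rw [this, Fin.insertNth_apply_succAbove]
    simp
  · refine Fin.succAboveCases j ?_ (fun c => ?_) b
    · simp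
    · rw [Fin.cons_succ, Fin.insertNth_apply_succAbove, ← Fin.succ_succAbove_succ,
        Fin.insertNth_apply_succAbove]
      rfl

theorem ofFn_insertNth {β : Type*} {n : ℕ} (x : β) (w : Fin n → β) (j : Fin (n + 1)) :
    List.ofFn (Fin.insertNth (α := fun _ => β) j x w)
      = (List.ofFn w).take j ++ x :: (List.ofFn w).drop j := by
  induction n with
  | zero =>
    obtain rfl : j = 0 := Fin.eq_zero j
    simp [Fin.insertNth_zero']
  | succ n ih =>
    refine Fin.cases ?_ (fun j => ?_) j
    · simp [Fin.insertNth_zero']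
    · rw [insertNth_succ_eq_cons, List.ofFn_cons, ih, List.ofFn_succ (f := w)]
      rfl

/-- The entry `x` is carried to the front by passing the `j` entries before it one at a time. -/
theorem GradedSymm.move {n : ℕ} (x : ℤ × α) (w : Fin n → ℤ × α) (j : Fin (n + 1))
    {f : List (ℤ × α) → M} (hf : GradedSymm f) :
    f (List.ofFn (Fin.insertNth (α := fun _ => ℤ × α) j x w))
      = (∏ a : Fin n, if (a : ℕ) < j then (x.1 * (w a).1).negOnePow else 1)
        • f (x :: List.ofFn w) := by
  induction n generalizing f with
  | zero =>
    obtain rfl : j = 0 := Fin.eq_zero j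
    simp [Fin.insertNth_zero']
  | succ n ih =>
    refine Fin.cases ?_ (fun j => ?_) j
    · simp [Fin.insertNth_zero']
    · rw [insertNth_succ_eq_cons, List.ofFn_cons, ih (Fin.tail w) j (hf.cons (w 0)), Fin.prod_univ_succ,
        List.ofFn_succ (f := w)]
      have := hf [] (List.ofFn fun i => w i.succ) (w 0) x
      simp only [List.nil_append] at this
      simp only [Fin.tail_def]
      rw [this, smul_smul, mul_comm]
      simp [mul_comm]

/-- A graded symmetric function changes by the Koszul sign under permutations. -/
theorem GradedSymm.perm {n : ℕ} (σ : Equiv.Perm (Fin n)) (v : Fin n → ℤ × α)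
    {f : List (ℤ × α) → M} (hf : GradedSymm f) :
    f (List.ofFn (v ∘ σ)) = koszul σ (fun t => (v t).1) • f (List.ofFn v) := by
  induction n generalizing f with
  | zero =>
    have : v ∘ σ = v := funext fun a => a.elim0
    rw [this]
    simp [koszul, Finset.univ_eq_empty]
  | succ n ih =>
    obtain ⟨⟨j, σ⟩, rfl⟩ := (insertAt_bijective n).2 σ
    simp only
    rw [comp_insertAt, hf.move, ih σ (Fin.tail v) (hf.cons (v 0)), koszul_insertAt, smul_smul,
      List.ofFn_succ (f := v)]
    rfl

/-- An adjacent transposition has a single inversion. -/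
theorem koszul_swap {n : ℕ} (i j : Fin n) (hij : (i : ℕ) + 1 = j) (d : Fin n → ℤ) :
    koszul (Equiv.swap i j) d = (d i * d j).negOnePow := by
  unfold koszul
  have : (Finset.univ.filter (fun p : Fin n × Fin n => p.1 < p.2 ∧
      Equiv.swap i j p.2 < Equiv.swap i j p.1)) = {(i, j)} := by
    ext ⟨a, b⟩
    simp only [Finset.mem_filter, Finset.mem_univ, true_and, Finset.mem_singleton, Prod.mk.injEq]
    simp only [Equiv.swap_apply_def, Fin.lt_def, Fin.ext_iff]
    split_ifs <;> simp_all <;> omega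
  rw [this, Finset.prod_singleton, Equiv.swap_apply_left, Equiv.swap_apply_right, mul_comm]

theorem exists_ofFn_append (l₁ l₂ : List α) (x y : α) :
    ∃ (n : ℕ) (v : Fin n → α) (i j : Fin n), (i : ℕ) + 1 = j ∧ v i = y ∧ v j = x ∧
      l₁ ++ y :: x :: l₂ = List.ofFn v ∧ l₁ ++ x :: y :: l₂ = List.ofFn (v ∘ Equiv.swap i j) := by
  refine ⟨(l₁ ++ y :: x :: l₂).length, (l₁ ++ y :: x :: l₂).get, ⟨l₁.length, by simp⟩,
    ⟨l₁.length + 1, by simp⟩, rfl, by simp, by simp, (List.ofFn_get _).symm, ?_⟩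
  refine List.ext_getElem (by simp; omega) ?_
  intro m h1 h2
  simp only [List.getElem_ofFn, Function.comp, Equiv.swap_apply_def, Fin.ext_iff]
  rcases lt_trichotomy m l₁.length with h | h | h
  · have h3 : m ≠ l₁.length := by omega
    have h4 : m ≠ l₁.length + 1 := by omega
    simp [h3, h4, List.getElem_append_left h]
  · subst h; simp
  · by_cases h5 : m = l₁.length + 1
    · subst h5; simp
    · obtain ⟨k, rfl⟩ : ∃ k, m = l₁.length + (k + 2) := ⟨m - l₁.length - 2, by omega⟩
      simp [List.getElem_append_right]

/-- Functions of tuples as functions of lists. -/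
def toL {X Y : Type*} (f : ∀ n : ℕ, (Fin n → X) → Y) (l : List X) : Y := f l.length l.get

@[simp] theorem toL_ofFn {X Y : Type*} (f : ∀ n : ℕ, (Fin n → X) → Y) {n : ℕ} (v : Fin n → X) :
    toL f (List.ofFn v) = f n v := by
  have := List.equivSigmaTuple.apply_symm_apply (⟨n, v⟩ : Σ n, Fin n → X)
  exact congrArg (fun s : (Σ n, Fin n → X) => f s.1 s.2) this

/-- A converse to `GradedSymm.perm`, since adjacent transpositions are permutations. The predicate
`H` will be homogeneity: outside it nothing is known about symmetry, so the function is taken to be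
zero there. -/
theorem gradedSymm_of_koszul (H : List (ℤ × α) → Prop) (hH : ∀ l₁ l₂ x y, H (l₁ ++ x :: y :: l₂) →
      H (l₁ ++ y :: x :: l₂)) (f : List (ℤ × α) → M) (h0 : ∀ l, ¬ H l → f l = 0)
    (h : ∀ (n : ℕ) (v : Fin n → ℤ × α), H (List.ofFn v) → ∀ σ : Equiv.Perm (Fin n),
      f (List.ofFn (v ∘ σ)) = koszul σ (fun t => (v t).1) • f (List.ofFn v)) :
    GradedSymm f := by
  intro l₁ l₂ x y
  by_cases hl : H (l₁ ++ x :: y :: l₂)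
  · have hl' := hH _ _ _ _ hl
    obtain ⟨n, v, i, j, hij, hi, hj, h1, h2⟩ := exists_ofFn_append l₁ l₂ x y
    rw [h1] at hl'
    rw [h2, h1, h n v hl', koszul_swap i j hij, hi, hj, mul_comm]
  · have hl' : ¬ H (l₁ ++ y :: x :: l₂) := fun h => hl (hH _ _ _ _ h)
    rw [h0 _ hl, h0 _ hl', smul_zero]

/-- A property of lists that is stable under adjacent transpositions is stable under
permutations. -/
theorem perm_of_swap {β : Type*} {P : List β → Prop}
    (hP : ∀ l₁ l₂ x y, P (l₁ ++ x :: y :: l₂) → P (l₁ ++ y :: x :: l₂)) {l l' : List β}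
    (h : l.Perm l') : P l → P l' := by
  suffices ∀ l₀, P (l₀ ++ l) → P (l₀ ++ l') from this []
  induction h with
  | nil => exact fun _ h => h
  | cons x _ ih =>
    intro l₀ h
    have := ih (l₀ ++ [x])
    simp only [List.append_assoc, List.singleton_append] at this
    exact this h
  | swap x y l => exact fun l₀ h => hP _ _ _ _ h
  | trans _ _ ih1 ih2 => exact fun l₀ h => ih2 l₀ (ih1 l₀ h)

/-! ### Sums over unshuffles -/

/-- The sum of `± G I J` over all ways to split a list into two complementary sublists, with Koszul
signs. -/
def ush : List (ℤ × α) → (List (ℤ × α) → List (ℤ × α) → M) → M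
  | [], G => G [] []
  | x :: l, G => ush l (fun I J => G (x :: I) J)
      + ush l (fun I J => (x.1 * degL I).negOnePow • G I (x :: J))

theorem ush_congr (l : List (ℤ × α)) {G G' : List (ℤ × α) → List (ℤ × α) → M}
    (h : ∀ I J, (I ++ J).Perm l → G I J = G' I J) : ush l G = ush l G' := by
  induction l generalizing G G' with
  | nil => exact h [] [] (by simp)
  | cons x l ih =>
    simp only [ush]
    congr 1
    · exact ih fun I J hIJ => h _ _ (by simpa using hIJ)
    · exact ih fun I J hIJ => by
        rw [h I (x :: J) (List.perm_middle.trans (hIJ.cons x))]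

theorem ush_add (l : List (ℤ × α)) (G G' : List (ℤ × α) → List (ℤ × α) → M) :
    ush l (fun I J => G I J + G' I J) = ush l G + ush l G' := by
  induction l generalizing G G' with
  | nil => rfl
  | cons x l ih =>
    simp only [ush, smul_add, ih]
    abel

theorem ush_map {N F : Type*} [AddCommGroup N] [FunLike F M N] [AddMonoidHomClass F M N] (f : F)
    (l : List (ℤ × α)) (G : List (ℤ × α) → List (ℤ × α) → M) :
    f (ush l G) = ush l (fun I J => f (G I J)) := by
  induction l generalizing G with
  | nil => rfl
  | cons x l ih =>
    simp only [ush, map_add, ih]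
    simp only [Units.smul_def, map_zsmul]

theorem ush_zero (l : List (ℤ × α)) : ush l (fun _ _ => (0 : M)) = 0 := by
  induction l with
  | nil => rfl
  | cons x l ih => simp [ush, ih]

theorem ush_smul (s : ℤˣ) (l : List (ℤ × α)) (G : List (ℤ × α) → List (ℤ × α) → M) :
    s • ush l G = ush l (fun I J => s • G I J) :=
  ush_map (DistribSMul.toAddMonoidHom M s) l G

theorem ush_sum {κ : Type*} (s : Finset κ) (l : List (ℤ × α))
    (G : κ → List (ℤ × α) → List (ℤ × α) → M) :
    ∑ k ∈ s, ush l (G k) = ush l (fun I J => ∑ k ∈ s, G k I J) := by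
  classical
  induction s using Finset.induction_on with
  | empty => simp [ush_zero]
  | insert a s ha ih => simp only [Finset.sum_insert ha, ush_add, ih]

/-- Interchanging the two sublists. -/
theorem ush_swap (l : List (ℤ × α)) (G : List (ℤ × α) → List (ℤ × α) → M) :
    ush l G = ush l (fun I J => (degL I * degL J).negOnePow • G J I) := by
  induction l generalizing G with
  | nil => simp [ush]
  | cons x l ih =>
    simp only [ush]
    rw [ih, ih (fun I J => (x.1 * degL I).negOnePow • G I (x :: J)), add_comm]
    congr 1
    · refine ush_congr l fun I J _ => ?_
      rw [smul_smul, ← Int.negOnePow_add]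
      congr 1
      exact negOnePow_congr ⟨0, by simp; ring⟩
    · refine ush_congr l fun I J _ => ?_
      rw [smul_smul, ← Int.negOnePow_add]
      congr 1
      exact negOnePow_congr ⟨-(degL I * x.1), by simp; ring⟩

/-- `ush` peels entries off the front; this peels one off the end. If `y` goes to the first sublist
it has to pass all of the second, whence the sign. -/
theorem ush_append_singleton (l : List (ℤ × α)) (y : ℤ × α)
    (G : List (ℤ × α) → List (ℤ × α) → M) :
    ush (l ++ [y]) G = ush l (fun I J => G I (J ++ [y]))
      + ush l (fun I J => (y.1 * degL J).negOnePow • G (I ++ [y]) J) := by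
  induction l generalizing G with
  | nil => simp [ush, add_comm]
  | cons x l ih =>
    simp only [List.cons_append, ush, ih]
    rw [add_add_add_comm]
    congr 2
    refine ush_congr l fun I J _ => ?_
    rw [smul_smul, smul_smul, ← Int.negOnePow_add, ← Int.negOnePow_add]
    congr 1
    exact negOnePow_congr ⟨0, by simp; ring⟩

theorem prod_negOnePow_take {n : ℕ} (x : ℤ) (w : Fin n → ℤ × α) (i : ℕ) :
    (∏ a : Fin n, if (a : ℕ) < i then (x * (w a).1).negOnePow else 1)
      = (x * degL ((List.ofFn w).take i)).negOnePow := by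
  induction n generalizing i with
  | zero => simp
  | succ n ih =>
    cases i with
    | zero => simp
    | succ i =>
      have := ih (fun a => w a.succ) i
      rw [Fin.prod_univ_succ, List.ofFn_succ, List.take_succ_cons, degL_cons, mul_add,
        Int.negOnePow_add, ← this]
      simp

theorem mem_unshuffles {i n : ℕ} {σ : Equiv.Perm (Fin n)} : σ ∈ unshuffles i n ↔
    (∀ a b : Fin n, a < b → (b : ℕ) < i → σ a < σ b) ∧
    (∀ a b : Fin n, a < b → i ≤ (a : ℕ) → σ a < σ b) := by
  simp [unshuffles]

theorem val_succAbove {n : ℕ} (j : Fin (n + 1)) (a : Fin n) :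
    (j.succAbove a : ℕ) = if (a : ℕ) < j then (a : ℕ) else a + 1 := by
  simp only [Fin.succAbove, Fin.lt_def, Fin.val_castSucc]
  split_ifs <;> simp

/-- In an unshuffle the least value stands at the beginning of one of the two increasing blocks, so
at position `0` or `i`. The condition `i ≠ 0` makes the two alternatives disjoint. -/
theorem insertAt_mem_unshuffles {i n : ℕ} (j : Fin (n + 1)) (σ : Equiv.Perm (Fin n)) :
    insertAt j σ ∈ unshuffles i (n + 1) ↔
      (j = 0 ∧ i ≠ 0 ∧ σ ∈ unshuffles (i - 1) n) ∨ ((j : ℕ) = i ∧ σ ∈ unshuffles i n) := by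
  simp only [mem_unshuffles]
  constructor
  · rintro ⟨h1, h2⟩
    have h3 : j = 0 ∨ (j : ℕ) = i := by
      by_contra! h
      obtain ⟨h, h'⟩ := h
      have h0 : 0 < j := Fin.pos_iff_ne_zero.2 h
      rcases lt_or_gt_of_ne h' with h'' | h''
      · simpa using h1 0 j h0 h''
      · simpa using h2 ⟨i, by omega⟩ j h'' le_rfl
    have h4 : ∀ a b : Fin n, a < b → (j.succAbove b : ℕ) < i → σ a < σ b := fun a b hab hb => by
      simpa using h1 (j.succAbove a) (j.succAbove b) (by simpa using hab) hb
    have h5 : ∀ a b : Fin n, a < b → i ≤ (j.succAbove a : ℕ) → σ a < σ b := fun a b hab hb => by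
      simpa using h2 (j.succAbove a) (j.succAbove b) (by simpa using hab) hb
    simp only [val_succAbove] at h4 h5
    by_cases h6 : (j : ℕ) = i
    · refine Or.inr ⟨h6, fun a b hab hb => h4 a b hab ?_, fun a b hab ha => h5 a b hab ?_⟩
      · split_ifs <;> omega
      · split_ifs <;> omega
    · obtain rfl : j = 0 := by tauto
      refine Or.inl ⟨rfl, fun h => h6 (by simp [h]), fun a b hab hb => h4 a b hab ?_,
        fun a b hab ha => h5 a b hab ?_⟩
      · simp; omega
      · simp; omega
  · intro h
    constructor
    · intro a b
      refine Fin.succAboveCases j ?_ (fun b => ?_) b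
      · intro h1 h2
        exfalso
        rcases h with ⟨rfl, -⟩ | ⟨h, -⟩
        · simp at h1
        · omega
      · refine Fin.succAboveCases j ?_ (fun a => ?_) a
        · simp
        · simp only [insertAt_succAbove, Fin.succAbove_lt_succAbove_iff, Fin.succ_lt_succ_iff,
            val_succAbove]
          rcases h with ⟨rfl, h0, h3, -⟩ | ⟨h, h3, -⟩
          · intro h1 h2
            exact h3 a b h1 (by simp at h2; omega)
          · intro h1 h2
            exact h3 a b h1 (by split_ifs at h2 <;> omega)
    · intro a b
      refine Fin.succAboveCases j ?_ (fun b => ?_) b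
      · intro h1 h2
        exfalso
        rcases h with ⟨rfl, -⟩ | ⟨h, -⟩
        · simp at h1
        · have : (a : ℕ) < j := h1
          omega
      · refine Fin.succAboveCases j ?_ (fun a => ?_) a
        · simp
        · simp only [insertAt_succAbove, Fin.succAbove_lt_succAbove_iff, Fin.succ_lt_succ_iff,
            val_succAbove]
          rcases h with ⟨rfl, h0, -, h3⟩ | ⟨h, -, h3⟩
          · intro h1 h2
            exact h3 a b h1 (by simp at h2; omega)
          · intro h1 h2
            exact h3 a b h1 (by split_ifs at h2 <;> omega)

/-- The sum over the `(i, n - i)`-unshuffles. -/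
theorem sum_unshuffles {i n : ℕ} (h : i ≤ n) (v : Fin n → ℤ × α)
    (G : List (ℤ × α) → List (ℤ × α) → M) :
    ∑ σ ∈ unshuffles i n, koszul σ (fun t => (v t).1) •
        G ((List.ofFn (v ∘ σ)).take i) ((List.ofFn (v ∘ σ)).drop i)
      = ush (List.ofFn v) (fun I J => if I.length = i then G I J else 0) := by
  classical
  induction n generalizing i G with
  | zero =>
    obtain rfl : i = 0 := by omega
    have : unshuffles 0 0 = {1} := by
      ext σ
      simp [mem_unshuffles, Subsingleton.elim σ 1]
    rw [this]
    simp [ush, koszul]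
  | succ n ih =>
    have hsplit : ∀ (j : Fin (n + 1)) (σ : Equiv.Perm (Fin n)) (y : M),
        (if insertAt j σ ∈ unshuffles i (n + 1) then y else 0)
          = (if j = 0 then (if i ≠ 0 then (if σ ∈ unshuffles (i - 1) n then y else 0) else 0) else 0)
            + (if (j : ℕ) = i then (if σ ∈ unshuffles i n then y else 0) else 0) := by
      intro j σ y
      simp only [insertAt_mem_unshuffles]
      by_cases h0 : i = 0
      · subst h0; simp [ite_and]
      · by_cases h1 : j = 0
        · subst h1; simp [h0, Ne.symm h0]
        · simp [h1, ite_and]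
    rw [← Fintype.sum_ite_mem, sum_perm_succ]
    simp only [hsplit, Finset.sum_add_distrib]
    rw [List.ofFn_succ, ush]
    congr 1
    · rw [Finset.sum_eq_single 0 (fun j _ hj => by simp [hj]) (by simp)]
      cases i with
      | zero => simp [ush_zero]
      | succ i =>
        have := ih (i := i) (by omega) (Fin.tail v) (fun I J => G (v 0 :: I) J)
        simp only [List.length_cons, Nat.add_right_cancel_iff]
        refine Eq.trans ?_ this
        simp only [if_true, ne_eq, Nat.succ_ne_zero, not_false_eq_true, Nat.add_sub_cancel]
        rw [Fintype.sum_ite_mem]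
        refine Finset.sum_congr rfl fun σ _ => ?_
        rw [comp_insertAt, koszul_insertAt, Fin.insertNth_zero']
        simp
        rfl
    · by_cases hi : i ≤ n
      · rw [Finset.sum_eq_single ⟨i, by omega⟩
          (fun j _ hj => Finset.sum_eq_zero fun σ _ => if_neg fun h => hj (Fin.ext h)) (by simp)]
        have := ih (i := i) hi (Fin.tail v)
          (fun I J => ((v 0).1 * degL I).negOnePow • G I (v 0 :: J))
        simp only [smul_ite, smul_zero]
        refine Eq.trans ?_ this
        simp only [if_true]
        rw [Fintype.sum_ite_mem]
        refine Finset.sum_congr rfl fun σ _ => ?_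
        have hl : ((List.ofFn (Fin.tail v ∘ σ)).take i).length = i := by simp [hi]
        have hp := prod_negOnePow_take (v 0).1 (Fin.tail v ∘ σ) i
        rw [comp_insertAt, koszul_insertAt, ofFn_insertNth, List.take_left' hl,
          List.drop_left' hl, smul_smul, mul_comm, ← hp]
        rfl
      -- Here `i = n + 1`: the second block is empty, so the least value cannot open it.
      · rw [Finset.sum_eq_zero fun (j : Fin (n + 1)) _ => Finset.sum_eq_zero fun σ _ =>
          if_neg (by have := j.2; omega)]
        rw [ush_congr _ (G' := fun _ _ => 0), ush_zero]
        intro I J hIJ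
        have := hIJ.length_eq
        simp only [List.length_append, List.length_ofFn] at this
        rw [if_neg (by omega), smul_zero]

/-- The sum over all unshuffles of `n` indices. -/
theorem sum_sum_unshuffles {n : ℕ} (v : Fin n → ℤ × α)
    (G : List (ℤ × α) → List (ℤ × α) → M) :
    ∑ i : Fin (n + 1), ∑ σ ∈ unshuffles i n, koszul σ (fun t => (v t).1) •
        G ((List.ofFn (v ∘ σ)).take i) ((List.ofFn (v ∘ σ)).drop i)
      = ush (List.ofFn v) G := by
  rw [Finset.sum_congr rfl fun (i : Fin (n + 1)) _ => sum_unshuffles (by omega) v G, ush_sum]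
  refine ush_congr _ fun I J hIJ => ?_
  have := hIJ.length_eq
  simp only [List.length_append, List.length_ofFn] at this
  rw [Finset.sum_eq_single ⟨I.length, by omega⟩ (fun j _ hj => if_neg fun h => hj (Fin.ext h.symm))
    (by simp)]
  simp

theorem take_ofFn {β : Type*} {n i : ℕ} (h : 0 + i ≤ n) (v : Fin n → β) :
    (List.ofFn v).take i = List.ofFn (block 0 i h v) := by
  refine List.ext_getElem (by simp; omega) fun m h1 h2 => ?_
  simp [block]

theorem drop_ofFn {β : Type*} {n i : ℕ} (h : i + (n - i) ≤ n) (v : Fin n → β) :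
    (List.ofFn v).drop i = List.ofFn (block i (n - i) h v) := by
  refine List.ext_getElem (by simp) fun m h1 h2 => ?_
  simp [block]

end Lists

/-! ### Lists of homogeneous elements -/

section Homogeneous

variable {K V : Type*} [Field K] [AddCommGroup V] [Module K V] {𝒱 : ℤ → Submodule K V}

/-- All entries of a list are homogeneous of the indicated degree. -/
def Homog {K V : Type*} [Field K] [AddCommGroup V] [Module K V] (𝒱 : ℤ → Submodule K V)
    (l : List (ℤ × V)) : Prop := ∀ x ∈ l, x.2 ∈ 𝒱 x.1

theorem homog_nil : Homog 𝒱 [] := by simp [Homog]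

theorem homog_cons {x : ℤ × V} {l : List (ℤ × V)} :
    Homog 𝒱 (x :: l) ↔ x.2 ∈ 𝒱 x.1 ∧ Homog 𝒱 l := by
  simp [Homog]

theorem homog_append {l l' : List (ℤ × V)} :
    Homog 𝒱 (l ++ l') ↔ Homog 𝒱 l ∧ Homog 𝒱 l' := by
  simp [Homog, or_imp, forall_and]

theorem homog_perm {l l' : List (ℤ × V)} (h : l.Perm l') : Homog 𝒱 l ↔ Homog 𝒱 l' := by
  simp [Homog, h.mem_iff]

theorem homog_ofFn {n : ℕ} (d : Fin n → ℤ) (u : Fin n → V) (h : ∀ t, u t ∈ 𝒱 (d t)) :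
    Homog 𝒱 (List.ofFn fun i => (d i, u i)) := by
  simp only [Homog, List.mem_ofFn, forall_exists_index, forall_apply_eq_imp_iff]
  exact h

end Homogeneous

/-! ### Iterated graded commutators along lists -/

section Operators

variable {K B M : Type*} [Field K] [Ring B] [Algebra K B]
  [AddCommGroup M] [Module K M] [Module B M] [IsScalarTower K B M]

theorem mu_apply (u : B) (m : M) : mu K u m = u • m := rfl

theorem mu_mul (u v : B) : mu K (M := M) (u * v) = mu K u * mu K v := by
  ext m
  exact mul_smul u v m

theorem mu_one : mu K (M := M) (1 : B) = 1 := by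
  ext m
  exact one_smul B m

theorem mu_add (u v : B) : mu K (M := M) (u + v) = mu K u + mu K v := by
  ext m
  exact add_smul u v m

theorem mu_smul (c : K) (u : B) : mu K (M := M) (c • u) = c • mu K u := by
  ext m
  exact smul_assoc c u m

theorem mu_zero : mu K (M := M) (0 : B) = 0 := by
  ext m
  exact zero_smul B m

theorem mu_units_smul (s : ℤˣ) (u : B) : mu K (M := M) (s • u) = s • mu K u := by
  ext m
  exact smul_assoc s u m

/-- The iterated graded commutator of an operator of degree `t` with the multiplications by the
entries of a list of homogeneous elements. -/
def itL : Module.End K M → ℤ → List (ℤ × B) → Module.End K M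
  | T, _, [] => T
  | T, t, x :: l => itL (gradedComm T t x.2 x.1) (t + x.1) l

theorem iterComm_eq_itL {n : ℕ} (T : Module.End K M) (t : ℤ) (d : Fin n → ℤ) (u : Fin n → B) :
    iterComm T t d u = itL T t (List.ofFn fun i => (d i, u i)) := by
  induction n generalizing T t with
  | zero => simp [iterComm, itL]
  | succ n ih =>
    rw [iterComm, ih, List.ofFn_succ, itL]
    rfl

theorem gradedComm_add (T T' : Module.End K M) (t : ℤ) (u : B) (e : ℤ) :
    gradedComm (T + T') t u e = gradedComm T t u e + gradedComm T' t u e := by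
  simp only [gradedComm, add_mul, mul_add, smul_add]
  abel

theorem gradedComm_smul (c : K) (T : Module.End K M) (t : ℤ) (u : B) (e : ℤ) :
    gradedComm (c • T) t u e = c • gradedComm T t u e := by
  simp only [gradedComm, smul_mul_assoc, mul_smul_comm, smul_sub]
  rw [smul_comm c]

theorem itL_add (T T' : Module.End K M) (t : ℤ) (l : List (ℤ × B)) :
    itL (T + T') t l = itL T t l + itL T' t l := by
  induction l generalizing T T' t with
  | nil => rfl
  | cons x l ih => rw [itL, gradedComm_add, ih]; rfl

theorem itL_smul (c : K) (T : Module.End K M) (t : ℤ) (l : List (ℤ × B)) :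
    itL (c • T) t l = c • itL T t l := by
  induction l generalizing T t with
  | nil => rfl
  | cons x l ih => rw [itL, gradedComm_smul, ih]; rfl

/-- `itL` as a linear map. -/
def itLHom (t : ℤ) (l : List (ℤ × B)) : Module.End K M →ₗ[K] Module.End K M where
  toFun T := itL T t l
  map_add' T T' := itL_add T T' t l
  map_smul' c T := itL_smul c T t l

theorem itL_zero (t : ℤ) (l : List (ℤ × B)) : itL (0 : Module.End K M) t l = 0 :=
  map_zero (itLHom t l)

theorem itL_sum {κ : Type*} (s : Finset κ) (T : κ → Module.End K M) (t : ℤ) (l : List (ℤ × B)) :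
    itL (∑ k ∈ s, T k) t l = ∑ k ∈ s, itL (T k) t l :=
  map_sum (itLHom t l) T s

theorem itL_units_smul (s : ℤˣ) (T : Module.End K M) (t : ℤ) (l : List (ℤ × B)) :
    itL (s • T) t l = s • itL T t l := by
  simp only [Units.smul_def]
  exact map_zsmul (itLHom t l) _ T

theorem itL_append (T : Module.End K M) (t : ℤ) (l l' : List (ℤ × B)) :
    itL T t (l ++ l') = itL (itL T t l) (t + degL l) l' := by
  induction l generalizing T t with
  | nil => simp [itL]
  | cons x l ih => rw [List.cons_append, itL, ih, itL, degL_cons, add_assoc]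

/-! ### Graded commutative algebras -/

/-- The submodules `𝓑 e` of `B` make `B` graded commutative. -/
structure IsGradedComm (𝓑 : ℤ → Submodule K B) : Prop where
  one_mem : 1 ∈ 𝓑 0
  mul_mem : ∀ {i j : ℤ} {a b : B}, a ∈ 𝓑 i → b ∈ 𝓑 j → a * b ∈ 𝓑 (i + j)
  comm : ∀ {i j : ℤ} {a b : B}, a ∈ 𝓑 i → b ∈ 𝓑 j → a * b = (i * j).negOnePow • (b * a)

variable {𝓑 : ℤ → Submodule K B}

/-- The product of the entries of a list. -/
def mulL (l : List (ℤ × B)) : B := (l.map Prod.snd).prod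

@[simp] theorem mulL_nil : mulL ([] : List (ℤ × B)) = 1 := rfl

@[simp] theorem mulL_cons (x : ℤ × B) (l : List (ℤ × B)) : mulL (x :: l) = x.2 * mulL l := by
  simp [mulL]

theorem mulL_append (l l' : List (ℤ × B)) : mulL (l ++ l') = mulL l * mulL l' := by
  simp [mulL]

theorem IsGradedComm.mulL_mem (h𝓑 : IsGradedComm 𝓑) {l : List (ℤ × B)} (hl : Homog 𝓑 l) :
    mulL l ∈ 𝓑 (degL l) := by
  induction l with
  | nil => exact h𝓑.one_mem
  | cons x l ih =>
    rw [homog_cons] at hl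
    rw [mulL_cons, degL_cons]
    exact h𝓑.mul_mem hl.1 (ih hl.2)

theorem IsGradedComm.mu_comm (h𝓑 : IsGradedComm 𝓑) {i j : ℤ} {a b : B} (ha : a ∈ 𝓑 i)
    (hb : b ∈ 𝓑 j) : mu K (M := M) a * mu K b = (i * j).negOnePow • (mu K b * mu K a) := by
  rw [← mu_mul, h𝓑.comm ha hb, mu_units_smul, mu_mul]

theorem IsGradedComm.gradedComm_mu (h𝓑 : IsGradedComm 𝓑) {i j : ℤ} {a b : B} (ha : a ∈ 𝓑 i)
    (hb : b ∈ 𝓑 j) : gradedComm (mu K (M := M) a) i b j = 0 := by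
  rw [gradedComm, h𝓑.mu_comm ha hb, sub_self]

theorem gradedComm_mul (T U : Module.End K M) (t t' : ℤ) (u : B) (e : ℤ) :
    gradedComm (T * U) (t + t') u e
      = T * gradedComm U t' u e + (t' * e).negOnePow • (gradedComm T t u e * U) := by
  simp only [gradedComm, mul_sub, sub_mul, smul_sub, mul_smul_comm, smul_mul_assoc, smul_smul,
    mul_assoc]
  rw [← Int.negOnePow_add, add_mul, add_comm (t' * e)]
  abel

/-- The graded commutator with multiplications is a derivation of the algebra of operators. -/
theorem itL_mul (T U : Module.End K M) (t t' : ℤ) (l : List (ℤ × B)) :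
    itL (T * U) (t + t') l
      = ush l (fun I J => (t' * degL I).negOnePow • (itL T t I * itL U t' J)) := by
  induction l generalizing T U t t' with
  | nil => simp [ush, itL]
  | cons x l ih =>
    rw [itL, gradedComm_mul, itL_add, itL_units_smul, ush, add_assoc t t', ih, add_comm t' x.1,
      ← add_assoc, ih, ush_smul, add_comm]
    congr 1
    · refine ush_congr l fun I J _ => ?_
      rw [smul_smul, ← Int.negOnePow_add, degL_cons, mul_add]
      rfl
    · refine ush_congr l fun I J _ => ?_
      rw [smul_smul, ← Int.negOnePow_add, add_mul, itL, add_comm t' x.1]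

/-- Multiplications commute with each other in the graded sense, so the factor `mu K v` contributes
no commutators. -/
theorem IsGradedComm.itL_mu_mul (h𝓑 : IsGradedComm 𝓑) {f : ℤ} {v : B} (hv : v ∈ 𝓑 f)
    (T : Module.End K M) (t : ℤ) {l : List (ℤ × B)} (hl : Homog 𝓑 l) :
    itL (mu K v * T) (f + t) l = mu K v * itL T t l := by
  induction l generalizing T t with
  | nil => rfl
  | cons x l ih =>
    rw [homog_cons] at hl
    rw [itL, gradedComm_mul, h𝓑.gradedComm_mu hv hl.1, zero_mul, smul_zero, add_zero, add_assoc,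
      ih _ _ hl.2]
    rfl

theorem IsGradedComm.itL_mul_mu (h𝓑 : IsGradedComm 𝓑) {f : ℤ} {v : B} (hv : v ∈ 𝓑 f)
    (T : Module.End K M) (t : ℤ) {l : List (ℤ × B)} (hl : Homog 𝓑 l) :
    itL (T * mu K v) (t + f) l = (f * degL l).negOnePow • (itL T t l * mu K v) := by
  induction l generalizing T t with
  | nil => simp [itL]
  | cons x l ih =>
    rw [homog_cons] at hl
    rw [itL, gradedComm_mul, h𝓑.gradedComm_mu hv hl.1, mul_zero, zero_add, itL_units_smul,
      add_right_comm, ih _ _ hl.2, smul_smul, ← Int.negOnePow_add, degL_cons, mul_add]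
    rfl

/-- The Leibniz rule for the iterated commutator in its first entry. -/
theorem IsGradedComm.itL_mul_cons (h𝓑 : IsGradedComm 𝓑) {e f : ℤ} {v w : B} (hv : v ∈ 𝓑 e)
    (hw : w ∈ 𝓑 f) (T : Module.End K M) (t : ℤ) {l : List (ℤ × B)} (hl : Homog 𝓑 l) :
    itL T t ((e + f, v * w) :: l)
      = (f * degL l).negOnePow • (itL T t ((e, v) :: l) * mu K w)
        + (t * e).negOnePow • (mu K v * itL T t ((f, w) :: l)) := by
  have h : gradedComm T t (v * w) (e + f)
      = gradedComm T t v e * mu K w + (t * e).negOnePow • (mu K v * gradedComm T t w f) := by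
    simp only [gradedComm, mu_mul, mul_sub, sub_mul, smul_sub, mul_smul_comm, smul_mul_assoc,
      smul_smul, mul_assoc]
    rw [← Int.negOnePow_add, ← mul_add]
    abel
  simp only [itL]
  rw [h, itL_add, itL_units_smul, ← add_assoc, h𝓑.itL_mul_mu hw _ _ hl, add_right_comm,
    add_comm (t + f) e, h𝓑.itL_mu_mul hv _ _ hl]

/-- By the graded Jacobi identity, `[[T, x], y]` and `± [[T, y], x]` differ by `[T, [x, y]]`, and
multiplications commute. The proof expands both sides into four terms. -/
theorem IsGradedComm.itL_swap (h𝓑 : IsGradedComm 𝓑) (T : Module.End K M) (t : ℤ)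
    {l l' : List (ℤ × B)} {x y : ℤ × B} (h : Homog 𝓑 (l ++ x :: y :: l')) :
    itL T t (l ++ x :: y :: l') = (x.1 * y.1).negOnePow • itL T t (l ++ y :: x :: l') := by
  induction l generalizing T t with
  | cons z l ih =>
    rw [List.cons_append, homog_cons] at h
    exact ih _ _ h.2
  | nil =>
    simp only [List.nil_append] at *
    rw [homog_cons, homog_cons] at h
    obtain ⟨hx, hy, -⟩ := h
    simp only [itL]
    rw [← itL_units_smul, add_right_comm]
    congr 1
    have e1 := h𝓑.mu_comm (M := M) hx hy
    have e2 : mu K (M := M) x.2 * (mu K y.2 * T)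
        = (x.1 * y.1).negOnePow • (mu K y.2 * (mu K x.2 * T)) := by
      rw [← mul_assoc, e1, smul_mul_assoc, mul_assoc]
    simp only [gradedComm, mul_sub, sub_mul, smul_sub, mul_smul_comm, smul_mul_assoc, smul_smul,
      mul_assoc, e1, e2, ← Int.negOnePow_add]
    rw [negOnePow_congr (a := x.1 * y.1 + (t + y.1) * x.1) (b := t * x.1) ⟨x.1 * y.1, by ring⟩,
      negOnePow_congr (a := x.1 * y.1 + t * y.1) (b := (t + x.1) * y.1) ⟨0, by ring⟩,
      negOnePow_congr (a := x.1 * y.1 + ((t + y.1) * x.1 + (t * y.1 + x.1 * y.1)))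
        (b := (t + x.1) * y.1 + t * x.1) ⟨x.1 * y.1, by ring⟩]
    abel

theorem IsGradedComm.itL_append_singleton (h𝓑 : IsGradedComm 𝓑) (T : Module.End K M) (t : ℤ)
    {l : List (ℤ × B)} {x : ℤ × B} (h : Homog 𝓑 (x :: l)) :
    itL T t (l ++ [x]) = (x.1 * degL l).negOnePow • itL T t (x :: l) := by
  induction l generalizing T t with
  | nil => simp
  | cons y l ih =>
    have h' := h
    rw [homog_cons, homog_cons] at h
    rw [List.cons_append, itL, ih _ _ (by rw [homog_cons]; exact ⟨h.1, h.2.2⟩)]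
    have := h𝓑.itL_swap T t (l := []) h'
    simp only [List.nil_append] at this
    rw [this, smul_smul, ← Int.negOnePow_add, degL_cons]
    rw [negOnePow_congr (a := x.1 * (y.1 + degL l) + x.1 * y.1) (b := x.1 * degL l)
      ⟨x.1 * y.1, by ring⟩]
    rfl

/-- Moving an operator past a product. -/
theorem apply_mulL_smul (T : Module.End K M) (t : ℤ) (l : List (ℤ × B)) (m : M) :
    T (mulL l • m)
      = ush l (fun J I => (t * degL J).negOnePow • (mulL J • itL T t I m)) := by
  induction l generalizing T t with
  | nil => simp [ush, itL]
  | cons x l ih =>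
    have h : T (mulL (x :: l) • m) = gradedComm T t x.2 x.1 (mulL l • m)
        + (t * x.1).negOnePow • (x.2 • T (mulL l • m)) := by
      simp only [gradedComm, LinearMap.sub_apply, Module.End.mul_apply, mu_apply, mulL_cons,
        mul_smul]
      exact (sub_add_cancel _ _).symm
    rw [h, ih _ (t + x.1), ih T t, ush, add_comm]
    congr 1
    · rw [← mu_apply (K := K), ush_map, ush_smul]
      refine ush_congr l fun I J _ => ?_
      rw [mu_apply, smul_comm x.2, smul_smul, ← Int.negOnePow_add, degL_cons, mul_add, mulL_cons,
        mul_smul]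
    · refine ush_congr l fun I J _ => ?_
      rw [smul_smul, ← Int.negOnePow_add, add_mul, add_comm (x.1 * _)]
      rfl

theorem itL_degree {ℳ : ℤ → Submodule K M}
    (hℳ : ∀ {i j : ℤ} {a : B} {m : M}, a ∈ 𝓑 i → m ∈ ℳ j → a • m ∈ ℳ (i + j))
    {T : Module.End K M} {t : ℤ} (hT : ∀ e, ∀ m ∈ ℳ e, T m ∈ ℳ (t + e))
    {l : List (ℤ × B)} (hl : Homog 𝓑 l) (e : ℤ) (m : M) (hm : m ∈ ℳ e) :
    itL T t l m ∈ ℳ (t + degL l + e) := by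
  induction l generalizing T t with
  | nil => simpa [itL] using hT e m hm
  | cons x l ih =>
    rw [homog_cons] at hl
    rw [degL_cons, ← add_assoc]
    refine ih (T := gradedComm T t x.2 x.1) (fun e m hm => ?_) hl.2
    refine Submodule.sub_mem _ ?_ ((Submodule.smul_mem_iff' (ℳ _) (t * x.1).negOnePow).2 ?_)
    · rw [add_assoc]
      exact hT _ _ (hℳ hl.1 hm)
    · rw [add_comm t, add_assoc]
      exact hℳ hl.1 (hT _ _ hm)

/-! ### Generation by homogeneous generators -/

/-- The span of the products of generators of total degree `e`. -/
def genSpan (K : Type*) {B : Type*} [Field K] [Ring B] [Algebra K B] (gen : ℤ × B → Prop) (e : ℤ) :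
    Submodule K B :=
  Submodule.span K {u | ∃ l : List (ℤ × B), (∀ x ∈ l, gen x) ∧ degL l = e ∧ u = mulL l}

theorem mulL_mem_genSpan {gen : ℤ × B → Prop} {l : List (ℤ × B)} (hl : ∀ x ∈ l, gen x) :
    mulL l ∈ genSpan K gen (degL l) :=
  Submodule.subset_span ⟨l, hl, rfl, rfl⟩

theorem gen_mem_genSpan {gen : ℤ × B → Prop} {x : ℤ × B} (hx : gen x) :
    x.2 ∈ genSpan K gen x.1 := by
  have := mulL_mem_genSpan (K := K) (gen := gen) (l := [x]) (by simpa using hx)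
  simpa using this

theorem isGradedComm_genSpan {gen : ℤ × B → Prop}
    (h : ∀ x y, gen x → gen y → x.2 * y.2 = (x.1 * y.1).negOnePow • (y.2 * x.2)) :
    IsGradedComm (genSpan K gen) where
  one_mem := by
    have := mulL_mem_genSpan (K := K) (gen := gen) (l := []) (by simp)
    simpa using this
  mul_mem := by
    intro i j a b ha hb
    induction ha using Submodule.span_induction with
    | zero => simp
    | add x y _ _ hx hy => rw [add_mul]; exact add_mem hx hy
    | smul c x _ hx => rw [smul_mul_assoc]; exact Submodule.smul_mem _ _ hx
    | mem x hx =>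
      obtain ⟨l, hl, rfl, rfl⟩ := hx
      induction hb using Submodule.span_induction with
      | zero => simp
      | add x y _ _ hx hy => rw [mul_add]; exact add_mem hx hy
      | smul c x _ hx => rw [mul_smul_comm]; exact Submodule.smul_mem _ _ hx
      | mem y hy =>
        obtain ⟨l', hl', rfl, rfl⟩ := hy
        rw [← mulL_append, ← degL_append]
        refine mulL_mem_genSpan fun x hx => ?_
        rw [List.mem_append] at hx
        exact hx.elim (hl x) (hl' x)
  comm := by
    intro i j a b ha hb
    have h1 : ∀ x, gen x → ∀ l : List (ℤ × B), (∀ y ∈ l, gen y) →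
        x.2 * mulL l = (x.1 * degL l).negOnePow • (mulL l * x.2) := by
      intro x hx l hl
      induction l with
      | nil => simp
      | cons y l ih =>
        rw [mulL_cons, ← mul_assoc, h x y hx (hl y (by simp)), smul_mul_assoc, mul_assoc,
          ih fun z hz => hl z (by simp [hz]), mul_smul_comm, smul_smul, ← Int.negOnePow_add,
          degL_cons, mul_add, mul_assoc]
    have h2 : ∀ l l' : List (ℤ × B), (∀ y ∈ l, gen y) → (∀ y ∈ l', gen y) →
        mulL l * mulL l' = (degL l * degL l').negOnePow • (mulL l' * mulL l) := by
      intro l l' hl hl'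
      induction l with
      | nil => simp
      | cons y l ih =>
        rw [mulL_cons, mul_assoc, ih fun z hz => hl z (by simp [hz]), mul_smul_comm, ← mul_assoc,
          h1 y (hl y (by simp)) l' hl', smul_mul_assoc, smul_smul, ← Int.negOnePow_add,
          degL_cons, add_mul, mul_assoc, add_comm (degL l * _)]
    induction ha using Submodule.span_induction with
    | zero => simp
    | add x y _ _ hx hy => rw [add_mul, mul_add, smul_add, hx, hy]
    | smul c x _ hx => rw [smul_mul_assoc, mul_smul_comm, hx, smul_comm]
    | mem x hx =>
      obtain ⟨l, hl, rfl, rfl⟩ := hx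
      induction hb using Submodule.span_induction with
      | zero => simp
      | add x y _ _ hx hy => rw [add_mul, mul_add, smul_add, hx, hy]
      | smul c x _ hx => rw [smul_mul_assoc, mul_smul_comm, hx, smul_comm]
      | mem y hy =>
        obtain ⟨l', hl', rfl, rfl⟩ := hy
        exact h2 l l' hl hl'

/-- A property of lists of homogeneous elements that is insensitive to the order and compatible with
linear combinations and products in the first entry holds if it holds for lists of generators. -/
theorem hom_induction {gen : ℤ × B → Prop} {P : List (ℤ × B) → Prop}
    (hswap : ∀ l₁ l₂ x y, P (l₁ ++ x :: y :: l₂) → P (l₁ ++ y :: x :: l₂))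
    (hzero : ∀ e l, Homog (genSpan K gen) l → P ((e, 0) :: l))
    (hadd : ∀ e u v l, u ∈ genSpan K gen e → v ∈ genSpan K gen e → Homog (genSpan K gen) l →
      P ((e, u) :: l) → P ((e, v) :: l) → P ((e, u + v) :: l))
    (hsmul : ∀ e (c : K) u l, u ∈ genSpan K gen e → Homog (genSpan K gen) l →
      P ((e, u) :: l) → P ((e, c • u) :: l))
    (hone : ∀ l, Homog (genSpan K gen) l → P ((0, 1) :: l))
    (hmul : ∀ e f u v l, u ∈ genSpan K gen e → v ∈ genSpan K gen f → Homog (genSpan K gen) l →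
      P ((e, u) :: l) → P ((f, v) :: l) → P ((e + f, u * v) :: l))
    (hgen : ∀ l, (∀ x ∈ l, gen x) → P l)
    (l : List (ℤ × B)) (hl : Homog (genSpan K gen) l) : P l := by
  -- Entries already known to be generators are stored at the end in `l'`. The first entry is
  -- decomposed into words; each of their letters is moved into `l'`, where the induction hypothesis
  -- on `l` applies.
  suffices ∀ l' : List (ℤ × B), (∀ x ∈ l', gen x) → P (l ++ l') by
    simpa using this [] (by simp)
  induction l with
  | nil => exact hgen
  | cons x l ih =>
    intro l' hl'
    rw [homog_cons] at hl
    obtain ⟨e, u⟩ := x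
    obtain ⟨hu, hl⟩ := hl
    have hll' : Homog (genSpan K gen) (l ++ l') :=
      homog_append.2 ⟨hl, fun x hx => gen_mem_genSpan (hl' x hx)⟩
    have hg : ∀ x, gen x → P (x :: l ++ l') := fun x hx =>
      perm_of_swap hswap (List.perm_middle (a := x)) (ih hl (x :: l') (List.forall_mem_cons.2 ⟨hx, hl'⟩))
    simp only at hu
    induction hu using Submodule.span_induction with
    | zero => exact hzero _ _ hll'
    | add x y hx hy h1 h2 => exact hadd _ _ _ _ hx hy hll' h1 h2
    | smul c x hx h => exact hsmul _ _ _ _ hx hll' h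
    | mem u h =>
      obtain ⟨w, hw, rfl, rfl⟩ := h
      induction w with
      | nil => exact hone _ hll'
      | cons y w ih' =>
        rw [degL_cons, mulL_cons]
        have hw' : ∀ x ∈ w, gen x := fun z hz => hw z (by simp [hz])
        exact hmul _ _ _ _ _ (gen_mem_genSpan (hw y (by simp))) (mulL_mem_genSpan hw') hll'
          (hg y (hw y (by simp))) (ih' hw')

end Operators

/-! ### Compositions of families of odd differential operators -/

section Squares

variable {K B M : Type*} [Field K] [Ring B] [Algebra K B]
  [AddCommGroup M] [Module K M] [Module B M] [IsScalarTower K B M] {𝓑 : ℤ → Submodule K B}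

/-- Used with `a`, `b` the lengths of two complementary sublists: an operator of order smaller than
the length of a list has vanishing iterated commutator along it. -/
theorem sum_antidiagonal_shift {N : Type*} [AddCommMonoid N] (a b m : ℕ) (f : ℕ × ℕ → N)
    (hf : ∀ p, p.1 < a ∨ p.2 < b → f p = 0) :
    ∑ p ∈ Finset.HasAntidiagonal.antidiagonal (a + b + m), f p
      = ∑ q ∈ Finset.HasAntidiagonal.antidiagonal m, f (a + q.1, b + q.2) := by
  symm
  refine Finset.sum_of_injOn (fun q => (a + q.1, b + q.2)) ?_ ?_ ?_ (fun _ _ => rfl)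
  · rintro ⟨p, q⟩ _ ⟨p', q'⟩ _ h
    simpa only [Prod.mk.injEq, Nat.add_left_cancel_iff] using h
  · rintro ⟨p, q⟩ h
    have h : p + q = m := by simpa using h
    have : a + p + (b + q) = a + b + m := by omega
    simpa using this
  · rintro ⟨p, q⟩ h1 h2
    have h1 : p + q = a + b + m := by simpa using h1
    refine hf _ ?_
    by_contra! h
    have h3 : p - a + (q - b) = m := by
      simp only at h
      omega
    refine h2 ⟨(p - a, q - b), by simpa using h3, ?_⟩
    simp only at h
    simp [h]

/-- The antidiagonal is symmetric, so both orders of composition give the same sum, and the factor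
`½` cancels. -/
theorem halfSquare_eq [CharZero K] (D : ℕ → Module.End K M) (k : ℕ) :
    halfSquare D k = ∑ p ∈ Finset.HasAntidiagonal.antidiagonal (k + 1), D p.1 * D p.2 := by
  have h : ∑ p ∈ Finset.HasAntidiagonal.antidiagonal (k + 1), D p.2 * D p.1
      = ∑ p ∈ Finset.HasAntidiagonal.antidiagonal (k + 1), D p.1 * D p.2 := by
    rw [← Finset.Nat.sum_antidiagonal_swap]
    rfl
  rw [halfSquare, Finset.sum_add_distrib, h, ← two_smul K, smul_smul,
    inv_mul_cancel₀ (two_ne_zero), one_smul]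

/-- The operators `D k` have degree one and order `k`, and `br` is the symbol of `D k` on lists of
length `k`. -/
structure IsSymbol (𝓑 : ℤ → Submodule K B) (D : ℕ → Module.End K M) (br : List (ℤ × B) → B) :
    Prop where
  mem : ∀ l, Homog 𝓑 l → br l ∈ 𝓑 (1 + degL l)
  eq : ∀ l, Homog 𝓑 l → itL (D l.length) 1 l = mu K (br l)
  eq_zero : ∀ k l, Homog 𝓑 l → k < l.length → itL (D k) 1 l = 0

theorem homog_left {l I J : List (ℤ × B)} (hl : Homog 𝓑 l) (h : (I ++ J).Perm l) : Homog 𝓑 I :=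
  (homog_append.1 ((homog_perm h).2 hl)).1

theorem homog_right {l I J : List (ℤ × B)} (hl : Homog 𝓑 l) (h : (I ++ J).Perm l) : Homog 𝓑 J :=
  (homog_append.1 ((homog_perm h).2 hl)).2

variable {D : ℕ → Module.End K M} {br : List (ℤ × B) → B}

theorem itL_sum_mul (l : List (ℤ × B)) (s : Finset (ℕ × ℕ)) :
    itL (∑ p ∈ s, D p.1 * D p.2) 2 l
      = ush l (fun I J => (degL I).negOnePow • ∑ p ∈ s, (itL (D p.1) 1 I * itL (D p.2) 1 J)) := by
  have h : (2 : ℤ) = 1 + 1 := rfl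
  rw [itL_sum, h]
  simp only [itL_mul, one_mul, Finset.smul_sum]
  rw [ush_sum]

/-- With the bracket as last entry, the iterated commutator is by definition the commutator of `itL
(D k) 1 J` with multiplication by `br I`; moving that entry to the front costs the sign of `(1 +
|I|)|J|`. -/
theorem IsSymbol.commutator (hs : IsSymbol 𝓑 D br) (h𝓑 : IsGradedComm 𝓑) (k : ℕ)
    {I J : List (ℤ × B)} (hI : Homog 𝓑 I) (hJ : Homog 𝓑 J) :
    itL (D k) 1 ((1 + degL I, br I) :: J)
      = (degL I).negOnePow • (mu K (br I) * itL (D k) 1 J)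
        + (degL I * degL J + degL J).negOnePow • (itL (D k) 1 J * mu K (br I)) := by
  have hx : Homog 𝓑 ((1 + degL I, br I) :: J) := homog_cons.2 ⟨hs.mem I hI, hJ⟩
  have h1 := h𝓑.itL_append_singleton (D k) 1 hx
  rw [itL_append] at h1
  simp only [itL] at h1
  rw [gradedComm] at h1
  have h2 : itL (D k) 1 ((1 + degL I, br I) :: J) = ((1 + degL I) * degL J).negOnePow •
      ((1 + degL I) * degL J).negOnePow • itL (D k) 1 ((1 + degL I, br I) :: J) := by
    rw [smul_smul, ← Int.negOnePow_add, negOnePow_congr (b := 0) ⟨(1 + degL I) * degL J, by ring⟩,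
      Int.negOnePow_zero, one_smul]
  simp only [itL] at h2 ⊢
  rw [h2, ← h1, smul_sub, smul_smul, ← Int.negOnePow_add,
    negOnePow_congr (a := (1 + degL I) * degL J) (b := degL I * degL J + degL J) ⟨0, by ring⟩,
    negOnePow_congr (a := (1 + degL I) * degL J + (1 + degL J) * (1 + degL I)) (b := degL I + 1)
      ⟨(1 + degL I) * degL J, by ring⟩, Int.negOnePow_succ, Units.neg_smul]
  abel

/-- The first order part of the square of `D`. -/
theorem IsSymbol.square_one (hs : IsSymbol 𝓑 D br) (h𝓑 : IsGradedComm 𝓑) {l : List (ℤ × B)}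
    (hl : Homog 𝓑 l) :
    itL (∑ p ∈ Finset.HasAntidiagonal.antidiagonal (l.length + 1), D p.1 * D p.2) 2 l
      = ush l fun I J => itL (D (J.length + 1)) 1 ((1 + degL I, br I) :: J) := by
  rw [itL_sum_mul]
  -- The orders must satisfy `p.1 ≥ |I|` and `p.2 ≥ |J|` and add up to `|I| + |J| + 1`, which leaves
  -- two pairs.
  have h1 : ∀ I J : List (ℤ × B), (I ++ J).Perm l →
      (degL I).negOnePow • ∑ p ∈ Finset.HasAntidiagonal.antidiagonal (l.length + 1),
        (itL (D p.1) 1 I * itL (D p.2) 1 J)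
      = (degL I).negOnePow • (mu K (br I) * itL (D (J.length + 1)) 1 J)
        + (degL I).negOnePow • (itL (D (I.length + 1)) 1 I * mu K (br J)) := by
    intro I J hIJ
    have hI := homog_left hl hIJ
    have hJ := homog_right hl hIJ
    rw [← hIJ.length_eq, List.length_append, sum_antidiagonal_shift]
    · simp [Finset.Nat.antidiagonal_succ, hs.eq I hI, hs.eq J hJ]
    · rintro p (hp | hp)
      · rw [hs.eq_zero _ _ hI hp, zero_mul]
      · rw [hs.eq_zero _ _ hJ hp, mul_zero]
  -- Interchanging the sublists in the second sum turns the two contributions into the two halves of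
  -- the commutator with `mu K (br I)`.
  rw [ush_congr l h1, ush_add,
    ush_swap l (fun I J => (degL I).negOnePow • (itL (D (I.length + 1)) 1 I * mu K (br J))),
    ← ush_add]
  refine ush_congr l fun I J hIJ => ?_
  rw [hs.commutator h𝓑 _ (homog_left hl hIJ) (homog_right hl hIJ), smul_smul,
    ← Int.negOnePow_add]

/-- The second order part of the square of `D`. -/
theorem IsSymbol.square_two (hs : IsSymbol 𝓑 D br) (h𝓑 : IsGradedComm 𝓑) {l : List (ℤ × B)}
    (hl : Homog 𝓑 l) :
    itL (∑ p ∈ Finset.HasAntidiagonal.antidiagonal (l.length + 2), D p.1 * D p.2) 2 l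
      = (ush l fun I J => itL (D (J.length + 2)) 1 ((1 + degL I, br I) :: J))
        + ush l fun I J => (degL I).negOnePow •
          (itL (D (I.length + 1)) 1 I * itL (D (J.length + 1)) 1 J) := by
  rw [itL_sum_mul]
  -- Now the orders exceed the lengths by two in total, so three pairs survive; the outer two
  -- recombine as for `square_one`.
  have h1 : ∀ I J : List (ℤ × B), (I ++ J).Perm l →
      (degL I).negOnePow • ∑ p ∈ Finset.HasAntidiagonal.antidiagonal (l.length + 2),
        (itL (D p.1) 1 I * itL (D p.2) 1 J)
      = ((degL I).negOnePow • (mu K (br I) * itL (D (J.length + 2)) 1 J)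
        + (degL I).negOnePow • (itL (D (I.length + 2)) 1 I * mu K (br J)))
        + (degL I).negOnePow •
          (itL (D (I.length + 1)) 1 I * itL (D (J.length + 1)) 1 J) := by
    intro I J hIJ
    have hI := homog_left hl hIJ
    have hJ := homog_right hl hIJ
    rw [← hIJ.length_eq, List.length_append, sum_antidiagonal_shift]
    · simp only [Finset.Nat.antidiagonal_succ, Finset.Nat.antidiagonal_zero]
      simp [hs.eq I hI, hs.eq J hJ]
      abel
    · rintro p (hp | hp)
      · rw [hs.eq_zero _ _ hI hp, zero_mul]
      · rw [hs.eq_zero _ _ hJ hp, mul_zero]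
  rw [ush_congr l h1, ush_add, ush_add,
    ush_swap l (fun I J => (degL I).negOnePow • (itL (D (I.length + 2)) 1 I * mu K (br J))),
    ← ush_add]
  congr 1
  refine ush_congr l fun I J hIJ => ?_
  rw [hs.commutator h𝓑 _ (homog_left hl hIJ) (homog_right hl hIJ), smul_smul,
    ← Int.negOnePow_add]

end Squares

/-! ### Multilinearity of iterated commutators -/

section Multilinear

variable {K B M : Type*} [Field K] [Ring B] [Algebra K B]
  [AddCommGroup M] [Module K M] [Module B M] [IsScalarTower K B M]

/-- Multiplication by elements of `B` as a linear map. -/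
def muHom (K : Type*) {B : Type*} (M : Type*) [Field K] [Ring B] [Algebra K B]
    [AddCommGroup M] [Module K M] [Module B M] [IsScalarTower K B M] : B →ₗ[K] Module.End K M where
  toFun := mu K
  map_add' := mu_add
  map_smul' := mu_smul

/-- The graded commutator with the multiplication by `p u`, where `p u` has degree `e`. -/
def commHom (p : B →ₗ[K] B) (t e : ℤ) :
    Module.End K M →ₗ[K] B →ₗ[K] Module.End K M :=
  LinearMap.mk₂ K (fun T u => gradedComm T t (p u) e)
    (fun T T' u => gradedComm_add T T' t (p u) e)
    (fun c T u => gradedComm_smul c T t (p u) e)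
    (fun T u v => by
      simp only [gradedComm, map_add, mu_add, mul_add, add_mul, smul_add]
      abel)
    (fun c T u => by
      simp only [gradedComm, map_smul, mu_smul, mul_smul_comm, smul_mul_assoc, smul_sub]
      rw [smul_comm c])

/-- The iterated commutator as a multilinear map, where `p₀` and `p₁` are the projections to the
even and the odd part of `B`. -/
def itMul (p₀ p₁ : B →ₗ[K] B) : ∀ n : ℕ, ℤ →
    Module.End K M →ₗ[K] MultilinearMap K (fun _ : Fin n => B) (Module.End K M)
  | 0, _ => (MultilinearMap.constLinearEquivOfIsEmpty K K (fun _ : Fin 0 => B)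
      (Module.End K M)).toLinearMap
  | n + 1, t =>
      ((multilinearCurryLeftEquiv K (fun _ : Fin (n + 1) => B)
          (Module.End K M)).symm.toLinearMap ∘ₗ
        (LinearMap.llcomp K B (Module.End K M) _ (itMul p₀ p₁ n t) ∘ₗ commHom p₀ t 0
          + LinearMap.llcomp K B (Module.End K M) _ (itMul p₀ p₁ n (t + 1)) ∘ₗ commHom p₁ t 1))

/-- `p₀` and `p₁` are the projections of `B` to the even and the odd part. -/
structure IsParity (𝓑 : ℤ → Submodule K B) (p₀ p₁ : B →ₗ[K] B) : Prop where
  even₀ : ∀ e u, Even e → u ∈ 𝓑 e → p₀ u = u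
  even₁ : ∀ e u, Even e → u ∈ 𝓑 e → p₁ u = 0
  odd₀ : ∀ e u, ¬ Even e → u ∈ 𝓑 e → p₀ u = 0
  odd₁ : ∀ e u, ¬ Even e → u ∈ 𝓑 e → p₁ u = u

theorem isParity_of_involution [CharZero K] {𝓑 : ℤ → Submodule K B} {ε : B →ₗ[K] B}
    (h : ∀ e u, u ∈ 𝓑 e → ε u = e.negOnePow • u) :
    IsParity 𝓑 ((2 : K)⁻¹ • (LinearMap.id + ε)) ((2 : K)⁻¹ • (LinearMap.id - ε)) := by
  have h2 : ∀ u : B, (2 : K)⁻¹ • u + (2 : K)⁻¹ • u = u := fun u => by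
    rw [← smul_add, ← two_smul K, smul_smul, inv_mul_cancel₀ two_ne_zero, one_smul]
  constructor
  · intro e u he hu
    simp [h e u hu, Int.negOnePow_even e he, h2]
  · intro e u he hu
    simp [h e u hu, Int.negOnePow_even e he]
  · intro e u he hu
    simp [h e u hu, Int.negOnePow_odd e (Int.not_even_iff_odd.1 he)]
  · intro e u he hu
    simp [h e u hu, Int.negOnePow_odd e (Int.not_even_iff_odd.1 he), h2]

theorem gradedComm_congr (T : Module.End K M) {t t' e e' : ℤ} (u : B)
    (h : Even (t * e - t' * e')) : gradedComm T t u e = gradedComm T t' u e' := by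
  rw [gradedComm, gradedComm, negOnePow_congr h]

theorem gradedComm_zero_right (T : Module.End K M) (t e : ℤ) :
    gradedComm T t (0 : B) e = 0 := by
  simp [gradedComm, mu_zero]

theorem itMul_succ_apply (p₀ p₁ : B →ₗ[K] B) (n : ℕ) (t : ℤ) (T : Module.End K M)
    (u : Fin (n + 1) → B) : itMul p₀ p₁ (n + 1) t T u
      = itMul p₀ p₁ n t (gradedComm T t (p₀ (u 0)) 0) (Fin.tail u)
        + itMul p₀ p₁ n (t + 1) (gradedComm T t (p₁ (u 0)) 1) (Fin.tail u) := rfl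

/-- The sign in a graded commutator depends only on the parities of both degrees. Thus on
homogeneous elements one of the two branches of `itMul` vanishes, and the other is the commutator
with the degree reduced to `0` or `1`. -/
theorem itMul_eq {𝓑 : ℤ → Submodule K B} {p₀ p₁ : B →ₗ[K] B} (hp : IsParity 𝓑 p₀ p₁) {n : ℕ}
    (t t' : ℤ) (ht : Even (t - t')) (T : Module.End K M) (d : Fin n → ℤ) (u : Fin n → B)
    (hu : ∀ i, u i ∈ 𝓑 (d i)) : itMul p₀ p₁ n t T u = iterComm T t' d u := by
  induction n generalizing t t' T with
  | zero => rfl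
  | succ n ih =>
    rw [itMul_succ_apply, iterComm]
    by_cases he : Even (d 0)
    · rw [hp.even₀ _ _ he (hu 0), hp.even₁ _ _ he (hu 0), gradedComm_zero_right, map_zero,
        MultilinearMap.zero_apply, add_zero]
      rw [gradedComm_congr (t' := t') (e' := d 0)]
      · exact ih _ _ (by grind) _ _ _ fun i => hu i.succ
      · grind
    · rw [hp.odd₀ _ _ he (hu 0), hp.odd₁ _ _ he (hu 0), gradedComm_zero_right, map_zero,
        MultilinearMap.zero_apply, zero_add]
      rw [gradedComm_congr (t' := t') (e' := d 0)]
      · exact ih _ _ (by grind) _ _ _ fun i => hu i.succ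
      · simp only [Int.even_sub, Int.even_mul, Int.not_even_one] at *
        tauto

end Multilinear

/-! ### Vanishing of iterated commutators -/

section Vanishing

variable {K B M : Type*} [Field K] [Ring B] [Algebra K B]
  [AddCommGroup M] [Module K M] [Module B M] [IsScalarTower K B M]

theorem itL_cons_add (T : Module.End K M) (t e : ℤ) (u v : B) (l : List (ℤ × B)) :
    itL T t ((e, u + v) :: l) = itL T t ((e, u) :: l) + itL T t ((e, v) :: l) := by
  simp only [itL]
  rw [← itL_add]
  congr 1
  exact map_add (commHom LinearMap.id t e T) u v

theorem itL_cons_smul (T : Module.End K M) (t e : ℤ) (c : K) (u : B) (l : List (ℤ × B)) :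
    itL T t ((e, c • u) :: l) = c • itL T t ((e, u) :: l) := by
  simp only [itL]
  rw [← itL_smul]
  congr 1
  exact map_smul (commHom LinearMap.id t e T) c u

theorem itL_cons_zero (T : Module.End K M) (t e : ℤ) (l : List (ℤ × B)) :
    itL T t ((e, (0 : B)) :: l) = 0 := by
  have := itL_cons_smul T t e (0 : K) (0 : B) l
  simpa using this

theorem itL_cons_one (T : Module.End K M) (t : ℤ) (l : List (ℤ × B)) :
    itL T t ((0, (1 : B)) :: l) = 0 := by
  simp only [itL, gradedComm, mu_one]
  simp [itL_zero]

/-- An operator is a differential operator if its iterated commutators with generators vanish. -/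
theorem itL_eq_zero_of_gen {gen : ℤ × B → Prop} (hg : IsGradedComm (genSpan K gen))
    (T : Module.End K M) (t : ℤ) (n : ℕ)
    (h : ∀ l : List (ℤ × B), (∀ x ∈ l, gen x) → l.length = n → itL T t l = 0)
    (l : List (ℤ × B)) (hl : Homog (genSpan K gen) l) (hn : l.length = n) : itL T t l = 0 := by
  refine hom_induction (K := K) (gen := gen)
    (P := fun l => Homog (genSpan K gen) l → l.length = n → itL T t l = 0)
    ?_ ?_ ?_ ?_ ?_ ?_ ?_ l hl hl hn
  · intro l₁ l₂ x y hP hH hn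
    have hp := (List.Perm.swap x y l₂).append_left l₁
    rw [hg.itL_swap T t hH, hP ((homog_perm hp).1 hH) (by simpa using hn), smul_zero]
  · intro e l _ _ _
    exact itL_cons_zero T t e l
  · intro e u v l hu hv hl h1 h2 _ hn
    rw [itL_cons_add, h1 (homog_cons.2 ⟨hu, hl⟩) hn, h2 (homog_cons.2 ⟨hv, hl⟩) hn, add_zero]
  · intro e c u l hu hl h1 _ hn
    rw [itL_cons_smul, h1 (homog_cons.2 ⟨hu, hl⟩) hn, smul_zero]
  · intro l _ _ _
    exact itL_cons_one T t l
  · intro e f u v l hu hv hl h1 h2 _ hn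
    rw [hg.itL_mul_cons hu hv T t hl, h1 (homog_cons.2 ⟨hu, hl⟩) hn,
      h2 (homog_cons.2 ⟨hv, hl⟩) hn, zero_mul, mul_zero, smul_zero, smul_zero, add_zero]
  · exact fun l hl _ hn => h l hl hn

end Vanishing

/-! ### The free graded commutative algebra -/

section FreeSym

variable (K : Type*) [Field K] {ι : Type*} (deg : ι → ℤ)

/-- The relations of the free graded commutative algebra. -/
inductive FreeRel : FreeAlgebra K ι → FreeAlgebra K ι → Prop
  | comm (i j : ι) : FreeRel (FreeAlgebra.ι K i * FreeAlgebra.ι K j)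
      (Int.negOnePow (deg i * deg j) • (FreeAlgebra.ι K j * FreeAlgebra.ι K i))

/-- The free graded commutative algebra on generators of the indicated degrees. -/
def FreeSym : Type _ := RingQuot (FreeRel K deg)

instance : Ring (FreeSym K deg) := inferInstanceAs (Ring (RingQuot (FreeRel K deg)))

instance : Algebra K (FreeSym K deg) := inferInstanceAs (Algebra K (RingQuot (FreeRel K deg)))

/-- The quotient map from the free algebra. -/
def FreeSym.mk : FreeAlgebra K ι →ₐ[K] FreeSym K deg := RingQuot.mkAlgHom K (FreeRel K deg)

/-- The generators. -/
def FreeSym.gen (i : ι) : FreeSym K deg := FreeSym.mk K deg (FreeAlgebra.ι K i)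

theorem FreeSym.mk_surjective : Function.Surjective (FreeSym.mk K deg) :=
  RingQuot.mkAlgHom_surjective K _

theorem FreeSym.gen_comm (i j : ι) : FreeSym.gen K deg i * FreeSym.gen K deg j
    = (deg i * deg j).negOnePow • (FreeSym.gen K deg j * FreeSym.gen K deg i) := by
  have h := RingQuot.mkAlgHom_rel K (FreeRel.comm (K := K) (deg := deg) i j)
  rw [map_mul] at h
  refine h.trans ?_
  simp only [Units.smul_def, map_zsmul, map_mul]
  rfl

variable {K deg}

/-- Algebra homomorphisms from the free graded commutative algebra. -/
def FreeSym.lift {E : Type*} [Ring E] [Algebra K E] (f : ι → E)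
    (hf : ∀ i j, f i * f j = (deg i * deg j).negOnePow • (f j * f i)) :
    FreeSym K deg →ₐ[K] E :=
  RingQuot.liftAlgHom K ⟨FreeAlgebra.lift K f, by
    rintro _ _ ⟨i, j⟩
    simp only [Units.smul_def, map_zsmul, map_mul, FreeAlgebra.lift_ι_apply]
    exact hf i j⟩

theorem FreeSym.lift_gen {E : Type*} [Ring E] [Algebra K E] (f : ι → E)
    (hf : ∀ i j, f i * f j = (deg i * deg j).negOnePow • (f j * f i)) (i : ι) :
    FreeSym.lift f hf (FreeSym.gen K deg i) = f i := by
  have := RingQuot.liftAlgHom_mkAlgHom_apply K (FreeAlgebra.lift K f) (s := FreeRel K deg) (by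
    rintro _ _ ⟨i, j⟩
    simp only [Units.smul_def, map_zsmul, map_mul, FreeAlgebra.lift_ι_apply]
    exact hf i j) (FreeAlgebra.ι K i)
  refine this.trans ?_
  simp

/-- A homogeneous generator together with its degree. -/
def FreeSym.sym (K : Type*) [Field K] {ι : Type*} (deg : ι → ℤ) (i : ι) : ℤ × FreeSym K deg :=
  (deg i, FreeSym.gen K deg i)

/-- The predicate of being a generator. -/
def FreeSym.IsGen (x : ℤ × FreeSym K deg) : Prop := ∃ i, x = FreeSym.sym K deg i

theorem FreeSym.exists_map {l : List (ℤ × FreeSym K deg)} (hl : ∀ x ∈ l, FreeSym.IsGen x) :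
    ∃ w : List ι, l = w.map (FreeSym.sym K deg) := by
  induction l with
  | nil => exact ⟨[], rfl⟩
  | cons x l ih =>
    obtain ⟨w, rfl⟩ := ih fun y hy => hl y (by simp [hy])
    obtain ⟨i, rfl⟩ := hl x (by simp)
    exact ⟨i :: w, rfl⟩

variable (K deg) in
/-- The grading of the free graded commutative algebra. -/
abbrev FreeSym.grading (e : ℤ) : Submodule K (FreeSym K deg) :=
  genSpan K (FreeSym.IsGen (K := K) (deg := deg)) e

theorem FreeSym.isGradedComm : IsGradedComm (FreeSym.grading K deg) :=
  isGradedComm_genSpan (by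
    rintro _ _ ⟨i, rfl⟩ ⟨j, rfl⟩
    exact FreeSym.gen_comm K deg i j)

variable (K deg) in
/-- The degree of a word in the generators. -/
def degW (deg : ι → ℤ) (w : List ι) : ℤ := (w.map deg).sum

@[simp] theorem degW_nil : degW deg [] = 0 := rfl

@[simp] theorem degW_cons (i : ι) (w : List ι) : degW deg (i :: w) = deg i + degW deg w := by
  simp [degW]

@[simp] theorem degW_append (w w' : List ι) : degW deg (w ++ w') = degW deg w + degW deg w' := by
  simp [degW]

theorem degL_map_sym (w : List ι) : degL (w.map (FreeSym.sym K deg)) = degW deg w := by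
  simp [degL, degW, FreeSym.sym, Function.comp_def]

theorem FreeSym.gen_mem (i : ι) : FreeSym.gen K deg i ∈ FreeSym.grading K deg (deg i) :=
  gen_mem_genSpan (gen := FreeSym.IsGen) (x := FreeSym.sym K deg i) ⟨i, rfl⟩

theorem homog_map_sym (w : List ι) : Homog (FreeSym.grading K deg) (w.map (FreeSym.sym K deg)) := by
  intro x hx
  obtain ⟨i, -, rfl⟩ := List.mem_map.1 hx
  exact FreeSym.gen_mem i

/-- Words in the generators span. -/
theorem FreeSym.word_induction {p : FreeSym K deg → Prop}
    (hadd : ∀ u v, p u → p v → p (u + v)) (hsmul : ∀ (c : K) u, p u → p (c • u))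
    (hword : ∀ w : List ι, p (mulL (w.map (FreeSym.sym K deg)))) (u : FreeSym K deg) : p u := by
  have h0 : p 0 := by simpa using hsmul 0 _ (hword [])
  let P : Submodule K (FreeSym K deg) :=
    { carrier := {u | p u}, add_mem' := fun {u v} => hadd u v, zero_mem' := h0, smul_mem' := hsmul }
  let Z : Submodule K (FreeSym K deg) :=
    Submodule.span K (Set.range fun w : List ι => mulL (w.map (FreeSym.sym K deg)))
  have hZ : Z ≤ P := Submodule.span_le.2 (by rintro _ ⟨w, rfl⟩; exact hword w)
  refine hZ ?_
  obtain ⟨x, rfl⟩ := FreeSym.mk_surjective K deg u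
  induction x using FreeAlgebra.induction with
  | grade0 c =>
    rw [AlgHom.commutes, Algebra.algebraMap_eq_smul_one]
    exact Z.smul_mem c (Submodule.subset_span ⟨[], rfl⟩)
  | grade1 i => exact Submodule.subset_span ⟨[i], by simp [FreeSym.sym, FreeSym.gen]⟩
  | add a b ha hb => rw [map_add]; exact Z.add_mem ha hb
  | mul a b ha hb =>
    rw [map_mul]
    generalize FreeSym.mk K deg a = a at ha
    generalize FreeSym.mk K deg b = b at hb
    induction ha using Submodule.span_induction with
    | zero => simp
    | add x y _ _ hx hy => rw [add_mul]; exact Z.add_mem hx hy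
    | smul c x _ hx => rw [smul_mul_assoc]; exact Z.smul_mem c hx
    | mem x hx =>
      obtain ⟨w, rfl⟩ := hx
      induction hb using Submodule.span_induction with
      | zero => simp
      | add x y _ _ hx hy => rw [mul_add]; exact Z.add_mem hx hy
      | smul c x _ hx => rw [mul_smul_comm]; exact Z.smul_mem c hx
      | mem y hy =>
        obtain ⟨w', rfl⟩ := hy
        exact Submodule.subset_span ⟨w ++ w', by simp [mulL_append]⟩

theorem FreeSym.induction {p : FreeSym K deg → Prop}
    (hadd : ∀ u v, p u → p v → p (u + v)) (hsmul : ∀ (c : K) u, p u → p (c • u))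
    (hone : p 1) (hmul : ∀ i u, p u → p (FreeSym.gen K deg i * u)) (u : FreeSym K deg) : p u := by
  refine FreeSym.word_induction hadd hsmul (fun w => ?_) u
  induction w with
  | nil => exact hone
  | cons i w ih => rw [List.map_cons, mulL_cons]; exact hmul i _ ih

theorem FreeSym.hom_ext {E : Type*} [AddCommGroup E] [Module K E] {𝓢 : Submodule K (FreeSym K deg)}
    (h : ∀ e, FreeSym.grading K deg e ≤ 𝓢) : 𝓢 = ⊤ := by
  rw [eq_top_iff]
  rintro u -
  refine FreeSym.word_induction (fun _ _ => 𝓢.add_mem) (fun c _ => 𝓢.smul_mem c) (fun w => ?_) u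
  refine h _ (mulL_mem_genSpan fun x hx => ?_)
  obtain ⟨i, -, rfl⟩ := List.mem_map.1 hx
  exact ⟨i, rfl⟩

end FreeSym

/-! ### Jets: the action on graded symmetric functions of words -/

section Jets

variable {K : Type*} [Field K] {ι : Type*} {deg : ι → ℤ} {W : Type*} [AddCommGroup W] [Module K W]

variable (K deg W) in
/-- The graded symmetric functions of words. -/
def SymFun : Submodule K (List ι → W) where
  carrier := {F | ∀ l₁ l₂ i j,
    F (l₁ ++ i :: j :: l₂) = (deg i * deg j).negOnePow • F (l₁ ++ j :: i :: l₂)}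
  add_mem' := by
    intro F G hF hG l₁ l₂ i j
    simp only [Pi.add_apply, hF l₁ l₂ i j, hG l₁ l₂ i j, smul_add]
  zero_mem' := by
    intro l₁ l₂ i j
    simp
  smul_mem' := by
    intro c F hF l₁ l₂ i j
    simp only [Pi.smul_apply, hF l₁ l₂ i j]
    rw [smul_comm]

/-- The action of a generator, if the generators act on `W` by `b`. -/
def jetAct (deg : ι → ℤ) (b : ι → Module.End K W) (i : ι) : Module.End K (SymFun K deg W) where
  toFun F := ⟨fun l => F.1 (l ++ [i]) + (deg i * (1 + degW deg l)).negOnePow • b i (F.1 l), by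
    intro l₁ l₂ j k
    simp only [List.append_assoc, List.cons_append]
    rw [F.2 l₁ (l₂ ++ [i]) j k, F.2 l₁ l₂ j k, smul_add]
    simp only [degW_append, degW_cons, Units.smul_def, map_zsmul]
    congr 1
    rw [smul_comm, add_left_comm (deg j)]⟩
  map_add' F G := by
    ext l
    simp only [Submodule.coe_add, Pi.add_apply, map_add, smul_add]
    abel
  map_smul' c F := by
    ext l
    simp only [Submodule.coe_smul, Pi.smul_apply, map_smul, smul_add, RingHom.id_apply]
    rw [smul_comm c]

theorem jetAct_apply (b : ι → Module.End K W) (i : ι) (F : SymFun K deg W) (l : List ι) :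
    (jetAct deg b i F).1 l
      = F.1 (l ++ [i]) + (deg i * (1 + degW deg l)).negOnePow • b i (F.1 l) := rfl

/-- Each side has four terms. The terms `F (l ++ [i, j])` agree because `F` is graded symmetric, the
terms with two factors `b` by `hb`, and the two mixed terms are matched crosswise. The summand `1`
in the exponent of `jetAct` records that the operator has degree one. -/
theorem jetAct_comm {b : ι → Module.End K W}
    (hb : ∀ i j, b i * b j = (deg i * deg j).negOnePow • (b j * b i)) (i j : ι) :
    jetAct deg b i * jetAct deg b j
      = (deg i * deg j).negOnePow • (jetAct deg b j * jetAct deg b i) := by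
  refine LinearMap.ext fun F => Subtype.ext (funext fun l => ?_)
  have h : b i (b j (F.1 l)) = (deg i * deg j).negOnePow • b j (b i (F.1 l)) := by
    have := congrArg (fun T => T (F.1 l)) (hb i j)
    exact this
  have hF := F.2 l [] i j
  have e : ((deg i * deg j).negOnePow • (jetAct deg b j * jetAct deg b i)) F
    = (deg i * deg j).negOnePow • (jetAct deg b j (jetAct deg b i F)) := rfl
  have e' : ((deg i * deg j).negOnePow • (jetAct deg b j (jetAct deg b i F))).1 l
    = (deg i * deg j).negOnePow • (jetAct deg b j (jetAct deg b i F)).1 l := rfl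
  rw [e, e']
  simp only [Module.End.mul_apply, jetAct_apply, List.append_assoc, List.cons_append,
    List.nil_append, hF, map_add, smul_add, degW_append, degW_cons, degW_nil, add_zero]
  have hs : ∀ (k : ι) (s : ℤˣ) (w : W), b k (s • w) = s • b k w := fun k s w => by
    simp only [Units.smul_def, map_zsmul]
  simp only [hs, h, smul_smul, ← Int.negOnePow_add]
  rw [negOnePow_congr (a := deg i * deg j + deg i * (1 + (degW deg l + deg j)))
      (b := deg i * (1 + degW deg l)) ⟨deg i * deg j, by ring⟩,
    negOnePow_congr (a := deg j * (1 + (degW deg l + deg i)))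
      (b := deg i * deg j + deg j * (1 + degW deg l)) ⟨0, by ring⟩,
    negOnePow_congr (a := deg i * deg j + (deg j * (1 + degW deg l) + deg i * (1 + degW deg l)))
      (b := deg i * (1 + degW deg l) + deg j * (1 + degW deg l) + deg i * deg j) ⟨0, by ring⟩]
  rw [negOnePow_congr (a := deg i * (1 + degW deg l) + (deg j * (1 + degW deg l) + deg i * deg j))
      (b := deg i * (1 + degW deg l) + deg j * (1 + degW deg l) + deg i * deg j) ⟨0, by ring⟩]
  abel

/-- The action of the free graded commutative algebra on graded symmetric functions of words. -/
def jetHom (b : ι → Module.End K W)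
    (hb : ∀ i j, b i * b j = (deg i * deg j).negOnePow • (b j * b i)) :
    FreeSym K deg →ₐ[K] Module.End K (SymFun K deg W) :=
  FreeSym.lift (jetAct deg b) (jetAct_comm hb)

/-- This says that `u ↦ (u F)(l ++ [i])` is the graded commutator of `u ↦ (u F)(l)` with the `i`-th
generator. -/
theorem jetHom_gen_mul (b : ι → Module.End K W)
    (hb : ∀ i j, b i * b j = (deg i * deg j).negOnePow • (b j * b i)) (i : ι) (u : FreeSym K deg)
    (F : SymFun K deg W) (l : List ι) :
    (jetHom b hb (FreeSym.gen K deg i * u) F).1 l = (jetHom b hb u F).1 (l ++ [i])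
      + (deg i * (1 + degW deg l)).negOnePow • b i ((jetHom b hb u F).1 l) := by
  rw [map_mul, jetHom, FreeSym.lift_gen]
  rfl

/-- Operators whose commutators with generators extend the word. -/
theorem itL_word {B M : Type*} [Ring B] [Algebra K B]
    [AddCommGroup M] [Module K M] [Module B M] [IsScalarTower K B M] {γ : ι → B}
    {R : List ι → Module.End K M}
    (hR : ∀ l i, gradedComm (R l) (1 + degW deg l) (γ i) (deg i) = R (l ++ [i]))
    (l l' : List ι) :
    itL (R l) (1 + degW deg l) (l'.map fun i => (deg i, γ i)) = R (l ++ l') := by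
  induction l' generalizing l with
  | nil => simp [itL]
  | cons i l' ih =>
    rw [List.map_cons, itL]
    simp only [hR]
    have := ih (l ++ [i])
    simp only [degW_append, degW_cons, degW_nil, add_zero, ← add_assoc, List.append_assoc,
      List.cons_append, List.nil_append] at this
    exact this

end Jets

/-! ### Graded symmetric multiderivations of odd degree -/

section MultiDer

variable {K B : Type*} [Field K] [Ring B] [Algebra K B]

/-- `br` restricts to graded symmetric multiderivations of degree one on homogeneous elements. -/
structure IsMultiDer (𝓑 : ℤ → Submodule K B) (br : List (ℤ × B) → B) : Prop where
  mem : ∀ l, Homog 𝓑 l → br l ∈ 𝓑 (1 + degL l)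
  swap : ∀ l l' x y, Homog 𝓑 (l ++ x :: y :: l') →
    br (l ++ x :: y :: l') = (x.1 * y.1).negOnePow • br (l ++ y :: x :: l')
  add : ∀ e u v l, u ∈ 𝓑 e → v ∈ 𝓑 e → Homog 𝓑 l →
    br ((e, u + v) :: l) = br ((e, u) :: l) + br ((e, v) :: l)
  smul : ∀ e (c : K) u l, u ∈ 𝓑 e → Homog 𝓑 l → br ((e, c • u) :: l) = c • br ((e, u) :: l)
  mul : ∀ e f v w l, v ∈ 𝓑 e → w ∈ 𝓑 f → Homog 𝓑 l →
    br ((e + f, v * w) :: l)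
      = (f * degL l).negOnePow • (br ((e, v) :: l) * w) + e.negOnePow • (v * br ((f, w) :: l))

variable {𝓑 : ℤ → Submodule K B} {br : List (ℤ × B) → B}

theorem IsMultiDer.zero (h : IsMultiDer 𝓑 br) (e : ℤ) {l : List (ℤ × B)} (hl : Homog 𝓑 l) :
    br ((e, 0) :: l) = 0 := by
  have := h.smul e 0 0 l (𝓑 e).zero_mem hl
  simpa using this

theorem IsMultiDer.one (h : IsMultiDer 𝓑 br) (h1 : (1 : B) ∈ 𝓑 0) {l : List (ℤ × B)}
    (hl : Homog 𝓑 l) : br ((0, 1) :: l) = 0 := by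
  have := h.mul 0 0 1 1 l h1 h1 hl
  simpa using this

theorem IsMultiDer.append_singleton (h : IsMultiDer 𝓑 br) {l : List (ℤ × B)} {x : ℤ × B}
    (hl : Homog 𝓑 (x :: l)) : br (l ++ [x]) = (x.1 * degL l).negOnePow • br (x :: l) := by
  suffices ∀ l₀, Homog 𝓑 (l₀ ++ x :: l) →
      br (l₀ ++ (l ++ [x])) = (x.1 * degL l).negOnePow • br (l₀ ++ x :: l) by
    simpa using this [] (by simpa using hl)
  clear hl
  induction l with
  | nil => simp
  | cons y l ih =>
    intro l₀ hl
    have := ih (l₀ ++ [y]) (by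
      rw [List.append_assoc]
      exact (homog_perm ((List.Perm.swap y x l).append_left l₀)).1 hl)
    simp only [List.append_assoc, List.cons_append, List.nil_append] at this ⊢
    rw [this, h.swap _ _ x y hl, smul_smul, ← Int.negOnePow_add, degL_cons,
      negOnePow_congr (a := x.1 * (y.1 + degL l) + x.1 * y.1) (b := x.1 * degL l)
        ⟨x.1 * y.1, by ring⟩]

/-- Multiderivations that agree on generators are equal. -/
theorem IsMultiDer.ext_of_gen {gen : ℤ × B → Prop} {br' : List (ℤ × B) → B}
    (hg : IsGradedComm (genSpan K gen)) (h : IsMultiDer (genSpan K gen) br)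
    (h' : IsMultiDer (genSpan K gen) br') (hgen : ∀ l, (∀ x ∈ l, gen x) → br l = br' l)
    (l : List (ℤ × B)) (hl : Homog (genSpan K gen) l) : br l = br' l := by
  refine hom_induction (K := K) (gen := gen)
    (P := fun l => Homog (genSpan K gen) l → br l = br' l)
    ?_ ?_ ?_ ?_ ?_ ?_ ?_ l hl hl
  · intro l₁ l₂ x y hP hH
    have hp := (List.Perm.swap x y l₂).append_left l₁
    rw [h.swap _ _ _ _ hH, h'.swap _ _ _ _ hH, hP ((homog_perm hp).1 hH)]
  · intro e l hl _
    rw [h.zero e hl, h'.zero e hl]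
  · intro e u v l hu hv hl h1 h2 _
    rw [h.add _ _ _ _ hu hv hl, h'.add _ _ _ _ hu hv hl, h1 (homog_cons.2 ⟨hu, hl⟩),
      h2 (homog_cons.2 ⟨hv, hl⟩)]
  · intro e c u l hu hl h1 _
    rw [h.smul _ _ _ _ hu hl, h'.smul _ _ _ _ hu hl, h1 (homog_cons.2 ⟨hu, hl⟩)]
  · intro l hl _
    rw [h.one hg.one_mem hl, h'.one hg.one_mem hl]
  · intro e f u v l hu hv hl h1 h2 _
    rw [h.mul _ _ _ _ _ hu hv hl, h'.mul _ _ _ _ _ hu hv hl, h1 (homog_cons.2 ⟨hu, hl⟩),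
      h2 (homog_cons.2 ⟨hv, hl⟩)]
  · exact fun l hl _ => hgen l hl

/-- Operators whose symbols on generators are given by a multiderivation. -/
theorem IsMultiDer.isSymbol {M : Type*} [AddCommGroup M] [Module K M] [Module B M]
    [IsScalarTower K B M] {gen : ℤ × B → Prop} (hg : IsGradedComm (genSpan K gen))
    (h : IsMultiDer (genSpan K gen) br) (D : ℕ → Module.End K M)
    (heq : ∀ l : List (ℤ × B), (∀ x ∈ l, gen x) → itL (D l.length) 1 l = mu K (br l))
    (hzero : ∀ k (l : List (ℤ × B)), (∀ x ∈ l, gen x) → k < l.length → itL (D k) 1 l = 0) :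
    IsSymbol (genSpan K gen) D br where
  mem := h.mem
  eq_zero k l hl hk := itL_eq_zero_of_gen hg (D k) 1 l.length
    (fun l' hl' hn => hzero k l' hl' (by omega)) l hl rfl
  eq l hl := by
    refine hom_induction (K := K) (gen := gen)
      (P := fun l => Homog (genSpan K gen) l → itL (D l.length) 1 l = mu K (br l))
      ?_ ?_ ?_ ?_ ?_ ?_ ?_ l hl hl
    · intro l₁ l₂ x y hP hH
      have hp := (List.Perm.swap x y l₂).append_left l₁
      have := hP ((homog_perm hp).1 hH)
      rw [← List.Perm.length_eq hp] at this
      rw [hg.itL_swap _ _ hH, h.swap _ _ _ _ hH, this, mu_units_smul]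
    · intro e l hl _
      rw [itL_cons_zero, h.zero e hl, mu_zero]
    · intro e u v l hu hv hl h1 h2 _
      have h1 := h1 (homog_cons.2 ⟨hu, hl⟩)
      have h2 := h2 (homog_cons.2 ⟨hv, hl⟩)
      simp only [List.length_cons] at *
      rw [itL_cons_add, h1, h2, h.add _ _ _ _ hu hv hl, mu_add]
    · intro e c u l hu hl h1 _
      have h1 := h1 (homog_cons.2 ⟨hu, hl⟩)
      simp only [List.length_cons] at *
      rw [itL_cons_smul, h1, h.smul _ _ _ _ hu hl, mu_smul]
    · intro l hl _
      rw [itL_cons_one, h.one hg.one_mem hl, mu_zero]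
    · intro e f u v l hu hv hl h1 h2 _
      have h1 := h1 (homog_cons.2 ⟨hu, hl⟩)
      have h2 := h2 (homog_cons.2 ⟨hv, hl⟩)
      simp only [List.length_cons] at *
      rw [hg.itL_mul_cons hu hv _ _ hl, h1, h2, h.mul _ _ _ _ _ hu hv hl, mu_add, mu_units_smul,
        mu_units_smul, mu_mul, mu_mul, one_mul]
    · exact fun l hl _ => heq l hl

/-- The symbol of operators on the algebra itself. -/
theorem IsSymbol.isMultiDer {D : ℕ → Module.End K B} (hs : IsSymbol 𝓑 D br)
    (h𝓑 : IsGradedComm 𝓑) : IsMultiDer 𝓑 br := by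
  have hbr : ∀ l, Homog 𝓑 l → br l = itL (D l.length) 1 l 1 := fun l hl => by
    rw [hs.eq l hl, mu_apply, smul_eq_mul, mul_one]
  refine ⟨hs.mem, ?_, ?_, ?_, ?_⟩
  · intro l l' x y hl
    have hp := (List.Perm.swap y x l').append_left l
    rw [hbr _ hl, hbr _ ((homog_perm hp).1 hl), h𝓑.itL_swap _ _ hl, List.Perm.length_eq hp]
    rfl
  · intro e u v l hu hv hl
    rw [hbr _ (homog_cons.2 ⟨(𝓑 e).add_mem hu hv, hl⟩), hbr _ (homog_cons.2 ⟨hu, hl⟩),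
      hbr _ (homog_cons.2 ⟨hv, hl⟩), itL_cons_add]
    rfl
  · intro e c u l hu hl
    rw [hbr _ (homog_cons.2 ⟨(𝓑 e).smul_mem c hu, hl⟩), hbr _ (homog_cons.2 ⟨hu, hl⟩),
      itL_cons_smul]
    rfl
  · intro e f v w l hv hw hl
    have h1 := hs.eq ((e, v) :: l) (homog_cons.2 ⟨hv, hl⟩)
    have h2 := hs.eq ((f, w) :: l) (homog_cons.2 ⟨hw, hl⟩)
    rw [hbr _ (homog_cons.2 ⟨h𝓑.mul_mem hv hw, hl⟩), h𝓑.itL_mul_cons hv hw _ _ hl]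
    simp only [List.length_cons] at *
    rw [h1, h2, ← mu_mul, ← mu_mul, ← mu_units_smul, ← mu_units_smul, ← mu_add, mu_apply,
      smul_eq_mul, mul_one, one_mul]

end MultiDer

/-! ### Operators on the free graded commutative algebra -/

section FreeOp

variable {K : Type*} [Field K] {ι : Type*} {deg : ι → ℤ}

theorem mu_gen_comm (i j : ι) :
    mu K (M := FreeSym K deg) (FreeSym.gen K deg i) * mu K (FreeSym.gen K deg j)
      = (deg i * deg j).negOnePow • (mu K (FreeSym.gen K deg j) * mu K (FreeSym.gen K deg i)) := by
  rw [← mu_mul, FreeSym.gen_comm, mu_units_smul, mu_mul]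

/-- The operator on the free graded commutative algebra whose iterated commutators with
generators, applied to `1`, are given by `F`, and its iterated commutator with the word `l`. -/
def freeOp (F : SymFun K deg (FreeSym K deg)) (l : List ι) : Module.End K (FreeSym K deg) :=
  LinearMap.proj l ∘ₗ (SymFun K deg (FreeSym K deg)).subtype ∘ₗ
    (jetHom (fun i => mu K (FreeSym.gen K deg i)) mu_gen_comm).toLinearMap.flip F

theorem freeOp_one (F : SymFun K deg (FreeSym K deg)) (l : List ι) : freeOp F l 1 = F.1 l := by
  change (jetHom _ _ (1 : FreeSym K deg) F).1 l = _
  rw [map_one]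
  rfl

theorem freeOp_gen_mul (F : SymFun K deg (FreeSym K deg)) (l : List ι) (i : ι)
    (u : FreeSym K deg) : freeOp F l (FreeSym.gen K deg i * u)
      = freeOp F (l ++ [i]) u
        + (deg i * (1 + degW deg l)).negOnePow • (FreeSym.gen K deg i * freeOp F l u) :=
  jetHom_gen_mul _ mu_gen_comm i u F l

theorem gradedComm_freeOp (F : SymFun K deg (FreeSym K deg)) (l : List ι) (i : ι) :
    gradedComm (freeOp F l) (1 + degW deg l) (FreeSym.gen K deg i) (deg i)
      = freeOp F (l ++ [i]) := by
  refine LinearMap.ext fun u => ?_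
  have := freeOp_gen_mul F l i u
  simp only [gradedComm, LinearMap.sub_apply, Module.End.mul_apply, mu_apply, smul_eq_mul]
  rw [this, mul_comm (deg i)]
  exact add_sub_cancel_right _ _

theorem itL_freeOp (F : SymFun K deg (FreeSym K deg)) (w : List ι) :
    itL (freeOp F []) 1 (w.map (FreeSym.sym K deg)) = freeOp F w := by
  have := itL_word (R := freeOp F) (gradedComm_freeOp F) [] w
  rw [degW_nil, add_zero] at this
  exact this

/-- The recursion for `freeOp` on products only lengthens the word, so it never returns to the
support of `F`. -/
theorem freeOp_eq_zero {F : SymFun K deg (FreeSym K deg)} {k : ℕ}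
    (hF : ∀ l, l.length ≠ k → F.1 l = 0) (l : List ι) (hl : k < l.length) : freeOp F l = 0 := by
  refine LinearMap.ext fun u => ?_
  induction u using FreeSym.induction generalizing l with
  | hadd u v hu hv => rw [map_add, hu l hl, hv l hl, LinearMap.zero_apply, LinearMap.zero_apply,
      LinearMap.zero_apply, add_zero]
  | hsmul c u hu => rw [map_smul, hu l hl, LinearMap.zero_apply, LinearMap.zero_apply, smul_zero]
  | hone => rw [freeOp_one, hF l (by omega), LinearMap.zero_apply]
  | hmul i u hu =>
    rw [freeOp_gen_mul, hu l hl, hu (l ++ [i]) (by simp; omega)]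
    simp

/-- The grading group is arbitrary because the lemma serves both for the degree and for the weight.
-/
theorem freeOp_mem {F : SymFun K deg (FreeSym K deg)} {Γ : Type*} [AddCommGroup Γ]
    {𝓦 : Γ → Submodule K (FreeSym K deg)} {wt : ι → Γ} {s : Γ}
    (hF : ∀ l, F.1 l ∈ 𝓦 (s + (l.map wt).sum))
    (hW : ∀ i e u, u ∈ 𝓦 e → FreeSym.gen K deg i * u ∈ 𝓦 (wt i + e)) (l w : List ι) :
    freeOp F l (mulL (w.map (FreeSym.sym K deg))) ∈ 𝓦 (s + (l.map wt).sum + (w.map wt).sum) := by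
  induction w generalizing l with
  | nil => simpa [freeOp_one] using hF l
  | cons i w ih =>
    change freeOp F l (mulL (FreeSym.sym K deg i :: w.map (FreeSym.sym K deg))) ∈ _
    rw [mulL_cons]
    change freeOp F l (FreeSym.gen K deg i * _) ∈ _
    rw [freeOp_gen_mul]
    refine Submodule.add_mem _ ?_ ((Submodule.smul_mem_iff' _ _).2 ?_)
    · have := ih (l ++ [i])
      simpa [add_assoc] using this
    · have := hW i _ _ (ih l)
      rw [List.map_cons, List.sum_cons, add_left_comm]
      exact this

variable (F : ℕ → SymFun K deg (FreeSym K deg))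

/-- The operators with prescribed iterated commutators. -/
def freeD (k : ℕ) : Module.End K (FreeSym K deg) := freeOp (F k) []

/-- The brackets on the free graded commutative algebra. -/
def freeBr (l : List (ℤ × FreeSym K deg)) : FreeSym K deg := itL (freeD F l.length) 1 l 1

variable {F}

theorem freeD_mem (hdeg : ∀ k l, (F k).1 l ∈ FreeSym.grading K deg (1 + degW deg l)) (k : ℕ)
    (e : ℤ) (u : FreeSym K deg) (hu : u ∈ FreeSym.grading K deg e) :
    freeD F k u ∈ FreeSym.grading K deg (1 + e) := by
  induction hu using Submodule.span_induction with
  | zero => simp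
  | add x y _ _ hx hy => rw [map_add]; exact Submodule.add_mem _ hx hy
  | smul c x _ hx => rw [map_smul]; exact Submodule.smul_mem _ _ hx
  | mem x hx =>
    obtain ⟨l, hl, rfl, rfl⟩ := hx
    obtain ⟨w, rfl⟩ := FreeSym.exists_map hl
    have := freeOp_mem (wt := deg) (s := 1) (hdeg k)
      (fun i e u hu => FreeSym.isGradedComm.mul_mem (FreeSym.gen_mem i) hu) [] w
    rw [degL_map_sym]
    rw [List.map_nil, List.sum_nil, add_zero] at this
    exact this

/-- The bracket is defined as the value on `1` of a `k`-fold commutator of `D_k`. As one more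
commutator vanishes, that operator commutes in the graded sense with all multiplications, and hence
is itself the multiplication by its value on `1`. -/
theorem freeBr_isSymbol (hF : ∀ k l, l.length ≠ k → (F k).1 l = 0)
    (hdeg : ∀ k l, (F k).1 l ∈ FreeSym.grading K deg (1 + degW deg l)) :
    IsSymbol (FreeSym.grading K deg) (freeD F) (freeBr F) := by
  have h0 : ∀ k l, Homog (FreeSym.grading K deg) l → k < l.length → itL (freeD F k) 1 l = 0 := by
    intro k l hl hk
    refine itL_eq_zero_of_gen FreeSym.isGradedComm _ 1 l.length (fun l' hl' hn => ?_) l hl rfl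
    obtain ⟨w, rfl⟩ := FreeSym.exists_map hl'
    rw [freeD, itL_freeOp]
    exact freeOp_eq_zero (hF k) w (by rw [List.length_map] at hn; omega)
  have hmem : ∀ l, Homog (FreeSym.grading K deg) l →
      freeBr F l ∈ FreeSym.grading K deg (1 + degL l) := fun l hl => by
    have := itL_degree (ℳ := FreeSym.grading K deg) (M := FreeSym K deg)
      (fun ha hm => FreeSym.isGradedComm.mul_mem ha hm) (freeD_mem hdeg l.length) hl 0 1
      FreeSym.isGradedComm.one_mem
    simpa [freeBr] using this
  refine ⟨hmem, fun l hl => ?_, h0⟩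
  have hcomm : ∀ e u, u ∈ FreeSym.grading K deg e → itL (freeD F l.length) 1 l u
      = freeBr F l * u := by
    intro e u hu
    have h := h0 l.length (l ++ [(e, u)]) (homog_append.2 ⟨hl, by simpa [Homog] using hu⟩)
      (by simp)
    rw [itL_append] at h
    simp only [itL, gradedComm] at h
    have h' := congrArg (fun T => T 1) h
    simp only [LinearMap.sub_apply, Module.End.mul_apply, mu_apply, smul_eq_mul, mul_one,
      LinearMap.zero_apply] at h'
    rw [sub_eq_zero.1 h', FreeSym.isGradedComm.comm (hmem l hl) hu]
    rfl
  refine LinearMap.ext fun u => ?_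
  refine FreeSym.word_induction (p := fun u => itL (freeD F l.length) 1 l u = mu K (freeBr F l) u)
    (fun u v hu hv => ?_) (fun c u hu => ?_) (fun w => ?_) u
  · rw [map_add, map_add, hu, hv]
  · rw [map_smul, map_smul, hu]
  · exact hcomm _ _ (FreeSym.isGradedComm.mulL_mem (homog_map_sym w))

theorem freeBr_map_sym (w : List ι) :
    freeBr F (w.map (FreeSym.sym K deg)) = (F w.length).1 w := by
  rw [freeBr, List.length_map, freeD, itL_freeOp, freeOp_one]

/-- The Jacobi identity holds if it holds for generators, in some order. -/
theorem freeBr_jacobi (hF : ∀ k l, l.length ≠ k → (F k).1 l = 0)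
    (hdeg : ∀ k l, (F k).1 l ∈ FreeSym.grading K deg (1 + degW deg l))
    (hjac : ∀ w : List ι, ∃ w' : List ι, w'.Perm w ∧
      (ush (w'.map (FreeSym.sym K deg)) fun I J => freeBr F ((1 + degL I, freeBr F I) :: J)) = 0)
    (l : List (ℤ × FreeSym K deg)) (hl : Homog (FreeSym.grading K deg) l) :
    (ush l fun I J => freeBr F ((1 + degL I, freeBr F I) :: J)) = 0 := by
  have hs := freeBr_isSymbol hF hdeg
  have h1 : ∀ l, Homog (FreeSym.grading K deg) l → itL (∑ p ∈
      Finset.HasAntidiagonal.antidiagonal (l.length + 1), freeD F p.1 * freeD F p.2) 2 l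
      = muHom K (FreeSym K deg)
        (ush l fun I J => freeBr F ((1 + degL I, freeBr F I) :: J)) := by
    intro l hl
    rw [hs.square_one FreeSym.isGradedComm hl, ush_map]
    refine ush_congr l fun I J hIJ => ?_
    exact hs.eq ((1 + degL I, freeBr F I) :: J)
      (homog_cons.2 ⟨hs.mem I (homog_left hl hIJ), homog_right hl hIJ⟩)
  -- By `h1` the Jacobiator is the iterated commutator of one fixed operator, so its vanishing may
  -- be tested on generators, and there in any order.
  have h2 := itL_eq_zero_of_gen FreeSym.isGradedComm (∑ p ∈
    Finset.HasAntidiagonal.antidiagonal (l.length + 1), freeD F p.1 * freeD F p.2) 2 l.length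
    (fun l' hl' hn => by
      obtain ⟨w, rfl⟩ := FreeSym.exists_map hl'
      obtain ⟨w', hp, hw'⟩ := hjac w
      refine perm_of_swap (P := fun l' => Homog (FreeSym.grading K deg) l' → itL (∑ p ∈
        Finset.HasAntidiagonal.antidiagonal (l.length + 1), freeD F p.1 * freeD F p.2) 2 l' = 0)
        (fun l₁ l₂ x y hP hH => ?_) (hp.map (FreeSym.sym K deg)) (fun hH => ?_) (homog_map_sym w)
      · rw [FreeSym.isGradedComm.itL_swap _ _ hH,
          hP ((homog_perm ((List.Perm.swap x y l₂).append_left l₁)).1 hH), smul_zero]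
      · rw [← hn, ← (hp.map (FreeSym.sym K deg)).length_eq, h1 _ hH, hw', map_zero]) l hl rfl
  rw [h1 l hl] at h2
  have h3 := congrArg (fun T => T 1) h2
  simp only [muHom, LinearMap.coe_mk, AddHom.coe_mk, mu_apply, smul_eq_mul, mul_one] at h3
  exact h3

end FreeOp

/-! ### Families of functions of tuples, evaluated on lists -/

section Eval

variable {L Y : Type*}

/-- The value of a family of functions of tuples on a list of elements with degrees. -/
def evalL (f : ∀ n : ℕ, (Fin n → L) → Y) (l : List (ℤ × L)) : Y :=
  f l.length fun t => (l.get t).2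

theorem evalL_ofFn (f : ∀ n : ℕ, (Fin n → L) → Y) {n : ℕ} (v : Fin n → ℤ × L) :
    evalL f (List.ofFn v) = f n fun t => (v t).2 :=
  toL_ofFn (fun n (v : Fin n → ℤ × L) => f n fun t => (v t).2) v

theorem evalL_nil (f : ∀ n : ℕ, (Fin n → L) → Y) (ξ : Fin 0 → L) : evalL f [] = f 0 ξ :=
  congrArg (f 0) (Subsingleton.elim _ _)

theorem evalL_cons (f : ∀ n : ℕ, (Fin n → L) → Y) (x : ℤ × L) (l : List (ℤ × L)) :
    evalL f (x :: l)
      = f (l.length + 1) (Fin.cons (α := fun _ => L) x.2 fun t => (l.get t).2) := by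
  refine congrArg (f (l.length + 1)) (funext fun t => ?_)
  refine Fin.cases rfl (fun t => ?_) t
  simp

theorem evalL_cons_ofFn (f : ∀ n : ℕ, (Fin n → L) → Y) (x : ℤ × L) {n : ℕ} (v : Fin n → ℤ × L) :
    evalL f (x :: List.ofFn v)
      = f (n + 1) (Fin.cons (α := fun _ => L) x.2 fun t => (v t).2) := by
  rw [← List.ofFn_cons, evalL_ofFn]
  refine congrArg (f (n + 1)) (funext fun t => ?_)
  refine Fin.cases rfl (fun t => ?_) t
  simp

theorem evalL_ofFn_append (f : ∀ n : ℕ, (Fin n → L) → Y) (x : ℤ × L) {n : ℕ} (v : Fin n → ℤ × L) :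
    evalL f (List.ofFn v ++ [x])
      = f (n + 1) (Fin.snoc (α := fun _ => L) (fun t => (v t).2) x.2) := by
  have : List.ofFn v ++ [x] = List.ofFn (Fin.snoc (α := fun _ => ℤ × L) v x) := by
    rw [List.ofFn_succ']
    simp
  rw [this, evalL_ofFn]
  refine congrArg (f (n + 1)) (funext fun t => ?_)
  refine Fin.lastCases ?_ (fun t => ?_) t
  · simp
  · simp

theorem exists_ofFn {α : Type*} (l : List (ℤ × α)) :
    ∃ (n : ℕ) (d : Fin n → ℤ) (ξ : Fin n → α), l = List.ofFn fun t => (d t, ξ t) :=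
  ⟨l.length, fun t => (l.get t).1, fun t => (l.get t).2, (List.ofFn_get l).symm⟩

theorem exists_ofFn_homog {K V : Type*} [Field K] [AddCommGroup V] [Module K V]
    {𝒱 : ℤ → Submodule K V} {l : List (ℤ × V)} (hl : Homog 𝒱 l) :
    ∃ (n : ℕ) (d : Fin n → ℤ) (ξ : Fin n → V), (∀ t, ξ t ∈ 𝒱 (d t)) ∧
      l = List.ofFn fun t => (d t, ξ t) :=
  ⟨l.length, fun t => (l.get t).1, fun t => (l.get t).2,
    fun t => hl _ (List.get_mem l t), (List.ofFn_get l).symm⟩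

variable {K : Type*} [Field K] [AddCommGroup L] [Module K L] [AddCommGroup Y] [Module K Y]

theorem evalL_cons_add (f : ∀ n : ℕ, MultilinearMap K (fun _ : Fin n => L) Y) (e e' e'' : ℤ)
    (u v : L) (l : List (ℤ × L)) : evalL (fun n => f n) ((e, u + v) :: l)
      = evalL (fun n => f n) ((e', u) :: l) + evalL (fun n => f n) ((e'', v) :: l) := by
  simp only [evalL_cons]
  exact (f _).cons_add _ u v

theorem evalL_cons_smul (f : ∀ n : ℕ, MultilinearMap K (fun _ : Fin n => L) Y) (e e' : ℤ)
    (c : K) (u : L) (l : List (ℤ × L)) : evalL (fun n => f n) ((e, c • u) :: l)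
      = c • evalL (fun n => f n) ((e', u) :: l) := by
  simp only [evalL_cons]
  exact (f _).cons_smul _ c u

/-- Graded symmetric families are graded symmetric on lists of homogeneous elements. -/
theorem evalL_swap {𝒱 : ℤ → Submodule K L} (f : ∀ n : ℕ, (Fin n → L) → Y)
    (hf : ∀ (n : ℕ) (d : Fin n → ℤ) (ξ : Fin n → L), (∀ t, ξ t ∈ 𝒱 (d t)) →
      ∀ σ : Equiv.Perm (Fin n), f n (ξ ∘ σ) = koszul σ d • f n ξ)
    (l l' : List (ℤ × L)) (x y : ℤ × L) (hl : Homog 𝒱 (l ++ x :: y :: l')) :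
    evalL f (l ++ x :: y :: l') = (x.1 * y.1).negOnePow • evalL f (l ++ y :: x :: l') := by
  classical
  have hH : ∀ l₁ l₂ x y, Homog 𝒱 (l₁ ++ x :: y :: l₂) → Homog 𝒱 (l₁ ++ y :: x :: l₂) :=
    fun l₁ l₂ x y h => (homog_perm ((List.Perm.swap y x l₂).append_left l₁)).1 h
  -- The symmetry is only assumed for homogeneous arguments, so the function is extended by zero.
  have := gradedSymm_of_koszul (Homog 𝒱) hH (fun l => if Homog 𝒱 l then evalL f l else 0)
    (fun l hl => if_neg hl) (fun n v hv σ => by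
      have hvσ : Homog 𝒱 (List.ofFn (v ∘ σ)) := by
        intro x hx
        obtain ⟨t, rfl⟩ := List.mem_ofFn.1 hx
        exact hv _ (List.mem_ofFn.2 ⟨σ t, rfl⟩)
      simp only [if_pos hv, if_pos hvσ, evalL_ofFn]
      exact hf n (fun t => (v t).1) (fun t => (v t).2) (fun t => hv _ (List.mem_ofFn.2 ⟨t, rfl⟩)) σ)
    l l' x y
  simpa only [if_pos hl, if_pos (hH _ _ _ _ hl)] using this

/-- Linear extension from homogeneous generators of the graded module. -/
theorem lin_induction {𝒱 : ℤ → Submodule K L} {gen : ℤ × L → Prop}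
    (hspan : ∀ e, 𝒱 e ≤ Submodule.span K {v | gen (e, v)}) (hgen𝒱 : ∀ x, gen x → x.2 ∈ 𝒱 x.1)
    {P : List (ℤ × L) → Prop}
    (hswap : ∀ l₁ l₂ x y, P (l₁ ++ x :: y :: l₂) → P (l₁ ++ y :: x :: l₂))
    (hzero : ∀ e l, Homog 𝒱 l → P ((e, 0) :: l))
    (hadd : ∀ e u v l, u ∈ 𝒱 e → v ∈ 𝒱 e → Homog 𝒱 l →
      P ((e, u) :: l) → P ((e, v) :: l) → P ((e, u + v) :: l))
    (hsmul : ∀ e (c : K) u l, u ∈ 𝒱 e → Homog 𝒱 l →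
      P ((e, u) :: l) → P ((e, c • u) :: l))
    (hgen : ∀ l, (∀ x ∈ l, gen x) → P l)
    (l : List (ℤ × L)) (hl : Homog 𝒱 l) : P l := by
  suffices ∀ l' : List (ℤ × L), (∀ x ∈ l', gen x) → P (l ++ l') by
    simpa using this [] (by simp)
  induction l with
  | nil => exact hgen
  | cons x l ih =>
    intro l' hl'
    rw [homog_cons] at hl
    obtain ⟨e, u⟩ := x
    obtain ⟨hu, hl⟩ := hl
    have hll' : Homog 𝒱 (l ++ l') := homog_append.2 ⟨hl, fun x hx => hgen𝒱 x (hl' x hx)⟩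
    have hs : Submodule.span K {v | gen (e, v)} ≤ 𝒱 e :=
      Submodule.span_le.2 fun v hv => hgen𝒱 (e, v) hv
    replace hu : u ∈ Submodule.span K {v | gen (e, v)} := hspan e hu
    induction hu using Submodule.span_induction with
    | zero => exact hzero _ _ hll'
    | add x y hx hy h1 h2 => exact hadd _ _ _ _ (hs hx) (hs hy) hll' h1 h2
    | smul c x hx h => exact hsmul _ _ _ _ (hs hx) hll' h
    | mem u h =>
      exact perm_of_swap hswap (List.perm_middle (a := (e, u)))
        (ih hl ((e, u) :: l') (List.forall_mem_cons.2 ⟨h, hl'⟩))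

/-- Sums over unshuffles of compositions as sums over sublists. -/
theorem sum_unshuffles_comp (f : ∀ n : ℕ, (Fin n → L) → Y) (g : ∀ n : ℕ, (Fin n → L) → L)
    {n : ℕ} (d : Fin n → ℤ) (ξ : Fin n → L) (z : List (ℤ × L) → ℤ) :
    ∑ i : Fin (n + 1), ∑ σ ∈ unshuffles i n, koszul σ d •
      f (n - i + 1)
        (Fin.cons (g i (block 0 i (by omega) (ξ ∘ σ))) (block i (n - i) (by omega) (ξ ∘ σ)))
      = ush (List.ofFn fun t => (d t, ξ t)) fun I J => evalL f ((z I, evalL g I) :: J) := by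
  rw [← sum_sum_unshuffles]
  refine Finset.sum_congr rfl fun i _ => Finset.sum_congr rfl fun σ _ => ?_
  rw [take_ofFn (by omega), drop_ofFn (by omega), evalL_cons_ofFn, evalL_ofFn]
  rfl

theorem sum_unshuffles_mul {E : Type*} [Ring E] (f g : ∀ n : ℕ, (Fin n → L) → E)
    {n : ℕ} (d : Fin n → ℤ) (ξ : Fin n → L) :
    ∑ i : Fin (n + 1), ∑ σ ∈ unshuffles i n,
      (Int.negOnePow (∑ t, block 0 i (by omega) (d ∘ σ) t) * koszul σ d) •
        (f i (block 0 i (by omega) (ξ ∘ σ)) * g (n - i) (block i (n - i) (by omega) (ξ ∘ σ)))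
      = ush (List.ofFn fun t => (d t, ξ t)) fun I J =>
        (degL I).negOnePow • (evalL f I * evalL g J) := by
  rw [← sum_sum_unshuffles]
  refine Finset.sum_congr rfl fun i _ => Finset.sum_congr rfl fun σ _ => ?_
  rw [take_ofFn (by omega), drop_ofFn (by omega), evalL_ofFn, evalL_ofFn, degL_ofFn, smul_smul,
    mul_comm (koszul σ _)]
  rfl

theorem ush_map_list {α β N : Type*} [AddCommGroup N] (φ : ℤ × α → ℤ × β)
    (hφ : ∀ x, (φ x).1 = x.1) (l : List (ℤ × α)) (G : List (ℤ × β) → List (ℤ × β) → N) :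
    ush (l.map φ) G = ush l fun I J => G (I.map φ) (J.map φ) := by
  have hd : ∀ l : List (ℤ × α), degL (l.map φ) = degL l := by
    intro l
    simp [degL, Function.comp_def, hφ]
  induction l generalizing G with
  | nil => rfl
  | cons x l ih =>
    rw [List.map_cons, ush, ih, ih, ush]
    congr 1
    refine ush_congr l fun I J _ => ?_
    rw [hφ, hd]
    rfl

/-- Sums over sublists of a word only depend on the values on its subwords. -/
theorem ush_word_congr {ι α N : Type*} [AddCommGroup N] (φ : ι → ℤ × α) (w : List ι)
    {G G' : List (ℤ × α) → List (ℤ × α) → N}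
    (h : ∀ w₁ w₂ : List ι, (w₁ ++ w₂).Perm w →
      G (w₁.map φ) (w₂.map φ) = G' (w₁.map φ) (w₂.map φ)) :
    ush (w.map φ) G = ush (w.map φ) G' := by
  induction w generalizing G G' with
  | nil => exact h [] [] List.Perm.nil
  | cons i w ih =>
    rw [List.map_cons, ush, ush]
    congr 1
    · exact ih fun w₁ w₂ hp => h (i :: w₁) w₂ (hp.cons i)
    · refine ih fun w₁ w₂ hp => ?_
      rw [← List.map_cons, h w₁ (i :: w₂) (List.perm_middle.trans (hp.cons i))]

/-- Graded symmetric multilinear functions on lists of homogeneous elements. -/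
structure IsGradedMul {K L Y : Type*} [Field K] [AddCommGroup L] [Module K L] [AddCommGroup Y]
    [Module K Y] (𝒱 : ℤ → Submodule K L) (f : List (ℤ × L) → Y) : Prop where
  swap : ∀ l l' x y, Homog 𝒱 (l ++ x :: y :: l') →
    f (l ++ x :: y :: l') = (x.1 * y.1).negOnePow • f (l ++ y :: x :: l')
  add : ∀ e u v l, u ∈ 𝒱 e → v ∈ 𝒱 e → Homog 𝒱 l →
    f ((e, u + v) :: l) = f ((e, u) :: l) + f ((e, v) :: l)
  smul : ∀ e (c : K) u l, u ∈ 𝒱 e → Homog 𝒱 l → f ((e, c • u) :: l) = c • f ((e, u) :: l)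

theorem IsGradedMul.zero {𝒱 : ℤ → Submodule K L} {f : List (ℤ × L) → Y} (h : IsGradedMul 𝒱 f)
    (e : ℤ) {l : List (ℤ × L)} (hl : Homog 𝒱 l) : f ((e, 0) :: l) = 0 := by
  have := h.smul e 0 0 l (𝒱 e).zero_mem hl
  simpa using this

theorem IsGradedMul.sub {𝒱 : ℤ → Submodule K L} {f : List (ℤ × L) → Y} (h : IsGradedMul 𝒱 f)
    {e : ℤ} {u v : L} {l : List (ℤ × L)} (hu : u ∈ 𝒱 e) (hv : v ∈ 𝒱 e) (hl : Homog 𝒱 l) :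
    f ((e, u - v) :: l) = f ((e, u) :: l) - f ((e, v) :: l) := by
  have h1 : u - v = u + (-1 : K) • v := by rw [neg_one_smul, sub_eq_add_neg]
  rw [h1, h.add _ _ _ _ hu ((𝒱 e).smul_mem _ hv) hl, h.smul _ _ _ _ hv hl, neg_one_smul,
    sub_eq_add_neg]

theorem IsGradedMul.append_singleton {𝒱 : ℤ → Submodule K L} {f : List (ℤ × L) → Y}
    (h : IsGradedMul 𝒱 f) {l : List (ℤ × L)} {x : ℤ × L}
    (hl : Homog 𝒱 (x :: l)) : f (l ++ [x]) = (x.1 * degL l).negOnePow • f (x :: l) := by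
  suffices ∀ l₀, Homog 𝒱 (l₀ ++ x :: l) →
      f (l₀ ++ (l ++ [x])) = (x.1 * degL l).negOnePow • f (l₀ ++ x :: l) by
    simpa using this [] (by simpa using hl)
  clear hl
  induction l with
  | nil => simp
  | cons y l ih =>
    intro l₀ hl
    have := ih (l₀ ++ [y]) (by
      rw [List.append_assoc]
      exact (homog_perm ((List.Perm.swap y x l).append_left l₀)).1 hl)
    simp only [List.append_assoc, List.cons_append, List.nil_append] at this ⊢
    rw [this, h.swap _ _ x y hl, smul_smul, ← Int.negOnePow_add, degL_cons,
      negOnePow_congr (a := x.1 * (y.1 + degL l) + x.1 * y.1) (b := x.1 * degL l)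
        ⟨x.1 * y.1, by ring⟩]

/-- Graded symmetric multilinear functions that agree on homogeneous generators are equal. -/
theorem IsGradedMul.ext {𝒱 : ℤ → Submodule K L} {f g : List (ℤ × L) → Y} (hf : IsGradedMul 𝒱 f)
    (hg : IsGradedMul 𝒱 g) {gen : ℤ × L → Prop}
    (hspan : ∀ e, 𝒱 e ≤ Submodule.span K {v | gen (e, v)}) (hgen𝒱 : ∀ x, gen x → x.2 ∈ 𝒱 x.1)
    (hgen : ∀ l, (∀ x ∈ l, gen x) → f l = g l) (l : List (ℤ × L)) (hl : Homog 𝒱 l) :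
    f l = g l := by
  refine lin_induction (K := K) (P := fun l => Homog 𝒱 l → f l = g l) hspan hgen𝒱 ?_ ?_ ?_ ?_
    (fun l hl _ => hgen l hl) l hl hl
  · intro l₁ l₂ x y hP hH
    rw [hf.swap _ _ _ _ hH, hg.swap _ _ _ _ hH,
      hP ((homog_perm ((List.Perm.swap x y l₂).append_left l₁)).1 hH)]
  · intro e l hl _
    rw [hf.zero e hl, hg.zero e hl]
  · intro e u v l hu hv hl h1 h2 _
    rw [hf.add _ _ _ _ hu hv hl, hg.add _ _ _ _ hu hv hl, h1 (homog_cons.2 ⟨hu, hl⟩),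
      h2 (homog_cons.2 ⟨hv, hl⟩)]
  · intro e c u l hu hl h1 _
    rw [hf.smul _ _ _ _ hu hl, hg.smul _ _ _ _ hu hl, h1 (homog_cons.2 ⟨hu, hl⟩)]

theorem IsGradedMul.eq_zero_of_span {𝒱 : ℤ → Submodule K L} {f : List (ℤ × L) → Y}
    (h : IsGradedMul 𝒱 f) {e : ℤ} {S : Set L} (hS : ∀ v ∈ S, v ∈ 𝒱 e) {l : List (ℤ × L)}
    (hl : Homog 𝒱 l) (hf : ∀ v ∈ S, f ((e, v) :: l) = 0) {u : L} (hu : u ∈ Submodule.span K S) :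
    f ((e, u) :: l) = 0 := by
  have hle : Submodule.span K S ≤ 𝒱 e := Submodule.span_le.2 hS
  induction hu using Submodule.span_induction with
  | zero => exact h.zero e hl
  | add x y hx hy h1 h2 => rw [h.add _ _ _ _ (hle hx) (hle hy) hl, h1, h2, add_zero]
  | smul c x hx h1 => rw [h.smul _ _ _ _ (hle hx) hl, h1, smul_zero]
  | mem u hu => exact hf u hu

/-- The map of pairs that is induced by a linear map of degree zero. -/
def degMap {V W : Type*} (φ : V → W) : ℤ × V → ℤ × W := Prod.map id φ

@[simp] theorem degMap_mk {V W : Type*} (φ : V → W) (e : ℤ) (v : V) :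
    degMap φ (e, v) = (e, φ v) := rfl

@[simp] theorem degMap_fst {V W : Type*} (φ : V → W) (x : ℤ × V) : (degMap φ x).1 = x.1 := rfl

@[simp] theorem degMap_snd {V W : Type*} (φ : V → W) (x : ℤ × V) : (degMap φ x).2 = φ x.2 := rfl

@[simp] theorem degL_map_degMap {V W : Type*} (φ : V → W) (l : List (ℤ × V)) :
    degL (l.map (degMap φ)) = degL l := by
  simp [degL, Function.comp_def]

theorem degL_perm {V : Type*} {l l' : List (ℤ × V)} (h : l.Perm l') : degL l = degL l' :=
  (h.map Prod.fst).sum_eq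

theorem homog_map_degMap {V W : Type*} [AddCommGroup V] [Module K V] [AddCommGroup W] [Module K W]
    {𝒱 : ℤ → Submodule K V} {𝒲 : ℤ → Submodule K W} {φ : V → W}
    (hφ : ∀ e v, v ∈ 𝒱 e → φ v ∈ 𝒲 e) {l : List (ℤ × V)} (hl : Homog 𝒱 l) :
    Homog 𝒲 (l.map (degMap φ)) := by
  intro x hx
  obtain ⟨y, hy, rfl⟩ := List.mem_map.1 hx
  exact hφ _ _ (hl y hy)

theorem IsGradedMul.comap {V W : Type*} [AddCommGroup V] [Module K V] [AddCommGroup W] [Module K W]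
    {𝒱 : ℤ → Submodule K V} {𝒲 : ℤ → Submodule K W} {φ : V →ₗ[K] W}
    (hφ : ∀ e v, v ∈ 𝒱 e → φ v ∈ 𝒲 e) {f : List (ℤ × W) → Y} (hf : IsGradedMul 𝒲 f) :
    IsGradedMul 𝒱 fun l => f (l.map (degMap φ)) where
  swap l l' x y hl := by
    have := hf.swap (l.map (degMap φ)) (l'.map (degMap φ)) (degMap φ x) (degMap φ y)
      (by simpa using homog_map_degMap hφ hl)
    simpa using this
  add e u v l hu hv hl := by
    have := hf.add e (φ u) (φ v) _ (hφ _ _ hu) (hφ _ _ hv) (homog_map_degMap hφ hl)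
    simpa using this
  smul e c u l hu hl := by
    have := hf.smul e c (φ u) _ (hφ _ _ hu) (homog_map_degMap hφ hl)
    simpa using this

theorem IsGradedMul.map {Z : Type*} [AddCommGroup Z] [Module K Z] {𝒱 : ℤ → Submodule K L}
    {f : List (ℤ × L) → Y} (hf : IsGradedMul 𝒱 f) (φ : Y →ₗ[K] Z) :
    IsGradedMul 𝒱 fun l => φ (f l) where
  swap l l' x y hl := by
    rw [hf.swap _ _ _ _ hl, Units.smul_def, Units.smul_def, map_zsmul]
  add e u v l hu hv hl := by rw [hf.add _ _ _ _ hu hv hl, map_add]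
  smul e c u l hu hl := by rw [hf.smul _ _ _ _ hu hl, map_smul]

theorem IsGradedMul.degL_smul {𝒱 : ℤ → Submodule K L}
    {f : List (ℤ × L) → Y} (hf : IsGradedMul 𝒱 f) (s : ℤ → ℤˣ) :
    IsGradedMul 𝒱 fun l => s (degL l) • f l where
  swap l l' x y hl := by
    rw [hf.swap _ _ _ _ hl, degL_perm ((List.Perm.swap y x l').append_left l), smul_comm]
  add e u v l hu hv hl := by
    rw [hf.add _ _ _ _ hu hv hl, smul_add, degL_cons, degL_cons, degL_cons]
  smul e c u l hu hl := by
    rw [hf.smul _ _ _ _ hu hl, degL_cons, degL_cons, smul_comm]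

theorem IsGradedMul.cons {𝒱 : ℤ → Submodule K L} {f : List (ℤ × L) → Y} (hf : IsGradedMul 𝒱 f)
    {x : ℤ × L} (hx : x.2 ∈ 𝒱 x.1) : IsGradedMul 𝒱 fun l => f (x :: l) where
  swap l l' y z hl := hf.swap (x :: l) l' y z (homog_cons.2 ⟨hx, hl⟩)
  add e u v l hu hv hl := by
    have hH : ∀ w, w ∈ 𝒱 e → Homog 𝒱 (x :: (e, w) :: l) := fun w hw =>
      homog_cons.2 ⟨hx, homog_cons.2 ⟨hw, hl⟩⟩
    have := hf.swap [] l x (e, u + v) (hH _ ((𝒱 e).add_mem hu hv))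
    rw [List.nil_append, List.nil_append] at this
    rw [this, hf.add _ _ _ _ hu hv (homog_cons.2 ⟨hx, hl⟩), smul_add]
    congr 1
    · exact (hf.swap [] l x (e, u) (hH _ hu)).symm
    · exact (hf.swap [] l x (e, v) (hH _ hv)).symm
  smul e c u l hu hl := by
    have hH : ∀ w, w ∈ 𝒱 e → Homog 𝒱 (x :: (e, w) :: l) := fun w hw =>
      homog_cons.2 ⟨hx, homog_cons.2 ⟨hw, hl⟩⟩
    have := hf.swap [] l x (e, c • u) (hH _ ((𝒱 e).smul_mem c hu))
    rw [List.nil_append, List.nil_append] at this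
    rw [this, hf.smul _ _ _ _ hu (homog_cons.2 ⟨hx, hl⟩), smul_comm]
    congr 1
    exact (hf.swap [] l x (e, u) (hH _ hu)).symm

theorem isGradedMul_evalL {𝒱 : ℤ → Submodule K L}
    (f : ∀ n : ℕ, MultilinearMap K (fun _ : Fin n => L) Y)
    (hf : ∀ (n : ℕ) (d : Fin n → ℤ) (ξ : Fin n → L), (∀ t, ξ t ∈ 𝒱 (d t)) →
      ∀ σ : Equiv.Perm (Fin n), f n (ξ ∘ σ) = koszul σ d • f n ξ) :
    IsGradedMul 𝒱 (evalL fun n => f n) where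
  swap l l' x y hl := evalL_swap _ hf l l' x y hl
  add _ _ _ _ _ _ _ := evalL_cons_add f _ _ _ _ _ _
  smul _ _ _ _ _ _ := evalL_cons_smul f _ _ _ _ _

theorem IsMultiDer.isGradedMul {B : Type*} [Ring B] [Algebra K B] {𝓑 : ℤ → Submodule K B}
    {br : List (ℤ × B) → B} (h : IsMultiDer 𝓑 br) : IsGradedMul 𝓑 br :=
  ⟨h.swap, h.add, h.smul⟩

end Eval

/-! ### The laws of `LR_∞[1]` algebras and right connections on lists -/

section Axioms

variable {K A L Q : Type*} [Field K] [Ring A] [Algebra K A]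
  [AddCommGroup L] [Module K L] [Module A L]
  [AddCommGroup Q] [Module K Q] [Module A Q]
  {𝒜 : ℤ → Submodule K A} {ℒ : ℤ → Submodule K L} {𝒬 : ℤ → Submodule K Q}

/-- The brackets on lists. -/
def LRInfty.br (X : LRInfty 𝒜 ℒ) : List (ℤ × L) → L := evalL fun n => X.bracket n

/-- The anchors on lists. -/
def LRInfty.an (X : LRInfty 𝒜 ℒ) : List (ℤ × L) → Module.End K A := evalL fun n => X.anchor n

variable (X : LRInfty 𝒜 ℒ)

theorem LRInfty.br_mem (l : List (ℤ × L)) (hl : Homog ℒ l) : X.br l ∈ ℒ (1 + degL l) := by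
  obtain ⟨n, d, ξ, h, rfl⟩ := exists_ofFn_homog hl
  rw [br, evalL_ofFn, degL_ofFn]
  exact X.bracket_degree n d ξ h

theorem LRInfty.br_swap (l l' : List (ℤ × L)) (x y : ℤ × L) (hl : Homog ℒ (l ++ x :: y :: l')) :
    X.br (l ++ x :: y :: l') = (x.1 * y.1).negOnePow • X.br (l ++ y :: x :: l') :=
  evalL_swap _ X.bracket_symm l l' x y hl

theorem LRInfty.an_mem (l : List (ℤ × L)) (hl : Homog ℒ l) (e : ℤ) (a : A) (ha : a ∈ 𝒜 e) :
    X.an l a ∈ 𝒜 (1 + degL l + e) := by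
  obtain ⟨n, d, ξ, h, rfl⟩ := exists_ofFn_homog hl
  rw [an, evalL_ofFn, degL_ofFn]
  exact X.anchor_degree n d ξ h e a ha

theorem LRInfty.an_swap (l l' : List (ℤ × L)) (x y : ℤ × L) (hl : Homog ℒ (l ++ x :: y :: l')) :
    X.an (l ++ x :: y :: l') = (x.1 * y.1).negOnePow • X.an (l ++ y :: x :: l') :=
  evalL_swap _ X.anchor_symm l l' x y hl

theorem LRInfty.an_linear (e : ℤ) (a : A) (ha : a ∈ 𝒜 e) (i j : ℤ) (ζ : L) (l : List (ℤ × L))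
    (b : A) : X.an ((i, a • ζ) :: l) b = e.negOnePow • (a * X.an ((j, ζ) :: l) b) := by
  rw [an, evalL_cons, evalL_cons]
  exact X.anchor_linear _ e a ha ζ _ b

theorem LRInfty.an_mul (l : List (ℤ × L)) (hl : Homog ℒ l) (e : ℤ) (a : A) (ha : a ∈ 𝒜 e) (b : A) :
    X.an l (a * b) = X.an l a * b + ((1 + degL l) * e).negOnePow • (a * X.an l b) := by
  obtain ⟨n, d, ξ, h, rfl⟩ := exists_ofFn_homog hl
  rw [an, evalL_ofFn, degL_ofFn]
  exact X.anchor_derivation n d ξ h e a ha b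

theorem LRInfty.an_one (l : List (ℤ × L)) (hl : Homog ℒ l) (h1 : (1 : A) ∈ 𝒜 0) :
    X.an l 1 = 0 := by
  have := X.an_mul l hl 0 1 h1 1
  simpa using this

theorem LRInfty.br_smul (l : List (ℤ × L)) (hl : Homog ℒ l) (e : ℤ) (a : A) (ha : a ∈ 𝒜 e)
    (i j : ℤ) (ζ : L) : X.br (l ++ [(i, a • ζ)])
      = X.an l a • ζ + ((1 + degL l) * e).negOnePow • (a • X.br (l ++ [(j, ζ)])) := by
  obtain ⟨n, d, ξ, h, rfl⟩ := exists_ofFn_homog hl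
  rw [an, br, evalL_ofFn, evalL_ofFn_append, evalL_ofFn_append, degL_ofFn]
  exact X.bracket_leibniz n d ξ h e a ha ζ

theorem LRInfty.br_jacobi (l : List (ℤ × L)) (hl : Homog ℒ l) :
    (ush l fun I J => X.br ((1 + degL I, X.br I) :: J)) = 0 := by
  obtain ⟨n, d, ξ, h, rfl⟩ := exists_ofFn_homog hl
  rw [← X.jacobi n d ξ h]
  exact (sum_unshuffles_comp _ _ d ξ fun I => 1 + degL I).symm

theorem LRInfty.an_jacobi (l : List (ℤ × L)) (hl : Homog ℒ l) :
    (ush l fun I J => (degL I).negOnePow • (X.an I * X.an J))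
      + (ush l fun I J => X.an ((1 + degL I, X.br I) :: J)) = 0 := by
  obtain ⟨n, d, ξ, h, rfl⟩ := exists_ofFn_homog hl
  rw [← X.anchor_jacobi n d ξ h]
  congr 1
  · exact (sum_unshuffles_mul _ _ d ξ).symm
  · exact (sum_unshuffles_comp (fun n => X.anchor n) (fun n => X.bracket n) d ξ
      fun I => 1 + degL I).symm

variable {X}

/-- The components of a right connection on lists. -/
def RightConnection.ev (Δ : RightConnection X 𝒬) : List (ℤ × L) → Module.End K Q :=
  evalL fun n => Δ.op n

variable (Δ : RightConnection X 𝒬)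

theorem RightConnection.ev_mem (l : List (ℤ × L)) (hl : Homog ℒ l) (e : ℤ) (q : Q)
    (hq : q ∈ 𝒬 e) : Δ.ev l q ∈ 𝒬 (1 + degL l + e) := by
  obtain ⟨n, d, ξ, h, rfl⟩ := exists_ofFn_homog hl
  rw [ev, evalL_ofFn, degL_ofFn]
  exact Δ.op_degree n d ξ h e q hq

theorem RightConnection.ev_swap (l l' : List (ℤ × L)) (x y : ℤ × L)
    (hl : Homog ℒ (l ++ x :: y :: l')) :
    Δ.ev (l ++ x :: y :: l') = (x.1 * y.1).negOnePow • Δ.ev (l ++ y :: x :: l') :=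
  evalL_swap _ Δ.op_symm l l' x y hl

theorem RightConnection.ev_leibniz (l : List (ℤ × L)) (hl : Homog ℒ l) (e : ℤ) (a : A)
    (ha : a ∈ 𝒜 e) (q : Q) : Δ.ev l (a • q)
      = ((1 + degL l) * e).negOnePow • (a • Δ.ev l q) - X.an l a • q := by
  obtain ⟨n, d, ξ, h, rfl⟩ := exists_ofFn_homog hl
  rw [ev, evalL_ofFn, degL_ofFn, LRInfty.an, evalL_ofFn]
  exact Δ.op_leibniz n d ξ h e a ha q

theorem RightConnection.ev_linear (l : List (ℤ × L)) (hl : Homog ℒ l) (c : ℤ) (ζ : L)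
    (hζ : ζ ∈ ℒ c) (e i : ℤ) (a : A) (ha : a ∈ 𝒜 e) (q : Q) : Δ.ev ((i, a • ζ) :: l) q
      = (e * (c + degL l)).negOnePow • Δ.ev ((c, ζ) :: l) (a • q) := by
  obtain ⟨n, d, ξ, h, rfl⟩ := exists_ofFn_homog hl
  rw [ev, evalL_cons_ofFn, evalL_cons_ofFn, degL_ofFn]
  exact Δ.op_linear n d ξ h c ζ hζ e a ha q

end Axioms

/-! ### Homogeneous bases -/

section HomogeneousBasis

variable {K V : Type*} [Field K] [AddCommGroup V] [Module K V] (𝒱 : ℤ → Submodule K V)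

/-- The index type of a homogeneous basis. -/
def HIdx : Type _ := Σ i : ℤ, Module.Basis.ofVectorSpaceIndex K (𝒱 i)

variable {𝒱} in
/-- The degree of a basis element. -/
def HIdx.deg (i : HIdx 𝒱) : ℤ := i.1

/-- A basis of homogeneous elements. -/
def hbasis [DirectSum.Decomposition 𝒱] : Module.Basis (HIdx 𝒱) K V :=
  (DirectSum.Decomposition.isInternal 𝒱).collectedBasis fun i =>
    Module.Basis.ofVectorSpace K (𝒱 i)

variable [DirectSum.Decomposition 𝒱]

/-- A basis element together with its degree. -/
def hsym (i : HIdx 𝒱) : ℤ × V := (i.deg, hbasis 𝒱 i)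

theorem hbasis_mem (i : HIdx 𝒱) : hbasis 𝒱 i ∈ 𝒱 i.deg :=
  (DirectSum.Decomposition.isInternal 𝒱).collectedBasis_mem _ i

theorem le_span_hsym (e : ℤ) :
    𝒱 e ≤ Submodule.span K {v | ∃ i, (e, v) = hsym 𝒱 i} := by
  intro v hv
  have h := (Module.Basis.ofVectorSpace K (𝒱 e)).mem_span ⟨v, hv⟩
  have h' := Submodule.mem_map_of_mem (f := (𝒱 e).subtype) h
  rw [Submodule.map_span] at h'
  refine Submodule.span_mono ?_ h'
  rintro _ ⟨_, ⟨j, rfl⟩, rfl⟩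
  refine ⟨⟨e, j⟩, Prod.ext rfl ?_⟩
  exact (congrFun ((DirectSum.Decomposition.isInternal 𝒱).collectedBasis_coe fun i =>
    Module.Basis.ofVectorSpace K (𝒱 i)) ⟨e, j⟩).symm

theorem hsym_mem (x : ℤ × V) (hx : ∃ i, x = hsym 𝒱 i) : x.2 ∈ 𝒱 x.1 := by
  obtain ⟨i, rfl⟩ := hx
  exact hbasis_mem 𝒱 i

theorem exists_map_hsym {l : List (ℤ × V)} (hl : ∀ x ∈ l, ∃ i, x = hsym 𝒱 i) :
    ∃ w : List (HIdx 𝒱), l = w.map (hsym 𝒱) := by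
  induction l with
  | nil => exact ⟨[], rfl⟩
  | cons x l ih =>
    obtain ⟨w, rfl⟩ := ih fun y hy => hl y (by simp [hy])
    obtain ⟨i, rfl⟩ := hl x (by simp)
    exact ⟨i :: w, rfl⟩

theorem homog_map_hsym (w : List (HIdx 𝒱)) : Homog 𝒱 (w.map (hsym 𝒱)) := by
  intro x hx
  obtain ⟨i, -, rfl⟩ := List.mem_map.1 hx
  exact hbasis_mem 𝒱 i

theorem degL_map_hsym (w : List (HIdx 𝒱)) :
    degL (w.map (hsym 𝒱)) = degW HIdx.deg w := by
  simp only [degL, degW, List.map_map]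
  rfl

end HomogeneousBasis

/-! ### Symmetric functions of words with at most one letter of the first kind -/

section Mixed

variable {α β W : Type*} [AddCommGroup W] (dα : α → ℤ) (dβ : β → ℤ)

/-- The letters of a word, if they are all of the second kind. -/
def rights : List (α ⊕ β) → Option (List β)
  | [] => some []
  | Sum.inl _ :: _ => none
  | Sum.inr b :: l => (rights l).map (b :: ·)

/-- The function of words that is given by `f` on words with no letter of the first kind and by `g`
on words with one such letter, moved to the end, and that vanishes on all other words. -/
def mixed : (List β → W) → (List β → α → W) → List (α ⊕ β) → W
  | f, _, [] => f []
  | f, g, Sum.inr b :: l => mixed (fun l => f (b :: l)) (fun l => g (b :: l)) l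
  | _, g, Sum.inl a :: l =>
    match rights l with
    | some l' => (dα a * degW dβ l').negOnePow • g l' a
    | none => 0

@[simp] theorem rights_map_inr (l : List β) :
    rights (α := α) (l.map Sum.inr) = some l := by
  induction l with
  | nil => rfl
  | cons b l ih => simp [rights, ih]

theorem countP_inl (a : α) (l : List (α ⊕ β)) :
    (Sum.inl a :: l).countP Sum.isLeft = l.countP Sum.isLeft + 1 :=
  List.countP_cons_of_pos rfl

theorem countP_inr (b : β) (l : List (α ⊕ β)) :
    (Sum.inr b :: l).countP Sum.isLeft = l.countP Sum.isLeft :=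
  List.countP_cons_of_neg (by simp)

theorem rights_eq_none {l : List (α ⊕ β)} (hl : 1 ≤ l.countP Sum.isLeft) : rights l = none := by
  induction l with
  | nil => simp at hl
  | cons x l ih =>
    cases x with
    | inl a => rfl
    | inr b => simp [rights, ih (by simpa using hl)]

theorem eq_map_of_countP {l : List (α ⊕ β)} (hl : l.countP Sum.isLeft = 0) :
    ∃ l' : List β, l = l'.map Sum.inr := by
  induction l with
  | nil => exact ⟨[], rfl⟩
  | cons x l ih =>
    cases x with
    | inl a => simp at hl
    | inr b =>
      obtain ⟨l', rfl⟩ := ih (by simpa using hl)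
      exact ⟨b :: l', rfl⟩

@[simp] theorem mixed_map_inr (f : List β → W) (g : List β → α → W) (l : List β) :
    mixed dα dβ f g (l.map Sum.inr) = f l := by
  induction l generalizing f g with
  | nil => rfl
  | cons b l ih => exact ih _ _

theorem mixed_inl (f : List β → W) (g : List β → α → W) (l : List β) (a : α) :
    mixed dα dβ f g (Sum.inl a :: l.map Sum.inr) = (dα a * degW dβ l).negOnePow • g l a := by
  simp [mixed]

@[simp] theorem mixed_append_inl (f : List β → W) (g : List β → α → W) (l : List β) (a : α) :
    mixed dα dβ f g (l.map Sum.inr ++ [Sum.inl a]) = g l a := by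
  induction l generalizing f g with
  | nil => simp [mixed, rights]
  | cons b l ih => exact ih _ _

theorem mixed_eq_zero (f : List β → W) (g : List β → α → W) {l : List (α ⊕ β)}
    (hl : 2 ≤ l.countP Sum.isLeft) : mixed dα dβ f g l = 0 := by
  induction l generalizing f g with
  | nil => simp at hl
  | cons x l ih =>
    cases x with
    | inl a =>
      rw [mixed, rights_eq_none]
      rw [countP_inl] at hl
      omega
    | inr b => exact ih _ _ (by simpa using hl)

theorem mixed_units_smul (s : ℤˣ) (f : List β → W) (g : List β → α → W) (l : List (α ⊕ β)) :
    mixed dα dβ (fun l => s • f l) (fun l a => s • g l a) l = s • mixed dα dβ f g l := by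
  induction l generalizing f g with
  | nil => rfl
  | cons x l ih =>
    cases x with
    | inl a =>
      simp only [mixed]
      cases rights l with
      | none => simp
      | some l' => simp only; rw [smul_comm]
    | inr b => exact ih _ _

/-- The sign in `mixed` is that of moving the single letter of the first kind to the end, so a
transposition involving that letter is absorbed by it. Transpositions of letters of the second kind
are covered by the symmetry of `f` and `g`, and with two letters of the first kind both sides
vanish. -/
theorem mixed_swap {f : List β → W} {g : List β → α → W}
    (hf : ∀ l₁ l₂ i j, f (l₁ ++ i :: j :: l₂) = (dβ i * dβ j).negOnePow • f (l₁ ++ j :: i :: l₂))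
    (hg : ∀ l₁ l₂ i j,
      g (l₁ ++ i :: j :: l₂) = (dβ i * dβ j).negOnePow • g (l₁ ++ j :: i :: l₂))
    (l₁ l₂ : List (α ⊕ β)) (i j : α ⊕ β) :
    mixed dα dβ f g (l₁ ++ i :: j :: l₂)
      = (Sum.elim dα dβ i * Sum.elim dα dβ j).negOnePow • mixed dα dβ f g (l₁ ++ j :: i :: l₂) := by
  induction l₁ generalizing f g with
  | cons x l ih =>
    cases x with
    | inr b =>
      exact ih (fun l₁ l₂ i j => hf (b :: l₁) l₂ i j) (fun l₁ l₂ i j => hg (b :: l₁) l₂ i j)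
    | inl a =>
      simp only [List.cons_append, mixed]
      -- After a leading letter of the first kind, either another one follows and both values are
      -- zero, or the remaining letters form a word of the second kind in which two neighbours are
      -- exchanged.
      have hr : ∀ (l l₂ : List (α ⊕ β)) (i j : α ⊕ β),
          (rights (l ++ i :: j :: l₂) = none ∧ rights (l ++ j :: i :: l₂) = none) ∨
          ∃ (m₁ m₂ : List β) (b c : β), i = Sum.inr b ∧ j = Sum.inr c ∧
            rights (l ++ i :: j :: l₂) = some (m₁ ++ b :: c :: m₂) ∧
            rights (l ++ j :: i :: l₂) = some (m₁ ++ c :: b :: m₂) := by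
        intro l l₂ i j
        by_cases h : 1 ≤ (l ++ i :: j :: l₂).countP Sum.isLeft
        · refine Or.inl ⟨rights_eq_none h, rights_eq_none ?_⟩
          rwa [((List.Perm.swap i j l₂).append_left l).countP_eq]
        · obtain ⟨l', hl'⟩ := eq_map_of_countP (l := l ++ i :: j :: l₂) (by omega)
          obtain ⟨m₁, m', rfl, rfl, h2⟩ := List.map_eq_append_iff.1 hl'.symm
          obtain ⟨b, m'', rfl, rfl, h3⟩ := List.map_eq_cons_iff.1 h2
          obtain ⟨c, m₂, rfl, rfl, rfl⟩ := List.map_eq_cons_iff.1 h3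
          refine Or.inr ⟨m₁, m₂, b, c, rfl, rfl, ?_, ?_⟩
          · rw [hl', rights_map_inr]
          · have := rights_map_inr (α := α) (m₁ ++ c :: b :: m₂)
            simpa using this
      rcases hr l l₂ i j with ⟨h1, h2⟩ | ⟨m₁, m₂, b, c, rfl, rfl, h1, h2⟩
      · rw [h1, h2, smul_zero]
      · rw [h1, h2]
        simp only [hg m₁ m₂ b c, Pi.smul_apply, Sum.elim_inr, degW_append, degW_cons]
        rw [smul_comm, add_left_comm (dβ b)]
  | nil =>
    simp only [List.nil_append]
    cases i with
    | inl a =>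
      cases j with
      | inl a' =>
        rw [mixed_eq_zero, mixed_eq_zero, smul_zero] <;>
          simp only [countP_inl] <;> omega
      | inr b =>
        by_cases h : 1 ≤ l₂.countP Sum.isLeft
        · rw [mixed_eq_zero, mixed_eq_zero, smul_zero]
          · simp only [countP_inl, countP_inr]; omega
          · simp only [countP_inl, countP_inr]; omega
        · obtain ⟨m, rfl⟩ := eq_map_of_countP (l := l₂) (by omega)
          have h1 := mixed_inl dα dβ f g (b :: m) a
          have h2 := mixed_inl dα dβ (fun l => f (b :: l)) (fun l => g (b :: l)) m a
          rw [List.map_cons] at h1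
          rw [h1, mixed, h2, smul_smul, ← Int.negOnePow_add]
          simp [mul_add]
    | inr b =>
      cases j with
      | inl a =>
        by_cases h : 1 ≤ l₂.countP Sum.isLeft
        · rw [mixed_eq_zero, mixed_eq_zero, smul_zero]
          · simp only [countP_inl, countP_inr]; omega
          · simp only [countP_inl, countP_inr]; omega
        · obtain ⟨m, rfl⟩ := eq_map_of_countP (l := l₂) (by omega)
          have h1 := mixed_inl dα dβ f g (b :: m) a
          have h2 := mixed_inl dα dβ (fun l => f (b :: l)) (fun l => g (b :: l)) m a
          rw [List.map_cons] at h1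
          rw [h1, mixed, h2, smul_smul, ← Int.negOnePow_add]
          simp only [Sum.elim_inl, Sum.elim_inr, degW_cons]
          rw [negOnePow_congr (a := dβ b * dα a + dα a * (dβ b + degW dβ m))
            (b := dα a * degW dβ m) ⟨dβ b * dα a, by ring⟩]
      | inr c =>
        simp only [mixed, Sum.elim_inr]
        rw [← mixed_units_smul]
        congr 1
        · exact funext fun l => hf [] l b c
        · exact funext fun l => hg [] l b c

/-- The offset `n` counts the letters already absorbed into `f` and `g` during the induction; it
also accommodates functions supported in a shifted length. -/
theorem mixed_length {f : List β → W} {g : List β → α → W} {n k : ℕ}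
    (hf : ∀ l, l.length + n ≠ k → f l = 0) (hg : ∀ l a, l.length + 1 + n ≠ k → g l a = 0)
    (l : List (α ⊕ β)) (hl : l.length + n ≠ k) : mixed dα dβ f g l = 0 := by
  by_cases h2 : 2 ≤ l.countP Sum.isLeft
  · exact mixed_eq_zero dα dβ f g h2
  induction l generalizing f g n with
  | nil => exact hf [] hl
  | cons x l ih =>
    cases x with
    | inr b =>
      refine ih (n := n + 1) (fun l hl => hf _ ?_) (fun l a hl => hg _ a ?_) ?_ (by simpa using h2)
      · simp only [List.length_cons]; omega
      · simp only [List.length_cons]; omega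
      · simp only [List.length_cons] at hl; omega
    | inl a =>
      obtain ⟨m, rfl⟩ := eq_map_of_countP (l := l) (by rw [countP_inl] at h2; omega)
      rw [mixed_inl, hg, smul_zero]
      simpa using hl

theorem mixed_mem {K : Type*} [Field K] [Module K W] {Γ : Type*} [AddCommGroup Γ]
    {𝓦 : Γ → Submodule K W} {wt : α ⊕ β → Γ} {s : Γ} {f : List β → W} {g : List β → α → W}
    (hf : ∀ l, f l ∈ 𝓦 (s + (l.map fun b => wt (Sum.inr b)).sum))
    (hg : ∀ l a, g l a ∈ 𝓦 (s + (l.map fun b => wt (Sum.inr b)).sum + wt (Sum.inl a)))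
    (l : List (α ⊕ β)) : mixed dα dβ f g l ∈ 𝓦 (s + (l.map wt).sum) := by
  by_cases h2 : 2 ≤ l.countP Sum.isLeft
  · rw [mixed_eq_zero dα dβ f g h2]
    exact Submodule.zero_mem _
  induction l generalizing f g s with
  | nil => simpa [mixed] using hf []
  | cons x l ih =>
    cases x with
    | inr b =>
      have := ih (s := s + wt (Sum.inr b)) (f := fun l => f (b :: l)) (g := fun l => g (b :: l))
        (fun l => by simpa [add_assoc] using hf (b :: l))
        (fun l a => by simpa [add_assoc] using hg (b :: l) a) (by simpa using h2)
      rw [List.map_cons, List.sum_cons, ← add_assoc]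
      exact this
    | inl a =>
      obtain ⟨m, rfl⟩ := eq_map_of_countP (l := l) (by rw [countP_inl] at h2; omega)
      rw [mixed_inl]
      refine (Submodule.smul_mem_iff' _ _).2 ?_
      have := hg m a
      rw [List.map_cons, List.sum_cons, add_comm (wt (Sum.inl a)), ← add_assoc, List.map_map]
      exact this

end Mixed

/-! ### The brackets on the free graded commutative algebra on a basis of `A ⊕ L` -/

section Extension

variable {K A L : Type*} [Field K] [Ring A] [Algebra K A]
  [AddCommGroup L] [Module K L] [Module A L]

/-- The degrees of the elements of homogeneous bases of `A` and `L`. -/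
def xdeg (𝒜 : ℤ → Submodule K A) (ℒ : ℤ → Submodule K L) : HIdx 𝒜 ⊕ HIdx ℒ → ℤ :=
  Sum.elim HIdx.deg HIdx.deg

variable (𝒜 : ℤ → Submodule K A) (ℒ : ℤ → Submodule K L)
  [DirectSum.Decomposition 𝒜] [DirectSum.Decomposition ℒ]

/-- The inclusion of `A` in the free graded commutative algebra on a basis of `A ⊕ L`. -/
def freeScalar : A →ₗ[K] FreeSym K (xdeg 𝒜 ℒ) :=
  (hbasis 𝒜).constr K fun i => FreeSym.gen K (xdeg 𝒜 ℒ) (Sum.inl i)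

/-- The inclusion of `L` in the free graded commutative algebra on a basis of `A ⊕ L`. -/
def freeVec : L →ₗ[K] FreeSym K (xdeg 𝒜 ℒ) :=
  (hbasis ℒ).constr K fun i => FreeSym.gen K (xdeg 𝒜 ℒ) (Sum.inr i)

theorem freeScalar_hbasis (i : HIdx 𝒜) :
    freeScalar 𝒜 ℒ (hbasis 𝒜 i) = FreeSym.gen K (xdeg 𝒜 ℒ) (Sum.inl i) :=
  (hbasis 𝒜).constr_basis _ _ _

theorem freeVec_hbasis (i : HIdx ℒ) :
    freeVec 𝒜 ℒ (hbasis ℒ i) = FreeSym.gen K (xdeg 𝒜 ℒ) (Sum.inr i) :=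
  (hbasis ℒ).constr_basis _ _ _

theorem freeScalar_mem {e : ℤ} {a : A} (ha : a ∈ 𝒜 e) :
    freeScalar 𝒜 ℒ a ∈ FreeSym.grading K (xdeg 𝒜 ℒ) e := by
  suffices h : 𝒜 e ≤ (FreeSym.grading K (xdeg 𝒜 ℒ) e).comap (freeScalar 𝒜 ℒ) from h ha
  refine (le_span_hsym 𝒜 e).trans (Submodule.span_le.2 ?_)
  rintro _ ⟨i, hi⟩
  obtain ⟨rfl, rfl⟩ := Prod.mk.inj hi
  rw [SetLike.mem_coe, Submodule.mem_comap, freeScalar_hbasis]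
  exact FreeSym.gen_mem (deg := xdeg 𝒜 ℒ) (Sum.inl i)

theorem freeVec_mem {e : ℤ} {ξ : L} (hξ : ξ ∈ ℒ e) :
    freeVec 𝒜 ℒ ξ ∈ FreeSym.grading K (xdeg 𝒜 ℒ) e := by
  suffices h : ℒ e ≤ (FreeSym.grading K (xdeg 𝒜 ℒ) e).comap (freeVec 𝒜 ℒ) from h hξ
  refine (le_span_hsym ℒ e).trans (Submodule.span_le.2 ?_)
  rintro _ ⟨i, hi⟩
  obtain ⟨rfl, rfl⟩ := Prod.mk.inj hi
  rw [SetLike.mem_coe, Submodule.mem_comap, freeVec_hbasis]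
  exact FreeSym.gen_mem (deg := xdeg 𝒜 ℒ) (Sum.inr i)

theorem map_inr_sym (w : List (HIdx ℒ)) :
    (w.map Sum.inr).map (FreeSym.sym K (xdeg 𝒜 ℒ))
      = (w.map (hsym ℒ)).map (degMap (freeVec 𝒜 ℒ)) := by
  rw [List.map_map, List.map_map]
  refine List.map_congr_left fun i _ => ?_
  simp only [Function.comp_apply, FreeSym.sym, hsym, degMap_mk, freeVec_hbasis]
  rfl

theorem sym_inl (i : HIdx 𝒜) :
    FreeSym.sym K (xdeg 𝒜 ℒ) (Sum.inl i) = degMap (freeScalar 𝒜 ℒ) (hsym 𝒜 i) := by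
  simp only [FreeSym.sym, hsym, degMap_mk, freeScalar_hbasis]
  rfl

variable {𝒜 ℒ} (X : LRInfty 𝒜 ℒ)

/-- The bracket of a word in the basis of `L`, if the word has length `k`. -/
def extVec (k : ℕ) (w : List (HIdx ℒ)) : FreeSym K (xdeg 𝒜 ℒ) :=
  if w.length = k then freeVec 𝒜 ℒ (X.br (w.map (hsym ℒ))) else 0

/-- The anchor of a word in the basis of `L`, if the word has length `k - 1`. -/
def extScalar (k : ℕ) (w : List (HIdx ℒ)) (a : HIdx 𝒜) : FreeSym K (xdeg 𝒜 ℒ) :=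
  if w.length + 1 = k then freeScalar 𝒜 ℒ (X.an (w.map (hsym ℒ)) (hbasis 𝒜 a)) else 0

theorem br_map_hsym_swap (l₁ l₂ : List (HIdx ℒ)) (i j : HIdx ℒ) :
    X.br ((l₁ ++ i :: j :: l₂).map (hsym ℒ))
      = (i.deg * j.deg).negOnePow • X.br ((l₁ ++ j :: i :: l₂).map (hsym ℒ)) := by
  have := X.br_swap (l₁.map (hsym ℒ)) (l₂.map (hsym ℒ)) (hsym ℒ i) (hsym ℒ j)
    (by simpa using homog_map_hsym ℒ (l₁ ++ i :: j :: l₂))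
  rw [List.map_append, List.map_append]
  exact this

theorem an_map_hsym_swap (l₁ l₂ : List (HIdx ℒ)) (i j : HIdx ℒ) :
    X.an ((l₁ ++ i :: j :: l₂).map (hsym ℒ))
      = (i.deg * j.deg).negOnePow • X.an ((l₁ ++ j :: i :: l₂).map (hsym ℒ)) := by
  have := X.an_swap (l₁.map (hsym ℒ)) (l₂.map (hsym ℒ)) (hsym ℒ i) (hsym ℒ j)
    (by simpa using homog_map_hsym ℒ (l₁ ++ i :: j :: l₂))
  rw [List.map_append, List.map_append]
  exact this

theorem length_swap {α : Type*} (l₁ l₂ : List α) (i j : α) :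
    (l₁ ++ i :: j :: l₂).length = (l₁ ++ j :: i :: l₂).length := by simp

theorem extVec_swap (k : ℕ) (l₁ l₂ : List (HIdx ℒ)) (i j : HIdx ℒ) :
    extVec X k (l₁ ++ i :: j :: l₂)
      = (i.deg * j.deg).negOnePow • extVec X k (l₁ ++ j :: i :: l₂) := by
  unfold extVec
  rw [length_swap l₁ l₂ i j]
  split_ifs
  · rw [br_map_hsym_swap, Units.smul_def, Units.smul_def, map_zsmul]
  · rw [smul_zero]

theorem extScalar_swap (k : ℕ) (l₁ l₂ : List (HIdx ℒ)) (i j : HIdx ℒ) :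
    extScalar X k (l₁ ++ i :: j :: l₂)
      = (i.deg * j.deg).negOnePow • extScalar X k (l₁ ++ j :: i :: l₂) := by
  funext a
  rw [Pi.smul_apply]
  unfold extScalar
  rw [length_swap l₁ l₂ i j]
  split_ifs
  · rw [an_map_hsym_swap, Units.smul_def, Units.smul_def, LinearMap.smul_apply, map_zsmul]
  · rw [smul_zero]

/-- The brackets of words in the generators. -/
def extF (k : ℕ) : SymFun K (xdeg 𝒜 ℒ) (FreeSym K (xdeg 𝒜 ℒ)) :=
  ⟨mixed HIdx.deg HIdx.deg (extVec X k) (extScalar X k),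
    mixed_swap HIdx.deg HIdx.deg (extVec_swap X k) (extScalar_swap X k)⟩

theorem extF_length (k : ℕ) (l : List (HIdx 𝒜 ⊕ HIdx ℒ)) (hl : l.length ≠ k) :
    (extF X k).1 l = 0 :=
  mixed_length (n := 0) _ _ (fun _ h => if_neg h) (fun _ _ h => if_neg h) l hl

theorem extF_eq_zero (k : ℕ) (l : List (HIdx 𝒜 ⊕ HIdx ℒ)) (hl : 2 ≤ l.countP Sum.isLeft) :
    (extF X k).1 l = 0 := mixed_eq_zero _ _ _ _ hl

variable (𝒜 ℒ) in
/-- The elements of the indicated degree that are in the image of `L`, if the second degree is zero,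
and in the image of `A`, if it is one. -/
def linPart (x : ℤ × ℤ) : Submodule K (FreeSym K (xdeg 𝒜 ℒ)) :=
  if x.2 = 0 then (ℒ x.1).map (freeVec 𝒜 ℒ)
  else if x.2 = 1 then (𝒜 x.1).map (freeScalar 𝒜 ℒ) else ⊥

theorem sum_map_prod {α : Type*} (f : α → ℤ) (p : α → Bool) (l : List α) :
    (l.map fun x => (f x, if p x then (1 : ℤ) else 0)).sum = ((l.map f).sum, (l.countP p : ℤ)) := by
  induction l with
  | nil => rfl
  | cons x l ih =>
    rw [List.map_cons, List.sum_cons, ih, List.countP_cons, List.map_cons, List.sum_cons]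
    ext <;> simp <;> ring

/-- This is `mixed_mem` for a grading by `ℤ × ℤ` that records the degree and the number of letters
from `A`: without such letters the value comes from `L`, with one from `A`, and otherwise it
vanishes. -/
theorem extF_mem_linPart (k : ℕ) (l : List (HIdx 𝒜 ⊕ HIdx ℒ)) :
    (extF X k).1 l ∈ linPart 𝒜 ℒ (1 + degW (xdeg 𝒜 ℒ) l, (l.countP Sum.isLeft : ℤ)) := by
  have h0 : ∀ w : List (HIdx ℒ), (w.map fun b => (xdeg 𝒜 ℒ (Sum.inr b),
      if (Sum.inr b : HIdx 𝒜 ⊕ HIdx ℒ).isLeft then (1 : ℤ) else 0)).sum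
        = (degL (w.map (hsym ℒ)), 0) := by
    intro w
    rw [sum_map_prod (fun b => xdeg 𝒜 ℒ (Sum.inr b))
      (fun b => (Sum.inr b : HIdx 𝒜 ⊕ HIdx ℒ).isLeft), degL_map_hsym]
    simp [degW, xdeg]
  have := mixed_mem (𝓦 := linPart 𝒜 ℒ) (s := (1, 0))
    (wt := fun x => (xdeg 𝒜 ℒ x, if x.isLeft then (1 : ℤ) else 0)) (dα := HIdx.deg)
    (dβ := HIdx.deg) (f := extVec X k) (g := extScalar X k) (fun w => ?_) (fun w a => ?_) l
  · rw [sum_map_prod, Prod.mk_add_mk, zero_add] at this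
    exact this
  · rw [h0, Prod.mk_add_mk, zero_add, linPart, if_pos rfl]
    unfold extVec
    split_ifs
    · exact Submodule.mem_map_of_mem (X.br_mem _ (homog_map_hsym ℒ w))
    · exact Submodule.zero_mem _
  · rw [h0, Prod.mk_add_mk, Prod.mk_add_mk, linPart]
    simp only [Sum.isLeft_inl, if_true, zero_add, one_ne_zero, if_false]
    unfold extScalar
    split_ifs
    · exact Submodule.mem_map_of_mem (X.an_mem _ (homog_map_hsym ℒ w) _ _ (hbasis_mem 𝒜 a))
    · exact Submodule.zero_mem _

theorem linPart_le (e : ℤ) (n : ℕ) :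
    linPart 𝒜 ℒ (e, (n : ℤ)) ≤ FreeSym.grading K (xdeg 𝒜 ℒ) e := by
  unfold linPart
  split_ifs
  · exact Submodule.map_le_iff_le_comap.2 fun _ h => freeVec_mem 𝒜 ℒ h
  · exact Submodule.map_le_iff_le_comap.2 fun _ h => freeScalar_mem 𝒜 ℒ h
  · exact bot_le

theorem extF_mem (k : ℕ) (l : List (HIdx 𝒜 ⊕ HIdx ℒ)) :
    (extF X k).1 l ∈ FreeSym.grading K (xdeg 𝒜 ℒ) (1 + degW (xdeg 𝒜 ℒ) l) :=
  linPart_le _ _ (extF_mem_linPart X k l)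

/-- The brackets on the free graded commutative algebra. -/
abbrev extBr : List (ℤ × FreeSym K (xdeg 𝒜 ℒ)) → FreeSym K (xdeg 𝒜 ℒ) := freeBr (extF X)

theorem extBr_isSymbol :
    IsSymbol (FreeSym.grading K (xdeg 𝒜 ℒ)) (freeD (extF X)) (extBr X) :=
  freeBr_isSymbol (extF_length X) (extF_mem X)

theorem extBr_isMultiDer : IsMultiDer (FreeSym.grading K (xdeg 𝒜 ℒ)) (extBr X) :=
  (extBr_isSymbol X).isMultiDer FreeSym.isGradedComm

theorem br_isGradedMul : IsGradedMul ℒ X.br := isGradedMul_evalL _ X.bracket_symm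

theorem an_isGradedMul : IsGradedMul ℒ X.an := isGradedMul_evalL _ X.anchor_symm

theorem extBr_map_sym (w : List (HIdx 𝒜 ⊕ HIdx ℒ)) :
    extBr X (w.map (FreeSym.sym K (xdeg 𝒜 ℒ))) = (extF X w.length).1 w := freeBr_map_sym w

theorem extBr_vec (l : List (ℤ × L)) (hl : Homog ℒ l) :
    extBr X (l.map (degMap (freeVec 𝒜 ℒ))) = freeVec 𝒜 ℒ (X.br l) := by
  have h1 : IsGradedMul ℒ fun l => extBr X (l.map (degMap (freeVec 𝒜 ℒ))) :=
    (extBr_isMultiDer X).isGradedMul.comap fun _ _ => freeVec_mem 𝒜 ℒ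
  have h2 : IsGradedMul ℒ fun l => freeVec 𝒜 ℒ (X.br l) := (br_isGradedMul X).map (freeVec 𝒜 ℒ)
  refine h1.ext h2 (gen := fun x => ∃ i, x = hsym ℒ i) (le_span_hsym ℒ) (hsym_mem ℒ) (fun l hl => ?_) l hl
  obtain ⟨w, rfl⟩ := exists_map_hsym ℒ hl
  rw [← map_inr_sym, extBr_map_sym]
  refine (mixed_map_inr _ _ _ _ w).trans (if_pos (by simp))

theorem extBr_scalar (l : List (ℤ × L)) (hl : Homog ℒ l) {e : ℤ} {a : A} (ha : a ∈ 𝒜 e) :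
    extBr X (l.map (degMap (freeVec 𝒜 ℒ)) ++ [(e, freeScalar 𝒜 ℒ a)])
      = freeScalar 𝒜 ℒ (X.an l a) := by
  have hm := (extBr_isMultiDer X).isGradedMul
  have hH : ∀ {l : List (ℤ × L)}, Homog ℒ l → Homog (FreeSym.grading K (xdeg 𝒜 ℒ))
    (l.map (degMap (freeVec 𝒜 ℒ))) := fun hl => homog_map_degMap (fun _ _ => freeVec_mem 𝒜 ℒ) hl
  have hs : ∀ {l : List (ℤ × L)} {a : A}, Homog ℒ l → a ∈ 𝒜 e →
      extBr X (l.map (degMap (freeVec 𝒜 ℒ)) ++ [(e, freeScalar 𝒜 ℒ a)])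
        = (e * degL l).negOnePow • extBr X
          ((e, freeScalar 𝒜 ℒ a) :: l.map (degMap (freeVec 𝒜 ℒ))) := fun {l a} hl ha => by
    have hx : Homog (FreeSym.grading K (xdeg 𝒜 ℒ))
        ((e, freeScalar 𝒜 ℒ a) :: l.map (degMap (freeVec 𝒜 ℒ))) :=
      homog_cons.2 ⟨freeScalar_mem 𝒜 ℒ ha, hH hl⟩
    rw [hm.append_singleton hx, degL_map_degMap]
  -- The scalar is reduced to a basis element first; for fixed scalar both sides are graded
  -- multilinear in the vectors. Moving the scalar to the front gives access to additivity in that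
  -- entry.
  suffices h : 𝒜 e ≤ Submodule.span K {a | a ∈ 𝒜 e ∧
      extBr X (l.map (degMap (freeVec 𝒜 ℒ)) ++ [(e, freeScalar 𝒜 ℒ a)])
        = freeScalar 𝒜 ℒ (X.an l a)} by
    refine (Submodule.span_induction (p := fun a _ => a ∈ 𝒜 e ∧
      extBr X (l.map (degMap (freeVec 𝒜 ℒ)) ++ [(e, freeScalar 𝒜 ℒ a)])
        = freeScalar 𝒜 ℒ (X.an l a)) (fun a h => h) ?_ ?_ ?_ (h ha)).2
    · refine ⟨Submodule.zero_mem _, ?_⟩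
      rw [hs hl (Submodule.zero_mem _), map_zero, hm.zero _ (hH hl), map_zero, map_zero, smul_zero]
    · rintro a b _ _ ⟨ha, ha'⟩ ⟨hb, hb'⟩
      refine ⟨Submodule.add_mem _ ha hb, ?_⟩
      rw [hs hl (Submodule.add_mem _ ha hb), map_add, hm.add _ _ _ _ (freeScalar_mem 𝒜 ℒ ha)
        (freeScalar_mem 𝒜 ℒ hb) (hH hl), smul_add, ← hs hl ha, ← hs hl hb, ha', hb', map_add,
        map_add]
    · rintro c a _ ⟨ha, ha'⟩
      refine ⟨Submodule.smul_mem _ c ha, ?_⟩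
      rw [hs hl (Submodule.smul_mem _ c ha), map_smul, hm.smul _ _ _ _ (freeScalar_mem 𝒜 ℒ ha)
        (hH hl), smul_comm, ← hs hl ha, ha', map_smul, map_smul]
  refine (le_span_hsym 𝒜 e).trans (Submodule.span_mono ?_)
  rintro _ ⟨i, hi⟩
  obtain ⟨rfl, rfl⟩ := Prod.mk.inj hi
  refine ⟨hbasis_mem 𝒜 i, ?_⟩
  have h1 : IsGradedMul ℒ fun l => (i.deg * degL l).negOnePow • extBr X
      ((i.deg, freeScalar 𝒜 ℒ (hbasis 𝒜 i)) :: l.map (degMap (freeVec 𝒜 ℒ))) :=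
    (((hm.cons (x := (i.deg, freeScalar 𝒜 ℒ (hbasis 𝒜 i)))
    (freeScalar_mem 𝒜 ℒ (hbasis_mem 𝒜 i))).comap fun _ _ => freeVec_mem 𝒜 ℒ)).degL_smul
      fun z => (i.deg * z).negOnePow
  have h2 : IsGradedMul ℒ fun l => freeScalar 𝒜 ℒ (X.an l (hbasis 𝒜 i)) := ((an_isGradedMul X).map (LinearMap.applyₗ (R := K) (hbasis 𝒜 i))).map
    (freeScalar 𝒜 ℒ)
  rw [hs hl (hbasis_mem 𝒜 i)]
  refine h1.ext h2 (gen := fun x => ∃ i, x = hsym ℒ i) (le_span_hsym ℒ) (hsym_mem ℒ) (fun l hl => ?_) l hl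
  obtain ⟨w, rfl⟩ := exists_map_hsym ℒ hl
  refine (hs (homog_map_hsym ℒ w) (hbasis_mem 𝒜 i)).symm.trans ?_
  have := sym_inl 𝒜 ℒ i
  rw [hsym, degMap_mk] at this
  rw [← map_inr_sym, ← this, ← List.map_singleton, ← List.map_append, extBr_map_sym]
  exact (mixed_append_inl _ _ _ _ w i).trans (if_pos (by simp))

theorem extBr_map_sym_eq_zero {w : List (HIdx 𝒜 ⊕ HIdx ℒ)} (hw : 2 ≤ w.countP Sum.isLeft) :
    extBr X (w.map (FreeSym.sym K (xdeg 𝒜 ℒ))) = 0 := by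
  rw [extBr_map_sym]
  exact extF_eq_zero X _ w hw

/-- Brackets of an element of the image of `A` or `L` with generators vanish, if at least two
entries are in the image of `A`. -/
theorem extBr_linPart_eq_zero {e : ℤ} {n : ℕ} {u : FreeSym K (xdeg 𝒜 ℒ)}
    (hu : u ∈ linPart 𝒜 ℒ (e, (n : ℤ))) {w : List (HIdx 𝒜 ⊕ HIdx ℒ)}
    (hw : 2 ≤ n + w.countP Sum.isLeft) :
    extBr X ((e, u) :: w.map (FreeSym.sym K (xdeg 𝒜 ℒ))) = 0 := by
  have hm := (extBr_isMultiDer X).isGradedMul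
  have hH := homog_map_sym (K := K) (deg := xdeg 𝒜 ℒ) w
  have key : ∀ V : Submodule K (FreeSym K (xdeg 𝒜 ℒ)), u ∈ V →
      V ≤ Submodule.span K {v | ∃ i : HIdx 𝒜 ⊕ HIdx ℒ, v = FreeSym.gen K (xdeg 𝒜 ℒ) i ∧
        xdeg 𝒜 ℒ i = e ∧ 2 ≤ (i :: w).countP Sum.isLeft} →
      extBr X ((e, u) :: w.map (FreeSym.sym K (xdeg 𝒜 ℒ))) = 0 := by
    intro V hu hV
    refine hm.eq_zero_of_span ?_ hH ?_ (hV hu)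
    · rintro _ ⟨i, rfl, rfl, hi⟩
      exact FreeSym.gen_mem (deg := xdeg 𝒜 ℒ) i
    · rintro _ ⟨i, rfl, rfl, hi⟩
      exact extBr_map_sym_eq_zero X (w := i :: w) hi
  unfold linPart at hu
  split_ifs at hu with h0 h1
  · refine key _ hu ?_
    refine (Submodule.map_mono (le_span_hsym ℒ e)).trans ?_
    rw [Submodule.map_span]
    refine Submodule.span_mono ?_
    rintro _ ⟨_, ⟨i, hi⟩, rfl⟩
    obtain ⟨rfl, rfl⟩ := Prod.mk.inj hi
    refine ⟨Sum.inr i, freeVec_hbasis 𝒜 ℒ i, rfl, ?_⟩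
    rw [countP_inr]
    have : n = 0 := Int.natCast_eq_zero.1 h0
    omega
  · refine key _ hu ?_
    refine (Submodule.map_mono (le_span_hsym 𝒜 e)).trans ?_
    rw [Submodule.map_span]
    refine Submodule.span_mono ?_
    rintro _ ⟨_, ⟨i, hi⟩, rfl⟩
    obtain ⟨rfl, rfl⟩ := Prod.mk.inj hi
    refine ⟨Sum.inl i, freeScalar_hbasis 𝒜 ℒ i, rfl, ?_⟩
    rw [countP_inl]
    have : n = 1 := by
      simp only at h1
      exact_mod_cast h1
    omega
  · rw [Submodule.mem_bot] at hu
    rw [hu]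
    exact hm.zero _ hH

theorem exists_perm_of_countP_eq_one {α β : Type*} {w : List (α ⊕ β)}
    (hw : w.countP Sum.isLeft = 1) :
    ∃ (l : List β) (a : α), (l.map Sum.inr ++ [Sum.inl a]).Perm w := by
  induction w with
  | nil => simp at hw
  | cons x w ih =>
    cases x with
    | inl a =>
      rw [countP_inl] at hw
      obtain ⟨l, rfl⟩ := eq_map_of_countP (l := w) (by omega)
      exact ⟨l, a, List.perm_append_comm⟩
    | inr b =>
      rw [countP_inr] at hw
      obtain ⟨l, a, h⟩ := ih hw
      exact ⟨b :: l, a, h.cons _⟩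

theorem extBr_jacobi_vec (l : List (ℤ × L)) (hl : Homog ℒ l) :
    (ush (l.map (degMap (freeVec 𝒜 ℒ))) fun I J =>
      extBr X ((1 + degL I, extBr X I) :: J)) = 0 := by
  rw [ush_map_list (degMap (freeVec 𝒜 ℒ)) fun _ => rfl]
  refine Eq.trans (ush_congr l fun I J hIJ => ?_) ((ush_map (freeVec 𝒜 ℒ) l fun I J =>
    X.br ((1 + degL I, X.br I) :: J)).symm.trans (by rw [X.br_jacobi l hl, map_zero]))
  have hI := (homog_append.1 ((homog_perm hIJ).2 hl)).1
  have hJ := (homog_append.1 ((homog_perm hIJ).2 hl)).2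
  rw [degL_map_degMap, extBr_vec X I hI, ← degMap_mk, ← List.map_cons]
  exact extBr_vec X _ (homog_cons.2 ⟨X.br_mem I hI, hJ⟩)

/-- Splittings with the scalar in the outer list yield `σ(X(I), J | a)`. Those with the scalar in
the inner list yield, after interchanging `I` and `J`, `± σ(I | σ(J | a))`. The total is the symbol
component of the Jacobi identity of `X`. -/
theorem extBr_jacobi_scalar (l : List (ℤ × L)) (hl : Homog ℒ l) {e : ℤ} {a : A} (ha : a ∈ 𝒜 e) :
    (ush (l.map (degMap (freeVec 𝒜 ℒ)) ++ [(e, freeScalar 𝒜 ℒ a)]) fun I J =>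
      extBr X ((1 + degL I, extBr X I) :: J)) = 0 := by
  have hm := (extBr_isMultiDer X).isGradedMul
  rw [ush_append_singleton, ush_map_list (degMap (freeVec 𝒜 ℒ)) fun _ => rfl, ush_map_list (degMap (freeVec 𝒜 ℒ)) fun _ => rfl]
  have h1 : (ush l fun I J => extBr X ((1 + degL (I.map (degMap (freeVec 𝒜 ℒ))),
      extBr X (I.map (degMap (freeVec 𝒜 ℒ)))) ::
        (J.map (degMap (freeVec 𝒜 ℒ)) ++ [(e, freeScalar 𝒜 ℒ a)])))
      = ush l fun I J => freeScalar 𝒜 ℒ (X.an ((1 + degL I, X.br I) :: J) a) := by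
    refine ush_congr l fun I J hIJ => ?_
    have hI := (homog_append.1 ((homog_perm hIJ).2 hl)).1
    have hJ := (homog_append.1 ((homog_perm hIJ).2 hl)).2
    rw [degL_map_degMap, extBr_vec X I hI, ← degMap_mk, ← List.cons_append, ← List.map_cons]
    exact extBr_scalar X _ (homog_cons.2 ⟨X.br_mem I hI, hJ⟩) ha
  have h2 : (ush l fun I J => (e * degL (J.map (degMap (freeVec 𝒜 ℒ)))).negOnePow •
      extBr X ((1 + degL (I.map (degMap (freeVec 𝒜 ℒ)) ++ [(e, freeScalar 𝒜 ℒ a)]),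
        extBr X (I.map (degMap (freeVec 𝒜 ℒ)) ++ [(e, freeScalar 𝒜 ℒ a)])) ::
          J.map (degMap (freeVec 𝒜 ℒ))))
      = ush l fun I J => (degL I).negOnePow • freeScalar 𝒜 ℒ (X.an I (X.an J a)) := by
    refine Eq.trans ?_ (ush_swap l _).symm
    refine ush_congr l fun I J hIJ => ?_
    have hI := (homog_append.1 ((homog_perm hIJ).2 hl)).1
    have hJ := (homog_append.1 ((homog_perm hIJ).2 hl)).2
    have hIa := X.an_mem I hI e a ha
    have hx : Homog (FreeSym.grading K (xdeg 𝒜 ℒ)) ((1 + degL I + e, freeScalar 𝒜 ℒ (X.an I a)) ::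
        J.map (degMap (freeVec 𝒜 ℒ))) := homog_cons.2 ⟨freeScalar_mem 𝒜 ℒ hIa,
      homog_map_degMap (fun _ _ => freeVec_mem 𝒜 ℒ) hJ⟩
    have h3 := hm.append_singleton hx
    rw [extBr_scalar X J hJ hIa] at h3
    simp only [degL_map_degMap, degL_append, degL_cons, degL_nil, add_zero] at h3 ⊢
    rw [extBr_scalar X I hI ha, ← add_assoc, h3, smul_smul, smul_smul, ← Int.negOnePow_add,
      ← Int.negOnePow_add]
    congr 1
    exact negOnePow_congr ⟨-(1 + degL I) * degL J, by ring⟩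
  refine (congrArg₂ (· + ·) h1 h2).trans ?_
  let ψ : Module.End K A →ₗ[K] FreeSym K (xdeg 𝒜 ℒ) := freeScalar 𝒜 ℒ ∘ₗ LinearMap.applyₗ a
  have h3 := congrArg ψ (X.an_jacobi l hl)
  rw [map_add, ush_map, ush_map, map_zero, add_comm] at h3
  refine Eq.trans ?_ h3
  congr 1
  refine ush_congr l fun I J _ => ?_
  rw [Units.smul_def, Units.smul_def, map_zsmul]
  rfl

/-- It suffices to treat words of generators, according to the number of letters from `A`. No letter
and one letter give the two Jacobi identities of `X`. With two or more, the inner bracket keeps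
count of the letters it consumed (`extF_mem_linPart`), so every outer bracket still has at least two
scalars and vanishes. -/
theorem extBr_jacobi (l : List (ℤ × FreeSym K (xdeg 𝒜 ℒ)))
    (hl : Homog (FreeSym.grading K (xdeg 𝒜 ℒ)) l) :
    (ush l fun I J => extBr X ((1 + degL I, extBr X I) :: J)) = 0 := by
  refine freeBr_jacobi (extF_length X) (extF_mem X) (fun w => ?_) l hl
  by_cases h2 : 2 ≤ w.countP Sum.isLeft
  · refine ⟨w, List.Perm.refl _, Eq.trans (ush_word_congr (G' := fun _ _ => 0) _ w
      fun w₁ w₂ hp => ?_) (ush_zero _)⟩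
    refine extBr_linPart_eq_zero X (n := w₁.countP Sum.isLeft) ?_ ?_
    · change extBr X _ ∈ _
      rw [extBr_map_sym, degL_map_sym]
      exact extF_mem_linPart X _ w₁
    · rwa [← List.countP_append, hp.countP_eq]
  by_cases h1 : w.countP Sum.isLeft = 1
  · obtain ⟨l, a, h⟩ := exists_perm_of_countP_eq_one h1
    refine ⟨_, h, ?_⟩
    rw [List.map_append, List.map_singleton, map_inr_sym, sym_inl]
    exact extBr_jacobi_scalar X _ (homog_map_hsym ℒ l) (hbasis_mem 𝒜 a)
  · obtain ⟨l, rfl⟩ := eq_map_of_countP (l := w) (by omega)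
    refine ⟨_, List.Perm.refl _, ?_⟩
    rw [map_inr_sym]
    exact extBr_jacobi_vec X _ (homog_map_hsym ℒ l)

end Extension

/-! ### The graded symmetric algebra -/

section SymAlgBasic

variable {K A L : Type*} [Field K] [Ring A] [Algebra K A]
  [AddCommGroup L] [Module K L] [Module A L]
  (𝒜 : ℤ → Submodule K A) (ℒ : ℤ → Submodule K L)

/-- The quotient map onto the graded symmetric algebra. -/
def SymAlg.mk : TensorAlgebra K (A × L) →ₐ[K] SymAlg 𝒜 ℒ := RingQuot.mkAlgHom K (SymRel 𝒜 ℒ)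

theorem SymAlg.mk_surjective : Function.Surjective (SymAlg.mk 𝒜 ℒ) :=
  RingQuot.mkAlgHom_surjective K _

theorem SymAlg.mk_rel {x y : TensorAlgebra K (A × L)} (h : SymRel 𝒜 ℒ x y) :
    SymAlg.mk 𝒜 ℒ x = SymAlg.mk 𝒜 ℒ y := RingQuot.mkAlgHom_rel K h

theorem SymAlg.mk_ι (a : A) (ξ : L) : SymAlg.mk 𝒜 ℒ (TensorAlgebra.ι K (a, ξ))
    = SymAlg.scalar 𝒜 ℒ a + SymAlg.vec 𝒜 ℒ ξ := by
  have : ((a, ξ) : A × L) = (a, 0) + (0, ξ) := by simp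
  rw [this, map_add, map_add]
  rfl

theorem SymAlg.mk_inl (a : A) : SymAlg.mk 𝒜 ℒ (TensorAlgebra.ι K ((a, 0) : A × L))
    = SymAlg.scalar 𝒜 ℒ a := rfl

theorem SymAlg.mk_inr (ξ : L) : SymAlg.mk 𝒜 ℒ (TensorAlgebra.ι K ((0, ξ) : A × L))
    = SymAlg.vec 𝒜 ℒ ξ := rfl

theorem SymAlg.scalar_one : SymAlg.scalar 𝒜 ℒ 1 = 1 := by
  rw [← SymAlg.mk_inl, SymAlg.mk_rel 𝒜 ℒ SymRel.one, map_one]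

theorem SymAlg.scalar_mul (a b : A) :
    SymAlg.scalar 𝒜 ℒ (a * b) = SymAlg.scalar 𝒜 ℒ a * SymAlg.scalar 𝒜 ℒ b := by
  rw [← SymAlg.mk_inl, SymAlg.mk_rel 𝒜 ℒ (SymRel.mul a b), map_mul]
  rfl

theorem SymAlg.vec_smul (a : A) (ξ : L) :
    SymAlg.vec 𝒜 ℒ (a • ξ) = SymAlg.scalar 𝒜 ℒ a * SymAlg.vec 𝒜 ℒ ξ := by
  rw [← SymAlg.mk_inr, SymAlg.mk_rel 𝒜 ℒ (SymRel.smul a ξ), map_mul]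
  rfl

variable {𝒜 ℒ}

theorem SymAlg.scalar_mul_vec {i j : ℤ} {a : A} {ξ : L} (ha : a ∈ 𝒜 i) (hξ : ξ ∈ ℒ j) :
    SymAlg.scalar 𝒜 ℒ a * SymAlg.vec 𝒜 ℒ ξ
      = (i * j).negOnePow • (SymAlg.vec 𝒜 ℒ ξ * SymAlg.scalar 𝒜 ℒ a) := by
  have h := SymAlg.mk_rel 𝒜 ℒ (SymRel.comm_scalar i j a ξ ha hξ)
  rw [Units.smul_def, map_zsmul, map_mul, map_mul, ← Units.smul_def] at h
  exact h

theorem SymAlg.vec_mul_vec {i j : ℤ} {ξ ζ : L} (hξ : ξ ∈ ℒ i) (hζ : ζ ∈ ℒ j) :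
    SymAlg.vec 𝒜 ℒ ξ * SymAlg.vec 𝒜 ℒ ζ
      = (i * j).negOnePow • (SymAlg.vec 𝒜 ℒ ζ * SymAlg.vec 𝒜 ℒ ξ) := by
  have h := SymAlg.mk_rel 𝒜 ℒ (SymRel.comm i j ξ ζ hξ hζ)
  rw [Units.smul_def, map_zsmul, map_mul, map_mul, ← Units.smul_def] at h
  exact h

variable (𝒜 ℒ) in
/-- The homogeneous elements of `A` and `L` that generate the graded symmetric algebra. -/
def SymAlg.IsGen (x : ℤ × SymAlg 𝒜 ℒ) : Prop :=
  (∃ a ∈ 𝒜 x.1, x.2 = SymAlg.scalar 𝒜 ℒ a) ∨ ∃ ξ ∈ ℒ x.1, x.2 = SymAlg.vec 𝒜 ℒ ξ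

theorem SymAlg.gen_comm (hA : ∀ (i j : ℤ) (a b : A), a ∈ 𝒜 i → b ∈ 𝒜 j →
      a * b = Int.negOnePow (i * j) • (b * a)) (x y : ℤ × SymAlg 𝒜 ℒ) (hx : SymAlg.IsGen 𝒜 ℒ x)
    (hy : SymAlg.IsGen 𝒜 ℒ y) : x.2 * y.2 = (x.1 * y.1).negOnePow • (y.2 * x.2) := by
  rcases hx with ⟨a, ha, hx⟩ | ⟨ξ, hξ, hx⟩ <;> rcases hy with ⟨b, hb, hy⟩ | ⟨ζ, hζ, hy⟩ <;>
    rw [hx, hy]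
  · rw [← SymAlg.scalar_mul, ← SymAlg.scalar_mul, hA _ _ a b ha hb, Units.smul_def, Units.smul_def,
      map_zsmul]
  · exact SymAlg.scalar_mul_vec ha hζ
  · rw [SymAlg.scalar_mul_vec hb hξ, smul_smul, ← Int.negOnePow_add,
      negOnePow_congr (b := 0) ⟨x.1 * y.1, by ring⟩, Int.negOnePow_zero, one_smul]
  · exact SymAlg.vec_mul_vec hξ hζ

theorem SymAlg.prod_eq_mulL {l : ℕ} (d : Fin l → ℤ) (ξ : Fin l → L) :
    SymAlg.prod 𝒜 ℒ ξ
      = mulL ((List.ofFn fun t => (d t, ξ t)).map (degMap (SymAlg.vec 𝒜 ℒ))) := by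
  simp [SymAlg.prod, mulL, List.map_ofFn, Function.comp_def]

theorem SymAlg.scalar_mul_mulL_mem {i e : ℤ} {a : A} (ha : a ∈ 𝒜 i) {l : List (ℤ × L)}
    (hl : Homog ℒ l) (he : i + degL l = e) :
    SymAlg.scalar 𝒜 ℒ a * mulL (l.map (degMap (SymAlg.vec 𝒜 ℒ))) ∈ SymAlg.grading 𝒜 ℒ e := by
  obtain ⟨n, d, ξ, h, rfl⟩ := exists_ofFn_homog hl
  refine Submodule.subset_span ⟨i, n, d, a, ξ, ha, h, ?_, ?_⟩
  · rw [degL_ofFn] at he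
    exact he
  · rw [← SymAlg.prod_eq_mulL]

theorem SymAlg.gen_mul_mem [GradedAlgebra 𝒜] {x : ℤ × SymAlg 𝒜 ℒ} (hx : SymAlg.IsGen 𝒜 ℒ x)
    {e : ℤ} {u : SymAlg 𝒜 ℒ} (hu : u ∈ SymAlg.grading 𝒜 ℒ e) :
    x.2 * u ∈ SymAlg.grading 𝒜 ℒ (x.1 + e) := by
  induction hu using Submodule.span_induction with
  | zero => simp
  | add v w _ _ hv hw => rw [mul_add]; exact Submodule.add_mem _ hv hw
  | smul c v _ hv => rw [mul_smul_comm]; exact Submodule.smul_mem _ _ hv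
  | mem v hv =>
    obtain ⟨i, l, d, a, ξ, ha, hξ, he, rfl⟩ := hv
    have hH := homog_ofFn d ξ hξ
    rw [SymAlg.prod_eq_mulL d]
    have hdeg := degL_ofFn fun t => (d t, ξ t)
    generalize (List.ofFn fun t => (d t, ξ t)) = l at *
    rcases hx with ⟨b, hb, hx⟩ | ⟨ζ, hζ, hx⟩ <;> rw [hx]
    · rw [← mul_assoc, ← SymAlg.scalar_mul]
      exact SymAlg.scalar_mul_mulL_mem (SetLike.mul_mem_graded hb ha) hH (by rw [hdeg, ← he]; ring)
    · have h := SymAlg.scalar_mul_vec ha hζ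
      have h' : SymAlg.vec 𝒜 ℒ ζ * SymAlg.scalar 𝒜 ℒ a
          = (i * x.1).negOnePow • (SymAlg.scalar 𝒜 ℒ a * SymAlg.vec 𝒜 ℒ ζ) := by
        rw [h, smul_smul, ← Int.negOnePow_add, negOnePow_congr (b := 0) ⟨i * x.1, by ring⟩,
          Int.negOnePow_zero, one_smul]
      rw [← mul_assoc, h', smul_mul_assoc, mul_assoc]
      refine (Submodule.smul_mem_iff' _ _).2 ?_
      have := SymAlg.scalar_mul_mulL_mem (e := x.1 + e) ha (l := (x.1, ζ) :: l)
        (homog_cons.2 ⟨hζ, hH⟩) (by rw [degL_cons, hdeg, ← he]; ring)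
      rwa [List.map_cons, mulL_cons] at this

/-- The grading is defined by normal forms with the scalar in front; scalars can be moved there with
a sign, so arbitrary products of generators give the same spans. In this form the lemmas on
generation apply. -/
theorem SymAlg.grading_eq [GradedAlgebra 𝒜] :
    SymAlg.grading 𝒜 ℒ = genSpan K (SymAlg.IsGen 𝒜 ℒ) := by
  funext e
  refine le_antisymm (Submodule.span_le.2 ?_) (Submodule.span_le.2 ?_)
  · rintro _ ⟨i, l, d, a, ξ, ha, hξ, rfl, rfl⟩
    rw [SymAlg.prod_eq_mulL d]
    have hdeg := degL_ofFn fun t => (d t, ξ t)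
    have hH := homog_ofFn d ξ hξ
    simp only at hdeg
    rw [← hdeg]
    generalize (List.ofFn fun t => (d t, ξ t)) = l at *
    have := mulL_mem_genSpan (K := K) (gen := SymAlg.IsGen 𝒜 ℒ)
      (l := (i, SymAlg.scalar 𝒜 ℒ a) :: l.map (degMap (SymAlg.vec 𝒜 ℒ))) (by
        refine List.forall_mem_cons.2 ⟨Or.inl ⟨a, ha, rfl⟩, fun x hx => ?_⟩
        obtain ⟨y, hy, rfl⟩ := List.mem_map.1 hx
        exact Or.inr ⟨y.2, hH y hy, rfl⟩)
    rwa [mulL_cons, degL_cons, degL_map_degMap] at this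
  · rintro _ ⟨l, hl, rfl, rfl⟩
    induction l with
    | nil =>
      have := SymAlg.scalar_mul_mulL_mem (𝒜 := 𝒜) (ℒ := ℒ) (e := 0)
        (SetLike.GradedOne.one_mem (A := 𝒜)) homog_nil (by simp)
      rw [SymAlg.scalar_one, one_mul] at this
      exact this
    | cons x l ih =>
      rw [mulL_cons, degL_cons]
      exact SymAlg.gen_mul_mem (hl x (by simp)) (ih fun y hy => hl y (by simp [hy]))

theorem SymAlg.isGradedComm [GradedAlgebra 𝒜]
    (hA : ∀ (i j : ℤ) (a b : A), a ∈ 𝒜 i → b ∈ 𝒜 j → a * b = Int.negOnePow (i * j) • (b * a)) :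
    IsGradedComm (SymAlg.grading 𝒜 ℒ) := by
  rw [SymAlg.grading_eq]
  exact isGradedComm_genSpan (SymAlg.gen_comm hA)

end SymAlgBasic

/-! ### The projection from the free graded commutative algebra -/

section Projection

variable {K A L : Type*} [Field K] [Ring A] [Algebra K A]
  [AddCommGroup L] [Module K L] [Module A L]
  (𝒜 : ℤ → Submodule K A) (ℒ : ℤ → Submodule K L) [GradedAlgebra 𝒜] [DirectSum.Decomposition ℒ]

/-- The generators of the graded symmetric algebra that come from bases. -/
def symGen : HIdx 𝒜 ⊕ HIdx ℒ → SymAlg 𝒜 ℒ :=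
  Sum.elim (fun i => SymAlg.scalar 𝒜 ℒ (hbasis 𝒜 i)) fun i => SymAlg.vec 𝒜 ℒ (hbasis ℒ i)

theorem isGen_symGen (i : HIdx 𝒜 ⊕ HIdx ℒ) :
    SymAlg.IsGen 𝒜 ℒ (xdeg 𝒜 ℒ i, symGen 𝒜 ℒ i) := by
  rcases i with i | i
  · exact Or.inl ⟨_, hbasis_mem 𝒜 i, rfl⟩
  · exact Or.inr ⟨_, hbasis_mem ℒ i, rfl⟩

variable {𝒜} (hA : ∀ (i j : ℤ) (a b : A), a ∈ 𝒜 i → b ∈ 𝒜 j →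
      a * b = Int.negOnePow (i * j) • (b * a))

theorem symGen_comm (hA : ∀ (i j : ℤ) (a b : A), a ∈ 𝒜 i → b ∈ 𝒜 j →
    a * b = Int.negOnePow (i * j) • (b * a)) (i j : HIdx 𝒜 ⊕ HIdx ℒ) : symGen 𝒜 ℒ i * symGen 𝒜 ℒ j
    = (xdeg 𝒜 ℒ i * xdeg 𝒜 ℒ j).negOnePow • (symGen 𝒜 ℒ j * symGen 𝒜 ℒ i) :=
  SymAlg.gen_comm hA (_, _) (_, _) (isGen_symGen 𝒜 ℒ i) (isGen_symGen 𝒜 ℒ j)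

/-- The projection from the free graded commutative algebra. -/
def symProj : FreeSym K (xdeg 𝒜 ℒ) →ₐ[K] SymAlg 𝒜 ℒ :=
  FreeSym.lift (symGen 𝒜 ℒ) (symGen_comm ℒ hA)

theorem symProj_gen (i : HIdx 𝒜 ⊕ HIdx ℒ) :
    symProj ℒ hA (FreeSym.gen K (xdeg 𝒜 ℒ) i) = symGen 𝒜 ℒ i := FreeSym.lift_gen _ _ i

theorem symProj_scalar (a : A) :
    symProj ℒ hA (freeScalar 𝒜 ℒ a) = SymAlg.scalar 𝒜 ℒ a := by
  suffices h : (symProj ℒ hA).toLinearMap ∘ₗ freeScalar 𝒜 ℒ = SymAlg.scalar 𝒜 ℒ from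
    LinearMap.congr_fun h a
  refine (hbasis 𝒜).ext fun i => ?_
  rw [LinearMap.comp_apply, freeScalar_hbasis]
  exact symProj_gen ℒ hA (Sum.inl i)

theorem symProj_vec (ξ : L) :
    symProj ℒ hA (freeVec 𝒜 ℒ ξ) = SymAlg.vec 𝒜 ℒ ξ := by
  suffices h : (symProj ℒ hA).toLinearMap ∘ₗ freeVec 𝒜 ℒ = SymAlg.vec 𝒜 ℒ from
    LinearMap.congr_fun h ξ
  refine (hbasis ℒ).ext fun i => ?_
  rw [LinearMap.comp_apply, freeVec_hbasis]
  exact symProj_gen ℒ hA (Sum.inr i)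

variable (𝒜) in
/-- The map from the tensor algebra to the free graded commutative algebra. -/
def tensorToFree : TensorAlgebra K (A × L) →ₐ[K] FreeSym K (xdeg 𝒜 ℒ) :=
  TensorAlgebra.lift K ((freeScalar 𝒜 ℒ).coprod (freeVec 𝒜 ℒ))

theorem symProj_tensorToFree (x : TensorAlgebra K (A × L)) :
    symProj ℒ hA (tensorToFree 𝒜 ℒ x) = SymAlg.mk 𝒜 ℒ x := by
  suffices h : (symProj ℒ hA).comp (tensorToFree 𝒜 ℒ) = SymAlg.mk 𝒜 ℒ from
    AlgHom.congr_fun h x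
  refine TensorAlgebra.hom_ext (LinearMap.ext fun y => ?_)
  simp only [LinearMap.comp_apply, AlgHom.toLinearMap_apply, AlgHom.comp_apply, tensorToFree,
    TensorAlgebra.lift_ι_apply, LinearMap.coprod_apply, map_add, symProj_scalar, symProj_vec]
  exact (SymAlg.mk_ι 𝒜 ℒ y.1 y.2).symm

theorem symProj_surjective : Function.Surjective (symProj ℒ hA) := fun u => by
  obtain ⟨x, rfl⟩ := SymAlg.mk_surjective 𝒜 ℒ u
  exact ⟨_, symProj_tensorToFree ℒ hA x⟩

theorem tensorToFree_surjective : Function.Surjective (tensorToFree (K := K) 𝒜 ℒ) := by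
  suffices h : ∀ u, u ∈ (tensorToFree (K := K) 𝒜 ℒ).range from h
  intro u
  refine FreeSym.induction (fun u v hu hv => add_mem hu hv) (fun c u hu => Subalgebra.smul_mem _ hu c)
    (one_mem _) (fun i u hu => mul_mem ?_ hu) u
  rcases i with i | i
  · refine ⟨TensorAlgebra.ι K (hbasis 𝒜 i, 0), ?_⟩
    simp [tensorToFree, freeScalar_hbasis]
  · refine ⟨TensorAlgebra.ι K (0, hbasis ℒ i), ?_⟩
    simp [tensorToFree, freeVec_hbasis]

/-- A subspace of the free graded commutative algebra that contains the images of the relations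
and is closed under multiplication contains the kernel of the projection. -/
theorem ker_symProj_le (Z : Submodule K (FreeSym K (xdeg 𝒜 ℒ)))
    (hl : ∀ u z, z ∈ Z → u * z ∈ Z) (hr : ∀ u z, z ∈ Z → z * u ∈ Z)
    (hZ : ∀ x y, SymRel 𝒜 ℒ x y → tensorToFree 𝒜 ℒ x - tensorToFree 𝒜 ℒ y ∈ Z)
    (u : FreeSym K (xdeg 𝒜 ℒ)) (hu : symProj ℒ hA u = 0) : u ∈ Z := by
  let I : TwoSidedIdeal (FreeSym K (xdeg 𝒜 ℒ)) := TwoSidedIdeal.mk' Z Z.zero_mem Z.add_mem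
    Z.neg_mem (fun {x y} h => hl x y h) (fun {x y} h => hr y x h)
  have hI : ∀ x y, (I.ringCon.mk' x = I.ringCon.mk' y) ↔ x - y ∈ Z := by
    intro x y
    have h1 : I.ringCon.mk' x = I.ringCon.mk' y ↔ I.ringCon x y := RingCon.eq _
    rw [h1, TwoSidedIdeal.rel_iff, TwoSidedIdeal.mem_mk']
    rfl
  obtain ⟨x, rfl⟩ := tensorToFree_surjective (𝒜 := 𝒜) ℒ u
  -- The map to the quotient by `Z` respects the defining relations, so it factors through `S_A L`
  -- and kills whatever the projection kills.
  let f : TensorAlgebra K (A × L) →+* I.ringCon.Quotient :=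
    I.ringCon.mk'.comp (tensorToFree (K := K) 𝒜 ℒ).toRingHom
  have hf : ∀ ⦃x y⦄, SymRel 𝒜 ℒ x y → f x = f y := fun x y h => (hI _ _).2 (hZ x y h)
  have h1 := RingQuot.lift_mkRingHom_apply f hf x
  have h2 : RingQuot.mkRingHom (SymRel 𝒜 ℒ) x = 0 := by
    rw [symProj_tensorToFree] at hu
    rw [← RingQuot.mkAlgHom_coe K]
    exact hu
  rw [h2, map_zero] at h1
  have h3 := (hI (tensorToFree 𝒜 ℒ x) 0).1 (by rw [map_zero]; exact h1.symm)
  rwa [sub_zero] at h3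

end Projection

/-! ### The brackets are compatible with the relations of the graded symmetric algebra -/

section PoissonIdeal

variable {K A L : Type*} [Field K] [Ring A] [Algebra K A]
  [AddCommGroup L] [Module K L] [Module A L]
  {𝒜 : ℤ → Submodule K A} {ℒ : ℤ → Submodule K L} [GradedAlgebra 𝒜] [DirectSum.Decomposition ℒ]
  (hA : ∀ (i j : ℤ) (a b : A), a ∈ 𝒜 i → b ∈ 𝒜 j →
      a * b = Int.negOnePow (i * j) • (b * a)) (X : LRInfty 𝒜 ℒ)

/-- The homogeneous elements of the kernel of the projection, all of whose brackets are in the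
kernel. -/
structure IsPoissonZero (e : ℤ) (z : FreeSym K (xdeg 𝒜 ℒ)) : Prop where
  mem : z ∈ FreeSym.grading K (xdeg 𝒜 ℒ) e
  proj : symProj ℒ hA z = 0
  br : ∀ l, Homog (FreeSym.grading K (xdeg 𝒜 ℒ)) l → symProj ℒ hA (extBr X ((e, z) :: l)) = 0

theorem symProj_extBr_isGradedMul {e : ℤ} {z : FreeSym K (xdeg 𝒜 ℒ)}
    (hz : z ∈ FreeSym.grading K (xdeg 𝒜 ℒ) e) :
    IsGradedMul (FreeSym.grading K (xdeg 𝒜 ℒ)) fun l => symProj ℒ hA (extBr X ((e, z) :: l)) :=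
  ((extBr_isMultiDer X).isGradedMul.cons (x := (e, z)) hz).map (symProj ℒ hA).toLinearMap

theorem symProj_units_smul (s : ℤˣ) (u : FreeSym K (xdeg 𝒜 ℒ)) :
    symProj ℒ hA (s • u) = s • symProj ℒ hA u := by
  rw [Units.smul_def, Units.smul_def, map_zsmul]

/-- The projected bracket with `z` is graded multilinear and satisfies the Leibniz rule in the
remaining entries, so it vanishes identically once it vanishes on words of generators; the order of
the letters only affects a sign. -/
theorem isPoissonZero_of_words {e : ℤ} {z : FreeSym K (xdeg 𝒜 ℒ)}
    (hz : z ∈ FreeSym.grading K (xdeg 𝒜 ℒ) e) (hp : symProj ℒ hA z = 0)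
    (hw : ∀ w : List (HIdx 𝒜 ⊕ HIdx ℒ), ∃ w' : List (HIdx 𝒜 ⊕ HIdx ℒ), w'.Perm w ∧
      symProj ℒ hA (extBr X ((e, z) :: w'.map (FreeSym.sym K (xdeg 𝒜 ℒ)))) = 0) :
    IsPoissonZero hA X e z := by
  refine ⟨hz, hp, fun l hl => ?_⟩
  have hf := symProj_extBr_isGradedMul hA X hz
  have hm := extBr_isMultiDer X
  have hS := FreeSym.isGradedComm (K := K) (deg := xdeg 𝒜 ℒ)
  have key : ∀ {i : ℤ} {u : FreeSym K (xdeg 𝒜 ℒ)} {l : List (ℤ × FreeSym K (xdeg 𝒜 ℒ))},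
      u ∈ FreeSym.grading K (xdeg 𝒜 ℒ) i → Homog (FreeSym.grading K (xdeg 𝒜 ℒ)) l →
      extBr X ((e, z) :: (i, u) :: l) = (e * i).negOnePow • extBr X ((i, u) :: (e, z) :: l) := by
    intro i u l hu hl
    have h1 : Homog (FreeSym.grading K (xdeg 𝒜 ℒ)) ((i, u) :: l) := homog_cons.2 ⟨hu, hl⟩
    have h2 : Homog (FreeSym.grading K (xdeg 𝒜 ℒ)) ((e, z) :: (i, u) :: l) :=
      homog_cons.2 ⟨hz, h1⟩
    exact hm.swap [] l (e, z) (i, u) h2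
  have hzl : ∀ {l : List (ℤ × FreeSym K (xdeg 𝒜 ℒ))}, Homog (FreeSym.grading K (xdeg 𝒜 ℒ)) l →
      Homog (FreeSym.grading K (xdeg 𝒜 ℒ)) ((e, z) :: l) := fun hl => homog_cons.2 ⟨hz, hl⟩
  have hswap : ∀ l₁ l₂ x y, (Homog (FreeSym.grading K (xdeg 𝒜 ℒ)) (l₁ ++ x :: y :: l₂) →
      symProj ℒ hA (extBr X ((e, z) :: (l₁ ++ x :: y :: l₂))) = 0) →
      (Homog (FreeSym.grading K (xdeg 𝒜 ℒ)) (l₁ ++ y :: x :: l₂) →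
      symProj ℒ hA (extBr X ((e, z) :: (l₁ ++ y :: x :: l₂))) = 0) := by
    intro l₁ l₂ x y hP hH
    rw [hf.swap _ _ _ _ hH, hP ((homog_perm ((List.Perm.swap x y l₂).append_left l₁)).1 hH),
      smul_zero]
  refine hom_induction (K := K) (gen := FreeSym.IsGen)
    (P := fun l => Homog (FreeSym.grading K (xdeg 𝒜 ℒ)) l →
      symProj ℒ hA (extBr X ((e, z) :: l)) = 0) hswap ?_ ?_ ?_ ?_ ?_ ?_ l hl hl
  · intro i l hl _
    exact hf.zero i hl
  · intro i u v l hu hv hl h1 h2 _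
    rw [hf.add _ _ _ _ hu hv hl, h1 (homog_cons.2 ⟨hu, hl⟩), h2 (homog_cons.2 ⟨hv, hl⟩), add_zero]
  · intro i c u l hu hl h1 _
    rw [hf.smul _ _ _ _ hu hl, h1 (homog_cons.2 ⟨hu, hl⟩), smul_zero]
  · intro l hl _
    rw [key hS.one_mem hl, hm.one hS.one_mem (hzl hl), smul_zero, map_zero]
  · intro i j u v l hu hv hl h1 h2 _
    have h1 := h1 (homog_cons.2 ⟨hu, hl⟩)
    have h2 := h2 (homog_cons.2 ⟨hv, hl⟩)
    rw [key hu hl, symProj_units_smul, smul_eq_zero_iff_eq] at h1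
    rw [key hv hl, symProj_units_smul, smul_eq_zero_iff_eq] at h2
    rw [key (hS.mul_mem hu hv) hl, hm.mul _ _ _ _ _ hu hv (hzl hl),
      symProj_units_smul, map_add, symProj_units_smul, symProj_units_smul, map_mul, map_mul, h1, h2,
      zero_mul, mul_zero, smul_zero, smul_zero, add_zero, smul_zero]
  · intro l hl
    obtain ⟨w, rfl⟩ := FreeSym.exists_map hl
    obtain ⟨w', hp, hw'⟩ := hw w
    exact perm_of_swap (P := fun l => Homog (FreeSym.grading K (xdeg 𝒜 ℒ)) l →
      symProj ℒ hA (extBr X ((e, z) :: l)) = 0) hswap (hp.map _) fun _ => hw'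

theorem extBr_scalar_cons (l : List (ℤ × L)) (hl : Homog ℒ l) {e : ℤ} {a : A} (ha : a ∈ 𝒜 e) :
    extBr X ((e, freeScalar 𝒜 ℒ a) :: l.map (degMap (freeVec 𝒜 ℒ)))
      = (e * degL l).negOnePow • freeScalar 𝒜 ℒ (X.an l a) := by
  have hx : Homog (FreeSym.grading K (xdeg 𝒜 ℒ))
      ((e, freeScalar 𝒜 ℒ a) :: l.map (degMap (freeVec 𝒜 ℒ))) :=
    homog_cons.2 ⟨freeScalar_mem 𝒜 ℒ ha, homog_map_degMap (fun _ _ => freeVec_mem 𝒜 ℒ) hl⟩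
  have := (extBr_isMultiDer X).append_singleton hx
  rw [extBr_scalar X l hl ha, degL_map_degMap] at this
  rw [this, smul_smul, ← Int.negOnePow_add, negOnePow_congr (b := 0) ⟨e * degL l, by ring⟩,
    Int.negOnePow_zero, one_smul]

theorem extBr_vec_cons (l : List (ℤ × L)) (hl : Homog ℒ l) {e : ℤ} {ξ : L} (hξ : ξ ∈ ℒ e) :
    extBr X ((e, freeVec 𝒜 ℒ ξ) :: l.map (degMap (freeVec 𝒜 ℒ)))
      = freeVec 𝒜 ℒ (X.br ((e, ξ) :: l)) :=
  extBr_vec X ((e, ξ) :: l) (homog_cons.2 ⟨hξ, hl⟩)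

theorem extBr_vec_cons_scalar (l : List (ℤ × L)) (hl : Homog ℒ l) {e j : ℤ} {a : A} {ξ : L}
    (hξ : ξ ∈ ℒ j) (ha : a ∈ 𝒜 e) :
    extBr X ((j, freeVec 𝒜 ℒ ξ) :: (l.map (degMap (freeVec 𝒜 ℒ)) ++ [(e, freeScalar 𝒜 ℒ a)]))
      = freeScalar 𝒜 ℒ (X.an ((j, ξ) :: l) a) :=
  extBr_scalar X ((j, ξ) :: l) (homog_cons.2 ⟨hξ, hl⟩) ha

theorem freeScalar_mem_linPart {e : ℤ} {a : A} (ha : a ∈ 𝒜 e) :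
    freeScalar 𝒜 ℒ a ∈ linPart 𝒜 ℒ (e, ((1 : ℕ) : ℤ)) := by
  simp only [linPart, Nat.cast_one, one_ne_zero, if_false, if_true]
  exact Submodule.mem_map_of_mem ha

theorem freeVec_mem_linPart {e : ℤ} {ξ : L} (hξ : ξ ∈ ℒ e) :
    freeVec 𝒜 ℒ ξ ∈ linPart 𝒜 ℒ (e, ((0 : ℕ) : ℤ)) := by
  simp only [linPart, Nat.cast_zero, if_true]
  exact Submodule.mem_map_of_mem hξ

/-- The anchors are derivations and therefore kill `1`; with a further scalar entry all brackets
vanish. -/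
theorem isPoissonZero_one : IsPoissonZero hA X 0 (freeScalar 𝒜 ℒ 1 - 1) := by
  have h1 : (1 : A) ∈ 𝒜 0 := SetLike.GradedOne.one_mem
  have hS := FreeSym.isGradedComm (K := K) (deg := xdeg 𝒜 ℒ)
  have hm := extBr_isMultiDer X
  refine isPoissonZero_of_words hA X (Submodule.sub_mem _ (freeScalar_mem 𝒜 ℒ h1) hS.one_mem)
    (by rw [map_sub, symProj_scalar, SymAlg.scalar_one, map_one, sub_self]) fun w =>
    ⟨w, List.Perm.refl _, ?_⟩
  rw [hm.isGradedMul.sub (freeScalar_mem 𝒜 ℒ h1) hS.one_mem (homog_map_sym w),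
    hm.one hS.one_mem (homog_map_sym w), sub_zero]
  by_cases hw : 1 ≤ w.countP Sum.isLeft
  · rw [extBr_linPart_eq_zero X (n := 1) (freeScalar_mem_linPart h1) (by omega), map_zero]
  · obtain ⟨l, rfl⟩ := eq_map_of_countP (l := w) (by omega)
    rw [map_inr_sym, extBr_scalar_cons X _ (homog_map_hsym ℒ l) h1,
      X.an_one _ (homog_map_hsym ℒ l) h1, map_zero, smul_zero, map_zero]

/-- On words of vectors this is the derivation rule of the anchors; with a further scalar entry all
terms vanish. -/
theorem isPoissonZero_mul {i j : ℤ} {a b : A} (ha : a ∈ 𝒜 i) (hb : b ∈ 𝒜 j) :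
    IsPoissonZero hA X (i + j) (freeScalar 𝒜 ℒ (a * b) - freeScalar 𝒜 ℒ a * freeScalar 𝒜 ℒ b) := by
  have hab : a * b ∈ 𝒜 (i + j) := SetLike.mul_mem_graded ha hb
  have hS := FreeSym.isGradedComm (K := K) (deg := xdeg 𝒜 ℒ)
  have hm := extBr_isMultiDer X
  have hab' := hS.mul_mem (freeScalar_mem 𝒜 ℒ ha) (freeScalar_mem 𝒜 ℒ hb)
  refine isPoissonZero_of_words hA X (Submodule.sub_mem _ (freeScalar_mem 𝒜 ℒ hab) hab')
    (by rw [map_sub, map_mul (symProj ℒ hA), symProj_scalar, symProj_scalar, symProj_scalar,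
      SymAlg.scalar_mul, sub_self]) fun w => ⟨w, List.Perm.refl _, ?_⟩
  rw [hm.isGradedMul.sub (freeScalar_mem 𝒜 ℒ hab) hab' (homog_map_sym w),
    hm.mul _ _ _ _ _ (freeScalar_mem 𝒜 ℒ ha) (freeScalar_mem 𝒜 ℒ hb) (homog_map_sym w)]
  by_cases hw : 1 ≤ w.countP Sum.isLeft
  · rw [extBr_linPart_eq_zero X (n := 1) (freeScalar_mem_linPart ha) (by omega),
      extBr_linPart_eq_zero X (n := 1) (freeScalar_mem_linPart hb) (by omega),
      extBr_linPart_eq_zero X (n := 1) (freeScalar_mem_linPart hab) (by omega)]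
    simp
  · obtain ⟨l, rfl⟩ := eq_map_of_countP (l := w) (by omega)
    rw [map_inr_sym]
    have hl := homog_map_hsym ℒ l
    generalize l.map (hsym ℒ) = l at hl ⊢
    rw [extBr_scalar_cons X _ hl ha, extBr_scalar_cons X _ hl hb, extBr_scalar_cons X _ hl hab,
      X.an_mul _ hl i a ha, degL_map_degMap]
    simp only [map_sub, map_add, map_mul, symProj_units_smul, symProj_scalar, smul_add, Units.smul_def,
      map_zsmul]
    simp only [← Units.smul_def, SymAlg.scalar_mul, smul_mul_assoc, mul_smul_comm, smul_smul,
      ← Int.negOnePow_add]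
    rw [negOnePow_congr (a := (i + j) * degL l) (b := j * degL l + i * degL l) ⟨0, by ring⟩,
      negOnePow_congr (a := (i + j) * degL l + (1 + degL l) * i) (b := i + j * degL l)
        ⟨i * degL l, by ring⟩, sub_self]

/-- On words of vectors this is the Leibniz rule of the brackets of `X`. With one further scalar it
is the `A`-linearity of the anchor, and with two or more all terms vanish. -/
theorem isPoissonZero_smul [SetLike.GradedSMul 𝒜 ℒ] {i j : ℤ} {a : A} {ξ : L} (ha : a ∈ 𝒜 i)
    (hξ : ξ ∈ ℒ j) : IsPoissonZero hA X (i + j)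
      (freeVec 𝒜 ℒ (a • ξ) - freeScalar 𝒜 ℒ a * freeVec 𝒜 ℒ ξ) := by
  have hab : a • ξ ∈ ℒ (i + j) := SetLike.GradedSMul.smul_mem ha hξ
  have hS := FreeSym.isGradedComm (K := K) (deg := xdeg 𝒜 ℒ)
  have hm := extBr_isMultiDer X
  have hab' := hS.mul_mem (freeScalar_mem 𝒜 ℒ ha) (freeVec_mem 𝒜 ℒ hξ)
  refine isPoissonZero_of_words hA X (Submodule.sub_mem _ (freeVec_mem 𝒜 ℒ hab) hab')
    (by rw [map_sub, map_mul, symProj_scalar, symProj_vec, symProj_vec, SymAlg.vec_smul,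
      sub_self]) fun w => ?_
  have hw : ∀ w : List (HIdx 𝒜 ⊕ HIdx ℒ), extBr X ((i + j, freeVec 𝒜 ℒ (a • ξ) -
      freeScalar 𝒜 ℒ a * freeVec 𝒜 ℒ ξ) :: w.map (FreeSym.sym K (xdeg 𝒜 ℒ))) = _ := fun w => by
    rw [hm.isGradedMul.sub (freeVec_mem 𝒜 ℒ hab) hab' (homog_map_sym w),
      hm.mul _ _ _ _ _ (freeScalar_mem 𝒜 ℒ ha) (freeVec_mem 𝒜 ℒ hξ) (homog_map_sym w)]
  by_cases hw2 : 2 ≤ w.countP Sum.isLeft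
  · refine ⟨w, List.Perm.refl _, ?_⟩
    rw [hw, extBr_linPart_eq_zero X (n := 1) (freeScalar_mem_linPart ha) (by omega),
      extBr_linPart_eq_zero X (n := 0) (freeVec_mem_linPart hξ) (by omega),
      extBr_linPart_eq_zero X (n := 0) (freeVec_mem_linPart hab) (by omega)]
    simp
  by_cases hw1 : w.countP Sum.isLeft = 1
  · obtain ⟨l, b, hp⟩ := exists_perm_of_countP_eq_one hw1
    refine ⟨_, hp, ?_⟩
    rw [hw, extBr_linPart_eq_zero X (n := 1) (freeScalar_mem_linPart ha) (by
      rw [hp.countP_eq]; omega), List.map_append, List.map_singleton, map_inr_sym, sym_inl]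
    have hl := homog_map_hsym ℒ l
    generalize l.map (hsym ℒ) = l at hl ⊢
    have hb : hbasis 𝒜 b ∈ 𝒜 b.deg := hbasis_mem 𝒜 b
    have e1 := extBr_vec_cons_scalar X l hl hab hb
    have e2 := extBr_vec_cons_scalar X l hl hξ hb
    rw [hsym, degMap_mk, e1, e2, X.an_linear i a ha (i + j) j ξ l]
    simp only [map_sub, map_add, map_mul, symProj_units_smul, symProj_scalar, zero_mul, smul_zero,
      zero_add, Units.smul_def, map_zsmul, SymAlg.scalar_mul, sub_self]
  · obtain ⟨l, rfl⟩ := eq_map_of_countP (l := w) (by omega)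
    refine ⟨_, List.Perm.refl _, ?_⟩
    rw [hw, map_inr_sym]
    have hl := homog_map_hsym ℒ l
    generalize l.map (hsym ℒ) = l at hl ⊢
    have h1 := (br_isGradedMul X).append_singleton (x := (i + j, a • ξ)) (homog_cons.2 ⟨hab, hl⟩)
    have h2 := (br_isGradedMul X).append_singleton (x := (j, ξ)) (homog_cons.2 ⟨hξ, hl⟩)
    have h3 := X.br_smul l hl i a ha (i + j) j ξ
    rw [h1, h2] at h3
    have h4 : X.br ((i + j, a • ξ) :: l) = ((i + j) * degL l).negOnePow • X.an l a • ξ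
        + i.negOnePow • a • X.br ((j, ξ) :: l) := by
      have := congrArg (fun u => ((i + j) * degL l).negOnePow • u) h3
      simp only [smul_add, smul_smul, ← Int.negOnePow_add] at this
      rw [negOnePow_congr (a := (i + j) * degL l + (i + j) * degL l) (b := 0)
        ⟨(i + j) * degL l, by ring⟩, Int.negOnePow_zero, one_smul] at this
      rw [this, smul_comm a, smul_smul, ← Int.negOnePow_add,
        negOnePow_congr (a := (i + j) * degL l + (1 + degL l) * i + j * degL l) (b := i)
        ⟨(i + j) * degL l, by ring⟩]
    rw [extBr_scalar_cons X _ hl ha, extBr_vec_cons X _ hl hab, extBr_vec_cons X _ hl hξ,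
      h4, degL_map_degMap]
    simp only [map_sub, map_add, map_mul, symProj_units_smul, symProj_scalar, symProj_vec,
      Units.smul_def, map_zsmul, SymAlg.vec_smul]
    simp only [← Units.smul_def, smul_mul_assoc, smul_smul, ← Int.negOnePow_add]
    rw [negOnePow_congr (a := (i + j) * degL l) (b := j * degL l + i * degL l) ⟨0, by ring⟩,
      sub_self]

/-- The span of the homogeneous elements of the kernel of the projection, all of whose brackets are
in the kernel. -/
def poissonIdeal : Submodule K (FreeSym K (xdeg 𝒜 ℒ)) :=
  Submodule.span K {z | ∃ e, IsPoissonZero hA X e z}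

variable {hA X} in
-- By the Leibniz rule a bracket with the product has one term containing `z` and one containing a
-- bracket of `z`; both project to zero.
theorem IsPoissonZero.gen_mul {e : ℤ} {z : FreeSym K (xdeg 𝒜 ℒ)} (hz : IsPoissonZero hA X e z)
    (i : HIdx 𝒜 ⊕ HIdx ℒ) :
    IsPoissonZero hA X (xdeg 𝒜 ℒ i + e) (FreeSym.gen K (xdeg 𝒜 ℒ) i * z) where
  mem := FreeSym.isGradedComm.mul_mem (FreeSym.gen_mem i) hz.mem
  proj := by rw [map_mul, hz.proj, mul_zero]
  br l hl := by
    rw [(extBr_isMultiDer X).mul _ _ _ _ _ (FreeSym.gen_mem i) hz.mem hl, map_add,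
      symProj_units_smul, symProj_units_smul, map_mul, map_mul, hz.br l hl, hz.proj, mul_zero,
      mul_zero, smul_zero, smul_zero, add_zero]

theorem gen_mul_mem_poissonIdeal (i : HIdx 𝒜 ⊕ HIdx ℒ) {z : FreeSym K (xdeg 𝒜 ℒ)}
    (hz : z ∈ poissonIdeal hA X) : FreeSym.gen K (xdeg 𝒜 ℒ) i * z ∈ poissonIdeal hA X := by
  induction hz using Submodule.span_induction with
  | zero => rw [mul_zero]; exact Submodule.zero_mem _
  | add x y _ _ hx hy => rw [mul_add]; exact Submodule.add_mem _ hx hy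
  | smul c x _ hx => rw [mul_smul_comm]; exact Submodule.smul_mem _ _ hx
  | mem z hz =>
    obtain ⟨e, hz⟩ := hz
    exact Submodule.subset_span ⟨_, hz.gen_mul i⟩

theorem mul_gen_mem_poissonIdeal (i : HIdx 𝒜 ⊕ HIdx ℒ) {z : FreeSym K (xdeg 𝒜 ℒ)}
    (hz : z ∈ poissonIdeal hA X) : z * FreeSym.gen K (xdeg 𝒜 ℒ) i ∈ poissonIdeal hA X := by
  induction hz using Submodule.span_induction with
  | zero => rw [zero_mul]; exact Submodule.zero_mem _
  | add x y _ _ hx hy => rw [add_mul]; exact Submodule.add_mem _ hx hy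
  | smul c x _ hx => rw [smul_mul_assoc]; exact Submodule.smul_mem _ _ hx
  | mem z hz =>
    obtain ⟨e, hz⟩ := hz
    rw [FreeSym.isGradedComm.comm hz.mem (FreeSym.gen_mem i)]
    exact (Submodule.smul_mem_iff' _ _).2 (Submodule.subset_span ⟨_, hz.gen_mul i⟩)

theorem mul_mem_poissonIdeal (u : FreeSym K (xdeg 𝒜 ℒ)) {z : FreeSym K (xdeg 𝒜 ℒ)}
    (hz : z ∈ poissonIdeal hA X) : u * z ∈ poissonIdeal hA X := by
  induction u using FreeSym.induction with
  | hadd u v hu hv => rw [add_mul]; exact Submodule.add_mem _ hu hv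
  | hsmul c u hu => rw [smul_mul_assoc]; exact Submodule.smul_mem _ _ hu
  | hone => rwa [one_mul]
  | hmul i u hu => rw [mul_assoc]; exact gen_mul_mem_poissonIdeal hA X i hu

theorem mul_mem_poissonIdeal' (u : FreeSym K (xdeg 𝒜 ℒ)) {z : FreeSym K (xdeg 𝒜 ℒ)}
    (hz : z ∈ poissonIdeal hA X) : z * u ∈ poissonIdeal hA X := by
  induction u using FreeSym.induction generalizing z with
  | hadd u v hu hv => rw [mul_add]; exact Submodule.add_mem _ (hu hz) (hv hz)
  | hsmul c u hu => rw [mul_smul_comm]; exact Submodule.smul_mem _ _ (hu hz)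
  | hone => rwa [mul_one]
  | hmul i u hu => rw [← mul_assoc]; exact hu (mul_gen_mem_poissonIdeal hA X i hz)

theorem iSup_eq_top_of_decomposition {V : Type*} [AddCommGroup V] [Module K V]
    (𝒱 : ℤ → Submodule K V) [DirectSum.Decomposition 𝒱] : ⨆ e, 𝒱 e = ⊤ :=
  (DirectSum.Decomposition.isInternal 𝒱).submodule_iSup_eq_top

theorem homogeneous_induction {V : Type*} [AddCommGroup V] [Module K V]
    (𝒱 : ℤ → Submodule K V) [DirectSum.Decomposition 𝒱] {p : V → Prop}
    (hadd : ∀ u v, p u → p v → p (u + v)) (h : ∀ e, ∀ v ∈ 𝒱 e, p v) (v : V) : p v := by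
  have hv : v ∈ ⨆ e, 𝒱 e := by rw [iSup_eq_top_of_decomposition]; trivial
  induction hv using Submodule.iSup_induction' with
  | mem e v hv => exact h e v hv
  | zero => exact h 0 0 (Submodule.zero_mem _)
  | add u v _ _ hu hv => exact hadd u v hu hv

/-- Graded commutativity already holds in the free algebra, so only three kinds of relations remain,
and these are additive in each argument. -/
theorem ker_symProj_le_of_homogeneous (hA : ∀ (i j : ℤ) (a b : A), a ∈ 𝒜 i → b ∈ 𝒜 j →
      a * b = Int.negOnePow (i * j) • (b * a)) (Z : Submodule K (FreeSym K (xdeg 𝒜 ℒ)))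
    (hl : ∀ u z, z ∈ Z → u * z ∈ Z) (hr : ∀ u z, z ∈ Z → z * u ∈ Z)
    (hone : freeScalar 𝒜 ℒ 1 - 1 ∈ Z)
    (hmul : ∀ i j, ∀ a ∈ 𝒜 i, ∀ b ∈ 𝒜 j,
      freeScalar 𝒜 ℒ (a * b) - freeScalar 𝒜 ℒ a * freeScalar 𝒜 ℒ b ∈ Z)
    (hsmul : ∀ i j, ∀ a ∈ 𝒜 i, ∀ ξ ∈ ℒ j,
      freeVec 𝒜 ℒ (a • ξ) - freeScalar 𝒜 ℒ a * freeVec 𝒜 ℒ ξ ∈ Z)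
    {u : FreeSym K (xdeg 𝒜 ℒ)} (hu : symProj ℒ hA u = 0) : u ∈ Z := by
  refine ker_symProj_le ℒ hA _ hl hr ?_ u hu
  have hι : ∀ (a : A), tensorToFree (K := K) 𝒜 ℒ (TensorAlgebra.ι K ((a, 0) : A × L))
      = freeScalar 𝒜 ℒ a := fun a => by simp [tensorToFree]
  have hι' : ∀ (ξ : L), tensorToFree (K := K) 𝒜 ℒ (TensorAlgebra.ι K ((0, ξ) : A × L))
      = freeVec 𝒜 ℒ ξ := fun a => by simp [tensorToFree]
  intro x y h
  cases h with
  | one =>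
    rw [hι, map_one (tensorToFree 𝒜 ℒ)]
    exact hone
  | mul a b =>
    rw [map_mul, hι, hι, hι]
    refine homogeneous_induction 𝒜 (p := fun a => freeScalar 𝒜 ℒ (a * b)
      - freeScalar 𝒜 ℒ a * freeScalar 𝒜 ℒ b ∈ Z) (fun a a' h h' => ?_)
      (fun i a ha => ?_) a
    · rw [add_mul, map_add, map_add, add_mul, add_sub_add_comm]
      exact Submodule.add_mem _ h h'
    refine homogeneous_induction 𝒜 (p := fun b => freeScalar 𝒜 ℒ (a * b)
      - freeScalar 𝒜 ℒ a * freeScalar 𝒜 ℒ b ∈ Z) (fun b b' h h' => ?_)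
      (fun j b hb => hmul i j a ha b hb) b
    rw [mul_add, map_add, map_add, mul_add, add_sub_add_comm]
    exact Submodule.add_mem _ h h'
  | smul a ξ =>
    rw [map_mul, hι, hι', hι']
    refine homogeneous_induction 𝒜 (p := fun a => freeVec 𝒜 ℒ (a • ξ)
      - freeScalar 𝒜 ℒ a * freeVec 𝒜 ℒ ξ ∈ Z) (fun a a' h h' => ?_)
      (fun i a ha => ?_) a
    · rw [add_smul, map_add, map_add, add_mul, add_sub_add_comm]
      exact Submodule.add_mem _ h h'
    refine homogeneous_induction ℒ (p := fun ξ => freeVec 𝒜 ℒ (a • ξ)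
      - freeScalar 𝒜 ℒ a * freeVec 𝒜 ℒ ξ ∈ Z) (fun b b' h h' => ?_)
      (fun j ξ hξ => hsmul i j a ha ξ hξ) ξ
    rw [smul_add, map_add, map_add, mul_add, add_sub_add_comm]
    exact Submodule.add_mem _ h h'
  | comm_scalar i j a ξ ha hξ =>
    rw [Units.smul_def, map_zsmul, map_mul, map_mul, hι, hι', ← Units.smul_def,
      FreeSym.isGradedComm.comm (freeScalar_mem 𝒜 ℒ ha) (freeVec_mem 𝒜 ℒ hξ), sub_self]
    exact Submodule.zero_mem _
  | comm i j ξ ζ hξ hζ =>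
    rw [Units.smul_def, map_zsmul, map_mul, map_mul, hι', hι', ← Units.smul_def,
      FreeSym.isGradedComm.comm (freeVec_mem 𝒜 ℒ hξ) (freeVec_mem 𝒜 ℒ hζ), sub_self]
    exact Submodule.zero_mem _

/-- The kernel of the projection is stable under brackets. -/
theorem mem_poissonIdeal [SetLike.GradedSMul 𝒜 ℒ] {u : FreeSym K (xdeg 𝒜 ℒ)}
    (hu : symProj ℒ hA u = 0) : u ∈ poissonIdeal hA X :=
  ker_symProj_le_of_homogeneous hA _ (fun u _ => mul_mem_poissonIdeal hA X u)
    (fun u _ => mul_mem_poissonIdeal' hA X u) (Submodule.subset_span ⟨_, isPoissonZero_one hA X⟩)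
    (fun _ _ _ ha _ hb => Submodule.subset_span ⟨_, isPoissonZero_mul hA X ha hb⟩)
    (fun _ _ _ ha _ hξ => Submodule.subset_span ⟨_, isPoissonZero_smul hA X ha hξ⟩) hu

end PoissonIdeal

/-! ### Multilinear maps and spanning sets -/

section Multilinear

variable {K V Y : Type*} [Field K] [AddCommGroup V] [Module K V] [AddCommGroup Y] [Module K Y]

theorem multilinear_mem_of_span {n : ℕ} (f : MultilinearMap K (fun _ : Fin n => V) Y)
    (S : Fin n → Set V) (N : Submodule K Y) (h : ∀ v : Fin n → V, (∀ t, v t ∈ S t) → f v ∈ N)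
    (v : Fin n → V) (hv : ∀ t, v t ∈ Submodule.span K (S t)) : f v ∈ N := by
  induction n with
  | zero => exact h v fun t => t.elim0
  | succ n ih =>
    suffices h0 : ∀ x ∈ Submodule.span K (S 0), f.curryLeft x (Fin.tail v) ∈ N by
      have := h0 (v 0) (hv 0)
      rwa [MultilinearMap.curryLeft_apply, Fin.cons_self_tail] at this
    intro x hx
    induction hx using Submodule.span_induction with
    | zero => simp
    | add x y _ _ hx hy =>
      rw [map_add, MultilinearMap.add_apply]
      exact N.add_mem hx hy
    | smul c x _ hx =>
      rw [map_smul, MultilinearMap.smul_apply]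
      exact N.smul_mem c hx
    | mem x hx =>
      refine ih (f.curryLeft x) (fun t => S t.succ) (fun w hw => ?_) (Fin.tail v)
        fun t => hv t.succ
      rw [MultilinearMap.curryLeft_apply]
      exact h _ (Fin.cases hx hw)

theorem multilinear_ext_of_span {n : ℕ} {f g : MultilinearMap K (fun _ : Fin n => V) Y}
    (S : Set V) (hS : Submodule.span K S = ⊤)
    (h : ∀ v : Fin n → V, (∀ t, v t ∈ S) → f v = g v) : f = g := by
  ext v
  have := multilinear_mem_of_span (f - g) (fun _ => S) ⊥ (fun v hv => by
    rw [Submodule.mem_bot, MultilinearMap.sub_apply, h v hv, sub_self]) v (fun t => by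
    rw [hS]; trivial)
  rwa [Submodule.mem_bot, MultilinearMap.sub_apply, sub_eq_zero] at this

theorem multilinear_congr {n : ℕ} (f : MultilinearMap K (fun _ : Fin n => V) Y)
    (Z : Submodule K V) (hZ : ∀ (v : Fin n → V) (t : Fin n), v t ∈ Z → f v = 0)
    (v w : Fin n → V) (h : ∀ t, v t - w t ∈ Z) : f v = f w := by
  induction n with
  | zero => exact congrArg f (Subsingleton.elim _ _)
  | succ n ih =>
    have h1 : f.curryLeft (v 0) (Fin.tail v) = f.curryLeft (v 0) (Fin.tail w) :=
      ih (f.curryLeft (v 0)) (fun u t hu => hZ _ t.succ (by rwa [Fin.cons_succ])) _ _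
        fun t => h t.succ
    have h2 : f.curryLeft (v 0 - w 0) (Fin.tail w) = 0 :=
      hZ _ 0 (by rw [Fin.cons_zero]; exact h 0)
    rw [map_sub, MultilinearMap.sub_apply, sub_eq_zero, ← h1] at h2
    rwa [MultilinearMap.curryLeft_apply, MultilinearMap.curryLeft_apply, Fin.cons_self_tail,
      Fin.cons_self_tail] at h2

end Multilinear

/-! ### The parity involution of the free graded commutative algebra -/

section Parity

variable (K : Type*) [Field K] {ι : Type*} (deg : ι → ℤ)

/-- The parity involution. -/
def FreeSym.parity : FreeSym K deg →ₐ[K] FreeSym K deg :=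
  FreeSym.lift (fun i => (deg i).negOnePow • FreeSym.gen K deg i) fun i j => by
    rw [smul_mul_smul_comm, FreeSym.gen_comm, smul_mul_smul_comm, smul_comm,
      mul_comm ((deg i).negOnePow)]

variable {K deg}

theorem FreeSym.parity_apply {e : ℤ} {u : FreeSym K deg} (hu : u ∈ FreeSym.grading K deg e) :
    FreeSym.parity K deg u = e.negOnePow • u := by
  induction hu using Submodule.span_induction with
  | zero => simp
  | add x y _ _ hx hy => rw [map_add, hx, hy, smul_add]
  | smul c x _ hx => rw [map_smul, hx, smul_comm]
  | mem x hx =>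
    obtain ⟨l, hl, rfl, rfl⟩ := hx
    obtain ⟨w, rfl⟩ := FreeSym.exists_map hl
    clear hl
    induction w with
    | nil => simp
    | cons i w ih =>
      rw [List.map_cons, mulL_cons, map_mul, ih, degL_cons, Int.negOnePow_add, ← smul_mul_smul_comm]
      congr 1
      exact FreeSym.lift_gen _ _ i

theorem FreeSym.isParity [CharZero K] : IsParity (FreeSym.grading K deg)
    ((2 : K)⁻¹ • (LinearMap.id + (FreeSym.parity K deg).toLinearMap))
    ((2 : K)⁻¹ • (LinearMap.id - (FreeSym.parity K deg).toLinearMap)) :=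
  isParity_of_involution fun _ _ => FreeSym.parity_apply

end Parity

/-! ### The brackets on the graded symmetric algebra -/

section SymBracket

variable {K A L : Type*} [Field K] [Ring A] [Algebra K A]
  [AddCommGroup L] [Module K L] [Module A L]
  {𝒜 : ℤ → Submodule K A} {ℒ : ℤ → Submodule K L} [GradedAlgebra 𝒜] [DirectSum.Decomposition ℒ]
  (hA : ∀ (i j : ℤ) (a b : A), a ∈ 𝒜 i → b ∈ 𝒜 j →
      a * b = Int.negOnePow (i * j) • (b * a)) (X : LRInfty 𝒜 ℒ)

theorem symProj_mem {e : ℤ} {u : FreeSym K (xdeg 𝒜 ℒ)} (hu : u ∈ FreeSym.grading K (xdeg 𝒜 ℒ) e) :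
    symProj ℒ hA u ∈ SymAlg.grading 𝒜 ℒ e := by
  rw [SymAlg.grading_eq]
  induction hu using Submodule.span_induction with
  | zero => simp
  | add x y _ _ hx hy => rw [map_add]; exact Submodule.add_mem _ hx hy
  | smul c x _ hx => rw [map_smul]; exact Submodule.smul_mem _ _ hx
  | mem x hx =>
    obtain ⟨l, hl, rfl, rfl⟩ := hx
    obtain ⟨w, rfl⟩ := FreeSym.exists_map hl
    have h1 : symProj ℒ hA (mulL (w.map (FreeSym.sym K (xdeg 𝒜 ℒ))))
        = mulL (w.map fun i => (xdeg 𝒜 ℒ i, symGen 𝒜 ℒ i)) := by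
      rw [mulL, mulL, map_list_prod, List.map_map, List.map_map, List.map_map]
      refine congrArg List.prod (List.map_congr_left fun i _ => symProj_gen ℒ hA i)
    have h2 : degL (w.map (FreeSym.sym K (xdeg 𝒜 ℒ)))
        = degL (w.map fun i => (xdeg 𝒜 ℒ i, symGen 𝒜 ℒ i)) := by
      rw [degL, degL, List.map_map, List.map_map]
      rfl
    rw [h1, h2]
    refine mulL_mem_genSpan fun x hx => ?_
    obtain ⟨i, -, rfl⟩ := List.mem_map.1 hx
    exact isGen_symGen 𝒜 ℒ i

theorem exists_symProj_eq {e : ℤ} {u : SymAlg 𝒜 ℒ} (hu : u ∈ SymAlg.grading 𝒜 ℒ e) :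
    ∃ v ∈ FreeSym.grading K (xdeg 𝒜 ℒ) e, symProj ℒ hA v = u := by
  rw [SymAlg.grading_eq] at hu
  change u ∈ (FreeSym.grading K (xdeg 𝒜 ℒ) e).map (symProj ℒ hA).toLinearMap
  refine (Submodule.span_le (p := (FreeSym.grading K (xdeg 𝒜 ℒ) e).map
    (symProj ℒ hA).toLinearMap)).2 ?_ hu
  clear hu
  rintro _ ⟨l, hl, rfl, rfl⟩
  induction l with
  | nil => exact ⟨1, FreeSym.isGradedComm.one_mem, map_one (symProj ℒ hA)⟩
  | cons x l ih =>
    obtain ⟨v, hv, hv'⟩ := ih fun y hy => hl y (by simp [hy])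
    obtain ⟨w, hw, hw'⟩ : ∃ w ∈ FreeSym.grading K (xdeg 𝒜 ℒ) x.1, symProj ℒ hA w = x.2 := by
      rcases hl x (by simp) with ⟨a, ha, h⟩ | ⟨ξ, hξ, h⟩
      · exact ⟨_, freeScalar_mem 𝒜 ℒ ha, by rw [symProj_scalar, h]⟩
      · exact ⟨_, freeVec_mem 𝒜 ℒ hξ, by rw [symProj_vec, h]⟩
    refine ⟨w * v, FreeSym.isGradedComm.mul_mem hw hv, ?_⟩
    rw [mulL_cons, ← hw', ← hv']
    exact map_mul (symProj ℒ hA) w v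

theorem exists_map_symProj {l : List (ℤ × SymAlg 𝒜 ℒ)} (hl : Homog (SymAlg.grading 𝒜 ℒ) l) :
    ∃ l', Homog (FreeSym.grading K (xdeg 𝒜 ℒ)) l' ∧ l = l'.map (degMap (symProj ℒ hA)) := by
  induction l with
  | nil => exact ⟨[], homog_nil, rfl⟩
  | cons x l ih =>
    obtain ⟨hx, hl⟩ := homog_cons.1 hl
    obtain ⟨l', hl', rfl⟩ := ih hl
    obtain ⟨v, hv, hv'⟩ := exists_symProj_eq hA hx
    exact ⟨(x.1, v) :: l', homog_cons.2 ⟨hv, hl'⟩, by rw [List.map_cons, degMap_mk, hv']⟩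

theorem span_homogeneous_free :
    Submodule.span K {u | ∃ e, u ∈ FreeSym.grading K (xdeg 𝒜 ℒ) e} = ⊤ :=
  FreeSym.hom_ext (E := K) fun e _ hu => Submodule.subset_span ⟨e, hu⟩

theorem span_homogeneous_sym (hA : ∀ (i j : ℤ) (a b : A), a ∈ 𝒜 i → b ∈ 𝒜 j →
      a * b = Int.negOnePow (i * j) • (b * a)) :
    Submodule.span K {u | ∃ e, u ∈ SymAlg.grading 𝒜 ℒ e} = ⊤ := by
  rw [eq_top_iff]
  rintro u -
  obtain ⟨v, rfl⟩ := symProj_surjective ℒ hA u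
  have hv : v ∈ (⊤ : Submodule K (FreeSym K (xdeg 𝒜 ℒ))) := trivial
  rw [← span_homogeneous_free] at hv
  have := Submodule.mem_map_of_mem (f := (symProj ℒ hA).toLinearMap) hv
  rw [Submodule.map_span] at this
  refine Submodule.span_mono ?_ this
  rintro _ ⟨w, ⟨e, hw⟩, rfl⟩
  exact ⟨e, symProj_mem hA hw⟩

/-- A linear section of the projection. -/
def symSection : SymAlg 𝒜 ℒ →ₗ[K] FreeSym K (xdeg 𝒜 ℒ) :=
  ((symProj ℒ hA).toLinearMap.exists_rightInverse_of_surjective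
    (LinearMap.range_eq_top.2 (symProj_surjective ℒ hA))).choose

theorem symProj_symSection (u : SymAlg 𝒜 ℒ) : symProj ℒ hA (symSection hA u) = u :=
  LinearMap.congr_fun ((symProj ℒ hA).toLinearMap.exists_rightInverse_of_surjective
    (LinearMap.range_eq_top.2 (symProj_surjective ℒ hA))).choose_spec u

/-- The projections of the brackets on the free graded commutative algebra. -/
def preBracket (k : ℕ) :
    MultilinearMap K (fun _ : Fin k => FreeSym K (xdeg 𝒜 ℒ)) (SymAlg 𝒜 ℒ) :=
  ((symProj ℒ hA).toLinearMap ∘ₗ LinearMap.applyₗ (1 : FreeSym K (xdeg 𝒜 ℒ))).compMultilinearMap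
    (itMul ((2 : K)⁻¹ • (LinearMap.id + (FreeSym.parity K (xdeg 𝒜 ℒ)).toLinearMap))
      ((2 : K)⁻¹ • (LinearMap.id - (FreeSym.parity K (xdeg 𝒜 ℒ)).toLinearMap)) k 1
      (freeD (extF X) k))

/-- The brackets on the graded symmetric algebra. -/
def symBracket (k : ℕ) : MultilinearMap K (fun _ : Fin k => SymAlg 𝒜 ℒ) (SymAlg 𝒜 ℒ) :=
  (preBracket hA X k).compLinearMap fun _ => symSection hA

theorem symBracket_apply {k : ℕ} (u : Fin k → SymAlg 𝒜 ℒ) :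
    symBracket hA X k u = preBracket hA X k fun t => symSection hA (u t) := rfl

/-- The brackets on lists. -/
def symBr : List (ℤ × SymAlg 𝒜 ℒ) → SymAlg 𝒜 ℒ := evalL fun k => symBracket hA X k

variable [CharZero K]

theorem preBracket_eq {k : ℕ} (d : Fin k → ℤ) (u : Fin k → FreeSym K (xdeg 𝒜 ℒ))
    (hu : ∀ t, u t ∈ FreeSym.grading K (xdeg 𝒜 ℒ) (d t)) :
    preBracket hA X k u = symProj ℒ hA (extBr X (List.ofFn fun t => (d t, u t))) := by
  have h := itMul_eq (FreeSym.isParity (K := K) (deg := xdeg 𝒜 ℒ)) 1 1 (by simp)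
    (freeD (extF X) k) d u hu
  have h' : extBr X (List.ofFn fun t => (d t, u t)) = iterComm (freeD (extF X) k) 1 d u 1 := by
    rw [iterComm_eq_itL, extBr, freeBr, List.length_ofFn]
  rw [h', ← h]
  rfl

variable [SetLike.GradedSMul 𝒜 ℒ]

/-- By `mem_poissonIdeal` and multilinearity, the entry in the kernel may be taken to be an
`IsPoissonZero` element and the others homogeneous. Moved to the front, that entry makes the bracket
project to zero by definition. -/
theorem preBracket_eq_zero {k : ℕ} (u : Fin k → FreeSym K (xdeg 𝒜 ℒ)) (t : Fin k)
    (ht : symProj ℒ hA (u t) = 0) : preBracket hA X k u = 0 := by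
  classical
  have hm := (extBr_isMultiDer X).isGradedMul
  have := multilinear_mem_of_span (preBracket hA X k) (fun s => if s = t then
    {z | ∃ e, IsPoissonZero hA X e z} else {z | ∃ e, z ∈ FreeSym.grading K (xdeg 𝒜 ℒ) e}) ⊥
    (fun v hv => ?_) u (fun s => ?_)
  · rwa [Submodule.mem_bot] at this
  · have h1 : ∀ s, ∃ e, v s ∈ FreeSym.grading K (xdeg 𝒜 ℒ) e ∧
        (s = t → IsPoissonZero hA X e (v s)) := fun s => by
      have := hv s
      split_ifs at this with h
      · obtain ⟨e, he⟩ := this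
        exact ⟨e, he.mem, fun _ => he⟩
      · obtain ⟨e, he⟩ := this
        exact ⟨e, he, fun h' => (h h').elim⟩
    choose d hd hd' using h1
    rw [Submodule.mem_bot, preBracket_eq hA X d v hd]
    have hH := homog_ofFn d v hd
    have hmem : (d t, v t) ∈ List.ofFn fun s => (d s, v s) := List.mem_ofFn.2 ⟨t, rfl⟩
    obtain ⟨l₁, l₂, hl⟩ := List.append_of_mem hmem
    rw [hl] at hH ⊢
    refine perm_of_swap (P := fun l => Homog (FreeSym.grading K (xdeg 𝒜 ℒ)) l →
      symProj ℒ hA (extBr X l) = 0) (fun l₁ l₂ x y hP hH => ?_)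
      (List.perm_middle (a := (d t, v t)) (l₁ := l₁) (l₂ := l₂)).symm (fun hH => ?_) hH
    · rw [hm.swap _ _ _ _ hH, symProj_units_smul,
        hP ((homog_perm ((List.Perm.swap x y l₂).append_left l₁)).1 hH), smul_zero]
    · exact (hd' t rfl).br _ (homog_cons.1 hH).2
  · split_ifs with h
    · rw [h]
      exact mem_poissonIdeal hA X ht
    · rw [span_homogeneous_free]
      trivial

/-- This makes the brackets on `S_A L` independent of the linear section in their definition, so
that any lifts may be used to compute them. -/
theorem preBracket_congr {k : ℕ} (u v : Fin k → FreeSym K (xdeg 𝒜 ℒ))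
    (h : ∀ t, symProj ℒ hA (u t) = symProj ℒ hA (v t)) :
    preBracket hA X k u = preBracket hA X k v :=
  multilinear_congr _ (LinearMap.ker (symProj ℒ hA).toLinearMap)
    (fun w t hw => preBracket_eq_zero hA X w t hw) u v fun t => by
      rw [LinearMap.mem_ker, AlgHom.toLinearMap_apply, map_sub, h, sub_self]

theorem symBr_map (l : List (ℤ × FreeSym K (xdeg 𝒜 ℒ)))
    (hl : Homog (FreeSym.grading K (xdeg 𝒜 ℒ)) l) :
    symBr hA X (l.map (degMap (symProj ℒ hA))) = symProj ℒ hA (extBr X l) := by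
  obtain ⟨n, d, u, hu, rfl⟩ := exists_ofFn_homog hl
  rw [List.map_ofFn, symBr, evalL_ofFn, symBracket_apply, ← preBracket_eq hA X d u hu]
  exact preBracket_congr hA X _ _ fun t => symProj_symSection hA _

theorem symBracket_symProj {k : ℕ} (d : Fin k → ℤ) (v : Fin k → FreeSym K (xdeg 𝒜 ℒ))
    (hv : ∀ t, v t ∈ FreeSym.grading K (xdeg 𝒜 ℒ) (d t)) :
    symBracket hA X k (fun t => symProj ℒ hA (v t))
      = symProj ℒ hA (extBr X (List.ofFn fun t => (d t, v t))) := by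
  rw [symBracket_apply, ← preBracket_eq hA X d v hv]
  exact preBracket_congr hA X _ _ fun t => symProj_symSection hA _

theorem symBr_isMultiDer : IsMultiDer (SymAlg.grading 𝒜 ℒ) (symBr hA X) where
  mem l hl := by
    obtain ⟨l, hl', rfl⟩ := exists_map_symProj hA hl
    rw [symBr_map hA X l hl', degL_map_degMap]
    exact symProj_mem hA ((extBr_isMultiDer X).mem l hl')
  swap l l' x y hl := by
    obtain ⟨m, hm, h⟩ := exists_map_symProj hA hl
    obtain ⟨m₁, m', rfl, rfl, h2⟩ := List.map_eq_append_iff.1 h.symm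
    obtain ⟨x, m'', rfl, rfl, h3⟩ := List.map_eq_cons_iff.1 h2
    obtain ⟨y, m₂, rfl, rfl, rfl⟩ := List.map_eq_cons_iff.1 h3
    have h1 := symBr_map hA X _ hm
    have h2 := symBr_map hA X (m₁ ++ y :: x :: m₂)
      ((homog_perm ((List.Perm.swap y x m₂).append_left m₁)).1 hm)
    rw [(extBr_isMultiDer X).swap _ _ _ _ hm, symProj_units_smul, ← h2] at h1
    simp only [List.map_append, List.map_cons] at h1
    exact h1
  add e u v l hu hv hl := evalL_cons_add _ _ _ _ _ _ _
  smul e c u l hu hl := evalL_cons_smul _ _ _ _ _ _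
  mul e f v w l hv hw hl := by
    obtain ⟨l, hl', rfl⟩ := exists_map_symProj hA hl
    obtain ⟨v, hv', rfl⟩ := exists_symProj_eq hA hv
    obtain ⟨w, hw', rfl⟩ := exists_symProj_eq hA hw
    have hS := FreeSym.isGradedComm (K := K) (deg := xdeg 𝒜 ℒ)
    have hH : ∀ {i : ℤ} {u : FreeSym K (xdeg 𝒜 ℒ)}, u ∈ FreeSym.grading K (xdeg 𝒜 ℒ) i →
        symBr hA X ((i, symProj ℒ hA u) :: l.map (degMap (symProj ℒ hA)))
          = symProj ℒ hA (extBr X ((i, u) :: l)) := fun {i u} hu =>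
      symBr_map hA X ((i, u) :: l) (homog_cons.2 ⟨hu, hl'⟩)
    rw [← map_mul, hH (hS.mul_mem hv' hw'), hH hv', hH hw',
      (extBr_isMultiDer X).mul _ _ _ _ _ hv' hw' hl', map_add, symProj_units_smul,
      symProj_units_smul, map_mul, map_mul, degL_map_degMap]

theorem symBr_jacobi (l : List (ℤ × SymAlg 𝒜 ℒ)) (hl : Homog (SymAlg.grading 𝒜 ℒ) l) :
    (ush l fun I J => symBr hA X ((1 + degL I, symBr hA X I) :: J)) = 0 := by
  obtain ⟨l, hl', rfl⟩ := exists_map_symProj hA hl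
  rw [ush_map_list (degMap (symProj ℒ hA)) fun _ => rfl]
  refine Eq.trans (ush_congr l fun I J hIJ => ?_) ((ush_map (symProj ℒ hA) l fun I J =>
    extBr X ((1 + degL I, extBr X I) :: J)).symm.trans (by rw [extBr_jacobi X l hl', map_zero]))
  have hI := homog_left hl' hIJ
  have hJ := homog_right hl' hIJ
  rw [degL_map_degMap, symBr_map hA X I hI]
  exact symBr_map hA X ((1 + degL I, extBr X I) :: J)
    (homog_cons.2 ⟨(extBr_isMultiDer X).mem I hI, hJ⟩)

theorem symBr_vec (l : List (ℤ × L)) (hl : Homog ℒ l) :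
    symBr hA X (l.map (degMap (SymAlg.vec 𝒜 ℒ))) = SymAlg.vec 𝒜 ℒ (X.br l) := by
  have h := symBr_map hA X _ (homog_map_degMap (fun _ _ => freeVec_mem 𝒜 ℒ) hl)
  rw [extBr_vec X l hl, symProj_vec, List.map_map] at h
  rw [← h]
  refine congrArg _ (List.map_congr_left fun x _ => ?_)
  exact Prod.ext rfl (symProj_vec ℒ hA x.2).symm

theorem symBr_scalar (l : List (ℤ × L)) (hl : Homog ℒ l) {e : ℤ} {a : A} (ha : a ∈ 𝒜 e) :
    symBr hA X (l.map (degMap (SymAlg.vec 𝒜 ℒ)) ++ [(e, SymAlg.scalar 𝒜 ℒ a)])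
      = SymAlg.scalar 𝒜 ℒ (X.an l a) := by
  have h := symBr_map hA X (l.map (degMap (freeVec 𝒜 ℒ)) ++ [(e, freeScalar 𝒜 ℒ a)])
    (homog_append.2 ⟨homog_map_degMap (fun _ _ => freeVec_mem 𝒜 ℒ) hl,
      homog_cons.2 ⟨freeScalar_mem 𝒜 ℒ ha, homog_nil⟩⟩)
  rw [extBr_scalar X l hl ha, symProj_scalar, List.map_append, List.map_map, List.map_singleton,
    degMap_mk, symProj_scalar] at h
  rw [← h]
  refine congrArg (fun m => symBr hA X (m ++ _)) (List.map_congr_left fun x _ => ?_)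
  exact Prod.ext rfl (symProj_vec ℒ hA x.2).symm

end SymBracket

/-! ### Weights -/

section Weight

theorem iterComm_weight {K B M : Type*} [Field K] [Ring B] [Algebra K B]
    [AddCommGroup M] [Module K M] [Module B M] [IsScalarTower K B M]
    {𝓦 : ℤ → Submodule K B} {𝓜 : ℤ → Submodule K M}
    (h𝓜 : ∀ {i j : ℤ} {a : B} {m : M}, a ∈ 𝓦 i → m ∈ 𝓜 j → a • m ∈ 𝓜 (i + j))
    {n : ℕ} {T : Module.End K M} {s : ℤ} (hT : ∀ e, ∀ m ∈ 𝓜 e, T m ∈ 𝓜 (s + e)) (t : ℤ)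
    (d : Fin n → ℤ) (u : Fin n → B) (wt : Fin n → ℤ) (hu : ∀ i, u i ∈ 𝓦 (wt i)) (e : ℤ) (m : M)
    (hm : m ∈ 𝓜 e) : iterComm T t d u m ∈ 𝓜 (s + ∑ i, wt i + e) := by
  induction n generalizing T s t with
  | zero => simpa [iterComm] using hT e m hm
  | succ n ih =>
    have := ih (T := gradedComm T t (u 0) (d 0)) (s := s + wt 0) (fun e m hm => ?_) (t + d 0)
      (Fin.tail d) (Fin.tail u) (Fin.tail wt) (fun i => hu i.succ)
    · rw [Fin.sum_univ_succ, ← add_assoc]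
      exact this
    · change T (u 0 • m) - (t * d 0).negOnePow • (u 0 • T m) ∈ _
      refine Submodule.sub_mem _ ?_ ((Submodule.smul_mem_iff' _ _).2 ?_)
      · rw [add_assoc]
        exact hT _ _ (h𝓜 (hu 0) hm)
      · rw [add_comm s, add_assoc]
        exact h𝓜 (hu 0) (hT _ _ hm)

variable {K A L : Type*} [Field K] [Ring A] [Algebra K A]
  [AddCommGroup L] [Module K L] [Module A L]

variable (𝒜 : ℤ → Submodule K A) (ℒ : ℤ → Submodule K L)

/-- The elements of weight `n` of the free graded commutative algebra. -/
def freeWeight (n : ℤ) : Submodule K (FreeSym K (xdeg 𝒜 ℒ)) :=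
  Submodule.span K {u | ∃ w : List (HIdx 𝒜 ⊕ HIdx ℒ),
    (w.map fun i => if i.isLeft then (0 : ℤ) else 1).sum = n ∧
      u = mulL (w.map (FreeSym.sym K (xdeg 𝒜 ℒ)))}

variable {𝒜 ℒ}

theorem gen_mem_freeWeight (i : HIdx 𝒜 ⊕ HIdx ℒ) :
    FreeSym.gen K (xdeg 𝒜 ℒ) i ∈ freeWeight 𝒜 ℒ (if i.isLeft then 0 else 1) :=
  Submodule.subset_span ⟨[i], by simp, by simp [FreeSym.sym]⟩

theorem mul_mem_freeWeight {m n : ℤ} {u v : FreeSym K (xdeg 𝒜 ℒ)} (hu : u ∈ freeWeight 𝒜 ℒ m)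
    (hv : v ∈ freeWeight 𝒜 ℒ n) : u * v ∈ freeWeight 𝒜 ℒ (m + n) := by
  induction hu using Submodule.span_induction with
  | zero => simp
  | add x y _ _ hx hy => rw [add_mul]; exact Submodule.add_mem _ hx hy
  | smul c x _ hx => rw [smul_mul_assoc]; exact Submodule.smul_mem _ _ hx
  | mem x hx =>
    obtain ⟨w, rfl, rfl⟩ := hx
    induction hv using Submodule.span_induction with
    | zero => simp
    | add x y _ _ hx hy => rw [mul_add]; exact Submodule.add_mem _ hx hy
    | smul c x _ hx => rw [mul_smul_comm]; exact Submodule.smul_mem _ _ hx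
    | mem y hy =>
      obtain ⟨w', rfl, rfl⟩ := hy
      exact Submodule.subset_span ⟨w ++ w', by simp, by rw [List.map_append, mulL_append]⟩

theorem one_mem_freeWeight : (1 : FreeSym K (xdeg 𝒜 ℒ)) ∈ freeWeight 𝒜 ℒ 0 :=
  Submodule.subset_span ⟨[], by simp, by simp⟩

theorem freeWeight_neg {n : ℤ} (hn : n < 0) : freeWeight 𝒜 ℒ n = ⊥ := by
  rw [eq_bot_iff]
  refine Submodule.span_le.2 ?_
  rintro _ ⟨w, hw, -⟩
  have : 0 ≤ (w.map fun i => if i.isLeft then (0 : ℤ) else 1).sum :=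
    List.sum_nonneg fun x hx => by
      obtain ⟨i, -, rfl⟩ := List.mem_map.1 hx
      split_ifs <;> simp
  omega

variable [DirectSum.Decomposition 𝒜] [DirectSum.Decomposition ℒ]

theorem freeScalar_mem_freeWeight (a : A) : freeScalar 𝒜 ℒ a ∈ freeWeight 𝒜 ℒ 0 := by
  suffices h : (⊤ : Submodule K A) ≤ (freeWeight 𝒜 ℒ 0).comap (freeScalar 𝒜 ℒ) from h trivial
  rw [← (hbasis 𝒜).span_eq]
  refine Submodule.span_le.2 ?_
  rintro _ ⟨i, rfl⟩
  rw [SetLike.mem_coe, Submodule.mem_comap, freeScalar_hbasis]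
  exact gen_mem_freeWeight (Sum.inl i)

theorem freeVec_mem_freeWeight (ξ : L) : freeVec 𝒜 ℒ ξ ∈ freeWeight 𝒜 ℒ 1 := by
  suffices h : (⊤ : Submodule K L) ≤ (freeWeight 𝒜 ℒ 1).comap (freeVec 𝒜 ℒ) from h trivial
  rw [← (hbasis ℒ).span_eq]
  refine Submodule.span_le.2 ?_
  rintro _ ⟨i, rfl⟩
  rw [SetLike.mem_coe, Submodule.mem_comap, freeVec_hbasis]
  exact gen_mem_freeWeight (Sum.inr i)

theorem sum_map_isLeft {α β : Type*} (l : List (α ⊕ β)) :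
    (l.map fun i => if i.isLeft then (0 : ℤ) else 1).sum = l.length - l.countP Sum.isLeft := by
  induction l with
  | nil => rfl
  | cons x l ih =>
    rw [List.map_cons, List.sum_cons, ih, List.countP_cons]
    split_ifs <;> simp <;> ring

/-- A word of length `k` with `c` letters from `A` has weight `k - c`. Its bracket has weight `1`
for `c = 0` and `0` for `c = 1`, so in both cases `1 - c = 1 - k + (k - c)`. -/
theorem extF_mem_freeWeight (X : LRInfty 𝒜 ℒ) (k : ℕ) (l : List (HIdx 𝒜 ⊕ HIdx ℒ)) :
    (extF X k).1 l ∈ freeWeight 𝒜 ℒ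
      (1 - k + (l.map fun i => if i.isLeft then (0 : ℤ) else 1).sum) := by
  by_cases hk : l.length = k
  · have h := extF_mem_linPart X k l
    rw [sum_map_isLeft, hk]
    unfold linPart at h
    split_ifs at h with h0 h1
    · obtain ⟨ξ, -, h⟩ := h
      simp only at h0
      rw [← h, h0]
      simpa using freeVec_mem_freeWeight ξ
    · obtain ⟨a, -, h⟩ := h
      simp only at h1
      rw [← h, h1]
      simpa using freeScalar_mem_freeWeight a
    · rw [(Submodule.mem_bot K).1 h]
      exact Submodule.zero_mem _
  · rw [extF_length X k l hk]
    exact Submodule.zero_mem _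

theorem freeD_mem_freeWeight (X : LRInfty 𝒜 ℒ) (k : ℕ) (n : ℤ) (u : FreeSym K (xdeg 𝒜 ℒ))
    (hu : u ∈ freeWeight 𝒜 ℒ n) : freeD (extF X) k u ∈ freeWeight 𝒜 ℒ (1 - k + n) := by
  induction hu using Submodule.span_induction with
  | zero => simp
  | add x y _ _ hx hy => rw [map_add]; exact Submodule.add_mem _ hx hy
  | smul c x _ hx => rw [map_smul]; exact Submodule.smul_mem _ _ hx
  | mem x hx =>
    obtain ⟨w, rfl, rfl⟩ := hx
    have := freeOp_mem (extF_mem_freeWeight X k)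
      (fun i e u hu => mul_mem_freeWeight (gen_mem_freeWeight i) hu) [] w
    rw [List.map_nil, List.sum_nil, add_zero] at this
    exact this

end Weight

/-! ### Weights on the graded symmetric algebra -/

section SymWeight

variable {K A L : Type*} [Field K] [Ring A] [Algebra K A]
  [AddCommGroup L] [Module K L] [Module A L]
  {𝒜 : ℤ → Submodule K A} {ℒ : ℤ → Submodule K L} [GradedAlgebra 𝒜] [DirectSum.Decomposition ℒ]
  (hA : ∀ (i j : ℤ) (a b : A), a ∈ 𝒜 i → b ∈ 𝒜 j →
      a * b = Int.negOnePow (i * j) • (b * a)) (X : LRInfty 𝒜 ℒ)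

theorem prod_cons (ξ : L) {l : ℕ} (ζ : Fin l → L) :
    SymAlg.prod 𝒜 ℒ (Fin.cons ξ ζ) = SymAlg.vec 𝒜 ℒ ξ * SymAlg.prod 𝒜 ℒ ζ := by
  simp [SymAlg.prod, List.ofFn_succ]

theorem vec_mul_mem_weight {j : ℤ} {ζ : L} (hζ : ζ ∈ ℒ j) {l : ℕ} {u : SymAlg 𝒜 ℒ}
    (hu : u ∈ SymAlg.weight 𝒜 ℒ l) : SymAlg.vec 𝒜 ℒ ζ * u ∈ SymAlg.weight 𝒜 ℒ (l + 1) := by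
  induction hu using Submodule.span_induction with
  | zero => simp
  | add x y _ _ hx hy => rw [mul_add]; exact Submodule.add_mem _ hx hy
  | smul c x _ hx => rw [mul_smul_comm]; exact Submodule.smul_mem _ _ hx
  | mem x hx =>
    obtain ⟨a, ξ, rfl⟩ := hx
    refine homogeneous_induction 𝒜 (p := fun a => SymAlg.vec 𝒜 ℒ ζ *
      (SymAlg.scalar 𝒜 ℒ a * SymAlg.prod 𝒜 ℒ ξ) ∈ SymAlg.weight 𝒜 ℒ (l + 1))
      (fun a b ha hb => ?_) (fun i a ha => ?_) a
    · rw [map_add, add_mul, mul_add]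
      exact Submodule.add_mem _ ha hb
    · have h := SymAlg.scalar_mul_vec ha hζ
      have h' : SymAlg.vec 𝒜 ℒ ζ * SymAlg.scalar 𝒜 ℒ a
          = (i * j).negOnePow • (SymAlg.scalar 𝒜 ℒ a * SymAlg.vec 𝒜 ℒ ζ) := by
        rw [h, smul_smul, ← Int.negOnePow_add, negOnePow_congr (b := 0) ⟨i * j, by ring⟩,
          Int.negOnePow_zero, one_smul]
      rw [← mul_assoc, h', smul_mul_assoc, mul_assoc, ← prod_cons]
      exact (Submodule.smul_mem_iff' _ _).2 (Submodule.subset_span ⟨a, _, rfl⟩)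

theorem scalar_mul_mem_weight (a : A) {l : ℕ} {u : SymAlg 𝒜 ℒ}
    (hu : u ∈ SymAlg.weight 𝒜 ℒ l) : SymAlg.scalar 𝒜 ℒ a * u ∈ SymAlg.weight 𝒜 ℒ l := by
  induction hu using Submodule.span_induction with
  | zero => simp
  | add x y _ _ hx hy => rw [mul_add]; exact Submodule.add_mem _ hx hy
  | smul c x _ hx => rw [mul_smul_comm]; exact Submodule.smul_mem _ _ hx
  | mem x hx =>
    obtain ⟨b, ξ, rfl⟩ := hx
    rw [← mul_assoc, ← SymAlg.scalar_mul]
    exact Submodule.subset_span ⟨a * b, ξ, rfl⟩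

theorem symProj_freeWeight_le (n : ℕ) :
    (freeWeight 𝒜 ℒ (n : ℤ)).map (symProj ℒ hA).toLinearMap ≤ SymAlg.weight 𝒜 ℒ n := by
  rw [freeWeight, Submodule.map_span]
  refine Submodule.span_le.2 ?_
  rintro _ ⟨_, ⟨w, hw, rfl⟩, rfl⟩
  rw [AlgHom.toLinearMap_apply]
  induction w generalizing n with
  | nil =>
    have hn : n = 0 := by
      rw [List.map_nil, List.sum_nil] at hw
      exact_mod_cast hw.symm
    rw [hn, List.map_nil, mulL_nil, map_one, SetLike.mem_coe, ← SymAlg.scalar_one 𝒜 ℒ]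
    exact Submodule.subset_span ⟨1, Fin.elim0, by simp [SymAlg.prod]⟩
  | cons i w ih =>
    rw [List.map_cons, mulL_cons, map_mul]
    change symProj ℒ hA (FreeSym.gen K (xdeg 𝒜 ℒ) i) * _ ∈ _
    rw [symProj_gen]
    rw [List.map_cons, List.sum_cons] at hw
    rcases i with i | i
    · exact scalar_mul_mem_weight _ (ih n (by simpa using hw))
    · have hw' : (1 : ℤ) + (w.map fun i => if i.isLeft then (0 : ℤ) else 1).sum = n := hw
      rw [sum_map_isLeft] at hw'
      have hc := List.countP_le_length (p := Sum.isLeft) (l := w)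
      obtain ⟨m, rfl⟩ : ∃ m, n = m + 1 := ⟨n - 1, by omega⟩
      exact vec_mul_mem_weight (hbasis_mem ℒ i) (ih m (by
        rw [sum_map_isLeft]; push_cast at hw'; omega))

theorem weight_le (n : ℕ) :
    SymAlg.weight 𝒜 ℒ n ≤ (freeWeight 𝒜 ℒ (n : ℤ)).map (symProj ℒ hA).toLinearMap := by
  refine Submodule.span_le.2 ?_
  rintro _ ⟨a, ξ, rfl⟩
  refine ⟨freeScalar 𝒜 ℒ a * (List.ofFn fun t => freeVec 𝒜 ℒ (ξ t)).prod, ?_, ?_⟩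
  · rw [← zero_add (n : ℤ)]
    refine mul_mem_freeWeight (freeScalar_mem_freeWeight a) ?_
    induction n with
    | zero => simpa using one_mem_freeWeight
    | succ n ih =>
      rw [List.ofFn_succ, List.prod_cons, Nat.cast_succ, add_comm]
      exact mul_mem_freeWeight (freeVec_mem_freeWeight _) (ih _)
  · rw [AlgHom.toLinearMap_apply, map_mul, symProj_scalar, map_list_prod, List.map_ofFn]
    congr 2
    refine congrArg List.ofFn (funext fun t => symProj_vec ℒ hA _)

variable [CharZero K] [SetLike.GradedSMul 𝒜 ℒ]

/-- The weight is an integer on purpose: nonnegative values give the statement on weights, and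
negative ones the vanishing, because there the free algebra has no elements. -/
theorem symBracket_mem_freeWeight {k : ℕ} (l : Fin k → ℕ) (u : Fin k → SymAlg 𝒜 ℒ)
    (hu : ∀ t, u t ∈ SymAlg.weight 𝒜 ℒ (l t)) : symBracket hA X k u
      ∈ (freeWeight 𝒜 ℒ (1 - k + ∑ t, (l t : ℤ))).map (symProj ℒ hA).toLinearMap := by
  refine multilinear_mem_of_span _ (fun t => {u | ∃ w : List (HIdx 𝒜 ⊕ HIdx ℒ),
    (w.map fun i => if i.isLeft then (0 : ℤ) else 1).sum = l t ∧
      u = symProj ℒ hA (mulL (w.map (FreeSym.sym K (xdeg 𝒜 ℒ))))}) _ (fun v hv => ?_) u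
    fun t => ?_
  · choose w hw hv using hv
    obtain rfl : v = fun t => symProj ℒ hA (mulL ((w t).map (FreeSym.sym K (xdeg 𝒜 ℒ)))) :=
      funext hv
    rw [symBracket_symProj hA X (fun t => degL ((w t).map (FreeSym.sym K (xdeg 𝒜 ℒ)))) _
      fun t => FreeSym.isGradedComm.mulL_mem (homog_map_sym (w t))]
    refine Submodule.mem_map_of_mem ?_
    rw [extBr, freeBr, List.length_ofFn, ← iterComm_eq_itL]
    have := iterComm_weight (𝓦 := freeWeight 𝒜 ℒ) (𝓜 := freeWeight 𝒜 ℒ)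
      (fun ha hm => mul_mem_freeWeight ha hm) (freeD_mem_freeWeight X k) 1
      (fun t => degL ((w t).map (FreeSym.sym K (xdeg 𝒜 ℒ))))
      (fun t => mulL ((w t).map (FreeSym.sym K (xdeg 𝒜 ℒ)))) (fun t => (l t : ℤ))
      (fun t => Submodule.subset_span ⟨w t, hw t, rfl⟩) 0 1 one_mem_freeWeight
    rwa [add_zero] at this
  · have := weight_le hA (l t) (hu t)
    rw [freeWeight, Submodule.map_span] at this
    refine Submodule.span_mono ?_ this
    rintro _ ⟨_, ⟨w, hw, rfl⟩, rfl⟩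
    exact ⟨w, hw, rfl⟩

end SymWeight

/-! ### The Poisson extension -/

section PoissonExtension

variable {K A L : Type*} [Field K] [Ring A] [Algebra K A]
  [AddCommGroup L] [Module K L] [Module A L]
  {𝒜 : ℤ → Submodule K A} {ℒ : ℤ → Submodule K L}

theorem IsGradedMul.koszul {V Y : Type*} [AddCommGroup V] [Module K V] [AddCommGroup Y] [Module K Y]
    {𝒱 : ℤ → Submodule K V} {f : List (ℤ × V) → Y} (hf : IsGradedMul 𝒱 f) {n : ℕ} (d : Fin n → ℤ)
    (u : Fin n → V) (hu : ∀ t, u t ∈ 𝒱 (d t)) (σ : Equiv.Perm (Fin n)) :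
    f (List.ofFn fun t => (d (σ t), u (σ t)))
      = SHLR.koszul σ d • f (List.ofFn fun t => (d t, u t)) := by
  classical
  -- Extension by zero outside homogeneous lists makes the function graded symmetric without
  -- restrictions.
  have hs : GradedSymm (fun l : List (ℤ × V) => if Homog 𝒱 l then f l else 0) := by
    intro l₁ l₂ x y
    have h' : Homog 𝒱 (l₁ ++ x :: y :: l₂) ↔ Homog 𝒱 (l₁ ++ y :: x :: l₂) :=
      homog_perm ((List.Perm.swap y x l₂).append_left l₁)
    by_cases hl : Homog 𝒱 (l₁ ++ x :: y :: l₂)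
    · simp only [if_pos hl, if_pos (h'.1 hl), hf.swap _ _ _ _ hl]
    · simp only [if_neg hl, if_neg (fun h'' => hl (h'.2 h'')), smul_zero]
  have := GradedSymm.perm σ (fun t => (d t, u t)) hs
  rw [if_pos (homog_ofFn d u hu)] at this
  rw [← this]
  exact (if_pos (homog_ofFn _ _ fun t => hu (σ t))).symm

variable [GradedAlgebra 𝒜] [DirectSum.Decomposition ℒ]
  (hA : ∀ (i j : ℤ) (a b : A), a ∈ 𝒜 i → b ∈ 𝒜 j →
      a * b = Int.negOnePow (i * j) • (b * a)) (X : LRInfty 𝒜 ℒ)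
  [CharZero K] [SetLike.GradedSMul 𝒜 ℒ]

/-- The Poisson extension. -/
def symLR : LRInfty (groundGrading K) (SymAlg.grading 𝒜 ℒ) where
  bracket := symBracket hA X
  -- The anchors take values in the `K`-linear derivations of `K`, which are zero.
  anchor _ := 0
  bracket_zero := by
    ext v
    have h := symBr_vec hA X [] homog_nil
    rw [List.map_nil, symBr, evalL_nil _ v, LRInfty.br, evalL_nil _ Fin.elim0, X.bracket_zero] at h
    rw [h, MultilinearMap.zero_apply, map_zero, MultilinearMap.zero_apply]
  bracket_degree k d u hu := by
    have := (symBr_isMultiDer hA X).mem _ (homog_ofFn d u hu)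
    rwa [symBr, evalL_ofFn, degL_ofFn] at this
  bracket_symm k d u hu σ := by
    have := (symBr_isMultiDer hA X).isGradedMul.koszul d u hu σ
    rwa [symBr, evalL_ofFn, evalL_ofFn] at this
  anchor_degree _ _ _ _ _ _ _ := Submodule.zero_mem _
  anchor_symm _ _ _ _ _ := by simp
  anchor_linear _ _ _ _ _ _ _ := by simp
  anchor_derivation _ _ _ _ _ _ _ _ := by simp
  bracket_leibniz n d u hu e c hc v := by
    have h0 : symBracket hA X (n + 1) (Fin.snoc (α := fun _ => SymAlg 𝒜 ℒ) u (c • v))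
        = c • symBracket hA X (n + 1) (Fin.snoc (α := fun _ => SymAlg 𝒜 ℒ) u v) := by
      simpa using (symBracket hA X (n + 1)).snoc_smul u c v
    rw [h0]
    -- `K` is concentrated in degree zero: either the sign is trivial or the scalar is zero.
    by_cases he : e = 0
    · simp [he]
    · have hc0 : c = 0 := by
        rw [groundGrading, if_neg he] at hc
        exact (Submodule.mem_bot K).1 hc
      simp [hc0]
  jacobi k d u hu := by
    have h := symBr_jacobi hA X _ (homog_ofFn d u hu)
    have h' := sum_unshuffles_comp (fun n => ⇑(symBracket hA X n)) (fun n => ⇑(symBracket hA X n))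
      d u fun I => 1 + degL I
    exact h'.trans h
  anchor_jacobi n d u hu := by
    rw [Finset.sum_eq_zero, Finset.sum_eq_zero, add_zero]
    · intro i _
      refine Finset.sum_eq_zero fun σ _ => ?_
      rw [MultilinearMap.zero_apply, smul_zero]
    · intro i _
      refine Finset.sum_eq_zero fun σ _ => ?_
      rw [MultilinearMap.zero_apply, zero_mul, smul_zero]

theorem IsMultiDer.mul_last {B : Type*} [Ring B] [Algebra K B] {𝓑 : ℤ → Submodule K B}
    (h𝓑 : IsGradedComm 𝓑) {br : List (ℤ × B) → B} (h : IsMultiDer 𝓑 br) {e f : ℤ} {v w : B}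
    {l : List (ℤ × B)} (hv : v ∈ 𝓑 e) (hw : w ∈ 𝓑 f) (hl : Homog 𝓑 l) :
    br (l ++ [(e + f, v * w)])
      = ((1 + degL l) * e).negOnePow • (v * br (l ++ [(f, w)])) + br (l ++ [(e, v)]) * w := by
  have hvw : Homog 𝓑 ((e + f, v * w) :: l) := homog_cons.2 ⟨h𝓑.mul_mem hv hw, hl⟩
  have hv' : Homog 𝓑 ((e, v) :: l) := homog_cons.2 ⟨hv, hl⟩
  have hw' : Homog 𝓑 ((f, w) :: l) := homog_cons.2 ⟨hw, hl⟩
  rw [h.append_singleton hvw, h.append_singleton hv', h.append_singleton hw',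
    h.mul e f v w l hv hw hl]
  simp only [smul_add, smul_smul, mul_smul_comm, smul_mul_assoc, ← Int.negOnePow_add]
  rw [add_comm]
  congr 2
  · refine negOnePow_congr ?_
    rw [show (e + f) * degL l + e - ((1 + degL l) * e + f * degL l) = 0 by ring]
    exact Even.zero
  · refine negOnePow_congr ?_
    rw [show (e + f) * degL l + f * degL l - e * degL l = 2 * (f * degL l) by ring]
    exact even_two_mul _

/-- A Poisson extension has its Leibniz rule in the last entry, `IsMultiDer` in the first; both
sides are compared by moving that entry through the list. -/
theorem isMultiDer_of_mul_last {B : Type*} [Ring B] [Algebra K B] {𝓑 : ℤ → Submodule K B}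
    (h𝓑 : IsGradedComm 𝓑) {br : List (ℤ × B) → B} (h : IsGradedMul 𝓑 br)
    (hmem : ∀ l, Homog 𝓑 l → br l ∈ 𝓑 (1 + degL l))
    (hmul : ∀ e f v w l, v ∈ 𝓑 e → w ∈ 𝓑 f → Homog 𝓑 l → br (l ++ [(e + f, v * w)])
      = ((1 + degL l) * e).negOnePow • (v * br (l ++ [(f, w)])) + br (l ++ [(e, v)]) * w) :
    IsMultiDer 𝓑 br where
  mem := hmem
  swap := h.swap
  add := h.add
  smul := h.smul
  mul e f v w l hv hw hl := by
    have hvw : Homog 𝓑 ((e + f, v * w) :: l) := homog_cons.2 ⟨h𝓑.mul_mem hv hw, hl⟩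
    have hv' : Homog 𝓑 ((e, v) :: l) := homog_cons.2 ⟨hv, hl⟩
    have hw' : Homog 𝓑 ((f, w) :: l) := homog_cons.2 ⟨hw, hl⟩
    have h1 := hmul e f v w l hv hw hl
    rw [h.append_singleton hvw, h.append_singleton hv', h.append_singleton hw'] at h1
    have h2 := congrArg (fun x => ((e + f) * degL l).negOnePow • x) h1
    simp only [smul_add, smul_smul, mul_smul_comm, smul_mul_assoc, ← Int.negOnePow_add] at h2
    rw [Int.negOnePow_even _ (Even.add_self _), one_smul] at h2
    rw [h2, add_comm]
    congr 2
    · refine negOnePow_congr ?_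
      rw [show (e + f) * degL l + e * degL l - f * degL l = 2 * (e * degL l) by ring]
      exact even_two_mul _
    · refine negOnePow_congr ?_
      rw [show (e + f) * degL l + ((1 + degL l) * e + f * degL l) - e
        = 2 * ((e + f) * degL l) by ring]
      exact even_two_mul _

theorem span_homogeneous {V : Type*} [AddCommGroup V] [Module K V]
    (𝒱 : ℤ → Submodule K V) [DirectSum.Decomposition 𝒱] :
    Submodule.span K {v | ∃ e, v ∈ 𝒱 e} = ⊤ := by
  refine eq_top_iff.2 fun v _ => ?_
  induction v using homogeneous_induction 𝒱 with
  | hadd u v hu hv => exact Submodule.add_mem _ (hu trivial) (hv trivial)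
  | h e v hv => exact Submodule.subset_span ⟨e, hv⟩

theorem multilinear_ext_of_homogeneous {V Y : Type*} [AddCommGroup V] [Module K V] [AddCommGroup Y]
    [Module K Y] {𝒱 : ℤ → Submodule K V} (h𝒱 : Submodule.span K {v | ∃ e, v ∈ 𝒱 e} = ⊤) {n : ℕ}
    {f g : MultilinearMap K (fun _ : Fin n => V) Y}
    (h : ∀ (d : Fin n → ℤ) (v : Fin n → V), (∀ t, v t ∈ 𝒱 (d t)) → f v = g v) : f = g := by
  refine multilinear_ext_of_span _ h𝒱 fun v hv => ?_
  choose d hd using hv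
  exact h d v hd

theorem symLR_isPoissonExtension : IsPoissonExtension X (symLR hA X) where
  vec k ξ := by
    have h : ((symBracket hA X k).compLinearMap fun _ => SymAlg.vec 𝒜 ℒ)
        = (SymAlg.vec 𝒜 ℒ).compMultilinearMap (X.bracket k) := by
      refine multilinear_ext_of_homogeneous (span_homogeneous ℒ) fun d ξ hξ => ?_
      have := symBr_vec hA X _ (homog_ofFn d ξ hξ)
      rw [List.map_ofFn, symBr, LRInfty.br, evalL_ofFn, evalL_ofFn] at this
      exact this
    exact congrArg (fun f => f ξ) h
  scalar n ξ a := by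
    induction a using homogeneous_induction 𝒜 with
    | hadd a b ha hb =>
      rw [map_add, MultilinearMap.snoc_add, ha, hb, map_add, map_add]
    | h e a ha =>
      have h : (LinearMap.applyₗ (SymAlg.scalar 𝒜 ℒ a)).compMultilinearMap
          ((symBracket hA X (n + 1)).curryRight.compLinearMap fun _ => SymAlg.vec 𝒜 ℒ)
          = (SymAlg.scalar 𝒜 ℒ ∘ₗ LinearMap.applyₗ a).compMultilinearMap (X.anchor n) := by
        refine multilinear_ext_of_homogeneous (span_homogeneous ℒ) fun d ξ hξ => ?_
        have := symBr_scalar hA X _ (homog_ofFn d ξ hξ) ha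
        rw [List.map_ofFn, symBr, LRInfty.an] at this
        erw [evalL_ofFn_append, evalL_ofFn] at this
        exact this
      exact congrArg (fun f => f ξ) h
  derivation n d u hu e v hv w := by
    have hw : w ∈ Submodule.span K {u | ∃ e, u ∈ SymAlg.grading 𝒜 ℒ e} := by
      rw [span_homogeneous_sym hA]
      trivial
    have hsm (c : K) (x : SymAlg 𝒜 ℒ) :
        (symLR hA X).bracket (n + 1) (Fin.snoc (α := fun _ => SymAlg 𝒜 ℒ) u (c • x))
          = c • (symLR hA X).bracket (n + 1) (Fin.snoc (α := fun _ => SymAlg 𝒜 ℒ) u x) :=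
      MultilinearMap.snoc_smul _ _ _ _
    have had (x y : SymAlg 𝒜 ℒ) :
        (symLR hA X).bracket (n + 1) (Fin.snoc (α := fun _ => SymAlg 𝒜 ℒ) u (x + y))
          = (symLR hA X).bracket (n + 1) (Fin.snoc (α := fun _ => SymAlg 𝒜 ℒ) u x)
            + (symLR hA X).bracket (n + 1) (Fin.snoc (α := fun _ => SymAlg 𝒜 ℒ) u y) :=
      MultilinearMap.snoc_add _ _ _ _
    have hze : (symLR hA X).bracket (n + 1) (Fin.snoc (α := fun _ => SymAlg 𝒜 ℒ) u 0) = 0 := by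
      simpa using hsm 0 0
    induction hw using Submodule.span_induction with
    | mem w hw =>
      obtain ⟨f, hw⟩ := hw
      have := (symBr_isMultiDer hA X).mul_last (SymAlg.isGradedComm hA) hv hw (homog_ofFn d u hu)
      rw [symBr, evalL_ofFn_append, evalL_ofFn_append, evalL_ofFn_append, degL_ofFn] at this
      exact this
    | zero => simp only [mul_zero, hze, smul_zero, add_zero]
    | add x y _ _ hx hy =>
      rw [mul_add, had, had, hx, hy]
      simp only [mul_add, smul_add]
      abel
    | smul c x _ hx =>
      rw [mul_smul_comm, hsm, hsm, hx]
      simp only [mul_smul_comm, smul_add]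
      rw [smul_comm c]
  weight k l u hu m hm := by
    have h := symBracket_mem_freeWeight hA X l u hu
    rw [show (1 - k + ∑ t, (l t : ℤ)) = (m : ℤ) by
      have : ((m + k : ℕ) : ℤ) = ((∑ t, l t + 1 : ℕ) : ℤ) := by rw [hm]
      push_cast at this
      linarith] at h
    exact symProj_freeWeight_le hA m h
  weight_neg k l u hu hk := by
    have h := symBracket_mem_freeWeight hA X l u hu
    rw [freeWeight_neg, Submodule.map_bot] at h
    · exact (Submodule.mem_bot K).1 h
    · have : ((∑ t, l t + 1 : ℕ) : ℤ) < k := by exact_mod_cast hk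
      push_cast at this
      linarith

theorem scalar_mem_weight (a : A) : SymAlg.scalar 𝒜 ℒ a ∈ SymAlg.weight 𝒜 ℒ 0 :=
  Submodule.subset_span ⟨a, Fin.elim0, by simp [SymAlg.prod]⟩

theorem vec_mem_weight (ξ : L) : SymAlg.vec 𝒜 ℒ ξ ∈ SymAlg.weight 𝒜 ℒ 1 :=
  Submodule.subset_span ⟨1, fun _ => ξ, by simp [SymAlg.prod, SymAlg.scalar_one]⟩

/-- The three alternatives are: no scalar entry, one scalar moved to the end, and two scalars moved
to the front. They are the cases in which the axioms of a Poisson extension fix the bracket. -/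
theorem SymAlg.perm_of_isGen (l : List (ℤ × SymAlg 𝒜 ℒ)) (hl : ∀ x ∈ l, SymAlg.IsGen 𝒜 ℒ x) :
    (∃ l', Homog ℒ l' ∧ l = l'.map (degMap (SymAlg.vec 𝒜 ℒ)))
    ∨ (∃ l' e, ∃ a ∈ 𝒜 e, Homog ℒ l' ∧
        (l'.map (degMap (SymAlg.vec 𝒜 ℒ)) ++ [(e, SymAlg.scalar 𝒜 ℒ a)]).Perm l)
    ∨ (∃ l' e f a b, (∀ x ∈ l', SymAlg.IsGen 𝒜 ℒ x) ∧
        ((e, SymAlg.scalar 𝒜 ℒ a) :: (f, SymAlg.scalar 𝒜 ℒ b) :: l').Perm l) := by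
  induction l with
  | nil => exact Or.inl ⟨[], homog_nil, rfl⟩
  | cons x l ih =>
    obtain ⟨i, x⟩ := x
    have hx := hl _ (List.mem_cons_self ..)
    rcases ih fun y hy => hl y (List.mem_cons_of_mem _ hy) with
      ⟨l', hl', rfl⟩ | ⟨l', e, a, ha, hl', hp⟩ | ⟨l', e, f, a, b, hl', hp⟩
    · rcases hx with ⟨a, ha, rfl⟩ | ⟨ξ, hξ, rfl⟩
      · exact Or.inr (Or.inl ⟨l', i, a, ha, hl', List.perm_append_singleton _ _⟩)
      · exact Or.inl ⟨(i, ξ) :: l', homog_cons.2 ⟨hξ, hl'⟩, rfl⟩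
    · rcases hx with ⟨b, hb, rfl⟩ | ⟨ξ, hξ, rfl⟩
      · refine Or.inr (Or.inr ⟨l'.map (degMap (SymAlg.vec 𝒜 ℒ)), i, e, b, a, ?_,
          (((List.perm_append_singleton _ _).symm.trans hp).cons _)⟩)
        intro y hy
        obtain ⟨z, hz, rfl⟩ := List.mem_map.1 hy
        exact Or.inr ⟨z.2, hl' z hz, rfl⟩
      · exact Or.inr (Or.inl ⟨(i, ξ) :: l', e, a, ha, homog_cons.2 ⟨hξ, hl'⟩, hp.cons _⟩)
    · refine Or.inr (Or.inr ⟨(i, x) :: l', e, f, a, b, ?_, ?_⟩)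
      · intro y hy
        rcases List.mem_cons.1 hy with rfl | hy
        · exact hx
        · exact hl' y hy
      · exact ((List.perm_middle (l₁ := [_, _])).trans (hp.cons _))

variable {X}

theorem IsPoissonExtension.isMultiDer (hA : ∀ (i j : ℤ) (a b : A), a ∈ 𝒜 i → b ∈ 𝒜 j →
      a * b = Int.negOnePow (i * j) • (b * a)) {Λ : LRInfty (groundGrading K) (SymAlg.grading 𝒜 ℒ)}
    (h : IsPoissonExtension X Λ) : IsMultiDer (SymAlg.grading 𝒜 ℒ) Λ.br := by
  refine isMultiDer_of_mul_last (SymAlg.isGradedComm hA)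
    (isGradedMul_evalL (fun n => Λ.bracket n) Λ.bracket_symm) Λ.br_mem ?_
  intro e f v w l hv hw hl
  obtain ⟨n, d, u, hu, rfl⟩ := exists_ofFn_homog hl
  have := h.derivation n d u hu e v hv w
  rw [LRInfty.br, evalL_ofFn_append, evalL_ofFn_append, evalL_ofFn_append, degL_ofFn]
  exact this

theorem IsPoissonExtension.br_vec {Λ : LRInfty (groundGrading K) (SymAlg.grading 𝒜 ℒ)}
    (h : IsPoissonExtension X Λ) (l : List (ℤ × L)) :
    Λ.br (l.map (degMap (SymAlg.vec 𝒜 ℒ))) = SymAlg.vec 𝒜 ℒ (X.br l) := by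
  obtain ⟨n, d, ξ, rfl⟩ := exists_ofFn l
  rw [List.map_ofFn, LRInfty.br, LRInfty.br, evalL_ofFn, evalL_ofFn]
  exact h.vec n ξ

theorem IsPoissonExtension.br_scalar {Λ : LRInfty (groundGrading K) (SymAlg.grading 𝒜 ℒ)}
    (h : IsPoissonExtension X Λ) (l : List (ℤ × L)) (e : ℤ) (a : A) :
    Λ.br (l.map (degMap (SymAlg.vec 𝒜 ℒ)) ++ [(e, SymAlg.scalar 𝒜 ℒ a)])
      = SymAlg.scalar 𝒜 ℒ (X.an l a) := by
  obtain ⟨n, d, ξ, rfl⟩ := exists_ofFn l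
  rw [List.map_ofFn, LRInfty.br, LRInfty.an, evalL_ofFn_append, evalL_ofFn]
  exact h.scalar n ξ a

/-- If `l` has `n` entries, the total weight is at most `n` while the bracket has `n + 2` arguments,
so the target exponent is at most `-1`. -/
theorem IsPoissonExtension.br_scalar_scalar {Λ : LRInfty (groundGrading K) (SymAlg.grading 𝒜 ℒ)}
    (h : IsPoissonExtension X Λ) (e f : ℤ) (a b : A) (l : List (ℤ × SymAlg 𝒜 ℒ))
    (hl : ∀ x ∈ l, SymAlg.IsGen 𝒜 ℒ x) :
    Λ.br ((e, SymAlg.scalar 𝒜 ℒ a) :: (f, SymAlg.scalar 𝒜 ℒ b) :: l) = 0 := by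
  have hw : ∀ t : Fin l.length, ∃ n ≤ 1, (l.get t).2 ∈ SymAlg.weight 𝒜 ℒ n := by
    intro t
    rcases hl _ (List.get_mem l t) with ⟨a, -, ha⟩ | ⟨ξ, -, hξ⟩
    · exact ⟨0, zero_le_one, by rw [ha]; exact scalar_mem_weight a⟩
    · exact ⟨1, le_rfl, by rw [hξ]; exact vec_mem_weight ξ⟩
  choose n hn hw using hw
  rw [LRInfty.br, evalL_cons]
  refine h.weight_neg (l.length + 2) (Fin.cons 0 (Fin.cons 0 n)) _
    (Fin.cases (scalar_mem_weight a) (Fin.cases (scalar_mem_weight b) hw)) ?_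
  rw [Fin.sum_cons, Fin.sum_cons]
  have : ∑ t, n t ≤ l.length := by
    simpa using Finset.sum_le_card_nsmul Finset.univ n 1 fun t _ => hn t
  omega

theorem IsPoissonExtension.br_eq (hA : ∀ (i j : ℤ) (a b : A), a ∈ 𝒜 i → b ∈ 𝒜 j →
      a * b = Int.negOnePow (i * j) • (b * a))
    {Λ Λ' : LRInfty (groundGrading K) (SymAlg.grading 𝒜 ℒ)} (h : IsPoissonExtension X Λ)
    (h' : IsPoissonExtension X Λ') (l : List (ℤ × SymAlg 𝒜 ℒ))
    (hl : Homog (SymAlg.grading 𝒜 ℒ) l) : Λ.br l = Λ'.br l := by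
  have h1 := h.isMultiDer hA
  have h2 := h'.isMultiDer hA
  have h0 := SymAlg.isGradedComm (ℒ := ℒ) hA
  have hgl : ∀ l : List (ℤ × SymAlg 𝒜 ℒ), (∀ x ∈ l, SymAlg.IsGen 𝒜 ℒ x) →
      Homog (SymAlg.grading 𝒜 ℒ) l := by
    intro l hl x hx
    rw [SymAlg.grading_eq]
    exact gen_mem_genSpan (hl x hx)
  have hswap : ∀ l₁ l₂ x y, (Homog (SymAlg.grading 𝒜 ℒ) (l₁ ++ x :: y :: l₂) →
      Λ.br (l₁ ++ x :: y :: l₂) = Λ'.br (l₁ ++ x :: y :: l₂)) →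
      (Homog (SymAlg.grading 𝒜 ℒ) (l₁ ++ y :: x :: l₂) →
      Λ.br (l₁ ++ y :: x :: l₂) = Λ'.br (l₁ ++ y :: x :: l₂)) := by
    intro l₁ l₂ x y h3 h4
    rw [h1.swap _ _ _ _ h4, h2.swap _ _ _ _ h4,
      h3 ((homog_perm ((List.Perm.swap x y l₂).append_left l₁)).1 h4)]
  have hgen : ∀ l : List (ℤ × SymAlg 𝒜 ℒ), (∀ x ∈ l, SymAlg.IsGen 𝒜 ℒ x) → Λ.br l = Λ'.br l := by
    intro l hl
    rcases SymAlg.perm_of_isGen l hl with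
      ⟨l', hl', rfl⟩ | ⟨l', e, a, ha, hl', hp⟩ | ⟨l', e, f, a, b, hl', hp⟩
    · rw [h.br_vec, h'.br_vec]
    · refine perm_of_swap
        (P := fun l => Homog (SymAlg.grading 𝒜 ℒ) l → Λ.br l = Λ'.br l) hswap hp ?_ (hgl l hl)
      intro _
      rw [h.br_scalar, h'.br_scalar]
    · refine perm_of_swap
        (P := fun l => Homog (SymAlg.grading 𝒜 ℒ) l → Λ.br l = Λ'.br l) hswap hp ?_ (hgl l hl)
      intro _
      rw [h.br_scalar_scalar e f a b l' hl', h'.br_scalar_scalar e f a b l' hl']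
  clear hswap
  -- The type of `Λ` mentions the grading, so the brackets are abstracted before the grading is
  -- rewritten.
  generalize Λ.br = f at *
  generalize Λ'.br = g at *
  rw [SymAlg.grading_eq] at h1 h2 h0 hl
  exact h1.ext_of_gen h0 h2 hgen l hl

/-- A derivation of `K` kills `1`, and by `K`-linearity everything. So the brackets alone determine
a structure over the ground field. -/
theorem anchor_groundGrading {B : Type*} [Ring B] [Algebra K B] {𝓑 : ℤ → Submodule K B}
    (h𝓑 : Submodule.span K {v | ∃ e, v ∈ 𝓑 e} = ⊤) (Λ : LRInfty (groundGrading K) 𝓑) (n : ℕ) :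
    Λ.anchor n = 0 := by
  refine multilinear_ext_of_homogeneous h𝓑 fun d v hv => ?_
  refine LinearMap.ext_ring ?_
  have h := Λ.anchor_derivation n d v hv 0 1 (by simp [groundGrading]) 1
  simpa using h

theorem IsPoissonExtension.eq (hA : ∀ (i j : ℤ) (a b : A), a ∈ 𝒜 i → b ∈ 𝒜 j →
      a * b = Int.negOnePow (i * j) • (b * a))
    {Λ Λ' : LRInfty (groundGrading K) (SymAlg.grading 𝒜 ℒ)} (h : IsPoissonExtension X Λ)
    (h' : IsPoissonExtension X Λ') : Λ = Λ' := by
  refine LRInfty.ext (funext fun k => ?_) (funext fun n => ?_)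
  · refine multilinear_ext_of_homogeneous (span_homogeneous_sym hA) fun d v hv => ?_
    have := h.br_eq hA h' _ (homog_ofFn d v hv)
    rwa [LRInfty.br, LRInfty.br, evalL_ofFn, evalL_ofFn] at this
  · rw [anchor_groundGrading (span_homogeneous_sym hA), anchor_groundGrading (span_homogeneous_sym hA)]

end PoissonExtension

/-! ### Jets with values in a space of linear maps -/

section JetMaps

variable {K : Type*} [Field K] {ι : Type*} {deg : ι → ℤ} {W W' : Type*} [AddCommGroup W]
  [Module K W] [AddCommGroup W'] [Module K W']

/-- Graded symmetric functions are functorial in the values. -/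
def SymFun.map (φ : W →ₗ[K] W') : SymFun K deg W →ₗ[K] SymFun K deg W' where
  toFun F := ⟨fun l => φ (F.1 l), fun l₁ l₂ i j => by
    simp only [F.2 l₁ l₂ i j, Units.smul_def, map_zsmul]⟩
  map_add' F G := by ext l; exact map_add φ _ _
  map_smul' c F := by ext l; exact map_smul φ _ _

theorem SymFun.map_apply (φ : W →ₗ[K] W') (F : SymFun K deg W) (l : List ι) :
    (SymFun.map φ F).1 l = φ (F.1 l) := rfl

variable {b : ι → Module.End K W} (hb : ∀ i j, b i * b j = (deg i * deg j).negOnePow • (b j * b i))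

/-- Applied below to precomposition with the action of `a` on `Q`, which commutes with
multiplication on the values. -/
theorem jetHom_map (φ : Module.End K W) (hφ : ∀ i, b i * φ = φ * b i) (u : FreeSym K deg)
    (F : SymFun K deg W) : jetHom b hb u (SymFun.map φ F) = SymFun.map φ (jetHom b hb u F) := by
  induction u using FreeSym.induction with
  | hadd u v hu hv => rw [map_add, LinearMap.add_apply, LinearMap.add_apply, map_add, hu, hv]
  | hsmul c u hu => rw [map_smul, LinearMap.smul_apply, LinearMap.smul_apply, map_smul, hu]
  | hone => rw [map_one]; rfl
  | hmul i u hu =>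
    ext l
    rw [SymFun.map_apply, jetHom_gen_mul, jetHom_gen_mul, hu, SymFun.map_apply, SymFun.map_apply,
      map_add, Units.smul_def, Units.smul_def, map_zsmul]
    congr 2
    exact LinearMap.congr_fun (hφ i) _

theorem jetHom_eq_zero {F : SymFun K deg W} {k : ℕ} (hF : ∀ l : List ι, k < l.length → F.1 l = 0)
    (u : FreeSym K deg) (l : List ι) (hl : k < l.length) : (jetHom b hb u F).1 l = 0 := by
  induction u using FreeSym.induction generalizing l with
  | hadd u v hu hv =>
    rw [map_add, LinearMap.add_apply, Submodule.coe_add, Pi.add_apply, hu l hl, hv l hl, add_zero]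
  | hsmul c u hu =>
    rw [map_smul, LinearMap.smul_apply, Submodule.coe_smul, Pi.smul_apply, hu l hl, smul_zero]
  | hone => rw [map_one]; exact hF l hl
  | hmul i u hu =>
    rw [jetHom_gen_mul, hu l hl, hu (l ++ [i]) (by simp; omega), map_zero, smul_zero, add_zero]

theorem jetHom_mem {F : SymFun K deg W} {Γ : Type*} [AddCommGroup Γ] {𝓦 : Γ → Submodule K W}
    {wt : ι → Γ} {s : Γ} (hF : ∀ l, F.1 l ∈ 𝓦 (s + (l.map wt).sum))
    (hW : ∀ i e u, u ∈ 𝓦 e → b i u ∈ 𝓦 (wt i + e)) (l w : List ι) :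
    (jetHom b hb (mulL (w.map (FreeSym.sym K deg))) F).1 l
      ∈ 𝓦 (s + (l.map wt).sum + (w.map wt).sum) := by
  induction w generalizing l with
  | nil =>
    rw [show mulL (List.map (FreeSym.sym K deg) []) = 1 from mulL_nil, map_one]
    simpa using hF l
  | cons i w ih =>
    rw [show mulL (List.map (FreeSym.sym K deg) (i :: w))
      = FreeSym.gen K deg i * mulL (w.map (FreeSym.sym K deg)) from mulL_cons _ _]
    rw [jetHom_gen_mul]
    refine Submodule.add_mem _ ?_ ((Submodule.smul_mem_iff' _ _).2 ?_)
    · have := ih (l ++ [i])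
      simpa [add_assoc] using this
    · have := hW i _ _ (ih l)
      rw [List.map_cons, List.sum_cons, add_left_comm]
      exact this

variable (b) in
/-- The jet of `F` at `u`. -/
def jetLin (F : SymFun K deg W) : FreeSym K deg →ₗ[K] SymFun K deg W :=
  (jetHom b hb).toLinearMap.flip F

theorem jetLin_one (F : SymFun K deg W) : jetLin b hb F 1 = F := by
  change jetHom b hb 1 F = F
  rw [map_one]
  rfl

theorem jetLin_gen_mul (F : SymFun K deg W) (i : ι) (u : FreeSym K deg) (l : List ι) :
    (jetLin b hb F (FreeSym.gen K deg i * u)).1 l = (jetLin b hb F u).1 (l ++ [i])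
      + (deg i * (1 + degW deg l)).negOnePow • b i ((jetLin b hb F u).1 l) :=
  jetHom_gen_mul b hb i u F l

theorem jetLin_mul (F : SymFun K deg W) (u v : FreeSym K deg) :
    jetLin b hb F (u * v) = jetLin b hb (jetLin b hb F v) u := by
  change jetHom b hb (u * v) F = _
  rw [map_mul]
  rfl

theorem jetLin_sub_eq_zero_iff (F : SymFun K deg W) (u v : FreeSym K deg) :
    jetLin b hb F (u - v) = 0 ↔ jetLin b hb F u = jetLin b hb F v := by
  rw [map_sub, sub_eq_zero]

theorem jetLin_zero (u : FreeSym K deg) : jetLin b hb 0 u = 0 := map_zero (jetHom b hb u)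

theorem jetLin_map (φ : Module.End K W) (hφ : ∀ i, b i * φ = φ * b i) (F : SymFun K deg W)
    (u : FreeSym K deg) : jetLin b hb (SymFun.map φ F) u = SymFun.map φ (jetLin b hb F u) :=
  jetHom_map hb φ hφ u F

/-- By symmetry, a single letter of the first kind may be assumed to stand at the end. -/
theorem symFun_ext {α β : Type*} {dα : α → ℤ} {dβ : β → ℤ} {F G : SymFun K (Sum.elim dα dβ) W}
    (h0 : ∀ w : List β, F.1 (w.map Sum.inr) = G.1 (w.map Sum.inr))
    (h1 : ∀ (w : List β) (a : α),
      F.1 (w.map Sum.inr ++ [Sum.inl a]) = G.1 (w.map Sum.inr ++ [Sum.inl a]))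
    (h2 : ∀ l : List (α ⊕ β), 2 ≤ l.countP Sum.isLeft → F.1 l = G.1 l) : F = G := by
  ext l
  have hcases : l.countP Sum.isLeft = 0 ∨ l.countP Sum.isLeft = 1 ∨ 2 ≤ l.countP Sum.isLeft := by
    omega
  rcases hcases with h | h | h
  · obtain ⟨w, rfl⟩ := eq_map_of_countP h
    exact h0 w
  · obtain ⟨w, a, hp⟩ := exists_perm_of_countP_eq_one h
    refine perm_of_swap (P := fun l => F.1 l = G.1 l) ?_ hp (h1 w a)
    intro l₁ l₂ i j hij
    rw [F.2 l₁ l₂ j i, G.2 l₁ l₂ j i, hij]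
  · exact h2 l h

theorem hbasis_induction {V : Type*} [AddCommGroup V] [Module K V] (𝒱 : ℤ → Submodule K V)
    [DirectSum.Decomposition 𝒱] {p : V → Prop} (hadd : ∀ u v, p u → p v → p (u + v))
    (hsmul : ∀ (c : K) u, p u → p (c • u)) (hz : p 0) (h : ∀ i, p (hbasis 𝒱 i)) (v : V) : p v := by
  have hv : v ∈ Submodule.span K (Set.range (hbasis 𝒱)) := Module.Basis.mem_span _ _
  induction hv using Submodule.span_induction with
  | mem v hv => obtain ⟨i, rfl⟩ := hv; exact h i
  | zero => exact hz
  | add u v _ _ hu hv => exact hadd u v hu hv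
  | smul c u _ hu => exact hsmul c u hu

end JetMaps

/-! ### The module `S_A L ⊗_A Q` -/

section SymTensor

variable {K A L Q : Type*} [Field K] [Ring A] [Algebra K A]
  [AddCommGroup L] [Module K L] [Module A L]
  [AddCommGroup Q] [Module K Q] [Module A Q]
  (𝒜 : ℤ → Submodule K A) (ℒ : ℤ → Submodule K L)

/-- `u ⊗ q` as a bilinear map. -/
def symTmulHom (Q : Type*) [AddCommGroup Q] [Module K Q] [Module A Q] :
    SymAlg 𝒜 ℒ →ₗ[K] Q →ₗ[K] SymTensor 𝒜 ℒ Q :=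
  LinearMap.mk₂ K (symTmul 𝒜 ℒ)
    (fun u v q => by rw [symTmul, TensorProduct.add_tmul]; rfl)
    (fun c u q => by rw [symTmul, ← TensorProduct.smul_tmul']; rfl)
    (fun u q r => by rw [symTmul, TensorProduct.tmul_add]; rfl)
    (fun c u q => by rw [symTmul, TensorProduct.tmul_smul]; rfl)

theorem symTmulHom_apply (u : SymAlg 𝒜 ℒ) (q : Q) :
    symTmulHom 𝒜 ℒ Q u q = symTmul 𝒜 ℒ u q := rfl

theorem smul_symTmul (u v : SymAlg 𝒜 ℒ) (q : Q) :
    u • symTmul 𝒜 ℒ v q = symTmul 𝒜 ℒ (u * v) q := rfl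

theorem symTmul_scalar (u : SymAlg 𝒜 ℒ) (a : A) (q : Q) :
    symTmul 𝒜 ℒ (u * SymAlg.scalar 𝒜 ℒ a) q = symTmul 𝒜 ℒ u (a • q) :=
  (Submodule.Quotient.eq _).2 (Submodule.subset_span ⟨u, a, q, rfl⟩)

theorem symTmul_units_smul (s : ℤˣ) (u : SymAlg 𝒜 ℒ) (q : Q) :
    symTmul 𝒜 ℒ (s • u) q = s • symTmul 𝒜 ℒ u q := by
  rw [← symTmulHom_apply, Units.smul_def, map_zsmul, LinearMap.smul_apply, ← Units.smul_def]
  rfl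

theorem symTmul_smul_units (s : ℤˣ) (u : SymAlg 𝒜 ℒ) (q : Q) :
    symTmul 𝒜 ℒ u (s • q) = s • symTmul 𝒜 ℒ u q := by
  rw [← symTmulHom_apply, Units.smul_def, map_zsmul, ← Units.smul_def]
  rfl

theorem SymTensor.hom_ext {Y : Type*} [AddCommGroup Y] [Module K Y]
    {f g : SymTensor 𝒜 ℒ Q →ₗ[K] Y} (h : ∀ u q, f (symTmul 𝒜 ℒ u q) = g (symTmul 𝒜 ℒ u q)) :
    f = g := by
  refine LinearMap.ext fun x => ?_
  obtain ⟨y, rfl⟩ := Submodule.Quotient.mk_surjective _ x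
  induction y with
  | zero => rw [Submodule.Quotient.mk_zero, map_zero, map_zero]
  | add y z hy hz => rw [Submodule.Quotient.mk_add, map_add, map_add, hy, hz]
  | tmul u q => exact h u q

/-- The universal property of `S_A L ⊗_A Q`. -/
def SymTensor.lift {Y : Type*} [AddCommGroup Y] [Module K Y] (f : SymAlg 𝒜 ℒ →ₗ[K] Q →ₗ[K] Y)
    (hf : ∀ u a q, f (u * SymAlg.scalar 𝒜 ℒ a) q = f u (a • q)) : SymTensor 𝒜 ℒ Q →ₗ[K] Y :=
  ((symTensorRel 𝒜 ℒ Q).restrictScalars K).liftQ (TensorProduct.lift f) (by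
    intro x hx
    -- The relations are spanned over `S_A L`, whereas `f` is only `K`-linear. The induction
    -- therefore has to run over all multiples of `x` at once.
    have h : ∀ v : SymAlg 𝒜 ℒ, TensorProduct.lift f (v • x) = 0 := by
      have hx' : x ∈ symTensorRel 𝒜 ℒ Q := hx
      clear hx
      induction hx' using Submodule.span_induction with
      | mem x hx =>
        obtain ⟨u, a, q, rfl⟩ := hx
        intro v
        rw [smul_sub, TensorProduct.smul_tmul', TensorProduct.smul_tmul', map_sub,
          TensorProduct.lift.tmul, TensorProduct.lift.tmul, smul_eq_mul, smul_eq_mul, ← mul_assoc,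
          hf, sub_self]
      | zero => intro v; rw [smul_zero, map_zero]
      | add x y _ _ hx hy => intro v; rw [smul_add, map_add, hx v, hy v, add_zero]
      | smul w x _ hx => intro v; rw [smul_smul]; exact hx _
    simpa using h 1) ∘ₗ (Submodule.Quotient.restrictScalarsEquiv K (symTensorRel 𝒜 ℒ Q)).symm.toLinearMap

theorem SymTensor.lift_symTmul {Y : Type*} [AddCommGroup Y] [Module K Y]
    (f : SymAlg 𝒜 ℒ →ₗ[K] Q →ₗ[K] Y)
    (hf : ∀ u a q, f (u * SymAlg.scalar 𝒜 ℒ a) q = f u (a • q)) (u : SymAlg 𝒜 ℒ) (q : Q) :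
    SymTensor.lift 𝒜 ℒ f hf (symTmul 𝒜 ℒ u q) = f u q :=
  TensorProduct.lift.tmul u q

end SymTensor

/-! ### The jets of the Rinehart operators -/

section RinehartJets

variable {K A L Q : Type*} [Field K] [Ring A] [Algebra K A]
  [AddCommGroup L] [Module K L] [Module A L]
  [AddCommGroup Q] [Module K Q] [Module A Q]
  {𝒜 : ℤ → Submodule K A} {ℒ : ℤ → Submodule K L} {𝒬 : ℤ → Submodule K Q}
  {X : LRInfty 𝒜 ℒ} (Δ : RightConnection X 𝒬)

/-- The value on `1 ⊗ q` of the iterated commutator of the `k`-th operator with elements of `L`. -/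
def jetVec (k : ℕ) (l : List (ℤ × L)) : Q →ₗ[K] SymTensor 𝒜 ℒ Q :=
  (if l.length = k then symTmulHom 𝒜 ℒ Q (SymAlg.vec 𝒜 ℒ (X.br l)) else 0)
    - (if l.length + 1 = k then symTmulHom 𝒜 ℒ Q 1 ∘ₗ Δ.ev l else 0)

variable (Q X) in
/-- The value on `1 ⊗ q` of the iterated commutator of the `k`-th operator with elements of `L` and
an element of `A`. -/
def jetScalar (k : ℕ) (l : List (ℤ × L)) (a : A) : Q →ₗ[K] SymTensor 𝒜 ℒ Q :=
  if l.length + 1 = k then symTmulHom 𝒜 ℒ Q (SymAlg.scalar 𝒜 ℒ (X.an l a)) else 0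

theorem jetVec_apply (k : ℕ) (l : List (ℤ × L)) (q : Q) : jetVec Δ k l q
    = (if l.length = k then symTmul 𝒜 ℒ (SymAlg.vec 𝒜 ℒ (X.br l)) q else 0)
      - (if l.length + 1 = k then symTmul 𝒜 ℒ 1 (Δ.ev l q) else 0) := by
  rw [jetVec, LinearMap.sub_apply]
  split_ifs <;> rfl

variable (X) in
theorem jetScalar_apply (k : ℕ) (l : List (ℤ × L)) (a : A) (q : Q) : jetScalar Q X k l a q
    = if l.length + 1 = k then symTmul 𝒜 ℒ (SymAlg.scalar 𝒜 ℒ (X.an l a)) q else 0 := by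
  rw [jetScalar]
  split_ifs <;> rfl

theorem scalar_mem_grading {e : ℤ} {a : A} (ha : a ∈ 𝒜 e) [GradedAlgebra 𝒜] :
    SymAlg.scalar 𝒜 ℒ a ∈ SymAlg.grading 𝒜 ℒ e := by
  rw [SymAlg.grading_eq]
  exact gen_mem_genSpan (x := (e, SymAlg.scalar 𝒜 ℒ a)) (Or.inl ⟨a, ha, rfl⟩)

theorem vec_mem_grading {e : ℤ} {ξ : L} (hξ : ξ ∈ ℒ e) [GradedAlgebra 𝒜] :
    SymAlg.vec 𝒜 ℒ ξ ∈ SymAlg.grading 𝒜 ℒ e := by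
  rw [SymAlg.grading_eq]
  exact gen_mem_genSpan (x := (e, SymAlg.vec 𝒜 ℒ ξ)) (Or.inr ⟨ξ, hξ, rfl⟩)

variable [GradedAlgebra 𝒜]

theorem scalar_smul_symTmul (hA : ∀ (i j : ℤ) (a b : A), a ∈ 𝒜 i → b ∈ 𝒜 j →
      a * b = Int.negOnePow (i * j) • (b * a)) {i j : ℤ} {a : A} {u : SymAlg 𝒜 ℒ} (ha : a ∈ 𝒜 i)
    (hu : u ∈ SymAlg.grading 𝒜 ℒ j) (q : Q) :
    SymAlg.scalar 𝒜 ℒ a • symTmul 𝒜 ℒ u q = (i * j).negOnePow • symTmul 𝒜 ℒ u (a • q) := by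
  rw [smul_symTmul, (SymAlg.isGradedComm hA).comm (scalar_mem_grading ha) hu, symTmul_units_smul,
    symTmul_scalar]

/-- This is the compatibility of the jets with `a ⊗ q = 1 ⊗ aq`. In length `k` the scalar merely
moves past the bracket. In length `k - 1` it is the Leibniz rule of `Δ`, whose symbol is minus the
anchor and thus supplies the term `jetScalar`. -/
theorem jetVec_smul (hA : ∀ (i j : ℤ) (a b : A), a ∈ 𝒜 i → b ∈ 𝒜 j →
      a * b = Int.negOnePow (i * j) • (b * a)) (k : ℕ) {l : List (ℤ × L)} (hl : Homog ℒ l) {e : ℤ}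
    {a : A} (ha : a ∈ 𝒜 e) (q : Q) : jetVec Δ k l (a • q) = jetScalar Q X k l a q
      + (e * (1 + degL l)).negOnePow • (SymAlg.scalar 𝒜 ℒ a • jetVec Δ k l q) := by
  rw [jetVec_apply, jetVec_apply, jetScalar_apply]
  by_cases h : l.length = k
  · have h' : ¬ l.length + 1 = k := by omega
    rw [if_pos h, if_neg h', if_neg h', if_neg h', if_pos h, sub_zero, sub_zero, zero_add,
      scalar_smul_symTmul hA ha (vec_mem_grading (X.br_mem l hl)), smul_smul, Int.units_mul_self,
      one_smul]
  by_cases h' : l.length + 1 = k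
  · rw [if_neg h, if_neg h, if_pos h', if_pos h', if_pos h', zero_sub, zero_sub,
      Δ.ev_leibniz l hl e a ha, smul_neg, smul_neg, smul_symTmul, mul_one,
      ← symTmulHom_apply 𝒜 ℒ 1, map_sub, symTmulHom_apply, symTmulHom_apply, symTmul_smul_units,
      ← symTmul_scalar, ← symTmul_scalar, one_mul, one_mul, mul_comm (1 + degL l)]
    abel
  · rw [if_neg h, if_neg h, if_neg h', if_neg h', if_neg h', sub_zero, smul_zero, smul_zero,
      add_zero]

theorem jetScalar_smul (hA : ∀ (i j : ℤ) (a b : A), a ∈ 𝒜 i → b ∈ 𝒜 j →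
      a * b = Int.negOnePow (i * j) • (b * a)) (k : ℕ) {l : List (ℤ × L)} (hl : Homog ℒ l)
    {e f : ℤ} {a b : A} (ha : a ∈ 𝒜 e) (hb : b ∈ 𝒜 f) (q : Q) :
    jetScalar Q X k l b (a • q)
      = (e * (1 + degL l + f)).negOnePow • (SymAlg.scalar 𝒜 ℒ a • jetScalar Q X k l b q) := by
  rw [jetScalar_apply, jetScalar_apply]
  split_ifs
  · rw [scalar_smul_symTmul hA ha (scalar_mem_grading (X.an_mem l hl f b hb)), smul_smul,
      Int.units_mul_self, one_smul]
  · rw [smul_zero, smul_zero]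

theorem LRInfty.br_smul_cons [DirectSum.Decomposition ℒ] [SetLike.GradedSMul 𝒜 ℒ]
    {l : List (ℤ × L)} (hl : Homog ℒ l)
    {e j : ℤ} {a : A} {ξ : L} (ha : a ∈ 𝒜 e) (hξ : ξ ∈ ℒ j) : X.br ((e + j, a • ξ) :: l)
      = ((e + j) * degL l).negOnePow • (X.an l a • ξ)
        + e.negOnePow • (a • X.br ((j, ξ) :: l)) := by
  have h1 := (br_isGradedMul X).append_singleton (l := l) (x := (e + j, a • ξ))
    (homog_cons.2 ⟨SetLike.GradedSMul.smul_mem ha hξ, hl⟩)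
  have h2 := (br_isGradedMul X).append_singleton (l := l) (x := (j, ξ)) (homog_cons.2 ⟨hξ, hl⟩)
  rw [X.br_smul l hl e a ha (e + j) j ξ, h2] at h1
  have h3 := congrArg (fun x => ((e + j) * degL l).negOnePow • x) h1
  simp only [smul_add, smul_smul, Int.units_mul_self, one_smul] at h3
  rw [← h3]
  congr 1
  rw [Units.smul_def (j * degL l).negOnePow, smul_comm a, ← Units.smul_def, smul_smul,
    ← Int.negOnePow_add, ← Int.negOnePow_add]
  congr 1
  refine negOnePow_congr ?_
  rw [show (e + j) * degL l + (1 + degL l) * e + j * degL l - e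
    = 2 * ((e + j) * degL l) by ring]
  exact even_two_mul _

/-- With `k` vectors in all, this is the Leibniz rule of the bracket, which produces an anchor term;
with `k - 1` vectors, it is the linearity axiom of the right connection, which moves `a` onto `q`.
-/
theorem jetVec_cons [DirectSum.Decomposition ℒ] [SetLike.GradedSMul 𝒜 ℒ]
    (hA : ∀ (i j : ℤ) (a b : A), a ∈ 𝒜 i → b ∈ 𝒜 j →
      a * b = Int.negOnePow (i * j) • (b * a)) (k : ℕ) {l : List (ℤ × L)} (hl : Homog ℒ l)
    {e j : ℤ} {a : A} {ξ : L} (ha : a ∈ 𝒜 e) (hξ : ξ ∈ ℒ j) (q : Q) :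
    jetVec Δ k ((e + j, a • ξ) :: l) q
      = (e * (j + degL l)).negOnePow • jetVec Δ k ((j, ξ) :: l) (a • q)
        + ((e + j) * degL l + j * (1 + degL l + e)).negOnePow •
          (SymAlg.vec 𝒜 ℒ ξ • jetScalar Q X k l a q) := by
  rw [jetVec_apply, jetVec_apply, jetScalar_apply, List.length_cons, List.length_cons]
  by_cases h : l.length + 1 = k
  · have h' : ¬ l.length + 1 + 1 = k := by omega
    have hb : X.br ((j, ξ) :: l) ∈ ℒ (1 + degL ((j, ξ) :: l)) :=
      X.br_mem _ (homog_cons.2 ⟨hξ, hl⟩)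
    rw [if_pos h, if_pos h, if_pos h, if_neg h', if_neg h', sub_zero, sub_zero,
      LRInfty.br_smul_cons hl ha hξ, map_add, Units.smul_def, Units.smul_def, map_zsmul, map_zsmul,
      ← Units.smul_def, ← Units.smul_def, SymAlg.vec_smul, SymAlg.vec_smul, ← symTmulHom_apply,
      map_add, LinearMap.add_apply, symTmulHom_apply, symTmulHom_apply, symTmul_units_smul,
      symTmul_units_smul, add_comm, ← smul_symTmul, scalar_smul_symTmul hA ha (vec_mem_grading hb),
      SymAlg.scalar_mul_vec (X.an_mem l hl e a ha) hξ, symTmul_units_smul, smul_symTmul, smul_smul,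
      smul_smul, ← Int.negOnePow_add, ← Int.negOnePow_add, degL_cons]
    congr 2
    · refine negOnePow_congr ?_
      rw [show e + e * (1 + (j + degL l)) - e * (j + degL l) = 2 * e by ring]
      exact even_two_mul _
    · congr 1
      ring
  by_cases h' : l.length + 1 + 1 = k
  · rw [if_neg h, if_neg h, if_neg h, if_pos h', if_pos h', zero_sub, zero_sub,
      Δ.ev_linear l hl j ξ hξ e (e + j) a ha, symTmul_smul_units, smul_zero, smul_zero, add_zero,
      smul_neg]
  · rw [if_neg h, if_neg h, if_neg h, if_neg h', if_neg h', sub_zero, smul_zero, smul_zero,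
      smul_zero, add_zero]

theorem jetScalar_cons (hA : ∀ (i j : ℤ) (a b : A), a ∈ 𝒜 i → b ∈ 𝒜 j →
      a * b = Int.negOnePow (i * j) • (b * a)) (k : ℕ) {l : List (ℤ × L)} (hl : Homog ℒ l)
    {e f j : ℤ} {a b : A} {ξ : L} (ha : a ∈ 𝒜 e) (hb : b ∈ 𝒜 f) (hξ : ξ ∈ ℒ j) (q : Q) :
    jetScalar Q X k ((e + j, a • ξ) :: l) b q
      = (e * (j + degL l + f)).negOnePow • jetScalar Q X k ((j, ξ) :: l) b (a • q) := by
  rw [jetScalar_apply, jetScalar_apply, List.length_cons, List.length_cons]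
  split_ifs
  · have hm := X.an_mem ((j, ξ) :: l) (homog_cons.2 ⟨hξ, hl⟩) f b hb
    rw [X.an_linear e a ha (e + j) j, Units.smul_def, map_zsmul, ← Units.smul_def,
      SymAlg.scalar_mul, symTmul_units_smul, ← smul_symTmul,
      scalar_smul_symTmul hA ha (scalar_mem_grading hm), smul_smul, ← Int.negOnePow_add, degL_cons]
    congr 1
    refine negOnePow_congr ?_
    rw [show e + e * (1 + (j + degL l) + f) - e * (j + degL l + f) = 2 * e by ring]
    exact even_two_mul _
  · rw [smul_zero]

variable [DirectSum.Decomposition ℒ]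

theorem ev_map_hsym_swap (l₁ l₂ : List (HIdx ℒ)) (i j : HIdx ℒ) :
    Δ.ev ((l₁ ++ i :: j :: l₂).map (hsym ℒ))
      = (i.deg * j.deg).negOnePow • Δ.ev ((l₁ ++ j :: i :: l₂).map (hsym ℒ)) := by
  have h := homog_map_hsym (l₁ ++ i :: j :: l₂) (𝒱 := ℒ)
  simp only [List.map_append, List.map_cons] at h ⊢
  exact Δ.ev_swap _ _ _ _ h

/-- The contribution of the right connection to the jets. -/
def jetConn (k : ℕ) : SymFun K (xdeg 𝒜 ℒ) (Q →ₗ[K] SymTensor 𝒜 ℒ Q) :=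
  ⟨mixed HIdx.deg HIdx.deg
    (fun w => if w.length + 1 = k then symTmulHom 𝒜 ℒ Q 1 ∘ₗ Δ.ev (w.map (hsym ℒ)) else 0)
    fun _ _ => 0, mixed_swap HIdx.deg HIdx.deg (fun l₁ l₂ i j => by
      simp only [length_swap l₁ l₂ i j, ev_map_hsym_swap Δ l₁ l₂ i j]
      split_ifs
      · ext q
        exact symTmul_smul_units 𝒜 ℒ _ _ _
      · rw [smul_zero]) fun l₁ l₂ i j => by
      ext a
      simp⟩

theorem jetConn_length (k : ℕ) (l : List (HIdx 𝒜 ⊕ HIdx ℒ)) (hl : l.length + 1 ≠ k) :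
    (jetConn Δ k).1 l = 0 :=
  mixed_length HIdx.deg HIdx.deg (n := 1) (k := k) (fun _ h => if_neg h) (fun _ _ _ => rfl) l hl

/-- The jets of the `k`-th Rinehart operator on the elements `1 ⊗ q`. -/
def jetF (hA : ∀ (i j : ℤ) (a b : A), a ∈ 𝒜 i → b ∈ 𝒜 j →
      a * b = Int.negOnePow (i * j) • (b * a)) (k : ℕ) :
    SymFun K (xdeg 𝒜 ℒ) (Q →ₗ[K] SymTensor 𝒜 ℒ Q) :=
  SymFun.map (symTmulHom 𝒜 ℒ Q ∘ₗ (symProj ℒ hA).toLinearMap) (extF X k) - jetConn Δ k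

variable (hA : ∀ (i j : ℤ) (a b : A), a ∈ 𝒜 i → b ∈ 𝒜 j →
      a * b = Int.negOnePow (i * j) • (b * a))

theorem jetF_apply (k : ℕ) (l : List (HIdx 𝒜 ⊕ HIdx ℒ)) : (jetF Δ hA k).1 l
    = symTmulHom 𝒜 ℒ Q (symProj ℒ hA ((extF X k).1 l)) - (jetConn Δ k).1 l := rfl

theorem jetF_inr (k : ℕ) (w : List (HIdx ℒ)) :
    (jetF Δ hA k).1 (w.map Sum.inr) = jetVec Δ k (w.map (hsym ℒ)) := by
  rw [jetF_apply, jetVec, List.length_map]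
  congr 1
  · rw [extF]
    dsimp only
    rw [mixed_map_inr, extVec]
    split_ifs
    · rw [symProj_vec]
    · rw [map_zero, map_zero]
  · rw [jetConn]
    dsimp only
    rw [mixed_map_inr]

theorem jetF_inl (k : ℕ) (w : List (HIdx ℒ)) (a : HIdx 𝒜) :
    (jetF Δ hA k).1 (w.map Sum.inr ++ [Sum.inl a])
      = jetScalar Q X k (w.map (hsym ℒ)) (hbasis 𝒜 a) := by
  rw [jetF_apply, jetScalar, List.length_map]
  have h : (jetConn Δ k).1 (w.map Sum.inr ++ [Sum.inl a]) = 0 := by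
    rw [jetConn]
    dsimp only
    rw [mixed_append_inl]
  rw [h, sub_zero, extF]
  dsimp only
  rw [mixed_append_inl, extScalar]
  split_ifs
  · rw [symProj_scalar]
  · rw [map_zero, map_zero]

theorem jetF_eq_zero (k : ℕ) (l : List (HIdx 𝒜 ⊕ HIdx ℒ)) (hl : 2 ≤ l.countP Sum.isLeft) :
    (jetF Δ hA k).1 l = 0 := by
  rw [jetF_apply, extF_eq_zero X k l hl, map_zero, map_zero, zero_sub, jetConn]
  dsimp only
  rw [mixed_eq_zero _ _ _ _ hl, neg_zero]

theorem jetF_length (k : ℕ) (l : List (HIdx 𝒜 ⊕ HIdx ℒ)) (hl : k < l.length) :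
    (jetF Δ hA k).1 l = 0 := by
  rw [jetF_apply, extF_length X k l (by omega), map_zero, map_zero, zero_sub,
    jetConn_length Δ k l (by omega), neg_zero]

variable (Q) in
/-- Multiplication by the generators on the linear maps with values in `S_A L ⊗_A Q`. -/
def genMul (i : HIdx 𝒜 ⊕ HIdx ℒ) : Module.End K (Q →ₗ[K] SymTensor 𝒜 ℒ Q) :=
  LinearMap.llcomp K Q (SymTensor 𝒜 ℒ Q) (SymTensor 𝒜 ℒ Q) (mu K (symGen 𝒜 ℒ i))

theorem genMul_apply (i : HIdx 𝒜 ⊕ HIdx ℒ) (T : Q →ₗ[K] SymTensor 𝒜 ℒ Q) (q : Q) :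
    genMul Q i T q = symGen 𝒜 ℒ i • T q := rfl

theorem genMul_comm (hA : ∀ (i j : ℤ) (a b : A), a ∈ 𝒜 i → b ∈ 𝒜 j →
      a * b = Int.negOnePow (i * j) • (b * a)) (i j : HIdx 𝒜 ⊕ HIdx ℒ) :
    genMul Q i * genMul Q j
      = (xdeg 𝒜 ℒ i * xdeg 𝒜 ℒ j).negOnePow • (genMul Q j * genMul Q i) := by
  ext T q
  rw [Units.smul_def]
  change symGen 𝒜 ℒ i • symGen 𝒜 ℒ j • T q 
    = ((xdeg 𝒜 ℒ i * xdeg 𝒜 ℒ j).negOnePow : ℤ) • (symGen 𝒜 ℒ j • symGen 𝒜 ℒ i • T q)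
  rw [smul_smul (symGen 𝒜 ℒ i), symGen_comm ℒ hA, smul_smul (symGen 𝒜 ℒ j), Units.smul_def,
    smul_assoc]

/-- The jets of the `k`-th Rinehart operator. -/
def jetOp (k : ℕ) : FreeSym K (xdeg 𝒜 ℒ) →ₗ[K] SymFun K (xdeg 𝒜 ℒ) (Q →ₗ[K] SymTensor 𝒜 ℒ Q) :=
  jetLin (genMul Q) (genMul_comm hA) (jetF Δ hA k)

theorem jetOp_one (k : ℕ) : jetOp Δ hA k 1 = jetF Δ hA k := jetLin_one _ _

theorem jetOp_gen_mul (k : ℕ) (i : HIdx 𝒜 ⊕ HIdx ℒ) (u : FreeSym K (xdeg 𝒜 ℒ))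
    (l : List (HIdx 𝒜 ⊕ HIdx ℒ)) (q : Q) :
    (jetOp Δ hA k (FreeSym.gen K (xdeg 𝒜 ℒ) i * u)).1 l q = (jetOp Δ hA k u).1 (l ++ [i]) q
      + (xdeg 𝒜 ℒ i * (1 + degW (xdeg 𝒜 ℒ) l)).negOnePow •
        (symGen 𝒜 ℒ i • (jetOp Δ hA k u).1 l q) :=
  LinearMap.congr_fun (jetLin_gen_mul (genMul_comm hA) (jetF Δ hA k) i u l) q

theorem degW_map_inr (w : List (HIdx ℒ)) :
    degW (xdeg 𝒜 ℒ) (w.map Sum.inr) = degW HIdx.deg w := by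
  rw [degW, List.map_map]
  rfl

variable [IsScalarTower K A Q]

/-- Precomposition with the action of `a`. -/
def precomp (Y : Type*) [AddCommGroup Y] [Module K Y] (a : A) : Module.End K (Q →ₗ[K] Y) :=
  LinearMap.lcomp K Y (mu K a)

theorem precomp_apply {Y : Type*} [AddCommGroup Y] [Module K Y] (a : A) (T : Q →ₗ[K] Y) (q : Q) :
    precomp Y a T q = T (a • q) := rfl

/-- For a basis element the jet is that of a generator acting on `jetF`. On words with no scalar the
claim is `jetVec_smul`, with one scalar `jetScalar_smul`, and beyond that both sides vanish. -/
theorem jetOp_scalar (k : ℕ) (a : A) :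
    jetOp Δ hA k (freeScalar 𝒜 ℒ a) = SymFun.map (precomp _ a) (jetF Δ hA k) := by
  induction a using hbasis_induction 𝒜 with
  | hadd a b ha hb =>
    rw [map_add, map_add, ha, hb]
    ext l q
    change (jetF Δ hA k).1 l (a • q) + (jetF Δ hA k).1 l (b • q)
      = (jetF Δ hA k).1 l ((a + b) • q)
    rw [add_smul, map_add]
  | hsmul c a ha =>
    rw [map_smul, map_smul, ha]
    ext l q
    change c • (jetF Δ hA k).1 l (a • q) = (jetF Δ hA k).1 l ((c • a) • q)
    rw [smul_assoc]
    exact (LinearMap.map_smul _ _ _).symm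
  | hz =>
    rw [map_zero, map_zero]
    ext l q
    change 0 = (jetF Δ hA k).1 l ((0 : A) • q)
    rw [zero_smul, map_zero]
  | h i =>
    have hv : ∀ (l : List (HIdx 𝒜 ⊕ HIdx ℒ)) (q : Q),
        (jetOp Δ hA k (freeScalar 𝒜 ℒ (hbasis 𝒜 i))).1 l q
          = (jetF Δ hA k).1 (l ++ [Sum.inl i]) q
            + (i.deg * (1 + degW (xdeg 𝒜 ℒ) l)).negOnePow •
              (SymAlg.scalar 𝒜 ℒ (hbasis 𝒜 i) • (jetF Δ hA k).1 l q) := by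
      intro l q
      rw [freeScalar_hbasis, ← mul_one (FreeSym.gen K (xdeg 𝒜 ℒ) (Sum.inl i)), jetOp_gen_mul,
        jetOp_one]
      rfl
    refine symFun_ext (fun w => LinearMap.ext fun q => ?_) (fun w b => LinearMap.ext fun q => ?_)
      fun l hl => LinearMap.ext fun q => ?_
    · rw [hv, SymFun.map_apply, precomp_apply, jetF_inr, jetF_inl,
        jetVec_smul Δ hA k (homog_map_hsym ℒ w) (hbasis_mem 𝒜 i), degL_map_hsym, degW_map_inr]
    · rw [hv, SymFun.map_apply, precomp_apply, jetF_inl, jetF_eq_zero, LinearMap.zero_apply,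
        zero_add, jetScalar_smul hA k (homog_map_hsym ℒ w) (hbasis_mem 𝒜 i) (hbasis_mem 𝒜 b),
        degL_map_hsym, degW_append, degW_map_inr, ← add_assoc]
      · simp [degW, xdeg]
      · simp only [List.countP_append, List.countP_cons, List.countP_nil, Sum.isLeft_inl, if_true]
        omega
    · rw [hv, SymFun.map_apply, precomp_apply, jetF_eq_zero Δ hA k l hl, jetF_eq_zero]
      · simp
      · rw [List.countP_append]; omega

end RinehartJets

/-! ### Descent of the jets to the symmetric algebra -/

section GradedMul

variable {K V Y : Type*} [Field K] [AddCommGroup V] [Module K V] [AddCommGroup Y] [Module K Y]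
  {𝒱 : ℤ → Submodule K V}

theorem IsGradedMul.ite_length {f : List (ℤ × V) → Y} (hf : IsGradedMul 𝒱 f) (n k : ℕ) :
    IsGradedMul 𝒱 fun l => if l.length + n = k then f l else 0 where
  swap l l' x y hl := by
    simp only [length_swap l l' x y, hf.swap l l' x y hl]
    split_ifs
    · rfl
    · rw [smul_zero]
  add e u v l hu hv hl := by
    simp only [List.length_cons, hf.add e u v l hu hv hl]
    split_ifs
    · rfl
    · rw [add_zero]
  smul e c u l hu hl := by
    simp only [List.length_cons, hf.smul e c u l hu hl]
    split_ifs
    · rfl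
    · rw [smul_zero]

theorem IsGradedMul.sub_fun {f g : List (ℤ × V) → Y} (hf : IsGradedMul 𝒱 f)
    (hg : IsGradedMul 𝒱 g) : IsGradedMul 𝒱 fun l => f l - g l where
  swap l l' x y hl := by simp only [hf.swap l l' x y hl, hg.swap l l' x y hl, smul_sub]
  add e u v l hu hv hl := by
    simp only [hf.add e u v l hu hv hl, hg.add e u v l hu hv hl]
    abel
  smul e c u l hu hl := by simp only [hf.smul e c u l hu hl, hg.smul e c u l hu hl, smul_sub]

theorem negOnePow_eq {a b : ℤ} (c : ℤ) (h : a - b = 2 * c) : a.negOnePow = b.negOnePow :=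
  negOnePow_congr (h ▸ even_two_mul c)

theorem smul_units_smul {B M : Type*} [Ring B] [AddCommGroup M] [Module B M] (s : ℤˣ) (u : B)
    (m : M) : u • s • m = s • u • m := by
  rw [Units.smul_def, Units.smul_def, smul_comm]

theorem units_smul_smul {B M : Type*} [Ring B] [AddCommGroup M] [Module B M] (s : ℤˣ) (u : B)
    (m : M) : (s • u) • m = s • u • m := by
  rw [Units.smul_def, Units.smul_def, smul_assoc]

theorem eq_of_hsym [DirectSum.Decomposition 𝒱] {e : ℤ} {f g : V → Y}
    (hf : ∀ u v, u ∈ 𝒱 e → v ∈ 𝒱 e → f (u + v) = f u + f v)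
    (hf' : ∀ (c : K) u, u ∈ 𝒱 e → f (c • u) = c • f u)
    (hg : ∀ u v, u ∈ 𝒱 e → v ∈ 𝒱 e → g (u + v) = g u + g v)
    (hg' : ∀ (c : K) u, u ∈ 𝒱 e → g (c • u) = c • g u)
    (h : ∀ i : HIdx 𝒱, i.deg = e → f (hbasis 𝒱 i) = g (hbasis 𝒱 i)) (u : V) (hu : u ∈ 𝒱 e) :
    f u = g u := by
  have hle : Submodule.span K {v | ∃ i, (e, v) = hsym 𝒱 i} ≤ 𝒱 e :=
    Submodule.span_le.2 fun v hv => hsym_mem 𝒱 (e, v) hv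
  have hu' := le_span_hsym 𝒱 e hu
  clear hu
  induction hu' using Submodule.span_induction with
  | mem v hv =>
    obtain ⟨i, hi⟩ := hv
    obtain ⟨rfl, rfl⟩ := Prod.mk.inj hi
    exact h i rfl
  | zero =>
    rw [← zero_smul K (0 : V), hf' 0 0 (Submodule.zero_mem _), hg' 0 0 (Submodule.zero_mem _),
      zero_smul, zero_smul]
  | add u v hu hv h1 h2 => rw [hf u v (hle hu) (hle hv), hg u v (hle hu) (hle hv), h1, h2]
  | smul c u hu h1 => rw [hf' c u (hle hu), hg' c u (hle hu), h1]

end GradedMul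

/-! ### Jets vanish on the kernel and are balanced over `A` -/

section Descent

variable {K A L Q : Type*} [Field K] [Ring A] [Algebra K A]
  [AddCommGroup L] [Module K L] [Module A L]
  [AddCommGroup Q] [Module K Q] [Module A Q]
  {𝒜 : ℤ → Submodule K A} {ℒ : ℤ → Submodule K L} {𝒬 : ℤ → Submodule K Q}
  {X : LRInfty 𝒜 ℒ} (Δ : RightConnection X 𝒬) [GradedAlgebra 𝒜] [DirectSum.Decomposition ℒ]

theorem RightConnection.ev_isGradedMul {X : LRInfty 𝒜 ℒ} (Δ : RightConnection X 𝒬) :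
    IsGradedMul ℒ Δ.ev :=
  isGradedMul_evalL (fun n => Δ.op n) Δ.op_symm

theorem jetVec_isGradedMul (k : ℕ) (q : Q) : IsGradedMul ℒ fun l => jetVec Δ k l q := by
  have h1 := ((br_isGradedMul X).map
    ((symTmulHom 𝒜 ℒ Q).flip q ∘ₗ SymAlg.vec 𝒜 ℒ)).ite_length 0 k
  have h2 := ((RightConnection.ev_isGradedMul Δ).map
    (symTmulHom 𝒜 ℒ Q 1 ∘ₗ LinearMap.applyₗ q)).ite_length 1 k
  have h3 := h1.sub_fun h2
  simp only [jetVec_apply]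
  exact h3

variable (X) in
theorem jetScalar_isGradedMul (k : ℕ) (a : A) (q : Q) :
    IsGradedMul ℒ fun l => jetScalar Q X k l a q := by
  have h1 := ((an_isGradedMul X).map
    ((symTmulHom 𝒜 ℒ Q).flip q ∘ₗ SymAlg.scalar 𝒜 ℒ ∘ₗ LinearMap.applyₗ a)).ite_length 1 k
  simp only [jetScalar_apply]
  exact h1

variable (hA : ∀ (i j : ℤ) (a b : A), a ∈ 𝒜 i → b ∈ 𝒜 j →
      a * b = Int.negOnePow (i * j) • (b * a))

theorem jetOp_add_apply (k : ℕ) (u v : FreeSym K (xdeg 𝒜 ℒ)) (l : List (HIdx 𝒜 ⊕ HIdx ℒ)) (q : Q) :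
    (jetOp Δ hA k (u + v)).1 l q = (jetOp Δ hA k u).1 l q + (jetOp Δ hA k v).1 l q := by
  rw [map_add]
  rfl

theorem jetOp_smul_apply (k : ℕ) (c : K) (u : FreeSym K (xdeg 𝒜 ℒ)) (l : List (HIdx 𝒜 ⊕ HIdx ℒ))
    (q : Q) : (jetOp Δ hA k (c • u)).1 l q = c • (jetOp Δ hA k u).1 l q := by
  rw [map_smul]
  rfl

/-- The recursion for generators appends a letter at the end. Here the letter is moved to the front
and extended linearly from basis elements to all homogeneous `ξ`, the form in which `jetVec_cons`
applies. -/
theorem jetOp_vec_inr (k : ℕ) {j : ℤ} {ξ : L} (hξ : ξ ∈ ℒ j) (w : List (HIdx ℒ)) (q : Q) :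
    (jetOp Δ hA k (freeVec 𝒜 ℒ ξ)).1 (w.map Sum.inr) q
      = (j * degW HIdx.deg w).negOnePow • jetVec Δ k ((j, ξ) :: w.map (hsym ℒ)) q
        + (j * (1 + degW HIdx.deg w)).negOnePow •
          (SymAlg.vec 𝒜 ℒ ξ • jetVec Δ k (w.map (hsym ℒ)) q) := by
  have hw := homog_map_hsym ℒ w
  refine eq_of_hsym (𝒱 := ℒ) (e := j)
    (f := fun ξ => (jetOp Δ hA k (freeVec 𝒜 ℒ ξ)).1 (w.map Sum.inr) q)
    (g := fun ξ => (j * degW HIdx.deg w).negOnePow • jetVec Δ k ((j, ξ) :: w.map (hsym ℒ)) q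
        + (j * (1 + degW HIdx.deg w)).negOnePow •
          (SymAlg.vec 𝒜 ℒ ξ • jetVec Δ k (w.map (hsym ℒ)) q))
    (fun u v _ _ => ?_) (fun c u _ => ?_) (fun u v hu hv => ?_) (fun c u hu => ?_)
    (fun i hi => ?_) ξ hξ
  · simp only [map_add (freeVec 𝒜 ℒ), jetOp_add_apply]
  · simp only [map_smul (freeVec 𝒜 ℒ), jetOp_smul_apply]
  · simp only [(jetVec_isGradedMul Δ k q).add _ _ _ _ hu hv hw, map_add, add_smul, smul_add]
    abel
  · simp only [(jetVec_isGradedMul Δ k q).smul _ _ _ _ hu hw, map_smul, smul_assoc, smul_add]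
    exact congrArg₂ (· + ·) (smul_comm _ _ _) (smul_comm _ _ _)
  · subst hi
    rw [freeVec_hbasis, ← mul_one (FreeSym.gen K (xdeg 𝒜 ℒ) (Sum.inr i)), jetOp_gen_mul, jetOp_one,
      jetF_inr, show w.map Sum.inr ++ [Sum.inr i] = (w ++ [i]).map (Sum.inr (α := HIdx 𝒜)) by simp,
      jetF_inr, List.map_append, degW_map_inr]
    have h := (jetVec_isGradedMul Δ k q).append_singleton (l := w.map (hsym ℒ)) (x := hsym ℒ i)
      (homog_cons.2 ⟨hbasis_mem ℒ i, hw⟩)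
    rw [degL_map_hsym] at h
    exact congrArg (· + _) h

theorem jetOp_vec_inl (k : ℕ) {j : ℤ} {ξ : L} (hξ : ξ ∈ ℒ j) (w : List (HIdx ℒ)) (b : HIdx 𝒜)
    (q : Q) : (jetOp Δ hA k (freeVec 𝒜 ℒ ξ)).1 (w.map Sum.inr ++ [Sum.inl b]) q
      = (j * (degW HIdx.deg w + b.deg)).negOnePow •
          jetScalar Q X k ((j, ξ) :: w.map (hsym ℒ)) (hbasis 𝒜 b) q
        + (j * (1 + degW HIdx.deg w + b.deg)).negOnePow •
          (SymAlg.vec 𝒜 ℒ ξ • jetScalar Q X k (w.map (hsym ℒ)) (hbasis 𝒜 b) q) := by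
  have hw := homog_map_hsym ℒ w
  refine eq_of_hsym (𝒱 := ℒ) (e := j)
    (f := fun ξ => (jetOp Δ hA k (freeVec 𝒜 ℒ ξ)).1 (w.map Sum.inr ++ [Sum.inl b]) q)
    (g := fun ξ => (j * (degW HIdx.deg w + b.deg)).negOnePow •
          jetScalar Q X k ((j, ξ) :: w.map (hsym ℒ)) (hbasis 𝒜 b) q
        + (j * (1 + degW HIdx.deg w + b.deg)).negOnePow •
          (SymAlg.vec 𝒜 ℒ ξ • jetScalar Q X k (w.map (hsym ℒ)) (hbasis 𝒜 b) q))
    (fun u v _ _ => ?_) (fun c u _ => ?_) (fun u v hu hv => ?_) (fun c u hu => ?_)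
    (fun i hi => ?_) ξ hξ
  · simp only [map_add (freeVec 𝒜 ℒ), jetOp_add_apply]
  · simp only [map_smul (freeVec 𝒜 ℒ), jetOp_smul_apply]
  · simp only [(jetScalar_isGradedMul X k _ q).add _ _ _ _ hu hv hw, map_add, add_smul, smul_add]
    abel
  · simp only [(jetScalar_isGradedMul X k _ q).smul _ _ _ _ hu hw, map_smul, smul_assoc, smul_add]
    exact congrArg₂ (· + ·) (smul_comm _ _ _) (smul_comm _ _ _)
  · subst hi
    rw [freeVec_hbasis, ← mul_one (FreeSym.gen K (xdeg 𝒜 ℒ) (Sum.inr i)), jetOp_gen_mul, jetOp_one,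
      jetF_inl, List.append_assoc, List.singleton_append, (jetF Δ hA k).2,
      show w.map Sum.inr ++ [Sum.inr i, Sum.inl b]
        = (w ++ [i]).map (Sum.inr (α := HIdx 𝒜)) ++ [Sum.inl b] by simp,
      jetF_inl, List.map_append, degW_append, degW_map_inr]
    have h := (jetScalar_isGradedMul X k (hbasis 𝒜 b) q).append_singleton (l := w.map (hsym ℒ))
      (x := hsym ℒ i) (homog_cons.2 ⟨hbasis_mem ℒ i, hw⟩)
    rw [degL_map_hsym] at h
    have hd : degW (xdeg 𝒜 ℒ) [Sum.inl b] = b.deg := by simp [degW, xdeg]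
    rw [hd]
    refine congrArg₂ (· + ·) ?_ ?_
    · refine (congrArg (fun y => (xdeg 𝒜 ℒ (Sum.inl b) * xdeg 𝒜 ℒ (Sum.inr i)).negOnePow • y)
        h).trans ?_
      rw [smul_smul, ← Int.negOnePow_add]
      congr 2
      change b.deg * i.deg + i.deg * _ = _
      ring
    · rw [← add_assoc]
      rfl

theorem jetOp_vec_eq_zero (k : ℕ) (ξ : L) (l : List (HIdx 𝒜 ⊕ HIdx ℒ))
    (hl : 2 ≤ l.countP Sum.isLeft) : (jetOp Δ hA k (freeVec 𝒜 ℒ ξ)).1 l = 0 := by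
  ext q
  induction ξ using hbasis_induction ℒ with
  | hadd a b ha hb =>
    rw [map_add, jetOp_add_apply, ha, hb, LinearMap.zero_apply, add_zero]
  | hsmul c a ha => rw [map_smul, jetOp_smul_apply, ha, LinearMap.zero_apply, smul_zero]
  | hz => rw [map_zero, map_zero]; rfl
  | h i =>
    rw [freeVec_hbasis, ← mul_one (FreeSym.gen K (xdeg 𝒜 ℒ) (Sum.inr i)), jetOp_gen_mul, jetOp_one,
      jetF_eq_zero Δ hA k l hl, jetF_eq_zero Δ hA k _ (by rw [List.countP_append]; omega)]
    simp

variable [IsScalarTower K A Q] [SetLike.GradedSMul 𝒜 ℒ]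

/-- The anchor term from the bracket's Leibniz rule (`jetVec_cons`) equals the one created by moving
`a` through the connection onto `q` (`jetVec_smul`). On words with a scalar the analogous lemmas for
`jetScalar` have no such terms. -/
theorem jetOp_vec_smul (k : ℕ) {e j : ℤ} {a : A} {ξ : L} (ha : a ∈ 𝒜 e) (hξ : ξ ∈ ℒ j) :
    jetOp Δ hA k (freeVec 𝒜 ℒ (a • ξ))
      = (e * j).negOnePow • SymFun.map (precomp _ a) (jetOp Δ hA k (freeVec 𝒜 ℒ ξ)) := by
  have haξ : a • ξ ∈ ℒ (e + j) := SetLike.GradedSMul.smul_mem ha hξ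
  have hs : ∀ (s : ℤˣ) (F : SymFun K (xdeg 𝒜 ℒ) (Q →ₗ[K] SymTensor 𝒜 ℒ Q))
      (l : List (HIdx 𝒜 ⊕ HIdx ℒ)) (q : Q),
      (s • SymFun.map (precomp _ a) F).1 l q = s • F.1 l (a • q) := fun _ _ _ _ => rfl
  refine symFun_ext (fun w => LinearMap.ext fun q => ?_) (fun w b => LinearMap.ext fun q => ?_)
    fun l hl => LinearMap.ext fun q => ?_
  · have hw := homog_map_hsym ℒ w
    rw [hs, jetOp_vec_inr Δ hA k haξ, jetOp_vec_inr Δ hA k hξ, jetVec_cons Δ hA k hw ha hξ,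
      jetVec_smul Δ hA k hw ha q, degL_map_hsym, SymAlg.vec_smul, SymAlg.scalar_mul_vec ha hξ]
    simp only [smul_add, smul_units_smul, units_smul_smul, smul_smul, ← Int.negOnePow_add]
    rw [add_assoc, negOnePow_eq (b := e * j + j * degW HIdx.deg w) (e * degW HIdx.deg w) (by ring),
      negOnePow_eq (a := (e + j) * degW HIdx.deg w + ((e + j) * degW HIdx.deg w
          + j * (1 + degW HIdx.deg w + e))) (b := e * j + j * (1 + degW HIdx.deg w))
        ((e + j) * degW HIdx.deg w) (by ring),
      show (e + j) * (1 + degW HIdx.deg w) + e * j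
        = e * j + (j * (1 + degW HIdx.deg w) + e * (1 + degW HIdx.deg w)) by ring]
  · have hw := homog_map_hsym ℒ w
    rw [hs, jetOp_vec_inl Δ hA k haξ, jetOp_vec_inl Δ hA k hξ,
      jetScalar_cons hA k hw ha (hbasis_mem 𝒜 b) hξ,
      jetScalar_smul hA k hw ha (hbasis_mem 𝒜 b) q, degL_map_hsym, SymAlg.vec_smul,
      SymAlg.scalar_mul_vec ha hξ]
    simp only [smul_add, smul_units_smul, units_smul_smul, smul_smul, ← Int.negOnePow_add]
    rw [negOnePow_eq (a := (e + j) * (degW HIdx.deg w + b.deg) + e * (j + degW HIdx.deg w + b.deg))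
        (b := e * j + j * (degW HIdx.deg w + b.deg)) (e * (degW HIdx.deg w + b.deg)) (by ring),
      show (e + j) * (1 + degW HIdx.deg w + b.deg) + e * j = e * j + (j * (1 + degW HIdx.deg w + b.deg)
        + e * (1 + degW HIdx.deg w + b.deg)) by ring]
  · rw [hs, jetOp_vec_eq_zero Δ hA k _ l hl, jetOp_vec_eq_zero Δ hA k _ l hl, LinearMap.zero_apply,
      LinearMap.zero_apply, smul_zero]

theorem jetHom_precomp (a : A) (u : FreeSym K (xdeg 𝒜 ℒ))
    (F : SymFun K (xdeg 𝒜 ℒ) (Q →ₗ[K] SymTensor 𝒜 ℒ Q)) :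
    jetLin (genMul Q) (genMul_comm hA) (SymFun.map (precomp _ a) F) u
      = SymFun.map (precomp _ a) (jetLin (genMul Q) (genMul_comm hA) F u) :=
  jetLin_map (genMul_comm hA) (precomp _ a) (fun _ => rfl) F u

theorem jetOp_mul_scalar (k : ℕ) (u : FreeSym K (xdeg 𝒜 ℒ)) (a : A) :
    jetOp Δ hA k (u * freeScalar 𝒜 ℒ a) = SymFun.map (precomp _ a) (jetOp Δ hA k u) := by
  refine (jetLin_mul (genMul_comm hA) (jetF Δ hA k) u (freeScalar 𝒜 ℒ a)).trans ?_
  refine (congrArg (fun F => jetLin (genMul Q) (genMul_comm hA) F u)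
    (jetOp_scalar Δ hA k a)).trans ?_
  exact jetHom_precomp hA a u _

/-- Up to sign `z` may be moved to the right of `u`, and the jets of `u * z` are obtained from those
of `z` by the action of `u`. -/
theorem jetOp_mul_eq_zero (k : ℕ) {e : ℤ} {z : FreeSym K (xdeg 𝒜 ℒ)}
    (hz : z ∈ FreeSym.grading K (xdeg 𝒜 ℒ) e) (h0 : jetOp Δ hA k z = 0)
    (u : FreeSym K (xdeg 𝒜 ℒ)) : jetOp Δ hA k (z * u) = 0 := by
  induction u using FreeSym.word_induction with
  | hadd u v hu hv => rw [mul_add, map_add, hu, hv, add_zero]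
  | hsmul c u hu => rw [mul_smul_comm, map_smul, hu, smul_zero]
  | hword w =>
    rw [FreeSym.isGradedComm.comm hz (FreeSym.isGradedComm.mulL_mem (homog_map_sym w)),
      Units.smul_def, map_zsmul]
    have h : jetOp Δ hA k (mulL (w.map (FreeSym.sym K (xdeg 𝒜 ℒ))) * z) = 0 := by
      refine (jetLin_mul (genMul_comm hA) (jetF Δ hA k) _ z).trans ?_
      refine (congrArg (fun F => jetLin (genMul Q) (genMul_comm hA) F
        (mulL (w.map (FreeSym.sym K (xdeg 𝒜 ℒ))))) h0).trans ?_
      exact jetLin_zero _ _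
    rw [h, smul_zero]

theorem jetOp_sub_eq_zero_iff (k : ℕ) (u v : FreeSym K (xdeg 𝒜 ℒ)) :
    jetOp Δ hA k (u - v) = 0 ↔ jetOp Δ hA k u = jetOp Δ hA k v :=
  jetLin_sub_eq_zero_iff (genMul_comm hA) (jetF Δ hA k) u v

theorem jetOp_scalar_one (k : ℕ) : jetOp Δ hA k (freeScalar 𝒜 ℒ 1) = jetOp Δ hA k 1 := by
  rw [jetOp_scalar, jetOp_one]
  ext l q
  change (jetF Δ hA k).1 l ((1 : A) • q) = (jetF Δ hA k).1 l q
  rw [one_smul]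

theorem jetOp_scalar_mul (k : ℕ) (a b : A) : jetOp Δ hA k (freeScalar 𝒜 ℒ (a * b))
    = jetOp Δ hA k (freeScalar 𝒜 ℒ a * freeScalar 𝒜 ℒ b) := by
  rw [jetOp_mul_scalar, jetOp_scalar, jetOp_scalar]
  ext l q
  change (jetF Δ hA k).1 l ((a * b) • q) = (jetF Δ hA k).1 l (a • b • q)
  rw [mul_smul]

theorem jetOp_scalar_mul_vec (k : ℕ) {e j : ℤ} {a : A} {ξ : L} (ha : a ∈ 𝒜 e) (hξ : ξ ∈ ℒ j) :
    jetOp Δ hA k (freeVec 𝒜 ℒ (a • ξ))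
      = jetOp Δ hA k (freeScalar 𝒜 ℒ a * freeVec 𝒜 ℒ ξ) := by
  rw [FreeSym.isGradedComm.comm (freeScalar_mem 𝒜 ℒ ha) (freeVec_mem 𝒜 ℒ hξ), Units.smul_def,
    map_zsmul, ← Units.smul_def, jetOp_mul_scalar, jetOp_vec_smul Δ hA k ha hξ]

/-- The elements `z` for which the jets of all `z * v` vanish form a two-sided ideal. It contains
the relations for `1`, for products in `A` and for the action on `L`, hence the whole kernel of the
projection. -/
theorem jetOp_eq_zero (k : ℕ) {u : FreeSym K (xdeg 𝒜 ℒ)} (hu : symProj ℒ hA u = 0) :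
    jetOp Δ hA k u = 0 := by
  let Z : Submodule K (FreeSym K (xdeg 𝒜 ℒ)) :=
    { carrier := {z | ∀ v, jetOp Δ hA k (z * v) = 0}
      add_mem' := fun {x y} hx hy v => by rw [add_mul, map_add, hx v, hy v, add_zero]
      zero_mem' := fun v => by rw [zero_mul, map_zero]
      smul_mem' := fun c x hx v => by rw [smul_mul_assoc, map_smul, hx v, smul_zero] }
  have hZ : u ∈ Z := by
    refine ker_symProj_le_of_homogeneous hA Z ?_ ?_ ?_ ?_ ?_ hu
    · intro u z hz v
      rw [mul_assoc]
      refine (jetLin_mul (genMul_comm hA) (jetF Δ hA k) _ (z * v)).trans ?_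
      refine (congrArg (fun F => jetLin (genMul Q) (genMul_comm hA) F u) (hz v)).trans ?_
      exact jetLin_zero _ _
    · intro u z hz v
      rw [mul_assoc]
      exact hz _
    · refine jetOp_mul_eq_zero Δ hA k (e := 0) (Submodule.sub_mem _
        (freeScalar_mem 𝒜 ℒ SetLike.GradedOne.one_mem) FreeSym.isGradedComm.one_mem) ?_
      exact (jetOp_sub_eq_zero_iff Δ hA k _ _).2 (jetOp_scalar_one Δ hA k)
    · intro i j a ha b hb
      refine jetOp_mul_eq_zero Δ hA k (e := i + j) (Submodule.sub_mem _
        (freeScalar_mem 𝒜 ℒ (SetLike.GradedMul.mul_mem ha hb))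
        (FreeSym.isGradedComm.mul_mem (freeScalar_mem 𝒜 ℒ ha) (freeScalar_mem 𝒜 ℒ hb))) ?_
      exact (jetOp_sub_eq_zero_iff Δ hA k _ _).2 (jetOp_scalar_mul Δ hA k a b)
    · intro i j a ha ξ hξ
      refine jetOp_mul_eq_zero Δ hA k (e := i + j) (Submodule.sub_mem _
        (freeVec_mem 𝒜 ℒ (SetLike.GradedSMul.smul_mem ha hξ))
        (FreeSym.isGradedComm.mul_mem (freeScalar_mem 𝒜 ℒ ha) (freeVec_mem 𝒜 ℒ hξ))) ?_
      exact (jetOp_sub_eq_zero_iff Δ hA k _ _).2 (jetOp_scalar_mul_vec Δ hA k ha hξ)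
  simpa using hZ 1

/-- The jets of the `k`-th Rinehart operator on the symmetric algebra. -/
def jetSym (k : ℕ) (l : List (HIdx 𝒜 ⊕ HIdx ℒ)) :
    SymAlg 𝒜 ℒ →ₗ[K] Q →ₗ[K] SymTensor 𝒜 ℒ Q :=
  LinearMap.proj l ∘ₗ (SymFun K (xdeg 𝒜 ℒ) (Q →ₗ[K] SymTensor 𝒜 ℒ Q)).subtype ∘ₗ
    jetOp Δ hA k ∘ₗ symSection hA

theorem jetSym_symProj (k : ℕ) (l : List (HIdx 𝒜 ⊕ HIdx ℒ)) (u : FreeSym K (xdeg 𝒜 ℒ)) :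
    jetSym Δ hA k l (symProj ℒ hA u) = (jetOp Δ hA k u).1 l := by
  have h : jetOp Δ hA k (symSection hA (symProj ℒ hA u)) = jetOp Δ hA k u := by
    refine (jetOp_sub_eq_zero_iff Δ hA k _ _).1 (jetOp_eq_zero Δ hA k ?_)
    rw [map_sub, symProj_symSection, sub_self]
  exact congrArg (fun F => F.1 l) h

theorem jetSym_mul_scalar (k : ℕ) (l : List (HIdx 𝒜 ⊕ HIdx ℒ)) (u : SymAlg 𝒜 ℒ) (a : A) (q : Q) :
    jetSym Δ hA k l (u * SymAlg.scalar 𝒜 ℒ a) q = jetSym Δ hA k l u (a • q) := by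
  obtain ⟨v, rfl⟩ := symProj_surjective ℒ hA u
  rw [← symProj_scalar ℒ hA, ← map_mul, jetSym_symProj, jetSym_symProj, jetOp_mul_scalar]
  rfl

/-- The iterated commutators of the `k`-th Rinehart operator with generators. -/
def rinehartJet (k : ℕ) (l : List (HIdx 𝒜 ⊕ HIdx ℒ)) : Module.End K (SymTensor 𝒜 ℒ Q) :=
  SymTensor.lift 𝒜 ℒ (jetSym Δ hA k l) (jetSym_mul_scalar Δ hA k l)

theorem rinehartJet_symTmul (k : ℕ) (l : List (HIdx 𝒜 ⊕ HIdx ℒ)) (u : FreeSym K (xdeg 𝒜 ℒ))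
    (q : Q) : rinehartJet Δ hA k l (symTmul 𝒜 ℒ (symProj ℒ hA u) q) = (jetOp Δ hA k u).1 l q := by
  rw [rinehartJet, SymTensor.lift_symTmul, jetSym_symProj]

theorem gradedComm_rinehartJet (k : ℕ) (l : List (HIdx 𝒜 ⊕ HIdx ℒ)) (i : HIdx 𝒜 ⊕ HIdx ℒ) :
    gradedComm (rinehartJet Δ hA k l) (1 + degW (xdeg 𝒜 ℒ) l) (symGen 𝒜 ℒ i) (xdeg 𝒜 ℒ i)
      = rinehartJet Δ hA k (l ++ [i]) := by
  refine SymTensor.hom_ext 𝒜 ℒ fun u q => ?_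
  obtain ⟨v, rfl⟩ := symProj_surjective ℒ hA u
  have h : rinehartJet Δ hA k l (symGen 𝒜 ℒ i • symTmul 𝒜 ℒ (symProj ℒ hA v) q)
      = rinehartJet Δ hA k (l ++ [i]) (symTmul 𝒜 ℒ (symProj ℒ hA v) q)
        + (xdeg 𝒜 ℒ i * (1 + degW (xdeg 𝒜 ℒ) l)).negOnePow •
          (symGen 𝒜 ℒ i • rinehartJet Δ hA k l (symTmul 𝒜 ℒ (symProj ℒ hA v) q)) := by
    rw [smul_symTmul, ← symProj_gen ℒ hA, ← map_mul, rinehartJet_symTmul, rinehartJet_symTmul,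
      rinehartJet_symTmul, jetOp_gen_mul, symProj_gen]
  rw [gradedComm, Units.smul_def, mul_comm (1 + degW (xdeg 𝒜 ℒ) l), ← Units.smul_def]
  exact sub_eq_of_eq_add h

/-- The higher Rinehart operators. -/
def rinehartOp (k : ℕ) : Module.End K (SymTensor 𝒜 ℒ Q) := rinehartJet Δ hA k []

theorem itL_rinehartOp (k : ℕ) (w : List (HIdx 𝒜 ⊕ HIdx ℒ)) :
    itL (rinehartOp Δ hA k) 1 (w.map fun i => (xdeg 𝒜 ℒ i, symGen 𝒜 ℒ i))
      = rinehartJet Δ hA k w := by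
  have h := itL_word (deg := xdeg 𝒜 ℒ) (γ := symGen 𝒜 ℒ) (R := rinehartJet Δ hA k)
    (gradedComm_rinehartJet Δ hA k) [] w
  rw [degW_nil, add_zero] at h
  exact h

end Descent

/-! ### Properties of the Rinehart operators -/

section RinehartOp

variable {K A L Q : Type*} [Field K] [Ring A] [Algebra K A]
  [AddCommGroup L] [Module K L] [Module A L]
  [AddCommGroup Q] [Module K Q] [Module A Q]
  {𝒜 : ℤ → Submodule K A} {ℒ : ℤ → Submodule K L} {𝒬 : ℤ → Submodule K Q}

/-- Basis elements suffice as generators; the jets are computed only along words in these. -/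
theorem SymAlg.grading_eq_symGen [GradedAlgebra 𝒜] [DirectSum.Decomposition ℒ]
    (hA : ∀ (i j : ℤ) (a b : A), a ∈ 𝒜 i → b ∈ 𝒜 j → a * b = Int.negOnePow (i * j) • (b * a)) :
    SymAlg.grading 𝒜 ℒ = genSpan K fun x => ∃ i, x = (xdeg 𝒜 ℒ i, symGen 𝒜 ℒ i) := by
  funext e
  refine le_antisymm (fun u hu => ?_) ?_
  · obtain ⟨v, hv, rfl⟩ := exists_symProj_eq hA hu
    change v ∈ (genSpan K _ e).comap (symProj ℒ hA).toLinearMap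
    refine (Submodule.span_le (p := (genSpan K _ e).comap (symProj ℒ hA).toLinearMap)).2 ?_ hv
    rintro _ ⟨l, hl, rfl, rfl⟩
    obtain ⟨w, rfl⟩ := FreeSym.exists_map hl
    refine Submodule.subset_span ⟨w.map fun i => (xdeg 𝒜 ℒ i, symGen 𝒜 ℒ i), ?_, ?_, ?_⟩
    · intro x hx
      obtain ⟨i, -, rfl⟩ := List.mem_map.1 hx
      exact ⟨i, rfl⟩
    · rw [degL, degL, List.map_map, List.map_map]
      rfl
    · change symProj ℒ hA (mulL _) = _
      rw [mulL, mulL, map_list_prod, List.map_map, List.map_map, List.map_map]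
      congr 1
      refine List.map_congr_left fun i _ => ?_
      exact symProj_gen ℒ hA i
  · rw [SymAlg.grading_eq]
    refine Submodule.span_mono ?_
    rintro _ ⟨l, hl, rfl, rfl⟩
    refine ⟨l, fun x hx => ?_, rfl, rfl⟩
    obtain ⟨i, rfl⟩ := hl x hx
    exact isGen_symGen 𝒜 ℒ i

theorem symTmul_mem {i j : ℤ} {u : SymAlg 𝒜 ℒ} {q : Q} (hu : u ∈ SymAlg.grading 𝒜 ℒ i)
    (hq : q ∈ 𝒬 j) : symTmul 𝒜 ℒ u q ∈ symTensorGrading 𝒜 ℒ 𝒬 (i + j) :=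
  Submodule.subset_span ⟨i, j, u, q, hu, hq, rfl, rfl⟩

theorem smul_mem_symTensorGrading [GradedAlgebra 𝒜]
    (hA : ∀ (i j : ℤ) (a b : A), a ∈ 𝒜 i → b ∈ 𝒜 j → a * b = Int.negOnePow (i * j) • (b * a))
    {i j : ℤ} {u : SymAlg 𝒜 ℒ} {m : SymTensor 𝒜 ℒ Q}
    (hu : u ∈ SymAlg.grading 𝒜 ℒ i) (hm : m ∈ symTensorGrading 𝒜 ℒ 𝒬 j) :
    u • m ∈ symTensorGrading 𝒜 ℒ 𝒬 (i + j) := by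
  change m ∈ (symTensorGrading 𝒜 ℒ 𝒬 (i + j)).comap (mu K u)
  refine (Submodule.span_le (p := (symTensorGrading 𝒜 ℒ 𝒬 (i + j)).comap (mu K u))).2 ?_ hm
  rintro _ ⟨i', j', v, q, hv, hq, rfl, rfl⟩
  change u • symTmul 𝒜 ℒ v q ∈ symTensorGrading 𝒜 ℒ 𝒬 (i + (i' + j'))
  rw [smul_symTmul, ← add_assoc]
  exact symTmul_mem ((SymAlg.isGradedComm hA).mul_mem hu hv) hq

variable (𝒜 ℒ 𝒬) in
/-- The linear maps of degree `s` from `Q` to `S_A L ⊗_A Q`. -/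
def homGrading (s : ℤ) : Submodule K (Q →ₗ[K] SymTensor 𝒜 ℒ Q) where
  carrier := {T | ∀ e, ∀ q ∈ 𝒬 e, T q ∈ symTensorGrading 𝒜 ℒ 𝒬 (s + e)}
  add_mem' hS hT e q hq := Submodule.add_mem _ (hS e q hq) (hT e q hq)
  zero_mem' _ _ _ := Submodule.zero_mem _
  smul_mem' c _ hT e q hq := Submodule.smul_mem _ c (hT e q hq)

theorem mem_homGrading {s : ℤ} {T : Q →ₗ[K] SymTensor 𝒜 ℒ Q} : T ∈ homGrading 𝒜 ℒ 𝒬 s ↔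
    ∀ e, ∀ q ∈ 𝒬 e, T q ∈ symTensorGrading 𝒜 ℒ 𝒬 (s + e) := Iff.rfl

variable {X : LRInfty 𝒜 ℒ} (Δ : RightConnection X 𝒬) [GradedAlgebra 𝒜] [DirectSum.Decomposition ℒ]
  (hA : ∀ (i j : ℤ) (a b : A), a ∈ 𝒜 i → b ∈ 𝒜 j →
      a * b = Int.negOnePow (i * j) • (b * a))

theorem jetConn_mem (hA : ∀ (i j : ℤ) (a b : A), a ∈ 𝒜 i → b ∈ 𝒜 j →
      a * b = Int.negOnePow (i * j) • (b * a)) (k : ℕ) (l : List (HIdx 𝒜 ⊕ HIdx ℒ)) :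
    (jetConn Δ k).1 l ∈ homGrading 𝒜 ℒ 𝒬 (1 + (l.map (xdeg 𝒜 ℒ)).sum) := by
  refine mixed_mem HIdx.deg HIdx.deg (𝓦 := homGrading 𝒜 ℒ 𝒬) (wt := xdeg 𝒜 ℒ) (s := 1)
    (fun w => ?_) (fun _ _ => Submodule.zero_mem _) l
  split_ifs
  · refine mem_homGrading.2 fun e q hq => ?_
    have h := Δ.ev_mem (w.map (hsym ℒ)) (homog_map_hsym ℒ w) e q hq
    rw [degL_map_hsym] at h
    have h1 := symTmul_mem (ℒ := ℒ) (𝒜 := 𝒜) (SymAlg.isGradedComm hA).one_mem h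
    rw [zero_add] at h1
    exact h1
  · exact Submodule.zero_mem _

theorem jetF_mem (k : ℕ) (l : List (HIdx 𝒜 ⊕ HIdx ℒ)) :
    (jetF Δ hA k).1 l ∈ homGrading 𝒜 ℒ 𝒬 (1 + (l.map (xdeg 𝒜 ℒ)).sum) := by
  rw [jetF_apply]
  refine Submodule.sub_mem _ (mem_homGrading.2 fun e q hq => ?_) (jetConn_mem Δ hA k l)
  exact symTmul_mem (symProj_mem hA (extF_mem X k l)) hq

theorem genMul_mem (hA : ∀ (i j : ℤ) (a b : A), a ∈ 𝒜 i → b ∈ 𝒜 j →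
      a * b = Int.negOnePow (i * j) • (b * a)) (i : HIdx 𝒜 ⊕ HIdx ℒ) (s : ℤ)
    (T : Q →ₗ[K] SymTensor 𝒜 ℒ Q) (hT : T ∈ homGrading 𝒜 ℒ 𝒬 s) :
    genMul Q i T ∈ homGrading 𝒜 ℒ 𝒬 (xdeg 𝒜 ℒ i + s) := by
  refine mem_homGrading.2 fun e q hq => ?_
  rw [genMul_apply, add_assoc]
  refine smul_mem_symTensorGrading hA ?_ (mem_homGrading.1 hT e q hq)
  rw [SymAlg.grading_eq]
  exact gen_mem_genSpan (x := (xdeg 𝒜 ℒ i, symGen 𝒜 ℒ i)) (isGen_symGen 𝒜 ℒ i)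

variable [IsScalarTower K A Q] [SetLike.GradedSMul 𝒜 ℒ]

theorem rinehartOp_mem (k : ℕ) (e : ℤ) (m : SymTensor 𝒜 ℒ Q)
    (hm : m ∈ symTensorGrading 𝒜 ℒ 𝒬 e) :
    rinehartOp Δ hA k m ∈ symTensorGrading 𝒜 ℒ 𝒬 (1 + e) := by
  change m ∈ (symTensorGrading 𝒜 ℒ 𝒬 (1 + e)).comap (rinehartOp Δ hA k)
  refine (Submodule.span_le (p := (symTensorGrading 𝒜 ℒ 𝒬 (1 + e)).comap
    (rinehartOp Δ hA k))).2 ?_ hm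
  rintro _ ⟨i, j, u, q, hu, hq, rfl, rfl⟩
  obtain ⟨v, hv, rfl⟩ := exists_symProj_eq hA hu
  change rinehartOp Δ hA k (symTmul 𝒜 ℒ (symProj ℒ hA v) q) ∈ symTensorGrading 𝒜 ℒ 𝒬 (1 + (i + j))
  rw [rinehartOp, rinehartJet_symTmul]
  clear hu hm
  induction hv using Submodule.span_induction with
  | mem v hv =>
    obtain ⟨l, hl, rfl, rfl⟩ := hv
    obtain ⟨w, rfl⟩ := FreeSym.exists_map hl
    have h := mem_homGrading.1 (jetHom_mem (𝓦 := homGrading 𝒜 ℒ 𝒬) (genMul_comm hA)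
      (jetF_mem Δ hA k) (genMul_mem hA) [] w) j q hq
    rw [degL_map_sym, degW]
    rw [List.map_nil, List.sum_nil, add_zero, add_assoc] at h
    exact h
  | zero => rw [map_zero]; exact Submodule.zero_mem _
  | add u v _ _ hu hv => rw [jetOp_add_apply]; exact Submodule.add_mem _ hu hv
  | smul c u _ hu => rw [jetOp_smul_apply]; exact Submodule.smul_mem _ _ hu

theorem jetOp_length (k : ℕ) (u : FreeSym K (xdeg 𝒜 ℒ)) (l : List (HIdx 𝒜 ⊕ HIdx ℒ))
    (hl : k < l.length) : (jetOp Δ hA k u).1 l = 0 :=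
  jetHom_eq_zero (genMul_comm hA) (jetF_length Δ hA k) u l hl

theorem rinehartJet_eq_zero (k : ℕ) (l : List (HIdx 𝒜 ⊕ HIdx ℒ)) (hl : k < l.length) :
    rinehartJet Δ hA k l = 0 := by
  refine SymTensor.hom_ext 𝒜 ℒ fun u q => ?_
  obtain ⟨v, rfl⟩ := symProj_surjective ℒ hA u
  rw [rinehartJet_symTmul, jetOp_length Δ hA k v l hl]
  rfl

/-- The connection contributes only in length `k - 1`, so on `1 ⊗ q` the jet of length `k` is the
bracket. Longer jets vanish, so this operator commutes with multiplications and the formula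
propagates to products. -/
theorem rinehartJet_eq_mu (l : List (HIdx 𝒜 ⊕ HIdx ℒ)) : rinehartJet Δ hA l.length l
    = mu K (symProj ℒ hA ((extF X l.length).1 l)) := by
  refine SymTensor.hom_ext 𝒜 ℒ fun u q => ?_
  obtain ⟨v, rfl⟩ := symProj_surjective ℒ hA u
  rw [rinehartJet_symTmul, mu_apply, smul_symTmul]
  induction v using FreeSym.induction with
  | hadd u v hu hv =>
    rw [jetOp_add_apply, hu, hv, map_add, mul_add, ← symTmulHom_apply, ← symTmulHom_apply,
      ← symTmulHom_apply, map_add, LinearMap.add_apply]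
  | hsmul c u hu =>
    rw [jetOp_smul_apply, hu, map_smul, mul_smul_comm, ← symTmulHom_apply,
      ← symTmulHom_apply, map_smul, LinearMap.smul_apply]
  | hone =>
    rw [jetOp_one, jetF_apply, jetConn_length Δ _ l (by omega), sub_zero, map_one, mul_one]
    rfl
  | hmul i u hu =>
    rw [jetOp_gen_mul, hu, jetOp_length Δ hA _ u _ (by simp), LinearMap.zero_apply, zero_add,
      map_mul, smul_symTmul, ← mul_assoc, ← mul_assoc, ← symProj_gen ℒ hA,
      (SymAlg.isGradedComm hA).comm (symProj_mem hA (FreeSym.gen_mem i))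
        (symProj_mem hA (extF_mem X l.length l)), smul_mul_assoc, symTmul_units_smul, smul_smul,
      Int.units_mul_self, one_smul]

/-- Only the empty word could contribute, through the bracket with no entries, which is zero. -/
theorem rinehartOp_zero : rinehartOp Δ hA 0 = 0 := by
  have h : jetF Δ hA 0 = 0 := by
    ext l q
    rw [jetF_apply, jetConn_length Δ 0 l (by omega), sub_zero]
    by_cases hl : l.length = 0
    · rw [List.length_eq_zero_iff.1 hl]
      have : (extF X 0).1 ([] : List (HIdx 𝒜 ⊕ HIdx ℒ)) = 0 := by
        change extVec X 0 [] = 0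
        rw [extVec, if_pos List.length_nil, List.map_nil, LRInfty.br, evalL_nil _ Fin.elim0, X.bracket_zero,
          MultilinearMap.zero_apply, map_zero]
      rw [this, map_zero, map_zero]
      rfl
    · rw [extF_length X 0 l hl, map_zero, map_zero]
      rfl
  refine SymTensor.hom_ext 𝒜 ℒ fun u q => ?_
  obtain ⟨v, rfl⟩ := symProj_surjective ℒ hA u
  rw [rinehartOp, rinehartJet_symTmul]
  have h' : jetOp Δ hA 0 v = 0 :=
    (congrArg (fun F => jetLin (genMul Q) (genMul_comm hA) F v) h).trans (jetLin_zero _ _)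
  rw [h']
  rfl

variable [CharZero K]

/-- On basis generators this is `rinehartJet_eq_mu` together with the vanishing of longer jets. It
extends to all homogeneous elements because iterated commutators and the bracket obey the same
Leibniz rule. -/
theorem rinehartOp_isSymbol :
    IsSymbol (SymAlg.grading 𝒜 ℒ) (rinehartOp Δ hA) (symBr hA X) := by
  have hg := SymAlg.isGradedComm (ℒ := ℒ) hA
  have hm := symBr_isMultiDer hA X
  have hmap : ∀ l : List (ℤ × SymAlg 𝒜 ℒ), (∀ x ∈ l, ∃ i, x = (xdeg 𝒜 ℒ i, symGen 𝒜 ℒ i)) →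
      ∃ w : List (HIdx 𝒜 ⊕ HIdx ℒ), l = w.map fun i => (xdeg 𝒜 ℒ i, symGen 𝒜 ℒ i) := by
    intro l hl
    induction l with
    | nil => exact ⟨[], rfl⟩
    | cons x l ih =>
      obtain ⟨i, rfl⟩ := hl x (List.mem_cons_self ..)
      obtain ⟨w, rfl⟩ := ih fun y hy => hl y (List.mem_cons_of_mem _ hy)
      exact ⟨i :: w, rfl⟩
  have heq : ∀ l : List (ℤ × SymAlg 𝒜 ℒ), (∀ x ∈ l, ∃ i, x = (xdeg 𝒜 ℒ i, symGen 𝒜 ℒ i)) →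
      itL (rinehartOp Δ hA l.length) 1 l = mu K (symBr hA X l) := by
    intro l hl
    obtain ⟨w, rfl⟩ := hmap l hl
    have h := symBr_map hA X (w.map (FreeSym.sym K (xdeg 𝒜 ℒ))) (homog_map_sym w)
    rw [extBr_map_sym, List.map_map] at h
    rw [itL_rinehartOp, List.length_map, rinehartJet_eq_mu, ← h]
    congr 2
    refine List.map_congr_left fun i _ => ?_
    exact Prod.ext rfl (symProj_gen ℒ hA i)
  have hzero : ∀ k (l : List (ℤ × SymAlg 𝒜 ℒ)),
      (∀ x ∈ l, ∃ i, x = (xdeg 𝒜 ℒ i, symGen 𝒜 ℒ i)) → k < l.length →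
      itL (rinehartOp Δ hA k) 1 l = 0 := by
    intro k l hl hk
    obtain ⟨w, rfl⟩ := hmap l hl
    rw [itL_rinehartOp, rinehartJet_eq_zero]
    simpa using hk
  rw [SymAlg.grading_eq_symGen hA] at hg hm ⊢
  exact hm.isSymbol hg _ heq hzero

end RinehartOp

/-! ### The higher Rinehart formula -/

section Formula

theorem drop_ofFn_block {β : Type*} {n i j : ℕ} (h : i + j = n) (v : Fin n → β) :
    (List.ofFn v).drop i = List.ofFn (block i j h.le v) := by
  refine List.ext_getElem (by simp; omega) fun m h1 h2 => ?_
  simp [block]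

theorem ush_sub {α M : Type*} [AddCommGroup M] (l : List (ℤ × α))
    (G G' : List (ℤ × α) → List (ℤ × α) → M) :
    ush l (fun I J => G I J - G' I J) = ush l G - ush l G' := by
  rw [eq_sub_iff_add_eq, ← ush_add]
  exact ush_congr l fun I J _ => sub_add_cancel _ _

variable {K A L Q : Type*} [Field K] [Ring A] [Algebra K A]
  [AddCommGroup L] [Module K L] [Module A L]
  [AddCommGroup Q] [Module K Q] [Module A Q]
  {𝒜 : ℤ → Submodule K A} {ℒ : ℤ → Submodule K L} {𝒬 : ℤ → Submodule K Q}

theorem itL_isGradedMul {B M : Type*} [Ring B] [Algebra K B] [AddCommGroup M] [Module K M]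
    [Module B M] [IsScalarTower K B M] {𝓑 : ℤ → Submodule K B} (h𝓑 : IsGradedComm 𝓑)
    (T : Module.End K M) (t : ℤ) : IsGradedMul 𝓑 (itL T t) where
  swap _ _ _ _ hl := h𝓑.itL_swap T t hl
  add e u v l _ _ _ := itL_cons_add T t e u v l
  smul e c u l _ _ := itL_cons_smul T t e c u l

theorem homog_map_vec [GradedAlgebra 𝒜] {l : List (ℤ × L)} (hl : Homog ℒ l) :
    Homog (SymAlg.grading 𝒜 ℒ) (l.map (degMap (SymAlg.vec 𝒜 ℒ))) :=
  homog_map_degMap (fun _ _ hv => vec_mem_grading hv) hl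

/-- A scalar coefficient can be moved to the right and absorbed by `Q`, so products of vectors
tensored with elements of `Q` already span. -/
theorem SymTensor.hom_ext_prod [GradedAlgebra 𝒜] (hA : ∀ (i j : ℤ) (a b : A), a ∈ 𝒜 i → b ∈ 𝒜 j →
      a * b = Int.negOnePow (i * j) • (b * a)) [DirectSum.Decomposition ℒ]
    [SetLike.GradedSMul 𝒜 ℒ] {Y : Type*} [AddCommGroup Y] [Module K Y]
    {f g : SymTensor 𝒜 ℒ Q →ₗ[K] Y}
    (h : ∀ (l : ℕ) (d : Fin l → ℤ) (ξ : Fin l → L), (∀ t, ξ t ∈ ℒ (d t)) → ∀ q,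
      f (symTmul 𝒜 ℒ (SymAlg.prod 𝒜 ℒ ξ) q) = g (symTmul 𝒜 ℒ (SymAlg.prod 𝒜 ℒ ξ) q)) : f = g := by
  refine SymTensor.hom_ext 𝒜 ℒ fun u q => ?_
  have key : ((f ∘ₗ (symTmulHom 𝒜 ℒ Q).flip q) : SymAlg 𝒜 ℒ →ₗ[K] Y)
      = g ∘ₗ (symTmulHom 𝒜 ℒ Q).flip q := by
    refine LinearMap.ext_on (span_homogeneous_sym hA) ?_
    rintro u ⟨e, hu⟩
    refine Submodule.span_induction (p := fun u _ => (f ∘ₗ (symTmulHom 𝒜 ℒ Q).flip q) u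
      = (g ∘ₗ (symTmulHom 𝒜 ℒ Q).flip q) u) ?_ ?_ ?_ ?_ hu
    · rintro _ ⟨i, l, d, a, ξ, ha, hξ, -, rfl⟩
      have hp : SymAlg.prod 𝒜 ℒ ξ ∈ SymAlg.grading 𝒜 ℒ (degL (List.ofFn fun t => (d t, ξ t))) := by
        rw [SymAlg.prod_eq_mulL d ξ, ← degL_map_degMap (SymAlg.vec 𝒜 ℒ)]
        exact (SymAlg.isGradedComm hA).mulL_mem (homog_map_vec (homog_ofFn d ξ hξ))
      change f (symTmul 𝒜 ℒ _ q) = g (symTmul 𝒜 ℒ _ q)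
      rw [(SymAlg.isGradedComm hA).comm (scalar_mem_grading ha) hp, symTmul_units_smul,
        symTmul_scalar, Units.smul_def, map_zsmul, map_zsmul, h l d ξ hξ]
    · rw [map_zero, map_zero]
    · intro u v _ _ hu hv
      rw [map_add, map_add, hu, hv]
    · intro c u _ hu
      rw [map_smul, map_smul, hu]
  exact LinearMap.congr_fun key u

variable {X : LRInfty 𝒜 ℒ} (Δ : RightConnection X 𝒬) [GradedAlgebra 𝒜] [DirectSum.Decomposition ℒ]
  (hA : ∀ (i j : ℤ) (a b : A), a ∈ 𝒜 i → b ∈ 𝒜 j →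
      a * b = Int.negOnePow (i * j) • (b * a)) [IsScalarTower K A Q] [SetLike.GradedSMul 𝒜 ℒ]

theorem itL_rinehartOp_vec (k : ℕ) (l : List (ℤ × L)) (hl : Homog ℒ l) (q : Q) :
    itL (rinehartOp Δ hA k) 1 (l.map (degMap (SymAlg.vec 𝒜 ℒ))) (symTmul 𝒜 ℒ 1 q)
      = jetVec Δ k l q := by
  have h1 := ((itL_isGradedMul (SymAlg.isGradedComm hA) (rinehartOp Δ hA k) 1).map
    (LinearMap.applyₗ (symTmul 𝒜 ℒ 1 q))).comap (𝒱 := ℒ) (φ := SymAlg.vec 𝒜 ℒ)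
    fun _ _ hv => vec_mem_grading hv
  refine h1.ext (jetVec_isGradedMul Δ k q) (gen := fun x => ∃ i, x = hsym ℒ i) (le_span_hsym ℒ)
    (hsym_mem ℒ) ?_ l hl
  intro l hl
  obtain ⟨w, rfl⟩ := exists_map_hsym ℒ hl
  have h2 := itL_rinehartOp Δ hA k (w.map Sum.inr)
  have h3 : ((w.map Sum.inr).map fun i => (xdeg 𝒜 ℒ i, symGen 𝒜 ℒ i))
      = (w.map (hsym ℒ)).map (degMap (SymAlg.vec 𝒜 ℒ)) := by
    rw [List.map_map, List.map_map]
    rfl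
  rw [h3] at h2
  have h4 := rinehartJet_symTmul Δ hA k (w.map Sum.inr) 1 q
  rw [map_one, jetOp_one, jetF_inr] at h4
  change itL (rinehartOp Δ hA k) 1 _ (symTmul 𝒜 ℒ 1 q) = _
  rw [h2, h4]

theorem degL_map_vec (l : List (ℤ × L)) : degL (l.map (degMap (SymAlg.vec 𝒜 ℒ))) = degL l := by
  rw [degL_map_degMap]

/-- This is the rule for moving an operator past a product, applied to `ξ_1 ⋯ ξ_l · (1 ⊗ q)`, where
the iterated commutators on `1 ⊗ q` are the values `jetVec`. -/
theorem rinehartOp_symTmul (k : ℕ) (l : List (ℤ × L)) (hl : Homog ℒ l) (q : Q) :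
    rinehartOp Δ hA k (symTmul 𝒜 ℒ (mulL (l.map (degMap (SymAlg.vec 𝒜 ℒ)))) q)
      = (ush l fun I J => if I.length = k then
          symTmul 𝒜 ℒ (SymAlg.vec 𝒜 ℒ (X.br I) * mulL (J.map (degMap (SymAlg.vec 𝒜 ℒ)))) q else 0)
        - ush l fun J I => if I.length + 1 = k then (degL J).negOnePow •
          symTmul 𝒜 ℒ (mulL (J.map (degMap (SymAlg.vec 𝒜 ℒ)))) (Δ.ev I q) else 0 := by
  rw [← mul_one (mulL _), ← smul_symTmul, apply_mulL_smul, ush_map_list (degMap (SymAlg.vec 𝒜 ℒ)) (fun _ => rfl),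
    -- The formula has the bracket in front of the remaining vectors, whereas the rule puts the
    -- commutator behind them; hence the interchange in the first sum only.
    ush_swap l (fun I J => if I.length = k then _ else 0), ← ush_sub]
  refine ush_congr l fun J I hp => ?_
  have hI : Homog ℒ I := (homog_append.1 ((homog_perm hp).2 hl)).2
  have hJ : Homog ℒ J := (homog_append.1 ((homog_perm hp).2 hl)).1
  rw [itL_rinehartOp_vec Δ hA k I hI, jetVec_apply, degL_map_vec, one_mul, smul_sub, smul_sub]
  refine congrArg₂ (· - ·) ?_ ?_
  · split_ifs
    · have hJ' := (SymAlg.isGradedComm hA).mulL_mem (homog_map_vec (𝒜 := 𝒜) hJ)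
      rw [degL_map_vec] at hJ'
      rw [smul_symTmul, (SymAlg.isGradedComm hA).comm hJ' (vec_mem_grading (X.br_mem I hI)),
        symTmul_units_smul, smul_smul, ← Int.negOnePow_add]
      congr 1
      exact negOnePow_eq (degL J) (by ring)
    · rw [smul_zero, smul_zero, smul_zero]
  · split_ifs
    · rw [smul_symTmul, mul_one]
    · rw [smul_zero, smul_zero]

theorem rinehartOp_isRinehart : IsRinehart Δ (rinehartOp Δ hA) where
  zero := rinehartOp_zero Δ hA
  formula n l d ξ hξ q := by
    rw [SymAlg.prod_eq_mulL d ξ, rinehartOp_symTmul Δ hA (n + 1) _ (homog_ofFn d ξ hξ) q]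
    refine congrArg₂ (· - ·) ?_ ?_
    · split_ifs with h
      · rw [← sum_unshuffles h]
        refine Finset.sum_congr rfl fun σ _ => ?_
        rw [take_ofFn (by omega), drop_ofFn (by omega), LRInfty.br, evalL_ofFn,
          SymAlg.prod_eq_mulL (block (n + 1) (l - (n + 1)) (by omega) (d ∘ σ))]
        rfl
      · refine (ush_congr _ fun I J hp => ?_).trans (ush_zero _)
        have := hp.length_eq
        rw [List.length_append, List.length_ofFn] at this
        rw [if_neg (by omega)]
    · split_ifs with h
      · have h1 : ∀ I J : List (ℤ × L), (I ++ J).Perm (List.ofFn fun t => (d t, ξ t)) →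
            (J.length + 1 = n + 1 ↔ I.length = l - n) := by
          intro I J hp
          have := hp.length_eq
          rw [List.length_append, List.length_ofFn] at this
          omega
        refine (ush_congr _ fun I J hp => if_congr (h1 I J hp) rfl rfl).trans ?_
        rw [← sum_unshuffles (Nat.sub_le l n)]
        refine Finset.sum_congr rfl fun σ _ => ?_
        rw [take_ofFn (by omega), drop_ofFn_block (j := n) (by omega), RightConnection.ev,
          evalL_ofFn, SymAlg.prod_eq_mulL (block 0 (l - n) (by omega) (d ∘ σ)), smul_smul,
          mul_comm, degL_ofFn]
        rfl
      · refine (ush_congr _ fun I J hp => ?_).trans (ush_zero _)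
        have := hp.length_eq
        rw [List.length_append, List.length_ofFn] at this
        rw [if_neg (by omega)]

theorem IsRinehart.eq {D : ℕ → Module.End K (SymTensor 𝒜 ℒ Q)} (hD : IsRinehart Δ D) :
    D = rinehartOp Δ hA := by
  funext k
  cases k with
  | zero => rw [hD.zero, rinehartOp_zero]
  | succ n =>
    refine SymTensor.hom_ext_prod hA fun l d ξ hξ q => ?_
    rw [hD.formula n l d ξ hξ q, (rinehartOp_isRinehart Δ hA).formula n l d ξ hξ q]

end Formula

/-! ### The right connection of a family of differential operators -/

section Derived

variable {K B M : Type*} [Field K] [CharZero K] [Ring B] [Algebra K B]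
  [AddCommGroup M] [Module K M] [Module B M] [IsScalarTower K B M]
  {𝓑 : ℤ → Submodule K B} {ℳ : ℤ → Submodule K M} {p₀ p₁ : B →ₗ[K] B}

theorem eq_zero_of_mem_groundGrading {e : ℤ} {c : K} (hc : c ∈ groundGrading K e) (he : e ≠ 0) :
    c = 0 := by
  rw [groundGrading, if_neg he] at hc
  exact (Submodule.mem_bot K).1 hc

/-- The multiples of the right connection with components `[⋯[D_{n+1}, μ_{u_1}] ⋯, μ_{u_n}]`. -/
def derivedConnection (h𝓑 : IsGradedComm 𝓑) (hspan : Submodule.span K {v | ∃ e, v ∈ 𝓑 e} = ⊤)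
    (hp : IsParity 𝓑 p₀ p₁)
    (hℳ : ∀ {i j : ℤ} {a : B} {m : M}, a ∈ 𝓑 i → m ∈ ℳ j → a • m ∈ ℳ (i + j))
    (Λ : LRInfty (groundGrading K) 𝓑) (D : ℕ → Module.End K M)
    (hD : ∀ k e, ∀ m ∈ ℳ e, D k m ∈ ℳ (1 + e)) (c : K) : RightConnection Λ ℳ where
  op n := c • itMul p₀ p₁ n 1 (D (n + 1))
  op_degree n d u hu e m hm := by
    rw [MultilinearMap.smul_apply, itMul_eq hp 1 1 (by simp) _ d u hu, iterComm_eq_itL]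
    have := itL_degree hℳ (hD (n + 1)) (homog_ofFn d u hu) e m hm
    rw [degL_ofFn] at this
    exact Submodule.smul_mem _ _ this
  op_symm n d u hu σ := by
    rw [MultilinearMap.smul_apply, MultilinearMap.smul_apply,
      itMul_eq hp 1 1 (by simp) _ (d ∘ σ) (u ∘ σ) fun t => hu (σ t),
      itMul_eq hp 1 1 (by simp) _ d u hu, iterComm_eq_itL, iterComm_eq_itL, smul_comm _ c]
    exact congrArg (c • ·) ((itL_isGradedMul h𝓑 (D (n + 1)) 1).koszul d u hu σ)
  op_leibniz n d u hu e a ha m := by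
    rw [anchor_groundGrading hspan, MultilinearMap.zero_apply, LinearMap.zero_apply, zero_smul,
      sub_zero, map_smul]
    by_cases he : e = 0
    · rw [he, mul_zero, Int.negOnePow_zero, one_smul]
    · rw [eq_zero_of_mem_groundGrading ha he, zero_smul, smul_zero]
  op_linear n d u hu f v hv e a ha m := by
    rw [MultilinearMap.cons_smul, map_smul, LinearMap.smul_apply]
    by_cases he : e = 0
    · rw [he, zero_mul, Int.negOnePow_zero, one_smul]
    · rw [eq_zero_of_mem_groundGrading ha he, zero_smul, smul_zero]

variable (h𝓑 : IsGradedComm 𝓑) (hspan : Submodule.span K {v | ∃ e, v ∈ 𝓑 e} = ⊤)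
  (hp : IsParity 𝓑 p₀ p₁)
  (hℳ : ∀ {i j : ℤ} {a : B} {m : M}, a ∈ 𝓑 i → m ∈ ℳ j → a • m ∈ ℳ (i + j))
  (Λ : LRInfty (groundGrading K) 𝓑) (D : ℕ → Module.End K M)
  (hD : ∀ k e, ∀ m ∈ ℳ e, D k m ∈ ℳ (1 + e))

theorem derivedConnection_op (c : K) {n : ℕ} (d : Fin n → ℤ) (u : Fin n → B)
    (hu : ∀ t, u t ∈ 𝓑 (d t)) : (derivedConnection h𝓑 hspan hp hℳ Λ D hD c).op n u
      = c • itL (D (n + 1)) 1 (List.ofFn fun t => (d t, u t)) := by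
  rw [← iterComm_eq_itL, ← itMul_eq hp 1 1 (by simp) _ d u hu]
  rfl

theorem derivedConnection_ev (c : K) (l : List (ℤ × B)) (hl : Homog 𝓑 l) :
    (derivedConnection h𝓑 hspan hp hℳ Λ D hD c).ev l = c • itL (D (l.length + 1)) 1 l := by
  obtain ⟨n, d, u, hu, rfl⟩ := exists_ofFn_homog hl
  rw [RightConnection.ev, evalL_ofFn, derivedConnection_op h𝓑 hspan hp hℳ Λ D hD c d u hu,
    List.length_ofFn]

/-- The curvature is a part linear in the connection minus a quadratic one, whereas `square_two` is
a sum of the corresponding parts for `R`. Replacing `R` by `-R` changes only the linear part, and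
the result is minus that sum. -/
theorem derivedConnection_curvature (hs : IsSymbol 𝓑 D Λ.br) {n : ℕ} (d : Fin n → ℤ)
    (u : Fin n → B) (hu : ∀ t, u t ∈ 𝓑 (d t)) :
    (derivedConnection h𝓑 hspan hp hℳ Λ D hD (-1)).curvature d u
      = -iterComm (halfSquare D (n + 1)) 2 d u := by
  have hl := homog_ofFn d u hu
  rw [iterComm_eq_itL, halfSquare_eq]
  have h2 := hs.square_two h𝓑 hl
  rw [List.length_ofFn] at h2
  rw [h2, neg_add, RightConnection.curvature, sub_eq_add_neg]
  refine congrArg₂ (· + ·) ?_ (congrArg Neg.neg ?_)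
  · have h := sum_unshuffles_comp (fun n => ⇑((derivedConnection h𝓑 hspan hp hℳ Λ D hD (-1)).op n))
      (fun n => ⇑(Λ.bracket n)) d u fun I => 1 + degL I
    refine h.trans ?_
    rw [eq_neg_iff_add_eq_zero, ← ush_add, ← ush_zero]
    refine ush_congr _ fun I J hIJ => ?_
    have hI : Homog 𝓑 I := homog_left hl hIJ
    have hJ : Homog 𝓑 J := homog_right hl hIJ
    refine (congrArg (· + _) (derivedConnection_ev h𝓑 hspan hp hℳ Λ D hD (-1) _
      (homog_cons.2 ⟨Λ.br_mem I hI, hJ⟩))).trans ?_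
    rw [neg_one_smul]
    exact neg_add_cancel _
  · have h := sum_unshuffles_mul (fun n => ⇑((derivedConnection h𝓑 hspan hp hℳ Λ D hD (-1)).op n))
      (fun n => ⇑((derivedConnection h𝓑 hspan hp hℳ Λ D hD (-1)).op n)) d u
    refine h.trans (ush_congr _ fun I J hIJ => congrArg _ ?_)
    refine (congrArg₂ (· * ·)
      (derivedConnection_ev h𝓑 hspan hp hℳ Λ D hD (-1) I (homog_left hl hIJ))
      (derivedConnection_ev h𝓑 hspan hp hℳ Λ D hD (-1) J (homog_right hl hIJ))).trans ?_
    rw [neg_one_smul, neg_one_smul, neg_mul_neg]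

/-- One more commutator, with `v`, reaches the order of the operator and is multiplication by the
bracket; this is the asserted identity solved for the operator applied to `v • m`. -/
theorem derivedConnection_smul (hs : IsSymbol 𝓑 D Λ.br) {n : ℕ} (d : Fin n → ℤ)
    (u : Fin n → B) (hu : ∀ t, u t ∈ 𝓑 (d t)) (e : ℤ) (v : B) (hv : v ∈ 𝓑 e) (m : M) :
    (derivedConnection h𝓑 hspan hp hℳ Λ D hD 1).op n u (v • m)
      = Λ.bracket (n + 1) (Fin.snoc (α := fun _ => B) u v) • m
        + Int.negOnePow (e * (∑ t, d t + 1)) •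
          (v • (derivedConnection h𝓑 hspan hp hℳ Λ D hD 1).op n u m) := by
  have hl := homog_ofFn d u hu
  have hl' : Homog 𝓑 ((List.ofFn fun t => (d t, u t)) ++ [(e, v)]) :=
    homog_append.2 ⟨hl, homog_cons.2 ⟨hv, homog_nil⟩⟩
  have h := hs.eq _ hl'
  rw [List.length_append, List.length_ofFn, LRInfty.br, evalL_ofFn_append, itL_append] at h
  have h1 := LinearMap.congr_fun h m
  rw [derivedConnection_op h𝓑 hspan hp hℳ Λ D hD 1 d u hu, one_smul]
  change (gradedComm (itL (D (n + 1)) 1 _) _ v e) m = _ at h1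
  rw [gradedComm, LinearMap.sub_apply, sub_eq_iff_eq_add] at h1
  rw [degL_ofFn, mul_comm, add_comm (1 : ℤ)] at h1
  exact h1

/-- The Leibniz rule for an iterated commutator in its first entry, with the operator of degree one;
the sign on the second term comes from moving `μ_u` to the right past the commutators with `w`. -/
theorem derivedConnection_mul {n : ℕ} (d : Fin n → ℤ)
    (w : Fin n → B) (hw : ∀ t, w t ∈ 𝓑 (d t)) (e : ℤ) (v : B) (hv : v ∈ 𝓑 e) (c : ℤ) (u : B)
    (hu : u ∈ 𝓑 c) (m : M) :
    (derivedConnection h𝓑 hspan hp hℳ Λ D hD 1).op (n + 1) (Fin.cons (v * u) w) m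
      = Int.negOnePow e •
          (v • (derivedConnection h𝓑 hspan hp hℳ Λ D hD 1).op (n + 1) (Fin.cons u w) m)
        + Int.negOnePow (c * ∑ t, d t) •
          (derivedConnection h𝓑 hspan hp hℳ Λ D hD 1).op (n + 1) (Fin.cons v w) (u • m) := by
  have key : ∀ (f : ℤ) (z : B), z ∈ 𝓑 f →
      (derivedConnection h𝓑 hspan hp hℳ Λ D hD 1).op (n + 1) (Fin.cons z w)
        = itL (D (n + 2)) 1 ((f, z) :: List.ofFn fun t => (d t, w t)) := by
    intro f z hz
    rw [derivedConnection_op h𝓑 hspan hp hℳ Λ D hD 1 (Fin.cons f d) (Fin.cons z w)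
      (Fin.cases hz hw), one_smul, List.ofFn_succ]
    rfl
  rw [key _ _ (h𝓑.mul_mem hv hu), key _ _ hu, key _ _ hv,
    h𝓑.itL_mul_cons hv hu _ _ (homog_ofFn d w hw), one_mul, degL_ofFn, add_comm]
  rfl

theorem IsSymbol.isDiffOp {br : List (ℤ × B) → B} (hs : IsSymbol 𝓑 D br)
    (hD : ∀ k e, ∀ m ∈ ℳ e, D k m ∈ ℳ (1 + e)) (k : ℕ) : IsDiffOp 𝓑 ℳ 1 k (D k) := by
  refine ⟨hD k, fun d u hu => ?_⟩
  rw [iterComm_eq_itL]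
  exact hs.eq_zero k _ (homog_ofFn d u hu) (by rw [List.length_ofFn]; exact k.lt_succ_self)

theorem IsSymbol.iterComm_eq (hs : IsSymbol 𝓑 D Λ.br) {k : ℕ} (d : Fin k → ℤ) (u : Fin k → B)
    (hu : ∀ t, u t ∈ 𝓑 (d t)) : iterComm (D k) 1 d u = mu K (Λ.bracket k u) := by
  have h := hs.eq _ (homog_ofFn d u hu)
  rw [List.length_ofFn, LRInfty.br, evalL_ofFn] at h
  rw [iterComm_eq_itL, h]

theorem IsSymbol.exists_connection (hs : IsSymbol 𝓑 D Λ.br) (h𝓑 : IsGradedComm 𝓑)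
    (hspan : Submodule.span K {v | ∃ e, v ∈ 𝓑 e} = ⊤) (hp : IsParity 𝓑 p₀ p₁)
    (hℳ : ∀ {i j : ℤ} {a : B} {m : M}, a ∈ 𝓑 i → m ∈ ℳ j → a • m ∈ ℳ (i + j))
    (hD : ∀ k e, ∀ m ∈ ℳ e, D k m ∈ ℳ (1 + e)) :
    ∃ R R' : RightConnection Λ ℳ,
      (∀ (n : ℕ) (d : Fin n → ℤ) (u : Fin n → B), (∀ t, u t ∈ 𝓑 (d t)) →
        R.op n u = iterComm (D (n + 1)) 1 d u) ∧
      (∀ (n : ℕ) (u : Fin n → B), R'.op n u = -R.op n u) ∧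
      (∀ (n : ℕ) (d : Fin n → ℤ) (u : Fin n → B), (∀ t, u t ∈ 𝓑 (d t)) →
        R'.curvature d u = -iterComm (halfSquare D (n + 1)) 2 d u) ∧
      (∀ (n : ℕ) (d : Fin n → ℤ) (u : Fin n → B), (∀ t, u t ∈ 𝓑 (d t)) →
        ∀ (e : ℤ) (v : B), v ∈ 𝓑 e → ∀ m : M,
          R.op n u (v • m) = Λ.bracket (n + 1) (Fin.snoc (α := fun _ => B) u v) • m
            + Int.negOnePow (e * (∑ t, d t + 1)) • (v • R.op n u m)) ∧
      (∀ (n : ℕ) (d : Fin n → ℤ) (w : Fin n → B), (∀ t, w t ∈ 𝓑 (d t)) →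
        ∀ (e : ℤ) (v : B), v ∈ 𝓑 e → ∀ (c : ℤ) (u : B), u ∈ 𝓑 c → ∀ m : M,
          R.op (n + 1) (Fin.cons (v * u) w) m
            = Int.negOnePow e • (v • R.op (n + 1) (Fin.cons u w) m)
              + Int.negOnePow (c * ∑ t, d t) • R.op (n + 1) (Fin.cons v w) (u • m)) := by
  refine ⟨derivedConnection h𝓑 hspan hp hℳ Λ D hD 1, derivedConnection h𝓑 hspan hp hℳ Λ D hD (-1),
    fun n d u hu => ?_, fun n u => ?_,
    fun n d u hu => derivedConnection_curvature h𝓑 hspan hp hℳ Λ D hD hs d u hu,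
    fun n d u hu => derivedConnection_smul h𝓑 hspan hp hℳ Λ D hD hs d u hu,
    fun n d w hw => derivedConnection_mul h𝓑 hspan hp hℳ Λ D hD d w hw⟩
  · rw [derivedConnection_op h𝓑 hspan hp hℳ Λ D hD 1 d u hu, one_smul, iterComm_eq_itL]
  · exact neg_smul (1 : K) (itMul p₀ p₁ n 1 (D (n + 1)) u)

end Derived

/-! ### The parity involution of the graded symmetric algebra -/

section Parity

variable {K A L : Type*} [Field K] [Ring A] [Algebra K A]
  [AddCommGroup L] [Module K L] [Module A L]
  {𝒜 : ℤ → Submodule K A} {ℒ : ℤ → Submodule K L} [GradedAlgebra 𝒜] [DirectSum.Decomposition ℒ]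
  (hA : ∀ (i j : ℤ) (a b : A), a ∈ 𝒜 i → b ∈ 𝒜 j →
      a * b = Int.negOnePow (i * j) • (b * a))

/-- The parity involution of the graded symmetric algebra. -/
def symParity : SymAlg 𝒜 ℒ →ₗ[K] SymAlg 𝒜 ℒ :=
  (symProj ℒ hA).toLinearMap ∘ₗ (FreeSym.parity K (xdeg 𝒜 ℒ)).toLinearMap ∘ₗ symSection hA

/-- The parity involution of the free algebra descends because the kernel of the projection is
spanned by homogeneous elements of the kernel; the description by `poissonIdeal` provides this. -/
theorem symParity_apply (X : LRInfty 𝒜 ℒ) [CharZero K] [SetLike.GradedSMul 𝒜 ℒ] (e : ℤ)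
    (u : SymAlg 𝒜 ℒ) (hu : u ∈ SymAlg.grading 𝒜 ℒ e) : symParity hA u = e.negOnePow • u := by
  obtain ⟨v, hv, rfl⟩ := exists_symProj_eq hA hu
  have h0 : symProj ℒ hA (symSection hA (symProj ℒ hA v) - v) = 0 := by
    rw [map_sub, symProj_symSection, sub_self]
  have h1 : ∀ z ∈ poissonIdeal hA X, symProj ℒ hA (FreeSym.parity K (xdeg 𝒜 ℒ) z) = 0 := by
    intro z hz
    induction hz using Submodule.span_induction with
    | zero => rw [map_zero, map_zero]
    | add x y _ _ hx hy => rw [map_add, map_add, hx, hy, add_zero]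
    | smul c x _ hx => rw [map_smul, map_smul, hx, smul_zero]
    | mem x hx =>
      obtain ⟨f, hf⟩ := hx
      rw [FreeSym.parity_apply hf.mem, Units.smul_def, map_zsmul, hf.proj, smul_zero]
  have h2 := h1 _ (mem_poissonIdeal hA X h0)
  rw [map_sub, map_sub, sub_eq_zero] at h2
  refine h2.trans ?_
  rw [FreeSym.parity_apply hv, Units.smul_def, map_zsmul, ← Units.smul_def]

end Parity

end SHLR

end

/-! ### Assembly of the brackets, the Rinehart operators and the derived connection -/

theorem mainTheorem9
    {K A L Q : Type*} [Field K] [CharZero K]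
    [Ring A] [Algebra K A] (𝒜 : ℤ → Submodule K A) [GradedAlgebra 𝒜]
    (hA : ∀ (i j : ℤ) (a b : A), a ∈ 𝒜 i → b ∈ 𝒜 j → a * b = Int.negOnePow (i * j) • (b * a))
    [AddCommGroup L] [Module K L] [Module A L] [IsScalarTower K A L]
    (ℒ : ℤ → Submodule K L) [DirectSum.Decomposition ℒ] [SetLike.GradedSMul 𝒜 ℒ]
    [AddCommGroup Q] [Module K Q] [Module A Q] [IsScalarTower K A Q]
    (𝒬 : ℤ → Submodule K Q) [DirectSum.Decomposition 𝒬] [SetLike.GradedSMul 𝒜 𝒬]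
    (X : LRInfty 𝒜 ℒ) (Δ : RightConnection X 𝒬) :
    -- the brackets `Λ` on `S_A L` and the operators `D_k` exist and are unique
    ∃ Λ : LRInfty (groundGrading K) (SymAlg.grading 𝒜 ℒ),
      (IsPoissonExtension X Λ ∧ ∀ Λ', IsPoissonExtension X Λ' → Λ' = Λ) ∧
    ∃ D : ℕ → Module.End K (SymTensor 𝒜 ℒ Q),
      (IsRinehart Δ D ∧ ∀ D', IsRinehart Δ D' → D' = D) ∧
      -- `[⋯[[D_k, μ_{u_1}], μ_{u_2}] ⋯, μ_{u_k}] = μ_{{u_1, ..., u_k}}`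
      (∀ (k : ℕ) (d : Fin k → ℤ) (u : Fin k → SymAlg 𝒜 ℒ),
        (∀ t, u t ∈ SymAlg.grading 𝒜 ℒ (d t)) →
          iterComm (D k) 1 d u = mu K (Λ.bracket k u)) ∧
      -- `D_k` is a differential operator of degree `1` and order `k`
      (∀ k : ℕ, IsDiffOp (SymAlg.grading 𝒜 ℒ) (symTensorGrading 𝒜 ℒ 𝒬) 1 k (D k)) ∧
      -- `R` and `R' = -R` are right `(K, S_A L)`-connections in `S_A L ⊗_A Q`
      ∃ R R' : RightConnection Λ (symTensorGrading 𝒜 ℒ 𝒬),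
        (∀ (n : ℕ) (d : Fin n → ℤ) (u : Fin n → SymAlg 𝒜 ℒ),
          (∀ t, u t ∈ SymAlg.grading 𝒜 ℒ (d t)) →
            R.op n u = iterComm (D (n + 1)) 1 d u) ∧
        (∀ (n : ℕ) (u : Fin n → SymAlg 𝒜 ℒ), R'.op n u = -R.op n u) ∧
        -- the curvature
        (∀ (n : ℕ) (d : Fin n → ℤ) (u : Fin n → SymAlg 𝒜 ℒ),
          (∀ t, u t ∈ SymAlg.grading 𝒜 ℒ (d t)) →
            R'.curvature d u = -iterComm (halfSquare D (n + 1)) 2 d u) ∧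
        -- the Leibniz rule in the last entry
        (∀ (n : ℕ) (d : Fin n → ℤ) (u : Fin n → SymAlg 𝒜 ℒ),
          (∀ t, u t ∈ SymAlg.grading 𝒜 ℒ (d t)) →
          ∀ (e : ℤ) (v : SymAlg 𝒜 ℒ), v ∈ SymAlg.grading 𝒜 ℒ e → ∀ U : SymTensor 𝒜 ℒ Q,
            R.op n u (v • U)
              = Λ.bracket (n + 1) (Fin.snoc (α := fun _ => SymAlg 𝒜 ℒ) u v) • U
                + Int.negOnePow (e * (∑ t, d t + 1)) • (v • R.op n u U)) ∧
        -- the Leibniz rule in the first entry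
        (∀ (n : ℕ) (d : Fin n → ℤ) (w : Fin n → SymAlg 𝒜 ℒ),
          (∀ t, w t ∈ SymAlg.grading 𝒜 ℒ (d t)) →
          ∀ (e : ℤ) (v : SymAlg 𝒜 ℒ), v ∈ SymAlg.grading 𝒜 ℒ e →
          ∀ (c : ℤ) (u : SymAlg 𝒜 ℒ), u ∈ SymAlg.grading 𝒜 ℒ c → ∀ U : SymTensor 𝒜 ℒ Q,
            R.op (n + 1) (Fin.cons (v * u) w) U
              = Int.negOnePow e • (v • R.op (n + 1) (Fin.cons u w) U)
                + Int.negOnePow (c * ∑ t, d t) • R.op (n + 1) (Fin.cons v w) (u • U)) := by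
  have hg := SymAlg.isGradedComm (ℒ := ℒ) hA
  have hs : IsSymbol (SymAlg.grading 𝒜 ℒ) (rinehartOp Δ hA) (symLR hA X).br :=
    rinehartOp_isSymbol Δ hA
  have hp := isParity_of_involution (symParity_apply hA X)
  have hspan := span_homogeneous_sym (ℒ := ℒ) hA
  have hℳ : ∀ {i j : ℤ} {u : SymAlg 𝒜 ℒ} {m : SymTensor 𝒜 ℒ Q}, u ∈ SymAlg.grading 𝒜 ℒ i →
      m ∈ symTensorGrading 𝒜 ℒ 𝒬 j → u • m ∈ symTensorGrading 𝒜 ℒ 𝒬 (i + j) :=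
    smul_mem_symTensorGrading hA
  have hD := rinehartOp_mem Δ hA
  exact ⟨symLR hA X, ⟨symLR_isPoissonExtension hA X,
      fun Λ' h => h.eq hA (symLR_isPoissonExtension hA X)⟩, rinehartOp Δ hA,
    ⟨rinehartOp_isRinehart Δ hA, fun D' h => h.eq Δ hA⟩,
    fun k d u hu => hs.iterComm_eq (symLR hA X) (rinehartOp Δ hA) d u hu,
    fun k => hs.isDiffOp (rinehartOp Δ hA) hD k,
    hs.exists_connection (symLR hA X) (rinehartOp Δ hA) hg hspan hp hℳ hD⟩
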